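/- Let $p$ be an odd prime, $F$ a totally real number field of degree $d=[F:\mathbb Q]$, $B$ a totally definite quaternion algebra over $F$ with canonical involution $*$, and $O_B\subset B$ an order that is stable under $*$ and maximal at $p$, i.e. $O_B\otimes_{\mathbb Z}\mathbb Z_p$ is a maximal order of $B\otimes_{\mathbb Q}\mathbb Q_p$. Let $\Lambda$ be a free $O_B\otimes\mathbb Z_p$-module of rank one with a perfect alternating $\mathbb Z_p$-bilinear pairing $\psi:\Lambda\times\Lambda\to\mathbb Z_p$ such that $\psi(ax,y)=\psi(x,a^*y)$ for all $a\in O_B$, $x,y\in\Lambda$. Consider the functor that sends a $\mathbb Z_p$-scheme $S$ to the set of $\mathcal O_S$-submodules $\mathscr F\subset\Lambda\otimes_{\mathbb Z_p}\mathcal O_S$ such that (i) $\mathscr F$ is isotropic with respect to $\psi$; (ii) $\mathscr F$ is locally free of rank $2d$ and, Zariski-locally on $S$, a direct summand of $\Lambda\otimes_{\mathbb Z_p}\mathcal O_S$; (iii) $\mathscr F$ is stable under $O_B$; (iv) for every $a\in O_B$, the characteristic polynomial of $a$ on $(\Lambda\otimes\mathcal O_S)/\mathscr F$ is the image in $\mathcal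 O_S[T]$ of the reduced characteristic polynomial $\prod_{\sigma:F\to\mathbb R}\bigl(T^2-\sigma(a+a^*)T+\sigma(aa^*)\bigr)\in\mathbb Z[T]$ of $a$. This functor is representable by a $\mathbb Z_p$-scheme $\mathbf M_\Lambda$ (the local model associated to $\Lambda$ and $\psi$), and the structure morphism $\mathbf M_\Lambda\to\operatorname{Spec}\mathbb Z_p$ is finite and flat. -/

import Mathlib

open CategoryTheory AlgebraicGeometry TensorProduct Opposite Polynomial Quaternion

universe w

noncomputable section

namespace RZLocalModel

/-! ### Orders in quaternion algebras -/

/-- `O` is an `R`-order of the `K`-algebra `A`: a finitely generated `R`-subalgebra that spans `A`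
over `K`. -/
def IsOrder (R K : Type*) {A : Type*} [CommRing R] [Field K] [Ring A] [Algebra R A] [Algebra K A]
    (O : Subalgebra R A) : Prop :=
  Module.Finite R O ∧ Submodule.span K (O : Set A) = ⊤

/-- `O` is a maximal `R`-order of the `K`-algebra `A`. -/
def IsMaximalOrder (R K : Type*) {A : Type*} [CommRing R] [Field K] [Ring A] [Algebra R A]
    [Algebra K A] (O : Subalgebra R A) : Prop :=
  Maximal (IsOrder R K) O

/-- The canonical map `ℤ_p ⊗ O → ℚ_p ⊗ B` attached to a subring `O` of a `ℚ`-algebra `B`. -/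
def padicMap (p : ℕ) [Fact p.Prime] {B : Type*} [Ring B] [Algebra ℚ B] (O : Subring B) :
    ℤ_[p] ⊗[ℤ] O →ₐ[ℤ_[p]] ℚ_[p] ⊗[ℚ] B :=
  Algebra.TensorProduct.lift (Algebra.ofId ℤ_[p] (ℚ_[p] ⊗[ℚ] B))
    (((Algebra.TensorProduct.includeRight : B →ₐ[ℚ] ℚ_[p] ⊗[ℚ] B).toRingHom.comp
      O.subtype).toIntAlgHom)
    (fun c _ => Algebra.commutes c _)

/-- `O` is maximal at `p`: the completion `ℤ_p ⊗ O` is a maximal order of `ℚ_p ⊗ B`. -/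
def IsMaximalAt (p : ℕ) [Fact p.Prime] {B : Type*} [Ring B] [Algebra ℚ B] (O : Subring B) : Prop :=
  IsMaximalOrder ℤ_[p] ℚ_[p] (padicMap p O).range

/-- The quaternion algebra `B = (α, β / F)` is totally definite: for every real embedding `σ` of
`F`, the algebra `B ⊗_{F, σ} ℝ = (σ α, σ β / ℝ)` is isomorphic to Hamilton's quaternions. -/
def IsTotallyDefinite {F : Type*} [Field F] (α β : F) : Prop :=
  ∀ σ : F →+* ℝ, Nonempty (ℍ[ℝ, σ α, σ β] ≃ₐ[ℝ] ℍ[ℝ])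

/-- The reduced characteristic polynomial of `a ∈ B = (α, β / F)` from `B` to `ℚ`, for a totally
real field `F`: the product over the real embeddings `σ` of `F` of the polynomials
`T² - σ(Trd a) T + σ(Nrd a)`, where `Trd a = a + a^*` and `Nrd a = a a^*`. A priori it has real
coefficients; it has integral coefficients when `a` lies in an order. -/
def redCharpoly {F : Type*} [Field F] [NumberField F] {α β : F} (a : ℍ[F, α, β]) : ℝ[X] :=
  ∏ σ : F →+* ℝ, (X ^ 2 - C (σ (a + star a).re) * X + C (σ (a * star a).re))

/-! ### Schemes over `ℤ_p` -/

section Sections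

variable {p : ℕ} [Fact p.Prime]

variable (p) in
/-- Schemes over `Spec ℤ_p`. -/
abbrev Sch : Type 1 := Over (Spec (CommRingCat.of ℤ_[p]))

/-- The ring of sections of the structure sheaf of the `ℤ_p`-scheme `S` over an open `U`. -/
abbrev Sec (S : Sch p) (U : S.left.Opens) : Type := Γ(S.left, U)

lemma le_preimage_top {X Y : Scheme.{0}} (f : X ⟶ Y) (U : X.Opens) : U ≤ f ⁻¹ᵁ ⊤ := le_top

/-- The structure map `ℤ_p → Γ(S, U)`. -/
def structMap (S : Sch p) (U : S.left.Opens) : ℤ_[p] →+* Sec S U :=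
  ((Scheme.ΓSpecIso (CommRingCat.of ℤ_[p])).inv ≫
    Scheme.Hom.appLE S.hom ⊤ U (le_preimage_top S.hom U)).hom

instance instAlgebraSec (S : Sch p) (U : S.left.Opens) : Algebra ℤ_[p] (Sec S U) :=
  (structMap S U).toAlgebra

lemma structMap_comp {S T : Sch p} (f : T ⟶ S) {U : S.left.Opens} {V : T.left.Opens}
    (h : V ≤ f.left ⁻¹ᵁ U) (r : ℤ_[p]) :
    (f.left.appLE U V h).hom (structMap S U r) = structMap T V r := by
  have key : ∀ {X Y Z : Scheme.{0}} (g : X ⟶ Y) (k : Y ⟶ Z) (l : X ⟶ Z) (_ : g ≫ k = l)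
      (U : Y.Opens) (V : X.Opens) (h : V ≤ g ⁻¹ᵁ U),
      k.appLE ⊤ U (le_preimage_top k U) ≫ g.appLE U V h = l.appLE ⊤ V (le_preimage_top l V) := by
    rintro X Y Z g k l rfl U V h
    rw [Scheme.Hom.appLE_comp_appLE]
  exact congrArg (fun φ => ((Scheme.ΓSpecIso (CommRingCat.of ℤ_[p])).inv ≫ φ).hom r)
    (key f.left S.hom T.hom (Over.w f) U V h)

/-- The map of `ℤ_p`-algebras `Γ(S, U) → Γ(T, V)` for a morphism `f : T ⟶ S` with
`V ⊆ f⁻¹ U`. -/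
def secMap {S T : Sch p} (f : T ⟶ S) {U : S.left.Opens} {V : T.left.Opens}
    (h : V ≤ f.left ⁻¹ᵁ U) : Sec S U →ₐ[ℤ_[p]] Sec T V :=
  { (f.left.appLE U V h).hom with
    commutes' := structMap_comp f h }

variable (Λ : Type w) [AddCommGroup Λ] [Module ℤ_[p] Λ]

/-- The sections `Γ(S, U) ⊗ Λ` of the `𝒪_S`-module `Λ ⊗ 𝒪_S` over `U`, for a finite free
`ℤ_p`-module `Λ`. -/
abbrev LSec (S : Sch p) (U : S.left.Opens) : Type w := Sec S U ⊗[ℤ_[p]] Λ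

/-- The pullback map `Γ(S, U) ⊗ Λ → Γ(T, V) ⊗ Λ` for `f : T ⟶ S` and `V ⊆ f⁻¹ U`. -/
def pull {S T : Sch p} (f : T ⟶ S) {U : S.left.Opens} {V : T.left.Opens}
    (h : V ≤ f.left ⁻¹ᵁ U) : LSec Λ S U →ₗ[ℤ_[p]] LSec Λ T V :=
  (secMap f h).toLinearMap.rTensor Λ

/-- The restriction map `Γ(S, U) ⊗ Λ → Γ(S, V) ⊗ Λ` for `V ⊆ U`. -/
def res {S : Sch p} {U V : S.left.Opens} (h : V ≤ U) : LSec Λ S U →ₗ[ℤ_[p]] LSec Λ S V :=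
  pull Λ (𝟙 S) h

variable {Λ}

lemma pull_smul {S T : Sch p} (f : T ⟶ S) {U : S.left.Opens} {V : T.left.Opens}
    (h : V ≤ f.left ⁻¹ᵁ U) (r : Sec S U) (x : LSec Λ S U) :
    pull Λ f h (r • x) = secMap f h r • pull Λ f h x := by
  induction x using TensorProduct.induction_on with
  | zero => simp
  | add x y hx hy => rw [smul_add, map_add, map_add, smul_add, hx, hy]
  | tmul a l => simp [pull, TensorProduct.smul_tmul']

lemma pull_pull {S T X : Sch p} (g : X ⟶ T) (f : T ⟶ S) {U : S.left.Opens} {V : T.left.Opens}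
    {Y : X.left.Opens} (h : V ≤ f.left ⁻¹ᵁ U) (h' : Y ≤ g.left ⁻¹ᵁ V)
    (k : X ⟶ S) (hk : g ≫ f = k) (h'' : Y ≤ k.left ⁻¹ᵁ U) (x : LSec Λ S U) :
    pull Λ g h' (pull Λ f h x) = pull Λ k h'' x := by
  subst hk
  induction x using TensorProduct.induction_on with
  | zero => simp
  | add x y hx hy => simp only [map_add, hx, hy]
  | tmul a l =>
    change secMap g h' (secMap f h a) ⊗ₜ[ℤ_[p]] l = secMap (g ≫ f) h'' a ⊗ₜ[ℤ_[p]] l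
    congr 1
    change (f.left.appLE U V h ≫ g.left.appLE V Y h').hom a = _
    rw [Scheme.Hom.appLE_comp_appLE]
    rfl

lemma res_self {S : Sch p} {U : S.left.Opens} (h : U ≤ U) (x : LSec Λ S U) :
    res Λ h x = x := by
  induction x using TensorProduct.induction_on with
  | zero => simp
  | add x y hx hy => simp only [map_add, hx, hy]
  | tmul a l =>
    change secMap (𝟙 S) h a ⊗ₜ[ℤ_[p]] l = a ⊗ₜ[ℤ_[p]] l
    congr 1
    change ((𝟙 S.left : S.left ⟶ S.left).appLE U U h).hom a = a
    simp only [Scheme.Hom.appLE, Scheme.Hom.id_app]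
    change ((S.left).presheaf.map (𝟙 (op U))).hom a = a
    rw [CategoryTheory.Functor.map_id]
    rfl


variable (Λ) in
/-- A sheaf of `𝒪_S`-submodules of `Λ ⊗ 𝒪_S`. -/
@[ext]
structure Subsheaf (S : Sch p) where
  /-- The module of sections over an open subset. -/
  sec (U : S.left.Opens) : Submodule (Sec S U) (LSec Λ S U)
  res_mem {U V : S.left.Opens} (h : V ≤ U) {s : LSec Λ S U} : s ∈ sec U → res Λ h s ∈ sec V
  mem_of_local {U : S.left.Opens} (s : LSec Λ S U) :
    (∀ x ∈ U, ∃ (V : S.left.Opens) (h : V ≤ U), x ∈ V ∧ res Λ h s ∈ sec V) → s ∈ sec U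

/-- The submodule of `Γ(T, V) ⊗ Λ` generated by the pullbacks of the sections of `𝓕` over `U`. -/
def pullSpan {S T : Sch p} (f : T ⟶ S) (𝓕 : Subsheaf Λ S) {U : S.left.Opens} {V : T.left.Opens}
    (h : V ≤ f.left ⁻¹ᵁ U) : Submodule (Sec T V) (LSec Λ T V) :=
  Submodule.span (Sec T V) (pull Λ f h '' (𝓕.sec U : Set (LSec Λ S U)))

lemma pull_res {S T : Sch p} (f : T ⟶ S) {U U' : S.left.Opens} {V : T.left.Opens}
    (h : V ≤ f.left ⁻¹ᵁ U) (hU : U' ≤ U) (h' : V ≤ f.left ⁻¹ᵁ U') (x : LSec Λ S U) :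
    pull Λ f h' (res Λ hU x) = pull Λ f h x :=
  pull_pull f (𝟙 S) hU h' f (Category.comp_id f) h x

lemma res_pull {S T : Sch p} (f : T ⟶ S) {U : S.left.Opens} {V V' : T.left.Opens}
    (h : V ≤ f.left ⁻¹ᵁ U) (hV : V' ≤ V) (h' : V' ≤ f.left ⁻¹ᵁ U) (x : LSec Λ S U) :
    res Λ hV (pull Λ f h x) = pull Λ f h' x :=
  pull_pull (𝟙 T) f h hV f (Category.id_comp f) h' x

lemma res_res {S : Sch p} {U V V' : S.left.Opens} (h : V ≤ U) (h' : V' ≤ V) (h'' : V' ≤ U)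
    (x : LSec Λ S U) : res Λ h' (res Λ h x) = res Λ h'' x :=
  res_pull (𝟙 S) h h' h'' x

lemma res_smul {S : Sch p} {U V : S.left.Opens} (h : V ≤ U) (r : Sec S U) (x : LSec Λ S U) :
    res Λ h (r • x) = secMap (𝟙 S) h r • res Λ h x :=
  pull_smul (𝟙 S) h r x

lemma res_mem_pullSpan {S T : Sch p} (f : T ⟶ S) (𝓕 : Subsheaf Λ S) {U U' : S.left.Opens}
    {V V' : T.left.Opens} (h : V ≤ f.left ⁻¹ᵁ U) (h' : V' ≤ f.left ⁻¹ᵁ U') (hU : U' ≤ U)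
    (hV : V' ≤ V) {s : LSec Λ T V} (hs : s ∈ pullSpan f 𝓕 h) :
    res Λ hV s ∈ pullSpan f 𝓕 h' := by
  induction hs using Submodule.span_induction with
  | mem x hx =>
    obtain ⟨y, hy, rfl⟩ := hx
    have h'' : V' ≤ f.left ⁻¹ᵁ U := hV.trans h
    rw [res_pull f h hV h'', ← pull_res f h'' hU h']
    exact Submodule.subset_span ⟨_, 𝓕.res_mem hU hy, rfl⟩
  | zero => rw [map_zero]; exact zero_mem _
  | add x y _ _ hx hy => rw [map_add]; exact add_mem hx hy
  | smul a x _ hx => rw [res_smul]; exact Submodule.smul_mem _ _ hx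

/-- The pullback of `𝓕 ⊆ Λ ⊗ 𝒪_S` along `f : T ⟶ S`, as a subsheaf of `Λ ⊗ 𝒪_T`: the image of
`f^* 𝓕` in `f^* (Λ ⊗ 𝒪_S) = Λ ⊗ 𝒪_T`, consisting of the sections that are locally linear
combinations of pullbacks of sections of `𝓕`. -/
def Subsheaf.pullback {S T : Sch p} (f : T ⟶ S) (𝓕 : Subsheaf Λ S) : Subsheaf Λ T where
  sec V :=
    { carrier := {s | ∀ t ∈ V, ∃ (V' : T.left.Opens) (hV : V' ≤ V) (U : S.left.Opens)
        (h : V' ≤ f.left ⁻¹ᵁ U), t ∈ V' ∧ res Λ hV s ∈ pullSpan f 𝓕 h}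
      zero_mem' := fun t ht => ⟨V ⊓ f.left ⁻¹ᵁ ⊤, inf_le_left, ⊤, inf_le_right, ⟨ht, trivial⟩, by
        rw [map_zero]; exact zero_mem _⟩
      add_mem' := by
        intro a b ha hb t ht
        obtain ⟨V₁, hV₁, U₁, h₁, ht₁, hs₁⟩ := ha t ht
        obtain ⟨V₂, hV₂, U₂, h₂, ht₂, hs₂⟩ := hb t ht
        have h : V₁ ⊓ V₂ ≤ f.left ⁻¹ᵁ (U₁ ⊓ U₂) := fun x hx => ⟨h₁ hx.1, h₂ hx.2⟩
        have hle : V₁ ⊓ V₂ ≤ V := inf_le_left.trans hV₁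
        refine ⟨V₁ ⊓ V₂, hle, U₁ ⊓ U₂, h, ⟨ht₁, ht₂⟩, ?_⟩
        rw [map_add]
        refine add_mem ?_ ?_
        · rw [← res_res hV₁ inf_le_left hle]
          exact res_mem_pullSpan f 𝓕 h₁ h inf_le_left inf_le_left hs₁
        · rw [← res_res hV₂ inf_le_right hle]
          exact res_mem_pullSpan f 𝓕 h₂ h inf_le_right inf_le_right hs₂
      smul_mem' := by
        intro c s hs t ht
        obtain ⟨V', hV, U, h, ht', hs'⟩ := hs t ht
        refine ⟨V', hV, U, h, ht', ?_⟩
        rw [res_smul]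
        exact Submodule.smul_mem _ _ hs' }
  res_mem := by
    intro V W hW s hs t ht
    obtain ⟨V', hV, U, h, ht', hs'⟩ := hs t (hW ht)
    have h' : V' ⊓ W ≤ f.left ⁻¹ᵁ U := inf_le_left.trans h
    refine ⟨V' ⊓ W, inf_le_right, U, h', ⟨ht', ht⟩, ?_⟩
    rw [res_res hW inf_le_right (inf_le_right.trans hW), ← res_res hV inf_le_left]
    exact res_mem_pullSpan f 𝓕 h h' le_rfl inf_le_left hs'
  mem_of_local := by
    intro V s hs t ht
    obtain ⟨W, hW, htW, hsW⟩ := hs t ht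
    obtain ⟨V', hV, U, h, ht', hs'⟩ := hsW t htW
    refine ⟨V', hV.trans hW, U, h, ht', ?_⟩
    rwa [res_res hW hV (hV.trans hW)] at hs'

lemma Subsheaf.mem_pullback {S T : Sch p} (f : T ⟶ S) (𝓕 : Subsheaf Λ S) {V : T.left.Opens}
    {s : LSec Λ T V} : s ∈ (𝓕.pullback f).sec V ↔ ∀ t ∈ V, ∃ (V' : T.left.Opens) (hV : V' ≤ V)
      (U : S.left.Opens) (h : V' ≤ f.left ⁻¹ᵁ U), t ∈ V' ∧ res Λ hV s ∈ pullSpan f 𝓕 h :=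
  Iff.rfl

lemma Subsheaf.pull_mem {S T : Sch p} (f : T ⟶ S) (𝓕 : Subsheaf Λ S) {U : S.left.Opens}
    {V : T.left.Opens} (h : V ≤ f.left ⁻¹ᵁ U) {s : LSec Λ S U} (hs : s ∈ 𝓕.sec U) :
    pull Λ f h s ∈ (𝓕.pullback f).sec V := fun t ht => ⟨V, le_rfl, U, h, ht, by
  rw [res_self]; exact Submodule.subset_span ⟨s, hs, rfl⟩⟩

lemma Subsheaf.pullSpan_le {S T : Sch p} (f : T ⟶ S) (𝓕 : Subsheaf Λ S) {U : S.left.Opens}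
    {V : T.left.Opens} (h : V ≤ f.left ⁻¹ᵁ U) : pullSpan f 𝓕 h ≤ (𝓕.pullback f).sec V :=
  Submodule.span_le.2 (by rintro _ ⟨s, hs, rfl⟩; exact 𝓕.pull_mem f h hs)

lemma Subsheaf.pullback_id {S : Sch p} (𝓕 : Subsheaf Λ S) : 𝓕.pullback (𝟙 S) = 𝓕 := by
  ext U s
  constructor
  · intro hs
    refine 𝓕.mem_of_local s fun t ht => ?_
    obtain ⟨V', hV, U', h, ht', hs'⟩ := hs t ht
    refine ⟨V', hV, ht', ?_⟩
    have : pullSpan (𝟙 S) 𝓕 h ≤ 𝓕.sec V' := Submodule.span_le.2 (by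
      rintro _ ⟨x, hx, rfl⟩
      exact 𝓕.res_mem (U := U') h hx)
    exact this hs'
  · intro hs
    have := 𝓕.pull_mem (𝟙 S) (U := U) (V := U) le_rfl hs
    rwa [show pull Λ (𝟙 S) (U := U) (V := U) le_rfl s = s from res_self le_rfl s] at this

lemma Subsheaf.pull_mem_comp {S T X : Sch p} (g : X ⟶ T) (f : T ⟶ S) (𝓕 : Subsheaf Λ S)
    {V : T.left.Opens} {Y : X.left.Opens} (h : Y ≤ g.left ⁻¹ᵁ V) {s : LSec Λ T V}
    (hs : s ∈ (𝓕.pullback f).sec V) : pull Λ g h s ∈ (𝓕.pullback (g ≫ f)).sec Y := by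
  refine (𝓕.pullback (g ≫ f)).mem_of_local _ fun x hx => ?_
  obtain ⟨V', hV, U, hU, ht, hs'⟩ := hs (g.left x) (h hx)
  have h₁ : Y ⊓ g.left ⁻¹ᵁ V' ≤ g.left ⁻¹ᵁ V' := inf_le_right
  have h₂ : Y ⊓ g.left ⁻¹ᵁ V' ≤ g.left ⁻¹ᵁ V := inf_le_left.trans h
  refine ⟨Y ⊓ g.left ⁻¹ᵁ V', inf_le_left, ⟨hx, ht⟩, ?_⟩
  rw [res_pull g h inf_le_left h₂, ← pull_res g h₂ hV h₁]
  generalize res Λ hV s = s' at hs'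
  have h₃ : Y ⊓ g.left ⁻¹ᵁ V' ≤ (g ≫ f).left ⁻¹ᵁ U := fun y hy => by
    have := hU (h₁ hy)
    simpa using this
  refine 𝓕.pullSpan_le (g ≫ f) h₃ ?_
  induction hs' using Submodule.span_induction with
  | mem x hx =>
    obtain ⟨y, hy, rfl⟩ := hx
    rw [pull_pull g f hU h₁ (g ≫ f) rfl h₃]
    exact Submodule.subset_span ⟨y, hy, rfl⟩
  | zero => rw [map_zero]; exact zero_mem _
  | add x y _ _ hx hy => rw [map_add]; exact add_mem hx hy
  | smul a x _ hx => rw [pull_smul]; exact Submodule.smul_mem _ _ hx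

lemma Subsheaf.pullback_comp {S T X : Sch p} (g : X ⟶ T) (f : T ⟶ S) (𝓕 : Subsheaf Λ S) :
    𝓕.pullback (g ≫ f) = (𝓕.pullback f).pullback g := by
  ext Y s
  constructor
  · intro hs
    refine ((𝓕.pullback f).pullback g).mem_of_local s fun x hx => ?_
    obtain ⟨Y', hY, U, h, hx', hs'⟩ := hs x hx
    refine ⟨Y', hY, hx', ?_⟩
    have h₁ : Y' ≤ g.left ⁻¹ᵁ (f.left ⁻¹ᵁ U) := fun y hy => by
      have := h hy
      simpa using this
    have : pullSpan (g ≫ f) 𝓕 h ≤ ((𝓕.pullback f).pullback g).sec Y' := Submodule.span_le.2 (by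
      rintro _ ⟨y, hy, rfl⟩
      rw [← pull_pull g f le_rfl h₁ (g ≫ f) rfl h]
      exact (𝓕.pullback f).pull_mem g h₁ (𝓕.pull_mem f le_rfl hy))
    exact this hs'
  · intro hs
    refine (𝓕.pullback (g ≫ f)).mem_of_local s fun x hx => ?_
    obtain ⟨Y', hY, V, h, hx', hs'⟩ := hs x hx
    refine ⟨Y', hY, hx', ?_⟩
    have : pullSpan g (𝓕.pullback f) h ≤ (𝓕.pullback (g ≫ f)).sec Y' := Submodule.span_le.2 (by
      rintro _ ⟨y, hy, rfl⟩
      exact 𝓕.pull_mem_comp g f h hy)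
    exact this hs'


/-! ### Base change of bases and forms along a map of algebras -/

section BaseChange

variable {R : Type} [CommRing R] {A A' : Type} [CommRing A] [CommRing A'] [Algebra R A]
  [Algebra R A'] {M : Type w} [AddCommGroup M] [Module R M]

lemma rTensor_smul (φ : A →ₐ[R] A') (a : A) (x : A ⊗[R] M) :
    φ.toLinearMap.rTensor M (a • x) = φ a • φ.toLinearMap.rTensor M x := by
  induction x using TensorProduct.induction_on with
  | zero => simp
  | add x y hx hy => rw [smul_add, map_add, map_add, smul_add, hx, hy]
  | tmul a l => simp [TensorProduct.smul_tmul']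

lemma exists_basis_map (φ : A →ₐ[R] A') {ι : Type} (b : Module.Basis ι A (A ⊗[R] M)) :
    ∃ b' : Module.Basis ι A' (A' ⊗[R] M), ∀ i, b' i = φ.toLinearMap.rTensor M (b i) := by
  let _ : Algebra A A' := φ.toRingHom.toAlgebra
  have : IsScalarTower R A A' := .of_algebraMap_eq' φ.comp_algebraMap.symm
  refine ⟨(b.baseChange A').map (AlgebraTensorModule.cancelBaseChange R A A' A' M), fun i => ?_⟩
  rw [Module.Basis.map_apply, Module.Basis.baseChange_apply]
  induction b i using TensorProduct.induction_on with
  | zero => simp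
  | add x y hx hy => rw [tmul_add, map_add, map_add, hx, hy]
  | tmul a l =>
    rw [AlgebraTensorModule.cancelBaseChange_tmul, Algebra.smul_def, mul_one]
    rfl

lemma repr_map (φ : A →ₐ[R] A') {ι : Type} [Fintype ι] (b : Module.Basis ι A (A ⊗[R] M))
    (b' : Module.Basis ι A' (A' ⊗[R] M)) (h : ∀ i, b' i = φ.toLinearMap.rTensor M (b i))
    (x : A ⊗[R] M) (i : ι) : b'.repr (φ.toLinearMap.rTensor M x) i = φ (b.repr x i) := by
  classical
  conv_lhs => rw [← b.sum_repr x]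
  rw [map_sum]
  simp only [rTensor_smul, ← h, map_sum, map_smul, Module.Basis.repr_self]
  simp [Finsupp.single_apply]

lemma rTensor_baseChange (φ : A →ₐ[R] A') (g : M →ₗ[R] M) (x : A ⊗[R] M) :
    φ.toLinearMap.rTensor M (g.baseChange A x) =
      g.baseChange A' (φ.toLinearMap.rTensor M x) := by
  induction x using TensorProduct.induction_on with
  | zero => simp
  | add x y hx hy => simp only [map_add, hx, hy]
  | tmul a l => simp

lemma toMatrix_map (φ : A →ₐ[R] A') {ι : Type} [Fintype ι] [DecidableEq ι]
    (b : Module.Basis ι A (A ⊗[R] M)) (b' : Module.Basis ι A' (A' ⊗[R] M))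
    (h : ∀ i, b' i = φ.toLinearMap.rTensor M (b i)) (g : M →ₗ[R] M) :
    LinearMap.toMatrix b' b' (g.baseChange A') =
      (LinearMap.toMatrix b b (g.baseChange A)).map φ := by
  ext i j
  rw [Matrix.map_apply, LinearMap.toMatrix_apply, LinearMap.toMatrix_apply, h,
    ← rTensor_baseChange, repr_map φ b b' h]

lemma form_map (φ : A →ₐ[R] A') (ψ : LinearMap.BilinForm R M) (x y : A ⊗[R] M) :
    ψ.baseChange A' (φ.toLinearMap.rTensor M x) (φ.toLinearMap.rTensor M y) =
      φ (ψ.baseChange A x y) := by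
  induction x using TensorProduct.induction_on with
  | zero => simp
  | add x y hx hy => simp only [map_add, LinearMap.add_apply, hx, hy]
  | tmul a l =>
    induction y using TensorProduct.induction_on with
    | zero => simp
    | add x y hx hy => simp only [map_add, hx, hy]
    | tmul a' l' =>
      simp [LinearMap.BilinForm.baseChange_tmul]

end BaseChange

/-! ### The local model -/

lemma secMap_eq_zero {S : Sch p} {U : S.left.Opens} (s : Sec S U)
    (h : ∀ x ∈ U, ∃ (V : S.left.Opens) (hV : V ≤ U), x ∈ V ∧ secMap (𝟙 S) hV s = 0) : s = 0 := by
  refine TopCat.Presheaf.section_ext S.left.sheaf U s 0 fun x hx => ?_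
  obtain ⟨V, hV, hxV, hs⟩ := h x hx
  have hs' : S.left.presheaf.map (homOfLE hV).op s = 0 := by
    rw [← hs]
    change _ = ((𝟙 S.left : S.left ⟶ S.left).appLE U V hV).hom s
    simp only [Scheme.Hom.appLE, Scheme.Hom.id_app]
    rfl
  rw [map_zero]
  have := TopCat.Presheaf.germ_res_apply S.left.presheaf (homOfLE hV) x hxV s
  erw [← this, hs', map_zero]
  rfl

/-- `b` is an adapted frame of the subsheaf `𝓕 ⊆ Λ ⊗ 𝒪_S` over the open subset `U`: it is a basis
of `Λ ⊗ 𝒪_S` over `U` whose first `m` vectors form a basis of `𝓕` over `U`. -/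
def IsAdapted {S : Sch p} (𝓕 : Subsheaf Λ S) {U : S.left.Opens} {m n : ℕ}
    (b : Module.Basis (Fin m ⊕ Fin n) (Sec S U) (LSec Λ S U)) : Prop :=
  ∀ (V : S.left.Opens) (h : V ≤ U),
    𝓕.sec V = Submodule.span (Sec S V) (Set.range fun i : Fin m => res Λ h (b (Sum.inl i)))

lemma IsAdapted.exists_pullback {S T : Sch p} (f : T ⟶ S) {𝓕 : Subsheaf Λ S} {U : S.left.Opens}
    {m n : ℕ} {b : Module.Basis (Fin m ⊕ Fin n) (Sec S U) (LSec Λ S U)} (hb : IsAdapted 𝓕 b)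
    {V : T.left.Opens} (h : V ≤ f.left ⁻¹ᵁ U) :
    ∃ b' : Module.Basis (Fin m ⊕ Fin n) (Sec T V) (LSec Λ T V),
      (∀ i, b' i = pull Λ f h (b i)) ∧ IsAdapted (𝓕.pullback f) b' := by
  obtain ⟨b', hb'⟩ := exists_basis_map (secMap f h) b
  refine ⟨b', hb', fun W hW => le_antisymm ?_ ?_⟩
  · intro s hs
    have hWU : W ≤ f.left ⁻¹ᵁ U := hW.trans h
    obtain ⟨c, hc⟩ := exists_basis_map (secMap f hWU) b
    have hcb : ∀ i, res Λ hW (b' i) = c i := fun i => by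
      rw [hb' i, hc i]; exact res_pull f h hW hWU (b i)
    have hz : ∀ j : Fin n, c.repr s (Sum.inr j) = 0 := by
      intro j
      refine secMap_eq_zero _ fun t ht => ?_
      obtain ⟨V', hV', U', h', ht', hs'⟩ := hs t ht
      have hVU : V' ≤ f.left ⁻¹ᵁ U := hV'.trans hWU
      have hVU' : V' ≤ f.left ⁻¹ᵁ (U' ⊓ U) := fun y hy => ⟨h' hy, hVU hy⟩
      have hs'' := res_mem_pullSpan f 𝓕 h' hVU' inf_le_left le_rfl hs'
      rw [res_self] at hs''
      obtain ⟨e, he⟩ := exists_basis_map (secMap f hVU) b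
      have hec : ∀ i, e i = res Λ hV' (c i) := fun i => by
        rw [he i, hc i]; exact (res_pull f hWU hV' hVU (b i)).symm
      refine ⟨V', hV', ht', ?_⟩
      rw [← repr_map (secMap (𝟙 T) hV') c e hec s]
      change e.repr (res Λ hV' s) (Sum.inr j) = 0
      have hle : pullSpan f 𝓕 hVU' ≤ LinearMap.ker (e.coord (Sum.inr j)) := by
        refine Submodule.span_le.2 ?_
        rintro _ ⟨y, hy, rfl⟩
        have hy' : y ∈ 𝓕.sec (U' ⊓ U) := hy
        rw [hb (U' ⊓ U) inf_le_right] at hy'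
        change pull Λ f hVU' y ∈ LinearMap.ker (e.coord (Sum.inr j))
        clear hy
        induction hy' using Submodule.span_induction with
        | mem x hx =>
          obtain ⟨i, rfl⟩ := hx
          have : pull Λ f hVU' (res Λ inf_le_right (b (Sum.inl i))) = e (Sum.inl i) := by
            rw [pull_res f hVU inf_le_right hVU', he]; rfl
          simp only [this, LinearMap.mem_ker, Module.Basis.coord_apply, Module.Basis.repr_self]
          simp
        | zero => rw [map_zero]; exact zero_mem _
        | add x y _ _ hx hy => rw [map_add]; exact add_mem hx hy
        | smul a x _ hx => rw [pull_smul]; exact Submodule.smul_mem _ _ hx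
      exact hle hs''
    rw [← c.sum_repr s, Fintype.sum_sum_type]
    simp only [hz, zero_smul, Finset.sum_const_zero, add_zero]
    refine Submodule.sum_mem _ fun i _ => Submodule.smul_mem _ _ (Submodule.subset_span ⟨i, ?_⟩)
    exact hcb _
  · refine Submodule.span_le.2 ?_
    rintro _ ⟨i, rfl⟩
    refine (𝓕.pullback f).res_mem hW ?_
    rw [hb']
    refine 𝓕.pull_mem f h ?_
    rw [hb U le_rfl]
    exact Submodule.subset_span ⟨i, res_self _ _⟩

section LocalModel

variable {F : Type*} [Field F] [NumberField F] {α β : F} {O : Subring ℍ[F, α, β]}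
  [Module (ℤ_[p] ⊗[ℤ] O) Λ] [IsScalarTower ℤ_[p] (ℤ_[p] ⊗[ℤ] O) Λ]

variable (p Λ) in
/-- The action of `a ∈ O_B` on the `O_B ⊗ ℤ_p`-module `Λ`. -/
def act (a : O) : Λ →ₗ[ℤ_[p]] Λ :=
  Algebra.lsmul ℤ_[p] ℤ_[p] Λ ((1 : ℤ_[p]) ⊗ₜ[ℤ] a)

variable (O) in
/-- The `S`-points of the local model of `(Λ, ψ)`: the `𝒪_S`-submodules `𝓕` of `Λ ⊗ 𝒪_S` which
are isotropic for `ψ`, stable under `O_B`, Zariski-locally on `S` free direct summands of rank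
`2 [F : ℚ]` (with complement of the same rank), and which satisfy the determinant condition: for
every `a ∈ O_B`, the characteristic polynomial of `a` on `(Λ ⊗ 𝒪_S) / 𝓕` is the image in `𝒪_S[T]`
of the reduced characteristic polynomial of `a`.

In an adapted frame, the matrix of `a` on the quotient `(Λ ⊗ 𝒪_S) / 𝓕`, with respect to the basis
given by the classes of the last `2 [F : ℚ]` vectors of the frame, is the lower right block of the
matrix of `a` on `Λ ⊗ 𝒪_S`. -/
structure IsLocalModelPoint (ψ : LinearMap.BilinForm ℤ_[p] Λ) {S : Sch p} (𝓕 : Subsheaf Λ S) :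
    Prop where
  isotropic (U : S.left.Opens) (x y : LSec Λ S U) :
    x ∈ 𝓕.sec U → y ∈ 𝓕.sec U → ψ.baseChange (Sec S U) x y = 0
  stable (a : O) (U : S.left.Opens) (x : LSec Λ S U) :
    x ∈ 𝓕.sec U → (act p Λ a).baseChange (Sec S U) x ∈ 𝓕.sec U
  locally_summand_det (s : S.left) : ∃ U : S.left.Opens, s ∈ U ∧
    ∃ b : Module.Basis (Fin (2 * Module.finrank ℚ F) ⊕ Fin (2 * Module.finrank ℚ F))
        (Sec S U) (LSec Λ S U),
      IsAdapted 𝓕 b ∧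
      ∀ a : O, ∃ c : ℤ[X], c.map (Int.castRingHom ℝ) = redCharpoly (a : ℍ[F, α, β]) ∧
        (LinearMap.toMatrix b b ((act p Λ a).baseChange (Sec S U))).toBlocks₂₂.charpoly =
          c.map (Int.castRingHom (Sec S U))

lemma IsLocalModelPoint.pullback {ψ : LinearMap.BilinForm ℤ_[p] Λ} {S T : Sch p} (f : T ⟶ S)
    {𝓕 : Subsheaf Λ S} (h𝓕 : IsLocalModelPoint O ψ 𝓕) : IsLocalModelPoint O ψ (𝓕.pullback f) where
  isotropic := by
    intro V x y hx hy
    refine secMap_eq_zero _ fun t ht => ?_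
    obtain ⟨V₁, hV₁, U₁, h₁, ht₁, hs₁⟩ := hx t ht
    obtain ⟨V₂, hV₂, U₂, h₂, ht₂, hs₂⟩ := hy t ht
    have h : V₁ ⊓ V₂ ≤ f.left ⁻¹ᵁ (U₁ ⊓ U₂) := fun x hx => ⟨h₁ hx.1, h₂ hx.2⟩
    have hle : V₁ ⊓ V₂ ≤ V := inf_le_left.trans hV₁
    have hx' := res_mem_pullSpan f 𝓕 h₁ h inf_le_left inf_le_left hs₁
    have hy' := res_mem_pullSpan f 𝓕 h₂ h inf_le_right inf_le_right hs₂
    rw [res_res hV₁ inf_le_left hle] at hx'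
    rw [res_res hV₂ inf_le_right hle] at hy'
    refine ⟨V₁ ⊓ V₂, hle, ⟨ht₁, ht₂⟩, ?_⟩
    rw [← form_map]
    change ψ.baseChange _ (res Λ hle x) (res Λ hle y) = 0
    generalize res Λ hle x = x' at hx'
    generalize res Λ hle y = y' at hy'
    induction hx', hy' using Submodule.span_induction₂ with
    | mem_mem x y hx hy =>
      obtain ⟨x, hx, rfl⟩ := hx
      obtain ⟨y, hy, rfl⟩ := hy
      refine (form_map (secMap f h) ψ x y).trans ?_
      rw [h𝓕.isotropic _ x y hx hy, map_zero]
    | zero_left y hy => simp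
    | zero_right y hy => simp
    | add_left x y z _ _ _ h₁ h₂ => rw [map_add, LinearMap.add_apply, h₁, h₂, add_zero]
    | add_right x y z _ _ _ h₁ h₂ => rw [map_add, h₁, h₂, add_zero]
    | smul_left r x y _ _ h => rw [map_smul, LinearMap.smul_apply, h, smul_zero]
    | smul_right r x y _ _ h => rw [map_smul, h, smul_zero]
  stable := by
    intro a V x hx t ht
    obtain ⟨V', hV, U, h, ht', hs⟩ := hx t ht
    refine ⟨V', hV, U, h, ht', ?_⟩
    have : res Λ hV ((act p Λ a).baseChange (Sec T V) x) =
        (act p Λ a).baseChange (Sec T V') (res Λ hV x) := rTensor_baseChange _ _ _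
    rw [this]
    generalize res Λ hV x = x' at hs
    induction hs using Submodule.span_induction with
    | mem x hx =>
      obtain ⟨y, hy, rfl⟩ := hx
      exact Submodule.subset_span ⟨_, h𝓕.stable a U y hy, rTensor_baseChange _ _ _⟩
    | zero => rw [map_zero]; exact zero_mem _
    | add x y _ _ hx hy => rw [map_add]; exact add_mem hx hy
    | smul r x _ hx => rw [map_smul]; exact Submodule.smul_mem _ _ hx
  locally_summand_det := by
    intro t
    obtain ⟨U, hU, b, hb, hdet⟩ := h𝓕.locally_summand_det (f.left t)
    obtain ⟨b', hb', hb''⟩ := hb.exists_pullback f (V := f.left ⁻¹ᵁ U) le_rfl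
    refine ⟨f.left ⁻¹ᵁ U, hU, b', hb'', fun a => ?_⟩
    obtain ⟨c, hc, hc'⟩ := hdet a
    refine ⟨c, hc, ?_⟩
    rw [toMatrix_map (secMap f le_rfl) b b' hb']
    have := congrArg (Polynomial.map (secMap f (le_refl (f.left ⁻¹ᵁ U))).toRingHom) hc'
    rw [← Matrix.charpoly_map, Polynomial.map_map] at this
    convert this using 2
    · rfl
    · exact Subsingleton.elim (α := ℤ →+* Sec T (f.left ⁻¹ᵁ U)) _ _

variable (O) in
/-- The functor on schemes over `ℤ_p` whose `S`-points are the `𝒪_S`-submodules of `Λ ⊗ 𝒪_S`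
described in `IsLocalModelPoint`, with pullback of submodules as functoriality. The local model of
`(Λ, ψ)` is the `ℤ_p`-scheme that represents it. -/
def localModelFunctor (ψ : LinearMap.BilinForm ℤ_[p] Λ) : (Sch p)ᵒᵖ ⥤ Type w where
  obj S := {𝓕 : Subsheaf Λ S.unop // IsLocalModelPoint O ψ 𝓕}
  map f := ↾fun 𝓕 => ⟨𝓕.1.pullback f.unop, 𝓕.2.pullback f.unop⟩
  map_id S := by
    refine ConcreteCategory.hom_ext _ _ fun 𝓕 => ?_
    exact Subtype.ext 𝓕.1.pullback_id
  map_comp f g := by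
    refine ConcreteCategory.hom_ext _ _ fun 𝓕 => ?_
    exact Subtype.ext (𝓕.1.pullback_comp g.unop f.unop)

end LocalModel

end Sections
end RZLocalModel
end

open RZLocalModel

/-! ### A Fitting-type divisibility -/

section Fitting

variable {A : Type*} [CommRing A] {ι κ : Type*} [Fintype ι] [DecidableEq ι] [Fintype κ]
  [DecidableEq κ]

/-! Completed at p, the order becomes standard. Let R be the product of the rings of integers of the
completions of F above p. Then O_B ⊗ ℤ_p is ℍ[R, ε, θ] with i² = ε a unit and j² = θ, and ψ(x, y) =
λ((x^* y).imJ) for a linear form λ on R. Indeed ψ(x, y) = ℓ(x^* y), where ℓ changes sign under the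
involution and the order is self-dual for ℓ(x y) (`exists_functional`). On each factor ℓ is the
trace against a pure quaternion t; self-duality forces t to normalize the order, and a suitable
multiple of t serves as j (`IsSelfDualMaxOrder.exists_isStandard`).

A point over A is then a left ideal I of the quaternion algebra over T = A ⊗ R, and the heart of the
matter is that the determinant condition forces x x'^* = 0 for all x, x' in I. In each factor one of
R[i], R[j] is generated over ℤ_p by a unit w, so the quotient by I is generated by two elements over
A[w], and two elements of I give a 2 × 2 matrix of relations. By a Fitting-type argument the
characteristic polynomial of w on the quotient divides the determinant of the relations
(`charpoly_dvd_det_of_relations`); it equals the reduced characteristic polynomial of w, which kills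
w. Hence the determinant vanishes, and such determinants are the components of x x'^*. The condition
is imposed only on O_B; it extends to the completion because polynomials vanishing on ℕ vanish on
ℤ_p (`charpoly_eq_rcp_of_span`).

Since ψ is perfect, I contains its own orthogonal, so I is stable under i ↦ -i, j ↦ j and is
determined by its intersection with T[j]. Over a finite extension W of ℤ_p that splits the
unramified part of R, this intersection contains, for each idempotent, a monic polynomial P(j) of
some degree n with P(X) P(-X) = ± E(X²), where E is a monic polynomial of degree n killing the
component of θ. Over a field no nonzero polynomial in j of degree less than n lies in I. Hence the
same products i^δ z j^l with l < n give a basis of every quotient, and the functor is represented by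
one affine chart (`SplitModel.IsChartBasis.isUnit_det`, `nonempty_representableBy_specOver`).

Over W the chart is generated by the d = [F : ℚ] coefficients of these polynomials. The relations
express the square of each coefficient through monomials of smaller weight, so the 2^d squarefree
monomials span (`span_prod_eq_top_of_sq`). Conversely, a choice of square root of χ(θ) for each of
the d homomorphisms χ from R to an algebraic closure gives 2^d distinct points. The spanning set is
therefore a basis (`free_of_span_of_algHom`), and finiteness and flatness descend from W to ℤ_p. -/

open Matrix in
lemma exists_eq_vecMul_charmatrix_add_C (M : Matrix κ κ A) (P : κ → A[X]) :
    ∃ (Y : κ → A[X]) (c : κ → A), P = Y ᵥ* M.charmatrix + fun l => C (c l) := by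
  let S : Set (κ → A[X]) := {P | ∃ (Y : κ → A[X]) (c : κ → A),
    P = Y ᵥ* M.charmatrix + fun l => C (c l)}
  have hadd : ∀ P ∈ S, ∀ P' ∈ S, P + P' ∈ S := by
    rintro _ ⟨Y, c, rfl⟩ _ ⟨Y', c', rfl⟩
    refine ⟨Y + Y', c + c', ?_⟩
    rw [add_vecMul]
    ext1 l
    simp only [Pi.add_apply, C_add]
    ring
  -- For a constant row c one has X c = c (X - M) + c M, so multiplication by X only creates a new
  -- constant remainder.
  have hX : ∀ P ∈ S, (X : A[X]) • P ∈ S := by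
    rintro _ ⟨Y, c, rfl⟩
    refine ⟨(X : A[X]) • Y + fun k => C (c k), c ᵥ* M, ?_⟩
    have : (fun k => C (c k)) ᵥ* M.charmatrix + (fun l => C ((c ᵥ* M) l)) =
        (X : A[X]) • fun k => C (c k) := by
      ext1 l
      simp only [Pi.add_apply, vecMul, dotProduct, charmatrix_apply, map_sum, mul_sub,
        Finset.sum_sub_distrib, Pi.smul_apply, smul_eq_mul, map_mul]
      rw [sub_add_cancel, Finset.sum_eq_single l]
      · rw [diagonal_apply_eq, mul_comm]
      · intro k _ hk
        rw [diagonal_apply_ne _ hk, mul_zero]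
      · simp
    rw [add_vecMul, smul_vecMul, add_assoc, this, smul_add]
  have hC : ∀ (a : A), ∀ P ∈ S, C a • P ∈ S := by
    rintro a _ ⟨Y, c, rfl⟩
    refine ⟨C a • Y, a • c, ?_⟩
    rw [smul_vecMul, smul_add]
    congr 1
    ext1 l
    simp
  have hsmul : ∀ (f : A[X]), ∀ P ∈ S, f • P ∈ S := by
    intro f P hP
    induction f using Polynomial.induction_on with
    | C a => exact hC a P hP
    | add f g hf hg => rw [add_smul]; exact hadd _ hf _ hg
    | monomial n a h =>
      have := hX _ h
      rw [smul_smul] at this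
      convert this using 2
      ring
  have hsingle : ∀ l, Pi.single l (1 : A[X]) ∈ S := fun l =>
    ⟨0, Pi.single l 1, by
      rw [zero_vecMul, zero_add]
      ext1 k
      by_cases h : k = l
      · subst h; simp
      · simp [h]⟩
  have h0 : (0 : κ → A[X]) ∈ S := ⟨0, 0, by ext1; simp⟩
  have : P = ∑ l, P l • Pi.single l (1 : A[X]) := by
    ext1 k
    simp [Finset.sum_apply, Pi.single_apply]
  change P ∈ S
  rw [this]
  exact Finset.sum_induction _ (· ∈ S) (fun a b ha hb => hadd _ ha _ hb) h0
    fun l _ => hsmul _ _ (hsingle l)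

variable {Q : Type*} [AddCommGroup Q] [Module A Q]

open Matrix in
lemma aeval_vecMul_charmatrix (b : Module.Basis κ A Q) (w : Module.End A Q) (Y : κ → A[X]) :
    ∑ l, aeval w ((Y ᵥ* (LinearMap.toMatrix b b w)ᵀ.charmatrix) l) (b l) = 0 := by
  simp only [vecMul, dotProduct, map_sum, LinearMap.sum_apply]
  rw [Finset.sum_comm]
  refine Finset.sum_eq_zero fun k _ => ?_
  simp only [map_mul, Module.End.mul_apply]
  rw [← map_sum]
  convert map_zero (aeval w (Y k))
  simp only [charmatrix_apply, map_sub, LinearMap.sub_apply, Finset.sum_sub_distrib,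
    transpose_apply, aeval_C, Module.algebraMap_end_apply]
  rw [sub_eq_zero]
  have : ∑ x, (LinearMap.toMatrix b b w) x k • b x = w (b k) := by
    simp only [LinearMap.toMatrix_apply, b.sum_repr]
  rw [this, Finset.sum_eq_single k]
  · simp
  · intro l _ hl
    simp [diagonal_apply_ne _ (Ne.symm hl)]
  · simp

-- With `aeval_vecMul_charmatrix` this presents Q over A[X] by the rows of X - M: modulo these rows
-- a relation becomes constant, and a constant relation between the vectors of a basis is zero.
open Matrix in
lemma exists_eq_vecMul_charmatrix (b : Module.Basis κ A Q) (w : Module.End A Q) (P : κ → A[X])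
    (h : ∑ l, aeval w (P l) (b l) = 0) :
    ∃ Y : κ → A[X], P = Y ᵥ* (LinearMap.toMatrix b b w)ᵀ.charmatrix := by
  obtain ⟨Y, c, rfl⟩ := exists_eq_vecMul_charmatrix_add_C (LinearMap.toMatrix b b w)ᵀ P
  refine ⟨Y, ?_⟩
  simp only [Pi.add_apply, map_add, LinearMap.add_apply, Finset.sum_add_distrib,
    aeval_vecMul_charmatrix, zero_add, aeval_C, Module.algebraMap_end_apply] at h
  have := Fintype.linearIndependent_iff.1 b.linearIndependent c h
  ext1 l
  simp [this]

open Matrix in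
/-- If `q` generates `Q` over `A[w]`, then the characteristic polynomial of `w` divides the
determinant of every square matrix of relations between the `q j`. -/
theorem charpoly_dvd_det_of_relations (b : Module.Basis κ A Q) (w : Module.End A Q) (q : ι → Q)
    (hq : ∀ x, ∃ P : ι → A[X], x = ∑ j, aeval w (P j) (q j)) (r : Matrix ι ι A[X])
    (hr : ∀ i, ∑ j, aeval w (r i j) (q j) = 0) :
    (LinearMap.toMatrix b b w).charpoly ∣ r.det := by
  set Cm := (LinearMap.toMatrix b b w)ᵀ.charmatrix
  let Φ : Matrix ι κ A[X] := fun i k => C (b.repr (q i) k)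
  choose Ψ hΨ using fun k => hq (b k)
  have hΦ : ∀ i, q i = ∑ k, aeval w (Φ i k) (b k) := fun i => by
    simp [Φ, Module.algebraMap_end_apply, b.sum_repr]
  have hcomb : ∀ (P : ι → A[X]), ∑ j, aeval w (P j) (q j) =
      ∑ k, aeval w ((P ᵥ* Φ) k) (b k) := by
    intro P
    conv_lhs => enter [2, j]; rw [hΦ j, map_sum]
    rw [Finset.sum_comm]
    refine Finset.sum_congr rfl fun k _ => ?_
    simp [vecMul, dotProduct]
  have h1 : ∀ i, ∃ Z : κ → A[X], r i ᵥ* Φ = Z ᵥ* Cm := fun i =>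
    exists_eq_vecMul_charmatrix b w _ (by rw [← hcomb, hr])
  have h2 : ∀ k, ∃ Z : κ → A[X], Pi.single k 1 - Ψ k ᵥ* Φ = Z ᵥ* Cm := fun k =>
    exists_eq_vecMul_charmatrix b w _ (by
      simp only [Pi.sub_apply, map_sub, LinearMap.sub_apply, Finset.sum_sub_distrib]
      rw [← hcomb, ← hΨ, sub_eq_zero, Finset.sum_eq_single k]
      · simp
      · intro l _ hl; simp [hl]
      · simp)
  choose Z hZ using h1
  choose Y hY using h2
  -- The given relations and the expressions of the basis vectors through the `q j` both factor
  -- through X - M. Bordering `r` by the latter keeps its determinant and exhibits the factor det (X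
  -- - M).
  have key : fromBlocks r 0 (-(Matrix.of Ψ)) 1 =
      fromBlocks r (Matrix.of Z) (-(Matrix.of Ψ)) (Matrix.of Y) * fromBlocks 1 (-Φ) 0 Cm := by
    rw [fromBlocks_multiply]
    congr 1
    · simp
    · ext1 i k
      have := congrFun (hZ i) k
      simp only [Matrix.zero_apply, Matrix.mul_neg, Matrix.add_apply, Matrix.neg_apply]
      change 0 = -(r i ᵥ* Φ) k + (Z i ᵥ* Cm) k
      rw [this]; ring
    · simp
    · ext1 k l
      have := congrFun (hY k) l
      simp only [Matrix.neg_mul, Matrix.mul_neg, neg_neg, Matrix.add_apply]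
      change (1 : Matrix κ κ A[X]) k l = (Ψ k ᵥ* Φ) l + (Y k ᵥ* Cm) l
      rw [← this]
      simp [one_apply, Pi.single_apply, eq_comm]
  have hdet := congrArg Matrix.det key
  rw [det_mul, det_fromBlocks_zero₁₂, det_fromBlocks_zero₂₁, det_one, det_one, mul_one,
    one_mul] at hdet
  have hCm : Cm.det = (LinearMap.toMatrix b b w).charpoly := by
    rw [← charpoly_transpose]; rfl
  rw [hdet, hCm]
  exact dvd_mul_left _ _

end Fitting

/-! ### Polynomial identities on `ℤ_p` -/

section Padic

variable {p : ℕ} [Fact p.Prime] {A : Type*} [CommRing A] [Algebra ℤ_[p] A]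

/-- Falling factorials are triangular for evaluation at 0, 1, 2, …, which suits polynomials
vanishing on ℕ. Their span is stable under X by the recurrence X (X)_n = (X)_(n+1) + n (X)_n. -/
lemma span_descPochhammer (A : Type*) [CommRing A] : Submodule.span A (Set.range (descPochhammer A)) = ⊤ := by
  set S := Submodule.span A (Set.range (descPochhammer A))
  have hX : ∀ P ∈ S, X * P ∈ S := by
    intro P hP
    induction hP using Submodule.span_induction with
    | mem x hx =>
      obtain ⟨n, rfl⟩ := hx
      have : (X : A[X]) * descPochhammer A n = descPochhammer A (n + 1) +
          (n : A) • descPochhammer A n := by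
        rw [descPochhammer_succ_right, smul_eq_C_mul]
        simp only [map_natCast]
        ring
      rw [this]
      exact add_mem (Submodule.subset_span ⟨_, rfl⟩)
        (Submodule.smul_mem _ _ (Submodule.subset_span ⟨_, rfl⟩))
    | zero => simp
    | add x y _ _ hx hy => rw [mul_add]; exact add_mem hx hy
    | smul a x _ hx => rw [mul_smul_comm]; exact Submodule.smul_mem _ _ hx
  have h1 : (1 : A[X]) ∈ S := Submodule.subset_span ⟨0, descPochhammer_zero A⟩
  refine Submodule.eq_top_iff'.2 fun P => ?_
  induction P using Polynomial.induction_on with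
  | C a => rw [C_eq_algebraMap, Algebra.algebraMap_eq_smul_one]; exact Submodule.smul_mem _ _ h1
  | add f g hf hg => exact add_mem hf hg
  | monomial n a h => rw [pow_succ', mul_left_comm]; exact hX _ h

/-- A polynomial over a `ℤ_p`-algebra that vanishes at the natural numbers vanishes on `ℤ_p`. -/
lemma eval_algebraMap_eq_zero_of_forall_nat (P : A[X]) (h : ∀ n : ℕ, P.eval (n : A) = 0)
    (x : ℤ_[p]) : P.eval (algebraMap ℤ_[p] A x) = 0 := by
  have hP : P ∈ Submodule.span A (Set.range (descPochhammer A)) := by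
    rw [span_descPochhammer]; trivial
  obtain ⟨c, rfl⟩ := (Finsupp.mem_span_range_iff_exists_finsupp).1 hP
  have heval : ∀ y : A, (c.sum fun i a => a • descPochhammer A i).eval y =
      c.sum fun i a => a * (descPochhammer A i).eval y := fun y => by
    simp [Finsupp.sum, eval_finsetSum, eval_smul]
  -- `A` may have torsion, so only j! times the coefficient vanishes. This is enough: (x)_j is j!
  -- times a binomial coefficient, which is again a p-adic integer.
  have hc : ∀ j, c j * (j.factorial : A) = 0 := by
    intro j
    induction j using Nat.strong_induction_on with
    | _ j ih =>
    have hj := h j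
    rw [heval, Finsupp.sum] at hj
    rw [Finset.sum_eq_single j] at hj
    · rwa [descPochhammer_eval_eq_descFactorial, Nat.descFactorial_self] at hj
    · intro i _ hi
      rw [descPochhammer_eval_eq_descFactorial]
      rcases lt_or_gt_of_ne hi with hi | hi
      · rw [Nat.descFactorial_eq_factorial_mul_choose, Nat.cast_mul, ← mul_assoc, ih i hi,
          zero_mul]
      · rw [Nat.descFactorial_of_lt hi]; simp
    · intro hj'
      rw [Finsupp.notMem_support_iff.1 hj', zero_mul]
  rw [heval, Finsupp.sum]
  refine Finset.sum_eq_zero fun j _ => ?_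
  have h1 : (descPochhammer A j).eval (algebraMap ℤ_[p] A x) =
      (j.factorial : A) * algebraMap ℤ_[p] A (Ring.choose x j) := by
    have h2 := Ring.descPochhammer_eq_factorial_smul_choose x j
    rw [← descPochhammer_map (algebraMap ℤ_[p] A), eval_map_algebraMap, aeval_algebraMap_apply,
      ← descPochhammer_map (Int.castRingHom ℤ_[p]), aeval_def, eval₂_map]
    have h3 : ((descPochhammer ℤ j).eval₂ ((algebraMap ℤ_[p] ℤ_[p]).comp (Int.castRingHom ℤ_[p])) x) =
        (descPochhammer ℤ j).smeval x := by
      rw [eval₂_eq_sum, smeval_eq_sum]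
      refine Finset.sum_congr rfl fun i _ => ?_
      simp only [Polynomial.smul_pow]
      simp
    rw [h3, h2]
    simp
  rw [h1, ← mul_assoc, hc, zero_mul]

end Padic

/-! ### Spanning by squarefree monomials -/

section Squarefree

variable {A B ι : Type*} [CommRing A] [CommRing B] [Algebra A B]

/-- If the squares of the generators `g i` are combinations of monomials of smaller weight, the
squarefree monomials in the `g i` span. -/
theorem span_prod_eq_top_of_sq (g : ι → B) (wt : ι → ℕ)
    (hgen : Algebra.adjoin A (Set.range g) = ⊤)
    (hsq : ∀ i, g i ^ 2 ∈ Submodule.span A {x | ∃ m : Multiset ι, (m.map wt).sum < 2 * wt i ∧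
      x = (m.map g).prod}) :
    Submodule.span A (Set.range fun s : Finset ι => ∏ i ∈ s, g i) = ⊤ := by
  classical
  set S := Submodule.span A (Set.range fun s : Finset ι => ∏ i ∈ s, g i)
  -- Strong induction on the weight: a monomial that is not squarefree contains some `g i ^ 2`, and
  -- rewriting this square lowers the weight.
  have key : ∀ (n : ℕ) (m : Multiset ι), (m.map wt).sum = n → (m.map g).prod ∈ S := by
    intro n
    induction n using Nat.strong_induction_on with
    | _ n ih =>
    intro m hm
    by_cases hnd : m.Nodup
    · exact Submodule.subset_span ⟨⟨m, hnd⟩, rfl⟩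
    · obtain ⟨i, hi⟩ : ∃ i, i ::ₘ i ::ₘ 0 ≤ m := by
        by_contra hcon
        push Not at hcon
        refine hnd (Multiset.nodup_iff_le.2 fun i hi => hcon i hi)
      obtain ⟨m', rfl⟩ := Multiset.le_iff_exists_add.1 hi
      have hprod : (((i ::ₘ i ::ₘ 0) + m').map g).prod = g i ^ 2 * (m'.map g).prod := by
        simp [sq, mul_assoc]
      rw [hprod]
      have hm2 : 2 * wt i + (m'.map wt).sum = n := by
        rw [← hm]; simp; ring
      have : ∀ y ∈ Submodule.span A {x | ∃ m : Multiset ι, (m.map wt).sum < 2 * wt i ∧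
          x = (m.map g).prod}, y * (m'.map g).prod ∈ S := by
        intro y hy
        induction hy using Submodule.span_induction with
        | mem x hx =>
          obtain ⟨m₁, h₁, rfl⟩ := hx
          rw [← Multiset.prod_add, ← Multiset.map_add]
          refine ih _ ?_ _ rfl
          rw [Multiset.map_add, Multiset.sum_add]
          omega
        | zero => simp
        | add x y _ _ hx hy => rw [add_mul]; exact add_mem hx hy
        | smul a x _ hx => rw [smul_mul_assoc]; exact Submodule.smul_mem _ _ hx
      exact this _ (hsq i)
  refine Submodule.eq_top_iff'.2 fun x => ?_
  have hx : x ∈ Algebra.adjoin A (Set.range g) := by rw [hgen]; trivial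
  rw [← Subalgebra.mem_toSubmodule, Algebra.adjoin_eq_span] at hx
  refine Submodule.span_le.2 ?_ hx
  intro y hy
  obtain ⟨m, hm⟩ : ∃ m : Multiset ι, y = (m.map g).prod := by
    induction hy using Submonoid.closure_induction with
    | mem x hx => obtain ⟨i, rfl⟩ := hx; exact ⟨{i}, by simp⟩
    | one => exact ⟨0, by simp⟩
    | mul x y _ _ hx hy =>
      obtain ⟨m, rfl⟩ := hx
      obtain ⟨m', rfl⟩ := hy
      exact ⟨m + m', by simp⟩
  rw [hm]
  exact key _ m rfl

end Squarefree

/-! ### Freeness by counting points -/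

section Freeness

/-- An algebra spanned by `n` elements with `n` distinct points in a field is free. -/
theorem free_of_span_of_algHom {A B K ι κ : Type*} [CommRing A] [CommRing B] [Algebra A B]
    [Field K] [Algebra A K] (hA : Function.Injective (algebraMap A K)) [Fintype ι] [Fintype κ]
    (hcard : Fintype.card ι = Fintype.card κ) (c : ι → B)
    (hc : Submodule.span A (Set.range c) = ⊤) (χ : κ → B →ₐ[A] K) (hχ : Function.Injective χ) :
    Module.Finite A B ∧ Module.Free A B := by
  classical
  -- Dedekind independence of the points makes the square matrix of their values on the spanning
  -- family invertible, and this excludes any linear relation.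
  have hli : LinearIndependent K (fun k => (fun x : B => χ k x)) := by
    have h1 := linearIndependent_monoidHom B K
    exact h1.comp (fun k => ((χ k : B →+* K) : B →* K)) (fun a b h => hχ (by
      ext x; exact DFunLike.congr_fun h x))
  have hli2 : LinearIndependent K (fun k : κ => fun i => χ k (c i)) := by
    rw [Fintype.linearIndependent_iff] at hli ⊢
    intro a ha
    refine hli a ?_
    ext x
    have hx : x ∈ Submodule.span A (Set.range c) := by rw [hc]; trivial
    simp only [Finset.sum_apply, Pi.smul_apply, smul_eq_mul, Pi.zero_apply]
    induction hx using Submodule.span_induction with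
    | mem x hx =>
      obtain ⟨i, rfl⟩ := hx
      simpa using congrFun ha i
    | zero => simp
    | add x y _ _ hx hy => simp [mul_add, Finset.sum_add_distrib, hx, hy]
    | smul r x _ hx =>
      simp only [map_smul, mul_smul_comm]
      rw [← Finset.smul_sum, hx, smul_zero]
  have e : ι ≃ κ := Fintype.equivOfCardEq hcard
  let M : Matrix ι ι K := Matrix.of fun k i => χ (e k) (c i)
  have hM : IsUnit M := by
    rw [← Matrix.linearIndependent_rows_iff_isUnit]
    exact hli2.comp e e.injective
  have hli3 : LinearIndependent A c := by
    rw [Fintype.linearIndependent_iff]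
    intro a ha
    have h0 : M.mulVec (fun i => algebraMap A K (a i)) = 0 := by
      ext k
      have := congrArg (χ (e k)) ha
      simp only [map_sum, map_zero, Algebra.smul_def] at this
      simp only [Matrix.mulVec, dotProduct, M, Matrix.of_apply, Pi.zero_apply]
      rw [← this]
      refine Finset.sum_congr rfl fun i _ => ?_
      rw [map_mul, AlgHom.commutes, mul_comm]
    have h1 := (Matrix.mulVec_injective_iff_isUnit.2 hM) (h0.trans (Matrix.mulVec_zero _).symm)
    intro i
    exact hA ((congrFun h1 i).trans (map_zero _).symm)
  have b := Module.Basis.mk hli3 hc.ge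
  exact ⟨.of_basis b, .of_basis b⟩

end Freeness

/-! ### Left ideals of quaternion algebras over commutative rings -/

section QuaternionIdeal

variable {A T : Type*} [CommRing A] [CommRing T] [Algebra A T] {ε θ : T}

/-- `I` is stable under left multiplication. -/
def IsLeftStable (I : Submodule A ℍ[T, ε, θ]) : Prop := ∀ h, ∀ x ∈ I, h * x ∈ I

/-- Left multiplication by `x` on the quotient by a left ideal. -/
noncomputable def lmulQ {I : Submodule A ℍ[T, ε, θ]} (hI : IsLeftStable I) (x : ℍ[T, ε, θ]) :
    Module.End A (ℍ[T, ε, θ] ⧸ I) :=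
  I.mapQ I (LinearMap.mulLeft A x) fun y hy => hI x y hy

lemma lmulQ_mk {I : Submodule A ℍ[T, ε, θ]} (hI : IsLeftStable I) (x y : ℍ[T, ε, θ]) :
    lmulQ hI x (I.mkQ y) = I.mkQ (x * y) := rfl

lemma aeval_lmulQ_mk {I : Submodule A ℍ[T, ε, θ]} (hI : IsLeftStable I) (w y : ℍ[T, ε, θ])
    (P : A[X]) : aeval (lmulQ hI w) P (I.mkQ y) = I.mkQ (aeval w P * y) := by
  induction P using Polynomial.induction_on generalizing y with
  | C a =>
    simp only [aeval_C, Module.algebraMap_end_apply]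
    rw [← map_smul, Algebra.smul_def]
  | add f g hf hg => simp only [map_add, LinearMap.add_apply, hf, hg, add_mul]
  | monomial n a h =>
    rw [pow_succ, ← mul_assoc, map_mul, map_mul (aeval w), aeval_X, aeval_X,
      Module.End.mul_apply, lmulQ_mk, h, mul_assoc]

lemma isCoprime_X_pow_of_isUnit_coeff_zero {E : A[X]} (hE : IsUnit (E.coeff 0)) (n : ℕ) :
    IsCoprime E (X ^ n) := by
  refine IsCoprime.pow_right ?_
  obtain ⟨u, hu⟩ := hE
  refine ⟨C (↑u⁻¹ : A), - C (↑u⁻¹ : A) * E.divX, ?_⟩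
  conv_lhs => enter [1, 2]; rw [← divX_mul_X_add E, ← hu]
  have : C (↑u⁻¹ : A) * C (↑u : A) = 1 := by rw [← C_mul]; simp
  linear_combination this

/-- The elements of `S` are polynomials in `w` on the component of `e`, so this component of the
quotient is generated over A[w] by the classes of e and e y. The two given elements of I are
relations with matrix (a, b; c, d), so `E` divides the corresponding determinant of polynomials, and
E(w) e = 0. -/
lemma mul_sub_mul_eq_zero_of_mem {κ : Type*} [Fintype κ] [DecidableEq κ]
    {I : Submodule A ℍ[T, ε, θ]} (hI : IsLeftStable I)
    (bQ : Module.Basis κ A (ℍ[T, ε, θ] ⧸ I)) (e : T) (he : e * e = e)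
    (w : ℍ[T, ε, θ]) (hw : w * (e : ℍ[T, ε, θ]) = w) (E : A[X]) (hE0 : IsUnit (E.coeff 0))
    (hEw : aeval w E * (e : ℍ[T, ε, θ]) = 0)
    (hE : E ∣ (LinearMap.toMatrix bQ bQ (lmulQ hI w)).charpoly)
    (y : ℍ[T, ε, θ]) (S : Set ℍ[T, ε, θ])
    (hS : ∀ s ∈ S, ∃ P : A[X], (e : ℍ[T, ε, θ]) * s = aeval w P * (e : ℍ[T, ε, θ]))
    (hdec : ∀ x : ℍ[T, ε, θ], ∃ a ∈ S, ∃ b ∈ S, x = a + b * y)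
    {a b c d : ℍ[T, ε, θ]} (ha : a ∈ S) (hb : b ∈ S) (hc : c ∈ S) (hd : d ∈ S)
    (hx : a + b * y ∈ I) (hx' : c + d * y ∈ I) :
    (e : ℍ[T, ε, θ]) * (a * d - b * c) = 0 := by
  classical
  have hcomm : ∀ x : ℍ[T, ε, θ], (e : ℍ[T, ε, θ]) * x = x * e := QuaternionAlgebra.comm e
  have hee : (e : ℍ[T, ε, θ]) * e = e := by rw [← QuaternionAlgebra.coe_mul, he]
  choose h hh using fun k => I.mkQ_surjective (bQ k)
  -- The complement of `e` is generated by the classes of (1 - e) h k, on which `w` acts as zero.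
  -- The relations X for these multiply the determinant by a power of X, harmless because `E` has
  -- unit constant term.
  let q : Fin 2 ⊕ κ → ℍ[T, ε, θ] ⧸ I := Sum.elim ![I.mkQ e, I.mkQ (e * y)]
    fun k => I.mkQ ((1 - e) * h k)
  obtain ⟨Pa, hPa⟩ := hS a ha
  obtain ⟨Pb, hPb⟩ := hS b hb
  obtain ⟨Pc, hPc⟩ := hS c hc
  obtain ⟨Pd, hPd⟩ := hS d hd
  let r : Matrix (Fin 2 ⊕ κ) (Fin 2 ⊕ κ) A[X] :=
    Matrix.fromBlocks !![Pa, Pb; Pc, Pd] 0 0 (Matrix.scalar κ X)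
  have hpart : ∀ (P P' : A[X]) (u v : ℍ[T, ε, θ]), (e : ℍ[T, ε, θ]) * u = aeval w P * e →
      (e : ℍ[T, ε, θ]) * v = aeval w P' * e →
      aeval (lmulQ hI w) P (I.mkQ e) + aeval (lmulQ hI w) P' (I.mkQ (e * y)) =
        I.mkQ (e * (u + v * y)) := by
    intro P P' u v hu hv
    rw [aeval_lmulQ_mk, aeval_lmulQ_mk, ← map_add, ← mul_assoc, ← hu, ← hv, mul_add, mul_assoc]
  have hdvd := charpoly_dvd_det_of_relations bQ (lmulQ hI w) q ?_ r ?_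
  · have hdet : r.det = (Pa * Pd - Pb * Pc) * X ^ Fintype.card κ := by
      simp only [r]
      rw [Matrix.det_fromBlocks_zero₂₁, Matrix.det_fin_two_of]
      simp
    rw [hdet] at hdvd
    obtain ⟨D, hD⟩ := (isCoprime_X_pow_of_isUnit_coeff_zero hE0 _).dvd_of_dvd_mul_right
      (hE.trans hdvd)
    have h0 : aeval w (Pa * Pd - Pb * Pc) * (e : ℍ[T, ε, θ]) = 0 := by
      rw [hD, mul_comm, map_mul, mul_assoc, hEw, mul_zero]
    rw [map_sub, map_mul, map_mul, sub_mul, mul_assoc, mul_assoc, ← hPd, ← hPc] at h0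
    rw [mul_sub, ← h0]
    congr 1
    · rw [← mul_assoc, ← mul_assoc, ← hPa]
    · rw [← mul_assoc, ← mul_assoc, ← hPb]
  · intro x
    obtain ⟨x, rfl⟩ := I.mkQ_surjective x
    obtain ⟨u, hu, v, hv, huv⟩ := hdec x
    obtain ⟨P, hP⟩ := hS u hu
    obtain ⟨P', hP'⟩ := hS v hv
    refine ⟨Sum.elim ![P, P'] fun k => C (bQ.repr (I.mkQ x) k), ?_⟩
    simp only [Fintype.sum_sum_type, Sum.elim_inl, Fin.sum_univ_two, Matrix.cons_val_zero,
      Matrix.cons_val_one, Sum.elim_inr, aeval_C, Module.algebraMap_end_apply, q]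
    rw [hpart P P' u v hP hP', ← huv]
    have h1 : ∑ k, bQ.repr (I.mkQ x) k • I.mkQ ((1 - e) * h k) =
        lmulQ hI (1 - e) (∑ k, bQ.repr (I.mkQ x) k • bQ k) := by
      simp only [map_sum, map_smul]
      refine Finset.sum_congr rfl fun k _ => ?_
      rw [← hh k, lmulQ_mk]
    rw [h1, bQ.sum_repr, lmulQ_mk, ← map_add]
    congr 1
    rw [sub_mul, one_mul, add_sub_cancel]
  · have hmem : ∀ z ∈ I, I.mkQ ((e : ℍ[T, ε, θ]) * z) = 0 := fun z hz => by
      rw [Submodule.mkQ_apply, Submodule.Quotient.mk_eq_zero]; exact hI _ _ hz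
    rintro (i | k)
    · fin_cases i
      · simpa [Fintype.sum_sum_type, r, q] using (hpart Pa Pb a b hPa hPb).trans (hmem _ hx)
      · simpa [Fintype.sum_sum_type, r, q] using (hpart Pc Pd c d hPc hPd).trans (hmem _ hx')
    · simp only [r, q, Fintype.sum_sum_type, Matrix.fromBlocks_apply₂₁, Matrix.zero_apply, map_zero,
        LinearMap.zero_apply, Finset.sum_const_zero, zero_add, Matrix.fromBlocks_apply₂₂,
        Matrix.scalar_apply, Sum.elim_inr]
      rw [Finset.sum_eq_single k]
      · rw [Matrix.diagonal_apply_eq, aeval_X, lmulQ_mk, ← mul_assoc, mul_sub, mul_one, hw,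
          sub_self, zero_mul, map_zero]
      · intro l _ hl
        rw [Matrix.diagonal_apply_ne _ (Ne.symm hl), map_zero, LinearMap.zero_apply]
      · simp

/-- The two products `X * star X'` of elements of a left ideal whose `2 × 2` determinants over
`T[i]` vanish are zero. -/
lemma mul_star_eq_zero_of_left {I : Submodule A ℍ[T, ε, θ]} (hI : IsLeftStable I) (e : T)
    (h : ∀ x ∈ I, ∀ x' ∈ I, (e : ℍ[T, ε, θ]) * ((⟨x.re, x.imI, 0, 0⟩ : ℍ[T, ε, θ]) *
      ⟨x'.imJ, x'.imK, 0, 0⟩ - ⟨x.imJ, x.imK, 0, 0⟩ * ⟨x'.re, x'.imI, 0, 0⟩) = 0)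
    {x x' : ℍ[T, ε, θ]} (hx : x ∈ I) (hx' : x' ∈ I) :
    (e : ℍ[T, ε, θ]) * (x * star x') = 0 := by
  have h1 := h x hx x' hx'
  -- The determinants attached to (x, x') and to (j x, x') together give the four components of x
  -- x'^*.
  have h2 := h _ (hI ⟨0, 0, 1, 0⟩ x hx) x' hx'
  rw [QuaternionAlgebra.ext_iff] at h1 h2 ⊢
  simp at h1 h2 ⊢
  exact ⟨by linear_combination -h2.1, by linear_combination h2.2, by linear_combination -h1.1,
    by linear_combination -h1.2⟩

lemma mul_star_eq_zero_of_right {I : Submodule A ℍ[T, ε, θ]} (hI : IsLeftStable I) (e : T)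
    (h : ∀ x ∈ I, ∀ x' ∈ I, (e : ℍ[T, ε, θ]) * ((⟨x.re, 0, x.imJ, 0⟩ : ℍ[T, ε, θ]) *
      ⟨x'.imI, 0, -x'.imK, 0⟩ - ⟨x.imI, 0, -x.imK, 0⟩ * ⟨x'.re, 0, x'.imJ, 0⟩) = 0)
    {x x' : ℍ[T, ε, θ]} (hx : x ∈ I) (hx' : x' ∈ I) :
    (e : ℍ[T, ε, θ]) * (x * star x') = 0 := by
  have h1 := h x hx x' hx'
  have h2 := h _ (hI ⟨0, 1, 0, 0⟩ x hx) x' hx'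
  rw [QuaternionAlgebra.ext_iff] at h1 h2 ⊢
  simp at h1 h2 ⊢
  exact ⟨by linear_combination -h2.1, by linear_combination -h1.1, by linear_combination h2.2,
    by linear_combination h1.2⟩

variable {I : Submodule A ℍ[T, ε, θ]}

/-- This is the automorphism i ↦ -i, j ↦ j. The pairing of the image of x with y is, up to sign, the
j-component of y x^*, which vanishes; and by `hperp` the ideal contains its orthogonal. -/
lemma conj_mem_of_mul_star_eq_zero (hzero : ∀ x ∈ I, ∀ x' ∈ I, x * star x' = 0)
    (hperp : ∀ z, (∀ y ∈ I, (star z * y).imJ = 0) → z ∈ I) {x : ℍ[T, ε, θ]} (hx : x ∈ I) :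
    (⟨x.re, -x.imI, x.imJ, -x.imK⟩ : ℍ[T, ε, θ]) ∈ I := by
  refine hperp _ fun y hy => ?_
  have := congrArg QuaternionAlgebra.imJ (hzero y hy x hx)
  simp at this ⊢
  linear_combination this

/-- A left ideal `I` as above is determined by `I ∩ T[j]`. -/
lemma mem_iff_of_mul_star_eq_zero (hI : IsLeftStable I) (h2 : IsUnit (2 : T)) (hε : IsUnit ε)
    (hzero : ∀ x ∈ I, ∀ x' ∈ I, x * star x' = 0)
    (hperp : ∀ z, (∀ y ∈ I, (star z * y).imJ = 0) → z ∈ I) (x : ℍ[T, ε, θ]) :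
    x ∈ I ↔ (⟨x.re, 0, x.imJ, 0⟩ : ℍ[T, ε, θ]) ∈ I ∧ (⟨x.imI, 0, x.imK, 0⟩ : ℍ[T, ε, θ]) ∈ I := by
  obtain ⟨u, hu⟩ := h2
  obtain ⟨v, hv⟩ := hε
  have hu' : (↑u⁻¹ : T) * 2 = 1 := by rw [← hu]; simp
  have hv' : (↑v⁻¹ : T) * ε = 1 := by rw [← hv]; simp
  have key : ∀ t : T, ∀ y ∈ I, t • y ∈ I := fun t y hy => by
    rw [← QuaternionAlgebra.coe_mul_eq_smul]; exact hI _ _ hy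
  constructor
  · intro hx
    have hc := conj_mem_of_mul_star_eq_zero hzero hperp hx
    -- Half the sum of x and its conjugate isolates the part in T[j]. Half the difference is i times
    -- the other part, so multiplying it by i and by ε⁻¹ recovers that part.
    have h1 := key (↑u⁻¹) _ (add_mem hx hc)
    have h2 := key (↑u⁻¹ * ↑v⁻¹) _ (hI ⟨0, 1, 0, 0⟩ _ (sub_mem hx hc))
    constructor
    · convert h1 using 1
      ext <;> simp
      · linear_combination (-x.re) * hu'
      · linear_combination (-x.imJ) * hu'
    · convert h2 using 1
      ext <;> simp
      · linear_combination (-x.imI * ↑v⁻¹ * ε) * hu' - x.imI * hv'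
      · linear_combination (-x.imK * ↑v⁻¹ * ε) * hu' - x.imK * hv'
  · rintro ⟨h1, h2⟩
    convert add_mem h1 (hI ⟨0, 1, 0, 0⟩ _ h2) using 1
    ext <;> simp

end QuaternionIdeal

/-! ### Polynomials in j and the quadratic relations -/

section EvenOdd

variable {A : Type*} [CommRing A]

/-- Since j² = θ, the even and odd parts of Q give the two components of Q(j) in T ⊕ T j. -/
lemma eq_expand_contract_add (Q : A[X]) :
    Q = expand A 2 (contract 2 Q) + X * expand A 2 (contract 2 Q.divX) := by
  ext k
  rw [coeff_add]
  rcases Nat.even_or_odd' k with ⟨m, rfl | rfl⟩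
  · rw [mul_comm 2 m, coeff_expand_mul two_pos, coeff_contract two_ne_zero]
    rcases m with _ | m
    · simp
    · rw [show (m + 1) * 2 = (m * 2 + 1) + 1 by ring, coeff_X_mul, coeff_expand two_pos,
        if_neg (by omega), add_zero]
  · rw [coeff_X_mul, coeff_expand two_pos, if_neg (by omega), zero_add, mul_comm 2 m,
      coeff_expand_mul two_pos, coeff_contract two_ne_zero, coeff_divX]

lemma degree_contract_two_lt {Q : A[X]} {n : ℕ} (h : Q.degree < (2 * n : ℕ)) :
    (contract 2 Q).degree < n := by
  rw [degree_lt_iff_coeff_zero] at h ⊢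
  intro m hm
  rw [coeff_contract two_ne_zero]
  exact h _ (by omega)

lemma degree_contract_two_divX_lt {Q : A[X]} {n : ℕ} (h : Q.degree < (2 * n : ℕ)) :
    (contract 2 Q.divX).degree < n := by
  rw [degree_lt_iff_coeff_zero] at h ⊢
  intro m hm
  rw [coeff_contract two_ne_zero, coeff_divX]
  exact h _ (by omega)

end EvenOdd

section Chart

variable {A T : Type*} [CommRing A] [CommRing T] [Algebra A T] {ε θ : T}

variable (ε θ) in
/-- The generator `j` of `T[j]`. -/
def quatJ : ℍ[T, ε, θ] := ⟨0, 0, 1, 0⟩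

lemma quatJ_sq : quatJ ε θ ^ 2 = (θ : ℍ[T, ε, θ]) := by
  rw [sq]; ext <;> simp [quatJ]

lemma coe_aeval (U : A[X]) : ((aeval θ U : T) : ℍ[T, ε, θ]) = aeval (θ : ℍ[T, ε, θ]) U := by
  rw [← QuaternionAlgebra.coe_algebraMap]
  exact (aeval_algebraMap_apply _ _ _).symm

lemma aeval_quatJ (Q : A[X]) : aeval (quatJ ε θ) Q =
    (⟨aeval θ (contract 2 Q), 0, aeval θ (contract 2 Q.divX), 0⟩ : ℍ[T, ε, θ]) := by
  conv_lhs => rw [eq_expand_contract_add Q]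
  rw [map_add, map_mul, aeval_X, expand_aeval, expand_aeval, quatJ_sq, ← coe_aeval, ← coe_aeval]
  ext <;> simp [quatJ]

/-- Independence of the first n powers of θ on the component of `e` doubles to independence of the
first 2 n powers of j, because both parts of Q have degree less than n. -/
lemma eq_zero_of_aeval_quatJ_mul_eq_zero {e : T} {n : ℕ}
    (hind : ∀ Q : A[X], Q.degree < n → aeval θ Q * e = 0 → Q = 0) {Q : A[X]}
    (hQ : Q.degree < (2 * n : ℕ)) (h : aeval (quatJ ε θ) Q * (e : ℍ[T, ε, θ]) = 0) : Q = 0 := by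
  rw [aeval_quatJ] at h
  have h1 := congrArg QuaternionAlgebra.re h
  have h2 := congrArg QuaternionAlgebra.imJ h
  simp at h1 h2
  rw [eq_expand_contract_add Q, hind _ (degree_contract_two_lt hQ) h1,
    hind _ (degree_contract_two_divX_lt hQ) h2]
  simp

lemma star_aeval_quatJ (P : A[X]) :
    star (aeval (quatJ ε θ) P) = aeval (quatJ ε θ) (P.comp (-X)) := by
  have h : star (quatJ ε θ) = -quatJ ε θ := by ext <;> simp [quatJ]
  have hs : ∀ (a : A) (x : ℍ[T, ε, θ]), star (a • x) = a • star x := fun a x => by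
    ext <;> simp
  rw [aeval_comp, map_neg, aeval_X, ← h]
  induction P using Polynomial.induction_on' with
  | add p q hp hq => simp only [map_add, star_add, hp, hq]
  | monomial n a => rw [aeval_monomial, aeval_monomial, ← Algebra.smul_def, ← Algebra.smul_def,
      hs, star_pow]

/-- Since j^* = -j, this is x x^* = 0 for x = P(j) e. -/
lemma aeval_mul_comp_neg_eq_zero {I : Submodule A ℍ[T, ε, θ]}
    (hzero : ∀ x ∈ I, ∀ x' ∈ I, x * star x' = 0) {e : T} (he : e * e = e) (P : A[X])
    (h : aeval (quatJ ε θ) P * (e : ℍ[T, ε, θ]) ∈ I) :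
    aeval (quatJ ε θ) (P * P.comp (-X)) * (e : ℍ[T, ε, θ]) = 0 := by
  have := hzero _ h _ h
  rw [star_mul, QuaternionAlgebra.star_coe, star_aeval_quatJ] at this
  rw [map_mul, ← this]
  have he' : (e : ℍ[T, ε, θ]) * (e : ℍ[T, ε, θ]) = e := by rw [← QuaternionAlgebra.coe_mul, he]
  have hc : ∀ x : ℍ[T, ε, θ], (e : ℍ[T, ε, θ]) * x = x * e := QuaternionAlgebra.comm e
  rw [mul_assoc, mul_assoc, ← mul_assoc (e : ℍ[T, ε, θ]), he', hc]

lemma coeff_comp_neg_X (P : A[X]) (k : ℕ) : (P.comp (-X)).coeff k = P.coeff k * (-1) ^ k := by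
  rw [show (-X : A[X]) = C (-1) * X by simp, comp_C_mul_X_coeff]

/-- Over a domain, a nonzero polynomial of degree less than `n` in `j` cannot lie in `I`. -/
lemma eq_zero_of_aeval_quatJ_mem [IsDomain A] {I : Submodule A ℍ[T, ε, θ]}
    (hzero : ∀ x ∈ I, ∀ x' ∈ I, x * star x' = 0) {e : T} (he : e * e = e) {n : ℕ}
    (hind : ∀ Q : A[X], Q.degree < n → aeval θ Q * e = 0 → Q = 0) {P : A[X]}
    (hP : P.degree < n) (h : aeval (quatJ ε θ) P * (e : ℍ[T, ε, θ]) ∈ I) : P = 0 := by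
  by_contra hne
  have hne' : P.comp (-X) ≠ 0 := by
    intro h0
    apply hne
    rw [show P = (P.comp (-X)).comp (-X) from (comp_neg_X_comp_neg_X P).symm, h0, zero_comp]
  -- The product P(X) P(-X) has degree less than 2 n and vanishes at j on the component of `e`, so
  -- it is zero; over a domain a factor must vanish.
  have h1 := eq_zero_of_aeval_quatJ_mul_eq_zero hind (Q := P * P.comp (-X)) ?_
    (aeval_mul_comp_neg_eq_zero hzero he P h)
  · exact mul_ne_zero hne hne' h1
  · rw [degree_mul, degree_eq_natDegree hne, degree_eq_natDegree hne', natDegree_eq_of_degree_eq degree_comp_neg_X]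
    rw [degree_eq_natDegree hne, Nat.cast_lt] at hP
    rw [← Nat.cast_add, Nat.cast_lt]
    omega

/-- The quadratic relations between the coefficients of a monic `P` with `P(j)` in `I`. -/
lemma mul_comp_neg_eq_of_monic {I : Submodule A ℍ[T, ε, θ]}
    (hzero : ∀ x ∈ I, ∀ x' ∈ I, x * star x' = 0) {e : T} (he : e * e = e) {n : ℕ}
    (hind : ∀ Q : A[X], Q.degree < n → aeval θ Q * e = 0 → Q = 0) (E : A[X])
    (hE : E.Monic) (hEn : E.natDegree = n) (hEθ : aeval θ E * e = 0) {P : A[X]}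
    (hP : P.Monic) (hPn : P.natDegree = n) (h : aeval (quatJ ε θ) P * (e : ℍ[T, ε, θ]) ∈ I) :
    P * P.comp (-X) = (-1) ^ n * expand A 2 E := by
  rcases subsingleton_or_nontrivial A with _ | _
  · exact Subsingleton.elim _ _
  rw [← sub_eq_zero]
  refine eq_zero_of_aeval_quatJ_mul_eq_zero (ε := ε) hind ?_ ?_
  -- The sign makes (-1)^n P(-X) monic. Both sides are then monic of degree 2 n up to the common
  -- sign, so their difference has degree less than 2 n and independence applies.
  · have h1 : ((-1) ^ n * P.comp (-X)).Monic := hPn ▸ hP.neg_one_pow_natDegree_mul_comp_neg_X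
    have h2 : (P * ((-1) ^ n * P.comp (-X))).Monic := hP.mul h1
    have h3 : (expand A 2 E).Monic := hE.expand two_pos
    have h4 : (P * ((-1) ^ n * P.comp (-X))).natDegree = 2 * n := by
      rw [hP.natDegree_mul h1, hPn]
      have h5 : ((-1) ^ n * P.comp (-X)).natDegree = n := by
        have : ((-1 : A[X]) ^ n) = C ((-1) ^ n) := by simp
        rw [this, natDegree_C_mul_of_mul_ne_zero, natDegree_eq_of_degree_eq degree_comp_neg_X, hPn]
        rw [comp_neg_X_leadingCoeff_eq, hPn, hP.leadingCoeff, mul_one, ← mul_pow]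
        simp
      rw [h5]; ring
    have h5 : (expand A 2 E).natDegree = 2 * n := by rw [natDegree_expand, hEn, mul_comm]
    have h6 := degree_sub_lt_left (p := P * ((-1) ^ n * P.comp (-X))) (q := expand A 2 E) (by
      rw [degree_eq_natDegree h2.ne_zero, degree_eq_natDegree h3.ne_zero, h4, h5]) h2.ne_zero
      (by rw [h2.leadingCoeff, h3.leadingCoeff])
    rw [degree_eq_natDegree h2.ne_zero, h4] at h6
    have h7 : P * P.comp (-X) - (-1) ^ n * expand A 2 E =
        C ((-1) ^ n) * (P * ((-1) ^ n * P.comp (-X)) - expand A 2 E) := by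
      have : ((-1 : A[X]) ^ n) * ((-1) ^ n) = 1 := by rw [← mul_pow]; simp
      simp only [C_pow, C_neg, C_1]
      linear_combination (-P * P.comp (-X)) * this
    rw [h7]
    rw [← smul_eq_C_mul]
    exact (degree_smul_le _ _).trans_lt h6
  · rw [map_sub, sub_mul, aeval_mul_comp_neg_eq_zero hzero he P h, map_mul, mul_assoc,
      expand_aeval, quatJ_sq, ← coe_aeval, ← QuaternionAlgebra.coe_mul, hEθ]
    simp

end Chart

/-! ### Extending characteristic polynomial identities from an order to its completion -/

section QuadDet

variable {ι : Type*} [Fintype ι] [DecidableEq ι] {B B' : Type*} [CommRing B] [CommRing B']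

/-- `det (X² - t X + n)`. -/
noncomputable def quadDet (t n : Matrix ι ι B) : B[X] :=
  ((X : B[X]) ^ 2 • (1 : Matrix ι ι B[X]) - (X : B[X]) • t.map C + n.map C).det

lemma quadDet_map (f : B →+* B') (t n : Matrix ι ι B) :
    quadDet (t.map f) (n.map f) = (quadDet t n).map f := by
  rw [quadDet, quadDet, ← coe_mapRingHom, RingHom.map_det]
  congr 1
  ext1 i j
  by_cases h : i = j
  · subst h; simp
  · simp [Matrix.one_apply_ne h]

end QuadDet

section ReducedCharpoly

variable {p : ℕ} [Fact p.Prime] {R : Type*} [CommRing R] [Algebra ℤ_[p] R] {ε θ : R}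
  {ι : Type*} [Fintype ι] [DecidableEq ι] (bR : Module.Basis ι ℤ_[p] R)

/-- The reduced characteristic polynomial over `ℤ_p` of an element of `ℍ[R, ε, θ]`. -/
noncomputable def rcp (x : ℍ[R, ε, θ]) : ℤ_[p][X] :=
  quadDet (Algebra.leftMulMatrix bR (2 * x.re)) (Algebra.leftMulMatrix bR (x * star x).re)

/-- Along the line x + c y the trace is affine and the norm quadratic in c, so the coefficients of
the reduced characteristic polynomial are polynomials in c. -/
lemma exists_rcp_add_smul (x y : ℍ[R, ε, θ]) : ∃ D : ℤ_[p][X][X], ∀ c : ℤ_[p],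
    rcp bR (x + c • y) = D.map (evalRingHom c) := by
  refine ⟨quadDet ((Algebra.leftMulMatrix bR (2 * x.re)).map C +
      (X : ℤ_[p][X]) • (Algebra.leftMulMatrix bR (2 * y.re)).map C)
    ((Algebra.leftMulMatrix bR (x * star x).re).map C + (X : ℤ_[p][X]) •
      (Algebra.leftMulMatrix bR (x * star y + y * star x).re).map C + (X : ℤ_[p][X]) ^ 2 •
      (Algebra.leftMulMatrix bR (y * star y).re).map C), fun c => ?_⟩
  rw [← quadDet_map, rcp]
  congr 1
  · have : 2 * (x + c • y).re = 2 * x.re + c • (2 * y.re) := by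
      simp [mul_add]
    rw [this, map_add, map_smul]
    generalize Algebra.leftMulMatrix bR (2 * x.re) = M₁
    generalize Algebra.leftMulMatrix bR (2 * y.re) = M₂
    ext1 i j
    simp
    ring
  · have : ((x + c • y) * star (x + c • y)).re =
        (x * star x).re + c • (x * star y + y * star x).re + c ^ 2 • (y * star y).re := by
      simp
      simp only [Algebra.smul_def, map_pow]
      ring
    rw [this, map_add, map_add, map_smul, map_smul]
    generalize Algebra.leftMulMatrix bR (x * star x).re = M₁
    generalize Algebra.leftMulMatrix bR (y * star y).re = M₂
    generalize Algebra.leftMulMatrix bR (x * star y + y * star x).re = M₃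
    ext1 i j
    simp
    ring

variable {A : Type*} [CommRing A] [Algebra ℤ_[p] A] {κ : Type*} [Fintype κ] [DecidableEq κ]

/-- The coefficients of both sides are polynomials in c that agree on ℕ, hence on ℤ_p by
`eval_algebraMap_eq_zero_of_forall_nat`, even if `A` has torsion. -/
lemma charpoly_eq_rcp_add_smul (ρ : ℍ[R, ε, θ] →ₗ[ℤ_[p]] Matrix κ κ A) (x y : ℍ[R, ε, θ])
    (h : ∀ n : ℕ, (ρ (x + (n : ℤ_[p]) • y)).charpoly =
      (rcp bR (x + (n : ℤ_[p]) • y)).map (algebraMap ℤ_[p] A)) (c : ℤ_[p]) :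
    (ρ (x + c • y)).charpoly = (rcp bR (x + c • y)).map (algebraMap ℤ_[p] A) := by
  obtain ⟨D, hD⟩ := exists_rcp_add_smul bR x y
  let D' : A[X][X] := D.map (mapRingHom (algebraMap ℤ_[p] A))
  let M : Matrix κ κ A[X] := (ρ x).map C + (X : A[X]) • (ρ y).map C
  have hM : ∀ c : ℤ_[p], (ρ (x + c • y)).charpoly =
      M.charpoly.map (evalRingHom (algebraMap ℤ_[p] A c)) := fun c => by
    rw [← Matrix.charpoly_map]
    congr 1
    ext1 i j
    simp only [map_add, map_smul, Matrix.add_apply, Matrix.smul_apply, Matrix.map_apply, M]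
    simp [Algebra.smul_def]
    ring
  have hD' : ∀ c : ℤ_[p], (rcp bR (x + c • y)).map (algebraMap ℤ_[p] A) =
      D'.map (evalRingHom (algebraMap ℤ_[p] A c)) := fun c => by
    rw [hD, Polynomial.map_map, Polynomial.map_map]
    congr 1
    ext a
    · simp
    · simp
  ext k
  have := eval_algebraMap_eq_zero_of_forall_nat ((M.charpoly - D').coeff k) (fun n => ?_) c
  · rw [coeff_sub, eval_sub, sub_eq_zero] at this
    rw [hM, hD', coeff_map, coeff_map]
    exact this
  · have hn := congrArg (fun P => coeff P k) (h n)
    beta_reduce at hn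
    rw [hM, hD', coeff_map, coeff_map] at hn
    rw [coeff_sub, eval_sub, sub_eq_zero]
    simpa using hn

/-- A characteristic polynomial identity that holds on a subring holds on its `ℤ_p`-span. -/
theorem charpoly_eq_rcp_of_span {O : Type*} [Ring O] (φ : O →+* ℍ[R, ε, θ])
    (hφ : Submodule.span ℤ_[p] (Set.range φ) = ⊤) (ρ : ℍ[R, ε, θ] →ₗ[ℤ_[p]] Matrix κ κ A)
    (h : ∀ a, (ρ (φ a)).charpoly = (rcp bR (φ a)).map (algebraMap ℤ_[p] A)) (x : ℍ[R, ε, θ]) :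
    (ρ x).charpoly = (rcp bR x).map (algebraMap ℤ_[p] A) := by
  let P : ℍ[R, ε, θ] → Prop := fun x =>
    (ρ x).charpoly = (rcp bR x).map (algebraMap ℤ_[p] A)
  -- The coordinates are freed one at a time. The property is kept for `φ a + z` with every `a`, so
  -- that natural multiples of `φ b` can be absorbed in `a`.
  have key : ∀ z : ℍ[R, ε, θ], (∀ a, P (φ a + z)) → ∀ (b : O) (c : ℤ_[p]), ∀ a,
      P (φ a + (z + c • φ b)) := by
    intro z hz b c a
    rw [← add_assoc]
    refine charpoly_eq_rcp_add_smul bR ρ _ _ (fun n => ?_) c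
    have := hz (a + n * b)
    rw [map_add, map_mul, map_natCast] at this
    convert this using 3 <;>
    · rw [add_right_comm, Nat.cast_smul_eq_nsmul, nsmul_eq_mul]
  have hx : x ∈ Submodule.span ℤ_[p] (Set.range φ) := by rw [hφ]; trivial
  obtain ⟨c, rfl⟩ := Finsupp.mem_span_range_iff_exists_finsupp.1 hx
  have : ∀ s : Finset O, ∀ a, P (φ a + ∑ b ∈ s, c b • φ b) := by
    intro s
    induction s using Finset.cons_induction with
    | empty => intro a; simpa [P] using h a
    | cons b s hb ih =>
      intro a
      rw [Finset.sum_cons, add_comm (c b • φ b)]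
      exact key _ ih b (c b) a
  simpa only [P, map_zero, zero_add, Finsupp.sum] using this c.support 0

end ReducedCharpoly

/-! ### Base change of quaternion algebras -/

section BaseChange

variable {k : Type*} [CommRing k] (A : Type*) [CommRing A] [Algebra k A]
  {R : Type*} [CommRing R] [Algebra k R] {ε θ : R}

variable (k) in
/-- The image of an element of `ℍ[R, ε, θ]` in its base change to `A`. -/
def quatMap (x : ℍ[R, ε, θ]) : ℍ[A ⊗[k] R, (1 : A) ⊗ₜ[k] ε, (1 : A) ⊗ₜ[k] θ] :=
  ⟨1 ⊗ₜ x.re, 1 ⊗ₜ x.imI, 1 ⊗ₜ x.imJ, 1 ⊗ₜ x.imK⟩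

/-- `A ⊗ ℍ[R, ε, θ] ≃ ℍ[A ⊗ R, ε, θ]`. -/
noncomputable def quatBaseChange :
    A ⊗[k] ℍ[R, ε, θ] ≃ₗ[A] ℍ[A ⊗[k] R, (1 : A) ⊗ₜ[k] ε, (1 : A) ⊗ₜ[k] θ] :=
  LinearEquiv.ofLinearMap
    { toFun := fun x => ⟨((QuaternionAlgebra.reₗ ε 0 θ).restrictScalars k).baseChange A x,
        ((QuaternionAlgebra.imIₗ ε 0 θ).restrictScalars k).baseChange A x,
        ((QuaternionAlgebra.imJₗ ε 0 θ).restrictScalars k).baseChange A x,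
        ((QuaternionAlgebra.imKₗ ε 0 θ).restrictScalars k).baseChange A x⟩
      map_add' := fun x y => by ext <;> simp
      map_smul' := fun a x => by ext <;> simp }
    (((LinearMap.toSpanSingleton R ℍ[R, ε, θ] ⟨1, 0, 0, 0⟩).restrictScalars k).baseChange A ∘ₗ
        (QuaternionAlgebra.reₗ _ 0 _).restrictScalars A +
      ((LinearMap.toSpanSingleton R ℍ[R, ε, θ] ⟨0, 1, 0, 0⟩).restrictScalars k).baseChange A ∘ₗ
        (QuaternionAlgebra.imIₗ _ 0 _).restrictScalars A +
      ((LinearMap.toSpanSingleton R ℍ[R, ε, θ] ⟨0, 0, 1, 0⟩).restrictScalars k).baseChange A ∘ₗ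
        (QuaternionAlgebra.imJₗ _ 0 _).restrictScalars A +
      ((LinearMap.toSpanSingleton R ℍ[R, ε, θ] ⟨0, 0, 0, 1⟩).restrictScalars k).baseChange A ∘ₗ
        (QuaternionAlgebra.imKₗ _ 0 _).restrictScalars A)
    (by
      have hc : ∀ (q : ℍ[R, ε, θ]) (ψ : ℍ[R, ε, θ] →ₗ[R] R) (t : A ⊗[k] R),
          (ψ.restrictScalars k).baseChange A (((LinearMap.toSpanSingleton R ℍ[R, ε, θ]
            q).restrictScalars k).baseChange A t) = ((1 : A) ⊗ₜ[k] ψ q) * t := fun q ψ t => by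
        induction t using TensorProduct.induction_on with
        | zero => simp
        | add x y hx hy => simp only [map_add, hx, hy, mul_add]
        | tmul a r => simp [mul_comm]
      refine LinearMap.ext fun x => ?_
      ext <;> simp [hc, ← Algebra.TensorProduct.one_def])
    (by
      refine AlgebraTensorModule.ext fun a x => ?_
      simp
      rw [← tmul_add, ← tmul_add, ← tmul_add]
      congr 1
      ext <;> simp)

end BaseChange

section QuatMapHom

variable {k : Type*} [CommRing k] (A : Type*) [CommRing A] [Algebra k A]
  {R : Type*} [CommRing R] [Algebra k R] {ε θ : R}

variable (k) in
/-- `quatMap` as a homomorphism of algebras. -/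
noncomputable def quatMapHom :
    ℍ[R, ε, θ] →ₐ[k] ℍ[A ⊗[k] R, (1 : A) ⊗ₜ[k] ε, (1 : A) ⊗ₜ[k] θ] :=
  AlgHom.ofLinearMap
    { toFun := quatMap k A
      map_add' := fun x y => by ext <;> simp [quatMap, tmul_add]
      map_smul' := fun c x => by ext <;> simp [quatMap] }
    (by ext <;> simp [quatMap, Algebra.TensorProduct.one_def])
    (fun x y => by
      ext <;> simp [quatMap, tmul_add, tmul_sub])

@[simp] lemma quatMapHom_re (x : ℍ[R, ε, θ]) : (quatMapHom k A x).re = 1 ⊗ₜ x.re := rfl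
@[simp] lemma quatMapHom_imI (x : ℍ[R, ε, θ]) : (quatMapHom k A x).imI = 1 ⊗ₜ x.imI := rfl
@[simp] lemma quatMapHom_imJ (x : ℍ[R, ε, θ]) : (quatMapHom k A x).imJ = 1 ⊗ₜ x.imJ := rfl
@[simp] lemma quatMapHom_imK (x : ℍ[R, ε, θ]) : (quatMapHom k A x).imK = 1 ⊗ₜ x.imK := rfl

lemma quatMapHom_star (x : ℍ[R, ε, θ]) : quatMapHom k A (star x) = star (quatMapHom k A x) := by
  ext <;> simp [tmul_neg]

lemma quatMapHom_coe (r : R) : quatMapHom k A (r : ℍ[R, ε, θ]) =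
    (((1 : A) ⊗ₜ[k] r : A ⊗[k] R) : ℍ[A ⊗[k] R, (1 : A) ⊗ₜ[k] ε, (1 : A) ⊗ₜ[k] θ]) := by
  ext <;> simp

lemma quatBaseChange_tmul (a : A) (x : ℍ[R, ε, θ]) :
    quatBaseChange A (a ⊗ₜ[k] x) = a • quatMapHom k A x := by
  ext <;> simp [quatBaseChange, TensorProduct.smul_tmul']

lemma span_range_quatMapHom :
    Submodule.span A (Set.range (quatMapHom k A (ε := ε) (θ := θ))) = ⊤ := by
  rw [eq_top_iff]
  rintro x -
  obtain ⟨y, rfl⟩ := (quatBaseChange A).surjective x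
  induction y using TensorProduct.induction_on with
  | zero => simp
  | add x y hx hy => rw [map_add]; exact add_mem hx hy
  | tmul a x =>
    rw [quatBaseChange_tmul]
    exact Submodule.smul_mem _ _ (Submodule.subset_span ⟨x, rfl⟩)

lemma aeval_quatMapHom (x : ℍ[R, ε, θ]) (P : k[X]) :
    aeval (quatMapHom k A x) (P.map (algebraMap k A)) = quatMapHom k A (aeval x P) := by
  rw [aeval_map_algebraMap, aeval_algHom_apply]

end QuatMapHom

/-! ### Unit generators and the vanishing of x x'^* -/

section LocalGenerator

variable {p : ℕ} [Fact p.Prime] {R : Type*} [CommRing R] [Algebra ℤ_[p] R]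
  {ι : Type*} [Fintype ι] [DecidableEq ι] (bR : Module.Basis ι ℤ_[p] R) (ε θ : R)

/-- `w` generates `e R[i]` or `e R[j]` (the elements `g a b`) over `ℤ_p`, and its reduced
characteristic polynomial is divisible by a polynomial of `w` with unit constant term. -/
structure IsLocalGenerator (e : R) (g : R → R → ℍ[R, ε, θ]) (w : ℍ[R, ε, θ]) : Prop where
  mul_idem : w * (e : ℍ[R, ε, θ]) = w
  exists_poly : ∃ E : ℤ_[p][X], IsUnit (E.coeff 0) ∧ aeval w E * (e : ℍ[R, ε, θ]) = 0 ∧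
    E ∣ rcp bR w
  gen (a b : R) : ∃ P : ℤ_[p][X], (e : ℍ[R, ε, θ]) * g a b = aeval w P * (e : ℍ[R, ε, θ])

variable {bR ε θ} {A : Type*} [CommRing A] [Algebra ℤ_[p] A]

/-- The polynomials P for which such an identity holds add up and scale, so it suffices to treat the
pairs of pure tensors 1 ⊗ a, 1 ⊗ b, which span over A. -/
lemma IsLocalGenerator.gen_baseChange {e : R} {g : R → R → ℍ[R, ε, θ]} {w : ℍ[R, ε, θ]}
    (h : IsLocalGenerator bR ε θ e g w)
    (g' : (A ⊗[ℤ_[p]] R) × (A ⊗[ℤ_[p]] R) →ₗ[A]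
      ℍ[A ⊗[ℤ_[p]] R, (1 : A) ⊗ₜ[ℤ_[p]] ε, (1 : A) ⊗ₜ[ℤ_[p]] θ])
    (hg : ∀ a b, g' (1 ⊗ₜ a, 1 ⊗ₜ b) = quatMapHom ℤ_[p] A (g a b)) (x) :
    ∃ P : A[X], (((1 : A) ⊗ₜ[ℤ_[p]] e : A ⊗[ℤ_[p]] R) :
        ℍ[A ⊗[ℤ_[p]] R, (1 : A) ⊗ₜ[ℤ_[p]] ε, (1 : A) ⊗ₜ[ℤ_[p]] θ]) * g' x =
      aeval (quatMapHom ℤ_[p] A w) P * (((1 : A) ⊗ₜ[ℤ_[p]] e : A ⊗[ℤ_[p]] R) :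
        ℍ[A ⊗[ℤ_[p]] R, (1 : A) ⊗ₜ[ℤ_[p]] ε, (1 : A) ⊗ₜ[ℤ_[p]] θ]) := by
  have hx : x ∈ Submodule.span A (Set.range fun y : R × R =>
      (((1 : A) ⊗ₜ[ℤ_[p]] y.1, (1 : A) ⊗ₜ[ℤ_[p]] y.2) : (A ⊗[ℤ_[p]] R) × (A ⊗[ℤ_[p]] R))) := by
    obtain ⟨x, y⟩ := x
    rw [← Prod.fst_add_snd (x, y)]
    refine add_mem ?_ ?_
    · induction x using TensorProduct.induction_on with
      | zero => exact zero_mem _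
      | add x y hx hy =>
        simp only at hx hy ⊢
        rw [← add_zero (0 : A ⊗[ℤ_[p]] R), ← Prod.mk_add_mk]; exact add_mem hx hy
      | tmul a r =>
        have := Submodule.smul_mem (Submodule.span A (Set.range fun y : R × R =>
          (((1 : A) ⊗ₜ[ℤ_[p]] y.1, (1 : A) ⊗ₜ[ℤ_[p]] y.2) :
            (A ⊗[ℤ_[p]] R) × (A ⊗[ℤ_[p]] R)))) a (Submodule.subset_span ⟨(r, 0), rfl⟩)
        simpa [TensorProduct.smul_tmul'] using this
    · induction y using TensorProduct.induction_on with
      | zero => exact zero_mem _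
      | add x y hx hy =>
        simp only at hx hy ⊢
        rw [← add_zero (0 : A ⊗[ℤ_[p]] R), ← Prod.mk_add_mk]; exact add_mem hx hy
      | tmul a r =>
        have := Submodule.smul_mem (Submodule.span A (Set.range fun y : R × R =>
          (((1 : A) ⊗ₜ[ℤ_[p]] y.1, (1 : A) ⊗ₜ[ℤ_[p]] y.2) :
            (A ⊗[ℤ_[p]] R) × (A ⊗[ℤ_[p]] R)))) a (Submodule.subset_span ⟨(0, r), rfl⟩)
        simpa [TensorProduct.smul_tmul'] using this
  induction hx using Submodule.span_induction with
  | mem x hx =>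
    obtain ⟨⟨a, b⟩, rfl⟩ := hx
    obtain ⟨P, hP⟩ := h.gen a b
    refine ⟨P.map (algebraMap _ _), ?_⟩
    rw [aeval_quatMapHom, hg, ← quatMapHom_coe, ← map_mul, ← map_mul, hP]
  | zero => exact ⟨0, by simp⟩
  | add x y _ _ hx hy =>
    obtain ⟨P, hP⟩ := hx
    obtain ⟨Q, hQ⟩ := hy
    exact ⟨P + Q, by rw [map_add, mul_add, hP, hQ, map_add, add_mul]⟩
  | smul c x _ hx =>
    obtain ⟨P, hP⟩ := hx
    exact ⟨c • P, by rw [map_smul, mul_smul_comm, hP, map_smul, smul_mul_assoc]⟩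

variable {I : Submodule A ℍ[A ⊗[ℤ_[p]] R, (1 : A) ⊗ₜ[ℤ_[p]] ε, (1 : A) ⊗ₜ[ℤ_[p]] θ]}
  {κ : Type*} [Fintype κ] [DecidableEq κ]

/-- Every element is a + b j with a, b in T[i], so `mul_sub_mul_eq_zero_of_mem` applies with y = j.
-/
lemma IsLocalGenerator.mul_star_eq_zero_left {e : R} (he : e * e = e) {w : ℍ[R, ε, θ]}
    (h : IsLocalGenerator bR ε θ e (fun a b => ⟨a, b, 0, 0⟩) w) (hI : IsLeftStable I)
    (bQ : Module.Basis κ A (_ ⧸ I))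
    (hchar : ∀ x : ℍ[R, ε, θ], (LinearMap.toMatrix bQ bQ (lmulQ hI (quatMapHom ℤ_[p] A x))).charpoly
      = (rcp bR x).map (algebraMap ℤ_[p] A)) {x x'} (hx : x ∈ I) (hx' : x' ∈ I) :
    (((1 : A) ⊗ₜ[ℤ_[p]] e : A ⊗[ℤ_[p]] R) :
        ℍ[A ⊗[ℤ_[p]] R, (1 : A) ⊗ₜ[ℤ_[p]] ε, (1 : A) ⊗ₜ[ℤ_[p]] θ]) * (x * star x') = 0 := by
  refine mul_star_eq_zero_of_left hI _ (fun x hx x' hx' => ?_) hx hx'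
  obtain ⟨E, hE0, hEw, hE⟩ := h.exists_poly
  let g' : (A ⊗[ℤ_[p]] R) × (A ⊗[ℤ_[p]] R) →ₗ[A]
      ℍ[A ⊗[ℤ_[p]] R, (1 : A) ⊗ₜ[ℤ_[p]] ε, (1 : A) ⊗ₜ[ℤ_[p]] θ] :=
    { toFun := fun x => ⟨x.1, x.2, 0, 0⟩
      map_add' := fun x y => by ext <;> simp
      map_smul' := fun a x => by ext <;> simp }
  refine mul_sub_mul_eq_zero_of_mem hI bQ _ ?_ (quatMapHom ℤ_[p] A w) ?_
    (E.map (algebraMap ℤ_[p] A)) ?_ ?_ ?_ ⟨0, 0, 1, 0⟩ (Set.range g') ?_ ?_ ?_ ?_ ?_ ?_ ?_ ?_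
  · simp [he]
  · rw [← quatMapHom_coe, ← map_mul, h.mul_idem]
  · rw [coeff_map]; exact hE0.map _
  · rw [aeval_quatMapHom, ← quatMapHom_coe, ← map_mul, hEw, map_zero]
  · rw [hchar]; exact Polynomial.map_dvd _ hE
  · rintro _ ⟨s, rfl⟩
    refine h.gen_baseChange g' (fun a b => ?_) s
    ext <;> simp [g']
  · intro x
    refine ⟨_, ⟨(x.re, x.imI), rfl⟩, _, ⟨(x.imJ, x.imK), rfl⟩, ?_⟩
    ext <;> simp [g']
  · exact ⟨(_, _), rfl⟩
  · exact ⟨(_, _), rfl⟩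
  · exact ⟨(_, _), rfl⟩
  · exact ⟨(_, _), rfl⟩
  · convert hx using 1
    ext <;> simp
  · convert hx' using 1
    ext <;> simp

lemma IsLocalGenerator.mul_star_eq_zero_right {e : R} (he : e * e = e) {w : ℍ[R, ε, θ]}
    (h : IsLocalGenerator bR ε θ e (fun a b => ⟨a, 0, b, 0⟩) w) (hI : IsLeftStable I)
    (bQ : Module.Basis κ A (_ ⧸ I))
    (hchar : ∀ x : ℍ[R, ε, θ], (LinearMap.toMatrix bQ bQ (lmulQ hI (quatMapHom ℤ_[p] A x))).charpoly
      = (rcp bR x).map (algebraMap ℤ_[p] A)) {x x'} (hx : x ∈ I) (hx' : x' ∈ I) :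
    (((1 : A) ⊗ₜ[ℤ_[p]] e : A ⊗[ℤ_[p]] R) :
        ℍ[A ⊗[ℤ_[p]] R, (1 : A) ⊗ₜ[ℤ_[p]] ε, (1 : A) ⊗ₜ[ℤ_[p]] θ]) * (x * star x') = 0 := by
  refine mul_star_eq_zero_of_right hI _ (fun x hx x' hx' => ?_) hx hx'
  obtain ⟨E, hE0, hEw, hE⟩ := h.exists_poly
  let g' : (A ⊗[ℤ_[p]] R) × (A ⊗[ℤ_[p]] R) →ₗ[A]
      ℍ[A ⊗[ℤ_[p]] R, (1 : A) ⊗ₜ[ℤ_[p]] ε, (1 : A) ⊗ₜ[ℤ_[p]] θ] :=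
    { toFun := fun x => ⟨x.1, 0, x.2, 0⟩
      map_add' := fun x y => by ext <;> simp
      map_smul' := fun a x => by ext <;> simp }
  refine mul_sub_mul_eq_zero_of_mem hI bQ _ ?_ (quatMapHom ℤ_[p] A w) ?_
    (E.map (algebraMap ℤ_[p] A)) ?_ ?_ ?_ ⟨0, 1, 0, 0⟩ (Set.range g') ?_ ?_ ?_ ?_ ?_ ?_ ?_ ?_
  · simp [he]
  · rw [← quatMapHom_coe, ← map_mul, h.mul_idem]
  · rw [coeff_map]; exact hE0.map _
  · rw [aeval_quatMapHom, ← quatMapHom_coe, ← map_mul, hEw, map_zero]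
  · rw [hchar]; exact Polynomial.map_dvd _ hE
  · rintro _ ⟨s, rfl⟩
    refine h.gen_baseChange g' (fun a b => ?_) s
    ext <;> simp [g']
  · intro x
    -- The sign of the last coefficient comes from j i = -i j: the part outside T[j] is (imI - imK
    -- j) i.
    refine ⟨_, ⟨(x.re, x.imJ), rfl⟩, _, ⟨(x.imI, -x.imK), rfl⟩, ?_⟩
    ext <;> simp [g']
  · exact ⟨(_, _), rfl⟩
  · exact ⟨(_, _), rfl⟩
  · exact ⟨(_, _), rfl⟩
  · exact ⟨(_, _), rfl⟩
  · convert hx using 1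
    ext <;> simp
  · convert hx' using 1
    ext <;> simp

end LocalGenerator

/-! ### Points over algebras as left ideals -/

section Points

variable {p : ℕ} [Fact p.Prime] {O : Type*} [Ring O] {Λ : Type*} [AddCommGroup Λ]
  [Module ℤ_[p] Λ]

/-- An adapted frame of an isotropic submodule of `A ⊗ Λ` that is stable under all `ρ a` and such
that `ρ a` has characteristic polynomial `c a` on the quotient. -/
structure IsAlgPoint (ρ : O → Module.End ℤ_[p] Λ) (c : O → ℤ[X]) (ψ : LinearMap.BilinForm ℤ_[p] Λ)
    {A : Type*} [CommRing A] [Algebra ℤ_[p] A] {m : ℕ}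
    (b : Module.Basis (Fin m ⊕ Fin m) A (A ⊗[ℤ_[p]] Λ)) : Prop where
  isotropic (i j : Fin m) : ψ.baseChange A (b (Sum.inl i)) (b (Sum.inl j)) = 0
  stable (a : O) (i j : Fin m) : b.repr ((ρ a).baseChange A (b (Sum.inl i))) (Sum.inr j) = 0
  det (a : O) : (LinearMap.toMatrix b b ((ρ a).baseChange A)).toBlocks₂₂.charpoly =
    (c a).map (Int.castRingHom A)

/-- An identification of `(Λ, ρ, ψ)` with a quaternion order `ℍ[R, ε, θ]`. -/
structure QuatModel (ρ : O → Module.End ℤ_[p] Λ) (c : O → ℤ[X]) (ψ : LinearMap.BilinForm ℤ_[p] Λ)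
    (R : Type*) [CommRing R] [Algebra ℤ_[p] R] (ε θ : R) where
  d : ℕ
  bR : Module.Basis (Fin d) ℤ_[p] R
  isUnit_ε : IsUnit ε
  u : Λ ≃ₗ[ℤ_[p]] ℍ[R, ε, θ]
  φ : O →+* ℍ[R, ε, θ]
  u_act (a : O) (x : Λ) : u (ρ a x) = φ a * u x
  span_φ : Submodule.span ℤ_[p] (Set.range φ) = ⊤
  map_c (a : O) : (c a).map (Int.castRingHom ℤ_[p]) = rcp bR (φ a)
  lam : R →ₗ[ℤ_[p]] ℤ_[p]
  form_eq (x y : Λ) : ψ x y = lam (star (u x) * u y).imJ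
  κ : Type
  fintypeκ : Fintype κ
  e : κ → R
  idem (k : κ) : e k * e k = e k
  sum_e : ∑ k, e k = 1
  exists_gen (k : κ) : (∃ w, IsLocalGenerator bR ε θ (e k) (fun a b => ⟨a, b, 0, 0⟩) w) ∨
    ∃ w, IsLocalGenerator bR ε θ (e k) (fun a b => ⟨a, 0, b, 0⟩) w

variable {ρ : O → Module.End ℤ_[p] Λ} {c : O → ℤ[X]} {ψ : LinearMap.BilinForm ℤ_[p] Λ}
  {R : Type*} [CommRing R] [Algebra ℤ_[p] R] {ε θ : R}

/-- Perfectness survives base change: the coordinate forms of a basis are represented over ℤ_p, and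
A-linear forms are combinations of these. -/
lemma exists_form_eq [Module.Finite ℤ_[p] Λ] [Module.Free ℤ_[p] Λ] [ψ.IsPerfPair]
    {A : Type*} [CommRing A] [Algebra ℤ_[p] A] (f : A ⊗[ℤ_[p]] Λ →ₗ[A] A) :
    ∃ z, ∀ x, ψ.baseChange A x z = f x := by
  classical
  let β := Module.Free.chooseBasis ℤ_[p] Λ
  choose g hg using fun k => (LinearMap.IsPerfPair.bijective_right ψ).surjective (β.coord k)
  refine ⟨∑ k, f (1 ⊗ₜ β k) ⊗ₜ g k, fun x => ?_⟩
  induction x using TensorProduct.induction_on with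
  | zero => simp
  | add x y hx hy => rw [map_add, LinearMap.add_apply, hx, hy, map_add]
  | tmul a l =>
    have h1 : ∀ k, ψ l (g k) = β.repr l k := fun k => by
      have := LinearMap.congr_fun (hg k) l
      simpa using this
    rw [map_sum]
    simp only [LinearMap.BilinForm.baseChange_tmul, h1]
    have h2 : a ⊗ₜ[ℤ_[p]] l = ∑ k, (a * algebraMap _ A (β.repr l k)) • (1 ⊗ₜ[ℤ_[p]] β k) := by
      conv_lhs => rw [← β.sum_repr l, tmul_sum]
      refine Finset.sum_congr rfl fun k _ => ?_
      rw [TensorProduct.smul_tmul', tmul_smul, TensorProduct.smul_tmul', Algebra.smul_def,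
        smul_eq_mul, mul_one, mul_comm]
    rw [h2, map_sum]
    refine Finset.sum_congr rfl fun k _ => ?_
    rw [map_smul, smul_eq_mul, Algebra.smul_def]
    ring

-- The span of the first m vectors contains its orthogonal. By isotropy only the m × m block `G`
-- between the two halves of the frame matters; perfectness gives it a right inverse, which is an
-- inverse because the block is square.
omit [Ring O] in
lemma IsAlgPoint.repr_inr_eq_zero [Module.Finite ℤ_[p] Λ] [Module.Free ℤ_[p] Λ] [ψ.IsPerfPair]
    {A : Type*} [CommRing A] [Algebra ℤ_[p] A] {m : ℕ}
    {b : Module.Basis (Fin m ⊕ Fin m) A (A ⊗[ℤ_[p]] Λ)} (h : IsAlgPoint ρ c ψ b) {z}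
    (hz : ∀ i, ψ.baseChange A (b (Sum.inl i)) z = 0) (j : Fin m) :
    b.repr z (Sum.inr j) = 0 := by
  classical
  have hexp : ∀ i z, ψ.baseChange A (b (Sum.inl i)) z =
      ∑ j, ψ.baseChange A (b (Sum.inl i)) (b (Sum.inr j)) * b.repr z (Sum.inr j) := fun i z => by
    conv_lhs => rw [← b.sum_repr z]
    rw [map_sum, Fintype.sum_sum_type]
    simp [h.isotropic, mul_comm]
  choose w hw using fun k => exists_form_eq (ψ := ψ) (b.coord k)
  let G : Matrix (Fin m) (Fin m) A := fun i j => ψ.baseChange A (b (Sum.inl i)) (b (Sum.inr j))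
  let H : Matrix (Fin m) (Fin m) A := fun j i => b.repr (w (Sum.inl i)) (Sum.inr j)
  have hGH : G * H = 1 := by
    ext i i'
    rw [Matrix.mul_apply]
    have := hexp i (w (Sum.inl i'))
    rw [hw] at this
    rw [← this]
    simp [Matrix.one_apply, Finsupp.single_apply]
  have hHG : H * G = 1 := mul_eq_one_comm.1 hGH
  have hG : G.mulVec (fun j => b.repr z (Sum.inr j)) = 0 := by
    ext i
    rw [Pi.zero_apply, ← hz i, hexp]
    rfl
  have : (H * G).mulVec (fun j => b.repr z (Sum.inr j)) = 0 := by
    rw [← Matrix.mulVec_mulVec, hG, Matrix.mulVec_zero]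
  rw [hHG, Matrix.one_mulVec] at this
  exact congrFun this j

namespace QuatModel

variable (D : QuatModel ρ c ψ R ε θ) {A : Type*} [CommRing A] [Algebra ℤ_[p] A]

variable (A) in
/-- The base change to `A` of the identification `Λ ≃ ℍ[R, ε, θ]`. -/
noncomputable def equiv : A ⊗[ℤ_[p]] Λ ≃ₗ[A]
    ℍ[A ⊗[ℤ_[p]] R, (1 : A) ⊗ₜ[ℤ_[p]] ε, (1 : A) ⊗ₜ[ℤ_[p]] θ] :=
  (D.u.baseChange ℤ_[p] A _ _) ≪≫ₗ quatBaseChange A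

lemma equiv_tmul (a : A) (x : Λ) : D.equiv A (a ⊗ₜ x) = a • quatMapHom ℤ_[p] A (D.u x) := by
  rw [equiv, LinearEquiv.trans_apply, ← quatBaseChange_tmul]
  rfl

lemma equiv_act (a : O) (x : A ⊗[ℤ_[p]] Λ) :
    D.equiv A ((ρ a).baseChange A x) = quatMapHom ℤ_[p] A (D.φ a) * D.equiv A x := by
  induction x using TensorProduct.induction_on with
  | zero => simp
  | add x y hx hy => rw [map_add, map_add, map_add, mul_add, hx, hy]
  | tmul r x =>
    rw [LinearMap.baseChange_tmul, equiv_tmul, equiv_tmul, D.u_act, map_mul, mul_smul_comm]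

variable (A) in
/-- The base change of the linear form of the model. -/
noncomputable def lamBaseChange : A ⊗[ℤ_[p]] R →ₗ[A] A :=
  (AlgebraTensorModule.rid ℤ_[p] A A).toLinearMap ∘ₗ D.lam.baseChange A

lemma baseChange_form (x y : A ⊗[ℤ_[p]] Λ) : ψ.baseChange A x y =
    D.lamBaseChange A (star (D.equiv A x) * D.equiv A y).imJ := by
  induction x using TensorProduct.induction_on with
  | zero => simp
  | add x x' hx hx' =>
    rw [map_add, LinearMap.add_apply, hx, hx', map_add, star_add, add_mul,
      QuaternionAlgebra.imJ_add, map_add]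
  | tmul a x =>
    induction y using TensorProduct.induction_on with
    | zero => simp
    | add y y' hy hy' =>
      rw [map_add, hy, hy', map_add, mul_add, QuaternionAlgebra.imJ_add, map_add]
    | tmul a' y =>
      have hs : star (a • quatMapHom ℤ_[p] A (D.u x)) = a • quatMapHom ℤ_[p] A (star (D.u x)) := by
        rw [quatMapHom_star]; ext <;> simp
      rw [LinearMap.BilinForm.baseChange_tmul, D.form_eq, equiv_tmul, equiv_tmul, hs,
        smul_mul_smul_comm, ← map_mul, QuaternionAlgebra.imJ_smul, map_smul, quatMapHom_imJ]
      simp [lamBaseChange, Algebra.smul_def, mul_comm]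

variable {m : ℕ} (b : Module.Basis (Fin m ⊕ Fin m) A (A ⊗[ℤ_[p]] Λ))

/-- The projection to the last `m` coordinates of a frame. -/
noncomputable def proj : ℍ[A ⊗[ℤ_[p]] R, (1 : A) ⊗ₜ[ℤ_[p]] ε, (1 : A) ⊗ₜ[ℤ_[p]] θ] →ₗ[A]
    (Fin m → A) :=
  (LinearMap.funLeft A A Sum.inr) ∘ₗ (b.map (D.equiv A)).equivFun.toLinearMap

lemma proj_equiv (x : A ⊗[ℤ_[p]] Λ) (j : Fin m) :
    D.proj b (D.equiv A x) j = b.repr x (Sum.inr j) := by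
  simp [proj, LinearMap.funLeft]

/-- The submodule of the quaternion algebra spanned by the first `m` vectors of a frame. -/
noncomputable def ideal :
    Submodule A ℍ[A ⊗[ℤ_[p]] R, (1 : A) ⊗ₜ[ℤ_[p]] ε, (1 : A) ⊗ₜ[ℤ_[p]] θ] :=
  LinearMap.ker (D.proj b)

lemma equiv_mem_ideal {x : A ⊗[ℤ_[p]] Λ} :
    D.equiv A x ∈ D.ideal b ↔ ∀ j, b.repr x (Sum.inr j) = 0 := by
  rw [ideal, LinearMap.mem_ker, funext_iff]
  simp [proj_equiv]

lemma proj_surjective : Function.Surjective (D.proj b) := by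
  classical
  intro v
  refine ⟨D.equiv A (∑ j, v j • b (Sum.inr j)), ?_⟩
  ext j
  rw [proj_equiv]
  simp [Finsupp.single_apply]

/-- The basis of the quotient given by the last `m` vectors of a frame. -/
noncomputable def quotBasis : Module.Basis (Fin m) A (_ ⧸ D.ideal b) :=
  Module.Basis.ofEquivFun ((D.proj b).quotKerEquivOfSurjective (D.proj_surjective b))

lemma quotBasis_repr (x) (j : Fin m) :
    (D.quotBasis b).repr ((D.ideal b).mkQ x) j = D.proj b x j := rfl

lemma quotBasis_apply (j : Fin m) :
    D.quotBasis b j = (D.ideal b).mkQ (D.equiv A (b (Sum.inr j))) := by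
  classical
  apply (D.quotBasis b).repr.injective
  ext i
  rw [quotBasis_repr, proj_equiv]
  simp [Finsupp.single_apply]

variable {b}

lemma equiv_inl_mem (i : Fin m) : D.equiv A (b (Sum.inl i)) ∈ D.ideal b := by
  rw [equiv_mem_ideal]
  intro j
  simp

lemma exists_sum_inl {x : A ⊗[ℤ_[p]] Λ} (hx : D.equiv A x ∈ D.ideal b) :
    x = ∑ i, b.repr x (Sum.inl i) • b (Sum.inl i) := by
  rw [equiv_mem_ideal] at hx
  conv_lhs => rw [← b.sum_repr x, Fintype.sum_sum_type]
  simp [hx]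

/-- Stability under `O` propagates because `φ` spans over ℤ_p, and the image of the order spans over
A. -/
lemma isLeftStable (h : IsAlgPoint ρ c ψ b) : IsLeftStable (D.ideal b) := by
  intro y x hx
  have hy : y ∈ Submodule.span A (Set.range (quatMapHom ℤ_[p] A)) := by
    rw [span_range_quatMapHom]; trivial
  induction hy using Submodule.span_induction with
  | zero => rw [zero_mul]; exact zero_mem _
  | add y z _ _ hy hz => rw [add_mul]; exact add_mem hy hz
  | smul a y _ hy => rw [smul_mul_assoc]; exact Submodule.smul_mem _ _ hy
  | mem y hy =>
    obtain ⟨y, rfl⟩ := hy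
    have hy : y ∈ Submodule.span ℤ_[p] (Set.range D.φ) := by rw [D.span_φ]; trivial
    induction hy using Submodule.span_induction with
    | zero => rw [map_zero, zero_mul]; exact zero_mem _
    | add y z _ _ hy hz => rw [map_add, add_mul]; exact add_mem hy hz
    | smul a y _ hy =>
      rw [map_smul, smul_mul_assoc, ← IsScalarTower.algebraMap_smul A a]
      exact Submodule.smul_mem _ _ hy
    | mem y hy =>
      obtain ⟨a, rfl⟩ := hy
      obtain ⟨x, rfl⟩ := (D.equiv A).surjective x
      rw [← equiv_act, exists_sum_inl D hx, map_sum, map_sum]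
      refine Submodule.sum_mem _ fun i _ => ?_
      rw [map_smul, map_smul]
      exact Submodule.smul_mem _ _ ((D.equiv_mem_ideal b).2 (h.stable a i))

/-- This carries the determinant condition from `O` to its completion, where the generators w live.
-/
lemma charpoly_lmulQ (h : IsAlgPoint ρ c ψ b) (x : ℍ[R, ε, θ]) :
    (LinearMap.toMatrix (D.quotBasis b) (D.quotBasis b)
      (lmulQ (D.isLeftStable h) (quatMapHom ℤ_[p] A x))).charpoly =
      (rcp D.bR x).map (algebraMap ℤ_[p] A) := by
  let L : ℍ[R, ε, θ] →ₗ[ℤ_[p]] Matrix (Fin m) (Fin m) A :=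
    { toFun := fun x => Matrix.of fun i j =>
        D.proj b (quatMapHom ℤ_[p] A x * D.equiv A (b (Sum.inr j))) i
      map_add' := fun x y => by
        ext i j
        simp [add_mul]
      map_smul' := fun a x => by
        ext i j
        rw [map_smul, Matrix.of_apply, smul_mul_assoc, ← IsScalarTower.algebraMap_smul A a, map_smul]
        simp [Algebra.smul_def] }
  have hL : ∀ x, LinearMap.toMatrix (D.quotBasis b) (D.quotBasis b)
      (lmulQ (D.isLeftStable h) (quatMapHom ℤ_[p] A x)) = L x := fun x => by
    ext i j
    rw [LinearMap.toMatrix_apply, quotBasis_apply, lmulQ_mk, quotBasis_repr]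
    rfl
  rw [hL]
  refine charpoly_eq_rcp_of_span D.bR D.φ D.span_φ L (fun a => ?_) x
  rw [← D.map_c, Polynomial.map_map, show (algebraMap ℤ_[p] A).comp (Int.castRingHom ℤ_[p]) =
    Int.castRingHom A from RingHom.ext_int _ _, ← h.det a]
  congr 1
  ext i j
  change D.proj b (quatMapHom ℤ_[p] A (D.φ a) * D.equiv A (b (Sum.inr j))) i = _
  rw [← equiv_act, proj_equiv]
  simp [Matrix.toBlocks₂₂, LinearMap.toMatrix_apply]

/-- The vanishing known on each component is summed over the idempotents, whose sum is 1. -/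
lemma mul_star_eq_zero (h : IsAlgPoint ρ c ψ b) {x x'} (hx : x ∈ D.ideal b)
    (hx' : x' ∈ D.ideal b) : x * star x' = 0 := by
  have key : ∀ k, (((1 : A) ⊗ₜ[ℤ_[p]] D.e k : A ⊗[ℤ_[p]] R) :
      ℍ[A ⊗[ℤ_[p]] R, (1 : A) ⊗ₜ[ℤ_[p]] ε, (1 : A) ⊗ₜ[ℤ_[p]] θ]) * (x * star x') = 0 := by
    intro k
    rcases D.exists_gen k with ⟨w, hw⟩ | ⟨w, hw⟩
    · exact hw.mul_star_eq_zero_left (D.idem k) (D.isLeftStable h) (D.quotBasis b)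
        (D.charpoly_lmulQ h) hx hx'
    · exact hw.mul_star_eq_zero_right (D.idem k) (D.isLeftStable h) (D.quotBasis b)
        (D.charpoly_lmulQ h) hx hx'
  have hone : (1 : ℍ[A ⊗[ℤ_[p]] R, (1 : A) ⊗ₜ[ℤ_[p]] ε, (1 : A) ⊗ₜ[ℤ_[p]] θ]) =
      quatMapHom ℤ_[p] A ((1 : R) : ℍ[R, ε, θ]) := by
    rw [quatMapHom_coe, ← Algebra.TensorProduct.one_def]; rfl
  have := D.fintypeκ
  rw [← one_mul (x * star x'), hone, ← D.sum_e, ← QuaternionAlgebra.coe_algebraMap, map_sum,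
    map_sum, Finset.sum_mul]
  refine Finset.sum_eq_zero fun k _ => ?_
  rw [QuaternionAlgebra.coe_algebraMap, quatMapHom_coe]
  exact key k

lemma mem_of_perp [Module.Finite ℤ_[p] Λ] [Module.Free ℤ_[p] Λ] [ψ.IsPerfPair]
    (h : IsAlgPoint ρ c ψ b) {z} (hz : ∀ y ∈ D.ideal b, (star z * y).imJ = 0) :
    z ∈ D.ideal b := by
  obtain ⟨z, rfl⟩ := (D.equiv A).surjective z
  rw [equiv_mem_ideal]
  refine h.repr_inr_eq_zero fun i => ?_
  have h1 : (star (D.equiv A (b (Sum.inl i))) * D.equiv A z).imJ = 0 := by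
    have := hz _ (D.equiv_inl_mem i)
    simp at this ⊢
    linear_combination -this
  rw [baseChange_form D, h1, map_zero]

lemma mem_ideal_iff [Module.Finite ℤ_[p] Λ] [Module.Free ℤ_[p] Λ] [ψ.IsPerfPair] (hp : p ≠ 2)
    (h : IsAlgPoint ρ c ψ b) (x) : x ∈ D.ideal b ↔
    (⟨x.re, 0, x.imJ, 0⟩ : ℍ[A ⊗[ℤ_[p]] R, (1 : A) ⊗ₜ[ℤ_[p]] ε, (1 : A) ⊗ₜ[ℤ_[p]] θ]) ∈ D.ideal b ∧
    (⟨x.imI, 0, x.imK, 0⟩ : ℍ[A ⊗[ℤ_[p]] R, (1 : A) ⊗ₜ[ℤ_[p]] ε, (1 : A) ⊗ₜ[ℤ_[p]] θ]) ∈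
      D.ideal b := by
  have h2 : IsUnit (2 : ℤ_[p]) := by
    rw [PadicInt.isUnit_iff, ← Nat.cast_ofNat, PadicInt.norm_natCast_eq_one_iff]
    exact (Nat.coprime_primes Fact.out Nat.prime_two).2 hp
  refine mem_iff_of_mul_star_eq_zero (D.isLeftStable h) ?_ ?_
    (fun x hx x' hx' => D.mul_star_eq_zero h hx hx') (fun z hz => D.mem_of_perp h hz) x
  · rw [← map_ofNat (algebraMap ℤ_[p] (A ⊗[ℤ_[p]] R)) 2]
    exact h2.map _
  · exact D.isUnit_ε.map (Algebra.TensorProduct.includeRight (R := ℤ_[p]) (A := A))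

end QuatModel

end Points

/-! ### Frames, shears and the chart ring -/

section Frames

variable {p : ℕ} [Fact p.Prime] {O : Type*} {Λ : Type*} [AddCommGroup Λ]
  [Module ℤ_[p] Λ] (ρ : O → Module.End ℤ_[p] Λ) (c : O → ℤ[X]) (ψ : LinearMap.BilinForm ℤ_[p] Λ)
  {m : ℕ}

/-- The equations for a frame to be adapted to a point of the local model. -/
def frameEqns {A : Type*} [CommRing A] [Algebra ℤ_[p] A]
    (b : Module.Basis (Fin m ⊕ Fin m) A (A ⊗[ℤ_[p]] Λ)) : Set A :=
  (Set.range fun x : Fin m × Fin m => ψ.baseChange A (b (Sum.inl x.1)) (b (Sum.inl x.2))) ∪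
  (Set.range fun x : O × Fin m × Fin m =>
    b.repr ((ρ x.1).baseChange A (b (Sum.inl x.2.1))) (Sum.inr x.2.2)) ∪
  (Set.range fun x : O × ℕ =>
    ((LinearMap.toMatrix b b ((ρ x.1).baseChange A)).toBlocks₂₂.charpoly -
    (c x.1).map (Int.castRingHom A)).coeff x.2)

variable {ρ c ψ}

lemma isAlgPoint_iff {A : Type*} [CommRing A] [Algebra ℤ_[p] A]
    {b : Module.Basis (Fin m ⊕ Fin m) A (A ⊗[ℤ_[p]] Λ)} :
    IsAlgPoint ρ c ψ b ↔ ∀ x ∈ frameEqns ρ c ψ b, x = 0 := by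
  constructor
  · rintro h x ((⟨y, rfl⟩ | ⟨y, rfl⟩) | ⟨y, rfl⟩)
    · exact h.isotropic _ _
    · exact h.stable _ _ _
    · simp [h.det]
  · intro h
    refine ⟨fun i j => h _ (Or.inl (Or.inl ⟨(i, j), rfl⟩)),
      fun a i j => h _ (Or.inl (Or.inr ⟨(a, i, j), rfl⟩)), fun a => ?_⟩
    rw [← sub_eq_zero]
    ext k
    exact h _ (Or.inr ⟨(a, k), rfl⟩)

variable {A A' : Type} [CommRing A] [Algebra ℤ_[p] A] [CommRing A'] [Algebra ℤ_[p] A']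

lemma frameEqns_map (f : A →ₐ[ℤ_[p]] A') {b : Module.Basis (Fin m ⊕ Fin m) A (A ⊗[ℤ_[p]] Λ)}
    {b' : Module.Basis (Fin m ⊕ Fin m) A' (A' ⊗[ℤ_[p]] Λ)}
    (h : ∀ i, b' i = f.toLinearMap.rTensor Λ (b i)) :
    frameEqns ρ c ψ b' = f '' frameEqns ρ c ψ b := by
  rw [frameEqns, frameEqns, Set.image_union, Set.image_union, ← Set.range_comp, ← Set.range_comp,
    ← Set.range_comp]
  congr 2
  · congr 1
    ext1 x
    rw [h, h, form_map]
    rfl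
  · congr 1
    ext1 x
    rw [h, ← rTensor_baseChange, repr_map f b b' h]
    rfl
  · ext1 x
    rw [toMatrix_map f b b' h]
    have : ((LinearMap.toMatrix b b ((ρ x.1).baseChange A)).map f).toBlocks₂₂ =
      (LinearMap.toMatrix b b ((ρ x.1).baseChange A)).toBlocks₂₂.map (f : A →+* A') := rfl
    rw [this, Matrix.charpoly_map, show Int.castRingHom A' = (f : A →+* A').comp
      (Int.castRingHom A) from RingHom.ext_int _ _, ← Polynomial.map_map, ← Polynomial.map_sub,
      coeff_map]
    rfl

lemma IsAlgPoint.map (f : A →ₐ[ℤ_[p]] A') {b : Module.Basis (Fin m ⊕ Fin m) A (A ⊗[ℤ_[p]] Λ)}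
    {b' : Module.Basis (Fin m ⊕ Fin m) A' (A' ⊗[ℤ_[p]] Λ)}
    (h : ∀ i, b' i = f.toLinearMap.rTensor Λ (b i)) (hb : IsAlgPoint ρ c ψ b) :
    IsAlgPoint ρ c ψ b' := by
  rw [isAlgPoint_iff, frameEqns_map f h]
  rintro _ ⟨x, hx, rfl⟩
  rw [isAlgPoint_iff.1 hb x hx, map_zero]

variable (β : Module.Basis (Fin m ⊕ Fin m) ℤ_[p] Λ)

/-- The shear `(v, v') ↦ (v, v' + v P)`. -/
def shear {A : Type*} [CommRing A] (P : Matrix (Fin m) (Fin m) A) :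
    (Fin m ⊕ Fin m → A) ≃ₗ[A] (Fin m ⊕ Fin m → A) where
  toFun v := Sum.elim (fun i => v (Sum.inl i))
    (fun j => v (Sum.inr j) + ∑ k, v (Sum.inl k) * P k j)
  invFun v := Sum.elim (fun i => v (Sum.inl i))
    (fun j => v (Sum.inr j) - ∑ k, v (Sum.inl k) * P k j)
  map_add' v w := by
    ext (i | j)
    · simp
    · simp [add_mul, Finset.sum_add_distrib]; ring
  map_smul' a v := by
    ext (i | j)
    · simp
    · simp [mul_add, Finset.mul_sum, mul_assoc]
  left_inv v := by ext (i | j) <;> simp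
  right_inv v := by ext (i | j) <;> simp

/-- The frame of `A ⊗ Λ` obtained from a basis of `Λ` by the shear with matrix `P`. -/
noncomputable def frame (P : Matrix (Fin m) (Fin m) A) :
    Module.Basis (Fin m ⊕ Fin m) A (A ⊗[ℤ_[p]] Λ) :=
  Module.Basis.ofEquivFun ((β.baseChange A).equivFun ≪≫ₗ shear P)

lemma frame_repr_inl (P : Matrix (Fin m) (Fin m) A) (x : A ⊗[ℤ_[p]] Λ) (k : Fin m) :
    (frame β P).repr x (Sum.inl k) = (β.baseChange A).repr x (Sum.inl k) := rfl

lemma frame_repr_inr (P : Matrix (Fin m) (Fin m) A) (x : A ⊗[ℤ_[p]] Λ) (j : Fin m) :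
    (frame β P).repr x (Sum.inr j) = (β.baseChange A).repr x (Sum.inr j) +
      ∑ k, (β.baseChange A).repr x (Sum.inl k) * P k j := rfl

lemma frame_inr (P : Matrix (Fin m) (Fin m) A) (j : Fin m) :
    frame β P (Sum.inr j) = 1 ⊗ₜ β (Sum.inr j) := by
  classical
  apply (frame β P).repr.injective
  ext (i | i)
  · rw [frame_repr_inl β P (1 ⊗ₜ β (Sum.inr j)), ← Module.Basis.baseChange_apply A β]
    simp
  · rw [frame_repr_inr β P (1 ⊗ₜ β (Sum.inr j)), ← Module.Basis.baseChange_apply A β]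
    simp [Finsupp.single_apply]

lemma frame_inl (P : Matrix (Fin m) (Fin m) A) (k : Fin m) :
    frame β P (Sum.inl k) = 1 ⊗ₜ β (Sum.inl k) - ∑ j, P k j • 1 ⊗ₜ β (Sum.inr j) := by
  classical
  apply (frame β P).repr.injective
  simp only [← frame_inr β P]
  ext (i | i)
  · rw [map_sub, Finsupp.sub_apply, frame_repr_inl β P (1 ⊗ₜ β (Sum.inl k)),
      ← Module.Basis.baseChange_apply A β]
    simp [Finsupp.single_apply]
  · rw [map_sub, Finsupp.sub_apply, frame_repr_inr β P (1 ⊗ₜ β (Sum.inl k)),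
      ← Module.Basis.baseChange_apply A β]
    simp [Finsupp.single_apply]

lemma frame_map (f : A →ₐ[ℤ_[p]] A') (P : Matrix (Fin m) (Fin m) A) (i : Fin m ⊕ Fin m) :
    frame β (P.map f) i = f.toLinearMap.rTensor Λ (frame β P i) := by
  rcases i with k | j
  · rw [frame_inl, frame_inl, map_sub, map_sum]
    simp [rTensor_smul]
  · rw [frame_inr, frame_inr]
    simp

/-- Both frames have the same last vectors, so corresponding first vectors differ by a combination
of these with coefficients P - P'; it has to vanish in the quotient. -/
lemma frame_injective {P P' : Matrix (Fin m) (Fin m) A}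
    (h : ∀ k j, (frame β P).repr (frame β P' (Sum.inl k)) (Sum.inr j) = 0) : P = P' := by
  classical
  ext k j
  have h1 : frame β P' (Sum.inl k) = frame β P (Sum.inl k) + ∑ j, (P k j - P' k j) •
      frame β P (Sum.inr j) := by
    have h2 : ∑ j, P k j • frame β P (Sum.inr j) = ∑ j, P' k j • frame β P (Sum.inr j) +
        ∑ j, (P k j - P' k j) • frame β P (Sum.inr j) := by
      rw [← Finset.sum_add_distrib]
      exact Finset.sum_congr rfl fun j _ => by rw [← add_smul, add_sub_cancel]
    have h3 : frame β P (Sum.inl k) + ∑ j, P k j • frame β P (Sum.inr j) =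
        frame β P' (Sum.inl k) + ∑ j, P' k j • frame β P (Sum.inr j) := by
      simp only [frame_inl, frame_inr, sub_add_cancel]
    rw [h2, add_comm (∑ j, P' k j • _), ← add_assoc] at h3
    exact (add_right_cancel h3).symm
  have := h k j
  rw [h1] at this
  simpa [Finsupp.single_apply, sub_eq_zero] using this

/-- A change of frame that preserves the span of the first `m` vectors. -/
lemma IsAlgPoint.of_repr_eq_zero {A : Type*} [CommRing A] [Algebra ℤ_[p] A]
    {b b' : Module.Basis (Fin m ⊕ Fin m) A (A ⊗[ℤ_[p]] Λ)}
    (hb : IsAlgPoint ρ c ψ b) (h : ∀ k j, b.repr (b' (Sum.inl k)) (Sum.inr j) = 0)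
    (h' : ∀ k j, b'.repr (b (Sum.inl k)) (Sum.inr j) = 0) : IsAlgPoint ρ c ψ b' := by
  classical
  have hsum : ∀ k, b' (Sum.inl k) = ∑ i, b.repr (b' (Sum.inl k)) (Sum.inl i) • b (Sum.inl i) := by
    intro k
    conv_lhs => rw [← b.sum_repr (b' (Sum.inl k)), Fintype.sum_sum_type]
    simp [h]
  have hb2 : ∀ x, (∀ j, b.repr x (Sum.inr j) = 0) → ∀ j, b'.repr x (Sum.inr j) = 0 := by
    intro x hx j
    rw [← b.sum_repr x, Fintype.sum_sum_type]
    simp [hx, h']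
  refine ⟨fun i j => ?_, fun a i j => hb2 _ (fun j => ?_) j, fun a => ?_⟩
  · rw [hsum i, hsum j]
    simp [hb.isotropic]
  · rw [hsum i]
    simp [hb.stable]
  · rw [← hb.det a]
    set g := (ρ a).baseChange A
    -- `T` and `T'` are the inverse changes of basis induced on the quotient. The two lower right
    -- blocks are conjugate by them, hence have the same characteristic polynomial.
    let T : Matrix (Fin m) (Fin m) A := Matrix.of fun i j => b.repr (b' (Sum.inr j)) (Sum.inr i)
    let T' : Matrix (Fin m) (Fin m) A := Matrix.of fun i j => b'.repr (b (Sum.inr j)) (Sum.inr i)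
    have hT : ∀ x i, b'.repr x (Sum.inr i) = ∑ j, T' i j * b.repr x (Sum.inr j) := by
      intro x i
      conv_lhs => rw [← b.sum_repr x, Fintype.sum_sum_type]
      simp [h', T', mul_comm]
    have h1 : T' * T = 1 := by
      ext i j
      rw [Matrix.mul_apply]
      simp only [T, Matrix.of_apply]
      rw [← hT]
      simp [Matrix.one_apply, Finsupp.single_apply, eq_comm]
    have hg : ∀ x i, b.repr (g x) (Sum.inr i) =
        ∑ j, (LinearMap.toMatrix b b g).toBlocks₂₂ i j * b.repr x (Sum.inr j) := by
      intro x i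
      conv_lhs => rw [← b.sum_repr x, Fintype.sum_sum_type]
      have : ∀ k, b.repr (g (b (Sum.inl k))) (Sum.inr i) = 0 := fun k => hb.stable a k i
      simp [this, Matrix.toBlocks₂₂, LinearMap.toMatrix_apply, mul_comm]
    have h2 : (LinearMap.toMatrix b' b' g).toBlocks₂₂ =
        T' * (LinearMap.toMatrix b b g).toBlocks₂₂ * T := by
      have h3 : ∀ i j, ((LinearMap.toMatrix b b g).toBlocks₂₂ * T) i j =
          b.repr (g (b' (Sum.inr j))) (Sum.inr i) := fun i j => by
        rw [Matrix.mul_apply]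
        exact (hg _ _).symm
      ext i j
      rw [Matrix.mul_assoc, Matrix.mul_apply]
      simp only [h3, ← hT]
      simp [Matrix.toBlocks₂₂, LinearMap.toMatrix_apply]
    rw [h2, Matrix.charpoly_mul_comm, ← Matrix.mul_assoc, mul_eq_one_comm.1 h1, Matrix.one_mul]

/-- If the last vectors of `β` form a basis of the quotient, the point is given by a frame. -/
lemma IsAlgPoint.exists_frame {b : Module.Basis (Fin m ⊕ Fin m) A (A ⊗[ℤ_[p]] Λ)}
    (hb : IsAlgPoint ρ c ψ b)
    (hu : IsUnit (Matrix.of fun k j => b.repr (1 ⊗ₜ β (Sum.inr k)) (Sum.inr j)).det) :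
    ∃ P, IsAlgPoint ρ c ψ (frame β P) ∧
      (∀ k j, b.repr (frame β P (Sum.inl k)) (Sum.inr j) = 0) ∧
      ∀ k j, (frame β P).repr (b (Sum.inl k)) (Sum.inr j) = 0 := by
  classical
  set G : Matrix (Fin m) (Fin m) A :=
    Matrix.of fun k j => b.repr (1 ⊗ₜ β (Sum.inr k)) (Sum.inr j)
  -- `B` and `G` hold the classes in the quotient of the first and of the last vectors of β. Solving
  -- for the former through the latter gives the matrix B G⁻¹.
  let B : Matrix (Fin m) (Fin m) A :=
    Matrix.of fun k j => b.repr (1 ⊗ₜ β (Sum.inl k)) (Sum.inr j)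
  have hG : G⁻¹ * G = 1 := Matrix.nonsing_inv_mul G hu
  have hG' : G * G⁻¹ = 1 := Matrix.mul_nonsing_inv G hu
  have h1 : ∀ k j, b.repr (frame β (B * G⁻¹) (Sum.inl k)) (Sum.inr j) = 0 := by
    intro k j
    have : ∑ i, (B * G⁻¹) k i * G i j = B k j := by
      rw [← Matrix.mul_apply, Matrix.mul_assoc, hG, Matrix.mul_one]
    rw [frame_inl]
    simp only [map_sub, map_sum, map_smul, Finsupp.sub_apply, Finsupp.finsetSum_apply,
      Finsupp.smul_apply, smul_eq_mul]
    rw [sub_eq_zero]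
    exact this.symm
  have h2 : ∀ k j, (frame β (B * G⁻¹)).repr (b (Sum.inl k)) (Sum.inr j) = 0 := by
    intro k j
    let v : Fin m → A := fun i => (frame β (B * G⁻¹)).repr (b (Sum.inl k)) (Sum.inr i)
    have h3 : Matrix.vecMul v G = 0 := by
      ext i
      have h4 : b.repr (b (Sum.inl k)) (Sum.inr i) = 0 := by simp
      conv_lhs at h4 => rw [← (frame β (B * G⁻¹)).sum_repr (b (Sum.inl k)), Fintype.sum_sum_type]
      simp only [frame_inr, map_add, map_sum, map_smul, Finsupp.add_apply, Finsupp.finsetSum_apply,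
        Finsupp.smul_apply, smul_eq_mul, h1, mul_zero, Finset.sum_const_zero, zero_add] at h4
      exact h4
    have h4 : Matrix.vecMul (Matrix.vecMul v G) G⁻¹ = 0 := by rw [h3, Matrix.zero_vecMul]
    rw [Matrix.vecMul_vecMul, hG', Matrix.vecMul_one] at h4
    exact congrFun h4 j
  exact ⟨_, hb.of_repr_eq_zero h1 h2, h1, h2⟩

variable (ρ c ψ)

/-- The matrix of indeterminates. -/
noncomputable def genericMatrix (p : ℕ) [Fact p.Prime] (m : ℕ) :
    Matrix (Fin m) (Fin m) (MvPolynomial (Fin m × Fin m) ℤ_[p]) :=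
  Matrix.of fun i j => MvPolynomial.X (i, j)

/-- The coordinate ring of the chart of the local model given by the basis `β`. -/
abbrev ChartRing : Type :=
  MvPolynomial (Fin m × Fin m) ℤ_[p] ⧸ Ideal.span (frameEqns ρ c ψ (frame β (genericMatrix p m)))

/-- The universal matrix over the chart. -/
noncomputable def chartMatrix : Matrix (Fin m) (Fin m) (ChartRing ρ c ψ β) :=
  (genericMatrix p m).map (Ideal.Quotient.mkₐ ℤ_[p] _)

lemma isAlgPoint_chartMatrix : IsAlgPoint ρ c ψ (frame β (chartMatrix ρ c ψ β)) := by
  rw [isAlgPoint_iff, chartMatrix, frameEqns_map _ (frame_map β (Ideal.Quotient.mkₐ ℤ_[p] _) _)]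
  rintro _ ⟨x, hx, rfl⟩
  exact Ideal.Quotient.eq_zero_iff_mem.2 (Ideal.subset_span hx)

variable {ρ c ψ β}

lemma exists_chartRing_algHom {P : Matrix (Fin m) (Fin m) A} (h : IsAlgPoint ρ c ψ (frame β P)) :
    ∃ f : ChartRing ρ c ψ β →ₐ[ℤ_[p]] A, (chartMatrix ρ c ψ β).map f = P := by
  let f₀ : MvPolynomial (Fin m × Fin m) ℤ_[p] →ₐ[ℤ_[p]] A :=
    MvPolynomial.aeval fun x => P x.1 x.2
  have hf₀ : (genericMatrix p m).map f₀ = P := by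
    ext i j
    simp [genericMatrix, f₀]
  refine ⟨Ideal.Quotient.liftₐ _ f₀ fun a ha => ?_, ?_⟩
  · have : Ideal.span (frameEqns ρ c ψ (frame β (genericMatrix p m))) ≤ RingHom.ker f₀ := by
      refine Ideal.span_le.2 fun x hx => ?_
      have h1 := frameEqns_map (ρ := ρ) (c := c) (ψ := ψ) f₀ (frame_map β f₀ (genericMatrix p m))
      rw [hf₀] at h1
      exact isAlgPoint_iff.1 h _ (h1 ▸ ⟨x, hx, rfl⟩)
    exact this ha
  · refine Eq.trans ?_ hf₀
    ext i j
    rfl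

lemma chartRing_algHom_ext {f g : ChartRing ρ c ψ β →ₐ[ℤ_[p]] A}
    (h : (chartMatrix ρ c ψ β).map f = (chartMatrix ρ c ψ β).map g) : f = g := by
  refine Ideal.Quotient.algHom_ext _ (MvPolynomial.algHom_ext fun x => ?_)
  exact congrFun (congrFun h x.1) x.2

lemma adjoin_chartMatrix : Algebra.adjoin ℤ_[p]
    (Set.range fun x : Fin m × Fin m => chartMatrix ρ c ψ β x.1 x.2) = ⊤ := by
  have h1 := congrArg (Subalgebra.map (Ideal.Quotient.mkₐ ℤ_[p]
    (Ideal.span (frameEqns ρ c ψ (frame β (genericMatrix p m))))))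
    (MvPolynomial.adjoin_range_X (R := ℤ_[p]) (σ := Fin m × Fin m))
  rw [AlgHom.map_adjoin, Algebra.map_top, ← Set.range_comp,
    (AlgHom.range_eq_top _).2 (Ideal.Quotient.mkₐ_surjective _ _)] at h1
  exact h1

end Frames

/-! ### The model split over W -/

/-- A splitting `W` of the maximal unramified part of `R`: the products `z x * θ ^ l` form a basis
of `R`, and the idempotents `e x` of `W ⊗ R` have the same span as the elements `z x`. -/
structure SplitModel (p : ℕ) [Fact p.Prime] {R : Type*} [CommRing R] [Algebra ℤ_[p] R] (θ : R)
    (W : Type) [CommRing W] [IsDomain W] [Algebra ℤ_[p] W] where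
  t : Type
  [fintype_t : Fintype t]
  n : t → ℕ
  n_pos (x : t) : 0 < n x
  z : t → R
  bz : Module.Basis (Σ x : t, Fin (n x)) ℤ_[p] R
  bz_apply (x : t) (l : Fin (n x)) : bz ⟨x, l⟩ = z x * θ ^ (l : ℕ)
  e : t → W ⊗[ℤ_[p]] R
  mul_e_self (x : t) : e x * e x = e x
  mul_e_ne (x y : t) (h : x ≠ y) : e x * e y = 0
  sum_e : ∑ x, e x = 1
  c : t → t → W
  c' : t → t → W
  z_eq (x : t) : (1 : W) ⊗ₜ z x = ∑ y, c x y • e y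
  e_eq (x : t) : e x = ∑ y, c' x y • ((1 : W) ⊗ₜ[ℤ_[p]] z y)
  c_ne (x y : t) (h : c x y ≠ 0) : n y = n x
  c'_ne (x y : t) (h : c' x y ≠ 0) : n y = n x
  χ : (Σ x : t, Fin (n x)) → (R →ₐ[ℤ_[p]] AlgebraicClosure (FractionRing W))
  χ_injective : Function.Injective χ
  χ_ne_zero (k) : χ k θ ≠ 0

namespace SplitModel

variable {p : ℕ} [Fact p.Prime] {R : Type*} [CommRing R] [Algebra ℤ_[p] R] {θ : R}
    {W : Type} [CommRing W] [IsDomain W] [Algebra ℤ_[p] W] (M : SplitModel p θ W)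
    (A : Type) [CommRing A] [Algebra ℤ_[p] A] [Algebra W A] [IsScalarTower ℤ_[p] W A]

instance : Fintype M.t := M.fintype_t

/-- The base change map `W ⊗ R → A ⊗ R`. -/
noncomputable def bc : W ⊗[ℤ_[p]] R →ₐ[W] A ⊗[ℤ_[p]] R :=
  Algebra.TensorProduct.map (Algebra.ofId W A) (AlgHom.id ℤ_[p] R)

omit [IsDomain W] in
lemma bc_tmul (a : W) (r : R) : bc (p := p) (R := R) A (a ⊗ₜ[ℤ_[p]] r) = algebraMap W A a ⊗ₜ r := by
  simp [bc, Algebra.ofId_apply]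

/-- The idempotents over a `W`-algebra. -/
noncomputable def eA (x : M.t) : A ⊗[ℤ_[p]] R := bc A (M.e x)

lemma eA_mul_self (x : M.t) : M.eA A x * M.eA A x = M.eA A x := by
  rw [eA, ← map_mul, M.mul_e_self]

lemma eA_mul_ne {x y : M.t} (h : x ≠ y) : M.eA A x * M.eA A y = 0 := by
  rw [eA, eA, ← map_mul, M.mul_e_ne x y h, map_zero]

lemma one_tmul_z (x : M.t) : (1 : A) ⊗ₜ[ℤ_[p]] M.z x =
    ∑ y, algebraMap W A (M.c x y) • M.eA A y := by
  have := congrArg (bc A) (M.z_eq x)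
  rw [bc_tmul, map_one, map_sum] at this
  rw [this]
  refine Finset.sum_congr rfl fun y _ => ?_
  rw [map_smul, IsScalarTower.algebraMap_smul, eA]

lemma eA_eq (x : M.t) : M.eA A x =
    ∑ y, algebraMap W A (M.c' x y) • ((1 : A) ⊗ₜ[ℤ_[p]] M.z y) := by
  rw [eA, M.e_eq, map_sum]
  refine Finset.sum_congr rfl fun y _ => ?_
  rw [map_smul, IsScalarTower.algebraMap_smul, bc_tmul, map_one]

/-- The elements 1 ⊗ z x are part of a basis of W ⊗ R, namely the vectors with l = 0. Expanding z in
e and back shows c c' = 1, and c' c = 1 follows for square matrices. -/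
lemma sum_c'_mul_c (x : M.t) : ∑ y, M.c' x y * M.c y x = 1 := by
  classical
  have h1 : (Matrix.of M.c * Matrix.of M.c' : Matrix M.t M.t W) = 1 := by
    ext x x'
    have h2 : (1 : W) ⊗ₜ[ℤ_[p]] M.z x = ∑ y, (∑ w, M.c x w * M.c' w y) •
        ((1 : W) ⊗ₜ[ℤ_[p]] M.z y) := by
      rw [M.z_eq]
      conv_lhs => enter [2, w]; rw [M.e_eq, Finset.smul_sum]
      rw [Finset.sum_comm]
      refine Finset.sum_congr rfl fun y _ => ?_
      rw [Finset.sum_smul]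
      simp only [smul_smul]
    have hz : ∀ y, (1 : W) ⊗ₜ[ℤ_[p]] M.z y = M.bz.baseChange W ⟨y, ⟨0, M.n_pos y⟩⟩ := fun y => by
      rw [Module.Basis.baseChange_apply, M.bz_apply]; simp
    have h3 := congrArg (fun v => (M.bz.baseChange W).repr v ⟨x', ⟨0, M.n_pos x'⟩⟩) h2
    simp only [hz, map_sum, map_smul, Finsupp.finsetSum_apply, Finsupp.smul_apply,
      Module.Basis.repr_self, Finsupp.single_apply] at h3
    have h4 : ∀ y, ((⟨y, ⟨0, M.n_pos y⟩⟩ : Σ x, Fin (M.n x)) = ⟨x', ⟨0, M.n_pos x'⟩⟩) ↔ y = x' :=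
      fun y => ⟨fun h => congrArg Sigma.fst h, by rintro rfl; rfl⟩
    simp only [h4] at h3
    rw [Matrix.mul_apply, Matrix.one_apply, h3]
    simp
  have h2 := mul_eq_one_comm.1 h1
  have h3 := congrFun (congrFun h2 x) x
  rw [Matrix.mul_apply, Matrix.one_apply_eq] at h3
  exact h3

/-- Expanding e x in the z y gives a relation between the basis vectors z y θ^l, because only y with
n y = n x occur. It kills each product of a coefficient of Q with c' x y; as A may have zero
divisors, the coefficient itself is recovered from ∑ c' x y c y x = 1. -/
lemma eq_zero_of_aeval_mul_eA (x : M.t) (Q : A[X]) (hQ : Q.degree < M.n x)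
    (h : aeval ((1 : A) ⊗ₜ[ℤ_[p]] θ) Q * M.eA A x = 0) : Q = 0 := by
  classical
  have key : ∀ y (l : ℕ), l < M.n x → Q.coeff l * algebraMap W A (M.c' x y) = 0 := by
    intro y l hl
    by_cases hy : M.c' x y = 0
    · simp [hy]
    have hn := M.c'_ne x y hy
    have h1 : ∑ y, ∑ l ∈ Finset.range (M.n x), (Q.coeff l * algebraMap W A (M.c' x y)) •
        ((1 : A) ⊗ₜ[ℤ_[p]] (M.z y * θ ^ l)) = 0 := by
      rw [← h, M.eA_eq, Finset.mul_sum]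
      refine Finset.sum_congr rfl fun y _ => ?_
      rw [aeval_eq_sum_range' (n := M.n x) (by
        rcases eq_or_ne Q 0 with rfl | hne
        · simpa using M.n_pos x
        · exact (natDegree_lt_iff_degree_lt hne).2 hQ), Finset.sum_mul]
      refine Finset.sum_congr rfl fun l _ => ?_
      rw [smul_mul_smul_comm, Algebra.TensorProduct.tmul_pow, Algebra.TensorProduct.tmul_mul_tmul,
        mul_comm (θ ^ l)]
      simp
    have h2 : ∀ y, ∑ l ∈ Finset.range (M.n x), (Q.coeff l * algebraMap W A (M.c' x y)) •
        ((1 : A) ⊗ₜ[ℤ_[p]] (M.z y * θ ^ l)) = ∑ l : Fin (M.n y),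
        (Q.coeff l * algebraMap W A (M.c' x y)) • M.bz.baseChange A ⟨y, l⟩ := by
      intro y
      by_cases hy : M.c' x y = 0
      · simp [hy]
      rw [← M.c'_ne x y hy, Finset.sum_range]
      refine Finset.sum_congr rfl fun l _ => ?_
      rw [Module.Basis.baseChange_apply, M.bz_apply]
    simp only [h2] at h1
    rw [← Fintype.sum_sigma'] at h1
    exact Fintype.linearIndependent_iff.1 (M.bz.baseChange A).linearIndependent
      (fun i => Q.coeff i.2 * algebraMap W A (M.c' x i.1)) h1 ⟨y, ⟨l, hn ▸ hl⟩⟩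
  ext l
  rw [coeff_zero]
  by_cases hl : l < M.n x
  · have h1 := congrArg (algebraMap W A) (M.sum_c'_mul_c x)
    rw [map_one, map_sum] at h1
    rw [← mul_one (Q.coeff l), ← h1, Finset.mul_sum]
    refine Finset.sum_eq_zero fun y _ => ?_
    rw [map_mul, ← mul_assoc, key y l hl, zero_mul]
  · exact coeff_eq_zero_of_degree_lt (hQ.trans_le (by exact_mod_cast not_lt.1 hl))

/-- Expand θ^(n x) in the basis z y θ^l and multiply by e x, which turns each z y into the scalar c
y x and leaves only terms with n y = n x. -/
lemma exists_monic (x : M.t) : ∃ E : W[X], E.Monic ∧ E.natDegree = M.n x ∧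
    aeval ((1 : A) ⊗ₜ[ℤ_[p]] θ) (E.map (algebraMap W A)) * M.eA A x = 0 := by
  classical
  let v := (1 : W) ⊗ₜ[ℤ_[p]] (θ ^ M.n x)
  let a := (M.bz.baseChange W).repr v
  let S : W[X] := ∑ i : (Σ x, Fin (M.n x)), (a i * M.c i.1 x) • X ^ (i.2 : ℕ)
  have hS : S.degree < M.n x := by
    refine (degree_sum_le _ _).trans_lt ((Finset.sup_lt_iff (WithBot.bot_lt_coe _)).2 fun i _ => ?_)
    by_cases hi : M.c i.1 x = 0
    · rw [hi, mul_zero, zero_smul, degree_zero]; exact WithBot.bot_lt_coe _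
    · refine (degree_smul_le _ _).trans_lt ?_
      refine (degree_X_pow_le _).trans_lt ?_
      rw [M.c_ne _ _ hi]
      exact_mod_cast i.2.2
  refine ⟨X ^ M.n x - S, monic_X_pow_sub hS, ?_, ?_⟩
  · refine natDegree_eq_of_degree_eq_some ?_
    rw [degree_sub_eq_left_of_degree_lt (by rwa [degree_X_pow]), degree_X_pow]
  · have h1 : aeval ((1 : W) ⊗ₜ[ℤ_[p]] θ) (X ^ M.n x - S) * M.e x = 0 := by
      have h2 : v * M.e x = aeval ((1 : W) ⊗ₜ[ℤ_[p]] θ) S * M.e x := by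
        conv_lhs => rw [← (M.bz.baseChange W).sum_repr v]
        rw [map_sum, Finset.sum_mul, Finset.sum_mul]
        refine Finset.sum_congr rfl fun i _ => ?_
        obtain ⟨y, l⟩ := i
        have h3 : (1 : W) ⊗ₜ[ℤ_[p]] M.z y * M.e x = M.c y x • M.e x := by
          rw [M.z_eq, Finset.sum_mul, Finset.sum_eq_single x]
          · rw [smul_mul_assoc, M.mul_e_self]
          · intro w _ hw
            rw [smul_mul_assoc, M.mul_e_ne w x hw, smul_zero]
          · simp
        have h4 : (1 : W) ⊗ₜ[ℤ_[p]] (M.z y * θ ^ (l : ℕ)) =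
            ((1 : W) ⊗ₜ[ℤ_[p]] θ) ^ (l : ℕ) * ((1 : W) ⊗ₜ[ℤ_[p]] M.z y) := by
          rw [Algebra.TensorProduct.tmul_pow, Algebra.TensorProduct.tmul_mul_tmul, one_pow, one_mul,
            mul_comm]
        rw [Module.Basis.baseChange_apply, M.bz_apply, map_smul, map_pow, aeval_X, smul_mul_assoc,
          h4, mul_assoc, h3, mul_smul_comm, smul_smul, smul_mul_assoc]
      rw [map_sub, map_pow, aeval_X, sub_mul, ← h2, Algebra.TensorProduct.tmul_pow, one_pow,
        sub_self]
    have h2 := congrArg (bc A) h1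
    rw [map_zero, map_mul, ← aeval_algHom_apply, bc_tmul, map_one] at h2
    rw [aeval_map_algebraMap]
    exact h2

variable {ε : R} {A}

variable (ε θ) in
/-- The generator `i` of a quaternion algebra. -/
def quatI {T : Type*} [Zero T] [One T] (ε θ : T) : ℍ[T, ε, θ] := ⟨0, 1, 0, 0⟩

/-- `∑ x, (P x (j) + i P' x (j)) e x`. -/
noncomputable def nElt (ε : R) (P P' : M.t → A[X]) :
    ℍ[A ⊗[ℤ_[p]] R, (1 : A) ⊗ₜ[ℤ_[p]] ε, (1 : A) ⊗ₜ[ℤ_[p]] θ] :=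
  ∑ x, (aeval (quatJ _ _) (P x) + quatI _ _ * aeval (quatJ _ _) (P' x)) *
    (M.eA A x : ℍ[A ⊗[ℤ_[p]] R, (1 : A) ⊗ₜ[ℤ_[p]] ε, (1 : A) ⊗ₜ[ℤ_[p]] θ])

lemma nElt_add (P P' Q Q' : M.t → A[X]) :
    M.nElt ε (P + Q) (P' + Q') = M.nElt ε P P' + M.nElt ε Q Q' := by
  rw [nElt, nElt, nElt, ← Finset.sum_add_distrib]
  refine Finset.sum_congr rfl fun x _ => ?_
  rw [Pi.add_apply, Pi.add_apply, map_add, map_add]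
  noncomm_ring

lemma nElt_smul (a : A) (P P' : M.t → A[X]) :
    M.nElt ε (a • P) (a • P') = a • M.nElt ε P P' := by
  rw [nElt, nElt, Finset.smul_sum]
  refine Finset.sum_congr rfl fun x _ => ?_
  rw [Pi.smul_apply, Pi.smul_apply, map_smul, map_smul, mul_smul_comm, ← smul_add, smul_mul_assoc]

/-- The elements `nElt P P'` with polynomials of small degree. -/
noncomputable def nSub (A : Type) [CommRing A] [Algebra ℤ_[p] A] [Algebra W A]
    [IsScalarTower ℤ_[p] W A] (ε : R) :
    Submodule A ℍ[A ⊗[ℤ_[p]] R, (1 : A) ⊗ₜ[ℤ_[p]] ε, (1 : A) ⊗ₜ[ℤ_[p]] θ] where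
  carrier := {y | ∃ P P' : M.t → A[X], (∀ x, (P x).degree < M.n x) ∧
    (∀ x, (P' x).degree < M.n x) ∧ y = M.nElt ε P P'}
  zero_mem' := ⟨0, 0, fun x => by simp, fun x => by simp,
    by simp [nElt]⟩
  add_mem' := by
    rintro _ _ ⟨P, P', hP, hP', rfl⟩ ⟨Q, Q', hQ, hQ', rfl⟩
    exact ⟨P + Q, P' + Q', fun x => (degree_add_le _ _).trans_lt (max_lt (hP x) (hQ x)),
      fun x => (degree_add_le _ _).trans_lt (max_lt (hP' x) (hQ' x)), (M.nElt_add _ _ _ _).symm⟩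
  smul_mem' := by
    rintro a _ ⟨P, P', hP, hP', rfl⟩
    exact ⟨a • P, a • P', fun x => (degree_smul_le _ _).trans_lt (hP x),
      fun x => (degree_smul_le _ _).trans_lt (hP' x), (M.nElt_smul _ _ _).symm⟩

lemma coe_eA_comm (x : M.t) (y : ℍ[A ⊗[ℤ_[p]] R, (1 : A) ⊗ₜ[ℤ_[p]] ε, (1 : A) ⊗ₜ[ℤ_[p]] θ]) :
    (M.eA A x : ℍ[A ⊗[ℤ_[p]] R, (1 : A) ⊗ₜ[ℤ_[p]] ε, (1 : A) ⊗ₜ[ℤ_[p]] θ]) * y = y * M.eA A x :=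
  QuaternionAlgebra.comm _ _

lemma eA_mul_nElt (x : M.t) (P P' : M.t → A[X]) :
    (M.eA A x : ℍ[A ⊗[ℤ_[p]] R, (1 : A) ⊗ₜ[ℤ_[p]] ε, (1 : A) ⊗ₜ[ℤ_[p]] θ]) * M.nElt ε P P' =
      (aeval (quatJ ((1 : A) ⊗ₜ[ℤ_[p]] ε) ((1 : A) ⊗ₜ[ℤ_[p]] θ)) (P x) +
        quatI _ _ * aeval (quatJ _ _) (P' x)) *
      (M.eA A x : ℍ[A ⊗[ℤ_[p]] R, (1 : A) ⊗ₜ[ℤ_[p]] ε, (1 : A) ⊗ₜ[ℤ_[p]] θ]) := by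
  rw [coe_eA_comm, nElt, Finset.sum_mul, Finset.sum_eq_single x]
  · rw [mul_assoc, ← QuaternionAlgebra.coe_mul, M.eA_mul_self]
  · intro y _ hy
    rw [mul_assoc, ← QuaternionAlgebra.coe_mul, M.eA_mul_ne A hy, QuaternionAlgebra.coe_zero,
      mul_zero]
  · simp

lemma nElt_fst (P P' : M.t → A[X]) : (⟨(M.nElt ε P P').re, 0, (M.nElt ε P P').imJ, 0⟩ :
    ℍ[A ⊗[ℤ_[p]] R, (1 : A) ⊗ₜ[ℤ_[p]] ε, (1 : A) ⊗ₜ[ℤ_[p]] θ]) = M.nElt ε P 0 := by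
  have h : ∀ (x y : ℍ[A ⊗[ℤ_[p]] R, (1 : A) ⊗ₜ[ℤ_[p]] ε, (1 : A) ⊗ₜ[ℤ_[p]] θ]),
    (⟨(x + y).re, 0, (x + y).imJ, 0⟩ : ℍ[A ⊗[ℤ_[p]] R, (1 : A) ⊗ₜ[ℤ_[p]] ε,
      (1 : A) ⊗ₜ[ℤ_[p]] θ]) = ⟨x.re, 0, x.imJ, 0⟩ + ⟨y.re, 0, y.imJ, 0⟩ := by
    intro x y; ext <;> simp
  let f : ℍ[A ⊗[ℤ_[p]] R, (1 : A) ⊗ₜ[ℤ_[p]] ε, (1 : A) ⊗ₜ[ℤ_[p]] θ] →+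
    ℍ[A ⊗[ℤ_[p]] R, (1 : A) ⊗ₜ[ℤ_[p]] ε, (1 : A) ⊗ₜ[ℤ_[p]] θ] :=
    { toFun := fun x => ⟨x.re, 0, x.imJ, 0⟩
      map_zero' := rfl
      map_add' := h }
  change f (M.nElt ε P P') = _
  rw [nElt, nElt, map_sum]
  refine Finset.sum_congr rfl fun x _ => ?_
  change (⟨_, 0, _, 0⟩ : ℍ[A ⊗[ℤ_[p]] R, (1 : A) ⊗ₜ[ℤ_[p]] ε, (1 : A) ⊗ₜ[ℤ_[p]] θ]) = _
  rw [Pi.zero_apply, aeval_quatJ, aeval_quatJ]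
  ext <;> simp [quatI]

lemma nElt_snd (P P' : M.t → A[X]) : (⟨(M.nElt ε P P').imI, 0, (M.nElt ε P P').imK, 0⟩ :
    ℍ[A ⊗[ℤ_[p]] R, (1 : A) ⊗ₜ[ℤ_[p]] ε, (1 : A) ⊗ₜ[ℤ_[p]] θ]) = M.nElt ε P' 0 := by
  have h : ∀ (x y : ℍ[A ⊗[ℤ_[p]] R, (1 : A) ⊗ₜ[ℤ_[p]] ε, (1 : A) ⊗ₜ[ℤ_[p]] θ]),
    (⟨(x + y).imI, 0, (x + y).imK, 0⟩ : ℍ[A ⊗[ℤ_[p]] R, (1 : A) ⊗ₜ[ℤ_[p]] ε,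
      (1 : A) ⊗ₜ[ℤ_[p]] θ]) = ⟨x.imI, 0, x.imK, 0⟩ + ⟨y.imI, 0, y.imK, 0⟩ := by
    intro x y; ext <;> simp
  let f : ℍ[A ⊗[ℤ_[p]] R, (1 : A) ⊗ₜ[ℤ_[p]] ε, (1 : A) ⊗ₜ[ℤ_[p]] θ] →+
    ℍ[A ⊗[ℤ_[p]] R, (1 : A) ⊗ₜ[ℤ_[p]] ε, (1 : A) ⊗ₜ[ℤ_[p]] θ] :=
    { toFun := fun x => ⟨x.imI, 0, x.imK, 0⟩
      map_zero' := rfl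
      map_add' := h }
  change f (M.nElt ε P P') = _
  rw [nElt, nElt, map_sum]
  refine Finset.sum_congr rfl fun x _ => ?_
  change (⟨_, 0, _, 0⟩ : ℍ[A ⊗[ℤ_[p]] R, (1 : A) ⊗ₜ[ℤ_[p]] ε, (1 : A) ⊗ₜ[ℤ_[p]] θ]) = _
  rw [Pi.zero_apply, aeval_quatJ, aeval_quatJ]
  ext <;> simp [quatI]

section Chart

variable {O : Type*} [Ring O] {Λ : Type*} [AddCommGroup Λ] [Module ℤ_[p] Λ]
  {ρ : O → Module.End ℤ_[p] Λ} {cp : O → ℤ[X]} {ψ : LinearMap.BilinForm ℤ_[p] Λ}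
  (D : QuatModel ρ cp ψ R ε θ) {m : ℕ} (β : Module.Basis (Fin m ⊕ Fin m) ℤ_[p] Λ)

/-- The last vectors of `β` are the elements `z x j ^ l` and `i z x j ^ l` with `l < n x`. -/
def IsChartBasis : Prop :=
  Set.range (fun k => D.u (β (Sum.inr k))) = Set.range fun i : Bool × Σ x : M.t, Fin (M.n x) =>
    (if i.1 then quatI ε θ else 1) * ((M.z i.2.1 : R) : ℍ[R, ε, θ]) * quatJ ε θ ^ (i.2.2 : ℕ)

variable {D β} {M}

lemma quatMapHom_quatI : quatMapHom ℤ_[p] A (quatI ε θ) = quatI _ _ := by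
  ext <;> simp [quatI, Algebra.TensorProduct.one_def]

lemma quatMapHom_quatJ : quatMapHom ℤ_[p] A (quatJ ε θ) = quatJ _ _ := by
  ext <;> simp [quatJ, Algebra.TensorProduct.one_def]

lemma quatMapHom_chart (δ : Bool) (x : M.t) (l : ℕ) :
    quatMapHom ℤ_[p] A ((if δ then quatI ε θ else 1) * ((M.z x : R) : ℍ[R, ε, θ]) *
      quatJ ε θ ^ l) = ∑ y, algebraMap W A (M.c x y) • ((if δ then quatI _ _ else 1) *
        quatJ _ _ ^ l * (M.eA A y : ℍ[A ⊗[ℤ_[p]] R, (1 : A) ⊗ₜ[ℤ_[p]] ε, (1 : A) ⊗ₜ[ℤ_[p]] θ])) := by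
  have h1 : quatMapHom ℤ_[p] A (if δ then quatI ε θ else 1) = if δ then quatI _ _ else 1 := by
    cases δ
    · simp
    · simpa using quatMapHom_quatI
  rw [map_mul, map_mul, map_pow, quatMapHom_coe, quatMapHom_quatJ, h1, one_tmul_z M A, mul_assoc,
    QuaternionAlgebra.comm, ← mul_assoc, ← QuaternionAlgebra.coe_algebraMap, map_sum,
    Finset.mul_sum]
  refine Finset.sum_congr rfl fun y _ => ?_
  rw [QuaternionAlgebra.coe_algebraMap, QuaternionAlgebra.coe_smul, mul_smul_comm]

lemma IsChartBasis.mem_nSub (hβ : M.IsChartBasis D β) (k : Fin m) :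
    D.equiv A (1 ⊗ₜ β (Sum.inr k)) ∈ M.nSub A ε := by
  classical
  have h : D.u (β (Sum.inr k)) ∈ Set.range (fun k => D.u (β (Sum.inr k))) := ⟨k, rfl⟩
  rw [hβ] at h
  obtain ⟨⟨δ, x, l⟩, hx⟩ := h
  rw [D.equiv_tmul, one_smul, ← hx]
  simp only
  rw [quatMapHom_chart]
  refine Submodule.sum_mem _ fun y _ => ?_
  by_cases hc : M.c x y = 0
  · rw [hc, map_zero, zero_smul]; exact zero_mem _
  refine Submodule.smul_mem _ _ ?_
  have hl : (l : ℕ) < M.n y := by rw [M.c_ne _ _ hc]; exact l.2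
  have hX : ∀ w, (Pi.single y (X ^ (l : ℕ)) : M.t → A[X]) w ∈ {Q : A[X] | Q.degree < M.n w} := by
    intro w
    rcases eq_or_ne w y with rfl | hw
    · rw [Pi.single_eq_same]
      exact (degree_X_pow_le _).trans_lt (by exact_mod_cast hl)
    · rw [Pi.single_eq_of_ne hw]
      simp
  have h0 : ∀ w, (0 : M.t → A[X]) w ∈ {Q : A[X] | Q.degree < M.n w} := by
    intro w; simp
  cases δ
  · refine ⟨Pi.single y (X ^ (l : ℕ)), 0, hX, h0, ?_⟩
    rw [nElt, Finset.sum_eq_single y]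
    · simp
    · intro w _ hw
      simp [Pi.single_eq_of_ne hw]
    · simp
  · refine ⟨0, Pi.single y (X ^ (l : ℕ)), h0, hX, ?_⟩
    rw [nElt, Finset.sum_eq_single y]
    · simp
    · intro w _ hw
      simp [Pi.single_eq_of_ne hw]
    · simp

lemma IsChartBasis.mem_addSubmonoid (hβ : M.IsChartBasis D β) (δ : Bool) (x : M.t) {l : ℕ}
    (hl : l < M.n x)
    (S : AddSubmonoid ℍ[A ⊗[ℤ_[p]] R, (1 : A) ⊗ₜ[ℤ_[p]] ε, (1 : A) ⊗ₜ[ℤ_[p]] θ])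
    (hS : ∀ a, ∀ y ∈ S, algebraMap W A a • y ∈ S)
    (hmem : ∀ k, D.equiv A (1 ⊗ₜ β (Sum.inr k)) ∈ S) :
    (if δ then quatI _ _ else 1) * quatJ _ _ ^ l * (M.eA A x :
      ℍ[A ⊗[ℤ_[p]] R, (1 : A) ⊗ₜ[ℤ_[p]] ε, (1 : A) ⊗ₜ[ℤ_[p]] θ]) ∈ S := by
  rw [eA_eq, ← QuaternionAlgebra.coe_algebraMap, map_sum, Finset.mul_sum]
  refine sum_mem fun y _ => ?_
  rw [QuaternionAlgebra.coe_algebraMap, QuaternionAlgebra.coe_smul, mul_smul_comm]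
  by_cases hc : M.c' x y = 0
  · rw [hc, map_zero, zero_smul]; exact zero_mem _
  refine hS _ _ ?_
  have h : (if δ then quatI ε θ else 1) * ((M.z y : R) : ℍ[R, ε, θ]) * quatJ ε θ ^ l ∈
    Set.range (fun k => D.u (β (Sum.inr k))) := by
    rw [hβ]
    exact ⟨(δ, ⟨y, ⟨l, M.c'_ne _ _ hc ▸ hl⟩⟩), rfl⟩
  obtain ⟨k, hk⟩ := h
  have h1 : quatMapHom ℤ_[p] A (if δ then quatI ε θ else 1) = if δ then quatI _ _ else 1 := by
    cases δ
    · simp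
    · simpa using quatMapHom_quatI
  have h2 := hmem k
  simp only at hk
  rwa [D.equiv_tmul, one_smul, hk, map_mul, map_mul, map_pow, quatMapHom_coe, quatMapHom_quatJ, h1,
    mul_assoc, QuaternionAlgebra.comm, ← mul_assoc] at h2

variable [Module.Finite ℤ_[p] Λ] [Module.Free ℤ_[p] Λ] [ψ.IsPerfPair]

lemma nElt_fst_mem (hp : p ≠ 2) {b : Module.Basis (Fin m ⊕ Fin m) A (A ⊗[ℤ_[p]] Λ)}
    (h : IsAlgPoint ρ cp ψ b) {P P' : M.t → A[X]} (hP : M.nElt ε P P' ∈ D.ideal b) (x : M.t) :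
    aeval (quatJ _ _) (P x) * (M.eA A x :
      ℍ[A ⊗[ℤ_[p]] R, (1 : A) ⊗ₜ[ℤ_[p]] ε, (1 : A) ⊗ₜ[ℤ_[p]] θ]) ∈ D.ideal b ∧
    aeval (quatJ _ _) (P' x) * (M.eA A x :
      ℍ[A ⊗[ℤ_[p]] R, (1 : A) ⊗ₜ[ℤ_[p]] ε, (1 : A) ⊗ₜ[ℤ_[p]] θ]) ∈ D.ideal b := by
  rw [D.mem_ideal_iff hp h, nElt_fst, nElt_snd] at hP
  have h1 := D.isLeftStable h (M.eA A x) _ hP.1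
  have h2 := D.isLeftStable h (M.eA A x) _ hP.2
  rw [eA_mul_nElt] at h1 h2
  simpa using And.intro h1 h2

lemma eq_zero_of_nElt_mem [IsDomain A] (hp : p ≠ 2)
    {b : Module.Basis (Fin m ⊕ Fin m) A (A ⊗[ℤ_[p]] Λ)}
    (h : IsAlgPoint ρ cp ψ b) {y} (hy : y ∈ M.nSub A ε) (hy' : y ∈ D.ideal b) : y = 0 := by
  obtain ⟨P, P', hP, hP', rfl⟩ := hy
  have key : ∀ x, P x = 0 ∧ P' x = 0 := by
    intro x
    obtain ⟨h1, h2⟩ := nElt_fst_mem hp h hy' x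
    exact ⟨eq_zero_of_aeval_quatJ_mem (fun x hx x' hx' => D.mul_star_eq_zero h hx hx')
      (M.eA_mul_self A x) (M.eq_zero_of_aeval_mul_eA A x) (hP x) h1,
      eq_zero_of_aeval_quatJ_mem (fun x hx x' hx' => D.mul_star_eq_zero h hx hx')
      (M.eA_mul_self A x) (M.eq_zero_of_aeval_mul_eA A x) (hP' x) h2⟩
  simp [nElt, key]

omit [Algebra W A] [IsScalarTower ℤ_[p] W A]

/-- The chart contains all points of the local model. -/
lemma IsChartBasis.isUnit_det [Module.Finite ℤ_[p] W] [Module.Free ℤ_[p] W]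
    (hp : p ≠ 2) (hβ : M.IsChartBasis D β)
    {b : Module.Basis (Fin m ⊕ Fin m) A (A ⊗[ℤ_[p]] Λ)} (h : IsAlgPoint ρ cp ψ b) :
    IsUnit (Matrix.of fun k j => b.repr (1 ⊗ₜ β (Sum.inr k)) (Sum.inr j)).det := by
  by_contra hu
  obtain ⟨I, hI, hdI⟩ := exists_max_ideal_of_mem_nonunits hu
  let κ := A ⧸ I
  let _ : Field κ := Ideal.Quotient.field I
  -- A zero of the determinant is moved to a field that is also a W-algebra, namely a residue field
  -- of κ ⊗ W; this ring is nonzero because W is free and nonzero.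
  have : Nontrivial (κ ⊗[ℤ_[p]] W) := inferInstance
  obtain ⟨J, hJ⟩ := Ideal.exists_maximal (κ ⊗[ℤ_[p]] W)
  let L := (κ ⊗[ℤ_[p]] W) ⧸ J
  let _ : Field L := Ideal.Quotient.field J
  let _ : Algebra W L := ((Ideal.Quotient.mk J).comp
    (Algebra.TensorProduct.includeRight (R := ℤ_[p]) (A := κ) (B := W)).toRingHom).toAlgebra
  have : IsScalarTower ℤ_[p] W L := IsScalarTower.of_algebraMap_eq fun a => by
    change _ = Ideal.Quotient.mk J (Algebra.TensorProduct.includeRight (R := ℤ_[p]) (A := κ)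
      (algebraMap _ _ a))
    rw [AlgHom.commutes]
    rfl
  let f : A →ₐ[ℤ_[p]] L := ((Ideal.Quotient.mkₐ ℤ_[p] J).comp
    ((Algebra.TensorProduct.includeLeft (R := ℤ_[p]) (S := ℤ_[p]) (A := κ) (B := W)))).comp
      (Ideal.Quotient.mkₐ ℤ_[p] I)
  obtain ⟨b', hb'⟩ := exists_basis_map f b
  have h' : IsAlgPoint ρ cp ψ b' := h.map f hb'
  set G : Matrix (Fin m) (Fin m) A :=
    Matrix.of fun k j => b.repr (1 ⊗ₜ β (Sum.inr k)) (Sum.inr j)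
  have hG : (G.map f).det = 0 := by
    have h0 : f G.det = 0 := by
      have : Ideal.Quotient.mk I G.det = 0 := Ideal.Quotient.eq_zero_iff_mem.2 hdI
      change Ideal.Quotient.mk J ((Ideal.Quotient.mk I G.det) ⊗ₜ 1) = 0
      rw [this, zero_tmul, map_zero]
    rw [← h0]
    exact (f.toRingHom.map_det G).symm
  obtain ⟨v, hv, hvG⟩ := Matrix.exists_vecMul_eq_zero_iff.2 hG
  apply hv
  -- A vanishing combination of the rows of the matrix is a combination of the chart vectors lying
  -- in the ideal. Over a field such an element is zero, although the chart vectors are independent.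
  have hmem : ∑ k, v k • D.equiv L (1 ⊗ₜ β (Sum.inr k)) ∈ D.ideal b' := by
    simp only [← map_smul, ← map_sum]
    rw [D.equiv_mem_ideal]
    intro j
    have := congrFun hvG j
    rw [Pi.zero_apply] at this
    rw [← this, map_sum, Finsupp.finsetSum_apply]
    refine Finset.sum_congr rfl fun k _ => ?_
    rw [map_smul, Finsupp.smul_apply, smul_eq_mul]
    congr 1
    have h1 : (1 : L) ⊗ₜ[ℤ_[p]] β (Sum.inr k) = f.toLinearMap.rTensor Λ (1 ⊗ₜ β (Sum.inr k)) := by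
      simp
    rw [h1, repr_map f b b' hb']
    rfl
  have h0 := eq_zero_of_nElt_mem hp h' (Submodule.sum_mem _ fun k _ =>
    Submodule.smul_mem _ _ (hβ.mem_nSub k)) hmem
  simp only [← map_smul, ← map_sum] at h0
  rw [LinearEquiv.map_eq_zero_iff] at h0
  have hli := (β.baseChange L).linearIndependent.comp Sum.inr Sum.inr_injective
  ext k
  refine Fintype.linearIndependent_iff.1 hli v ?_ k
  rw [← h0]
  simp [Module.Basis.baseChange_apply]

end Chart

end SplitModel

/-! ### Generators and relations of the chart -/

namespace SplitModel

variable {p : ℕ} [Fact p.Prime] {R : Type*} [CommRing R] [Algebra ℤ_[p] R] {ε θ : R}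
  {W : Type} [CommRing W] [IsDomain W] [Algebra ℤ_[p] W] {M : SplitModel p θ W}
  {A : Type} [CommRing A] [Algebra ℤ_[p] A] [Algebra W A] [IsScalarTower ℤ_[p] W A]
  {O : Type*} [Ring O] {Λ : Type*} [AddCommGroup Λ] [Module ℤ_[p] Λ]
  {ρ : O → Module.End ℤ_[p] Λ} {cp : O → ℤ[X]} {ψ : LinearMap.BilinForm ℤ_[p] Λ}
  {D : QuatModel ρ cp ψ R ε θ} {m : ℕ} {β : Module.Basis (Fin m ⊕ Fin m) ℤ_[p] Λ}

/-- The exponent of j is not bounded here: the powers of θ in the basis of R are absorbed as even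
powers of j. -/
lemma mem_span_chart (M : SplitModel p θ W) (q : ℍ[R, ε, θ]) :
    q ∈ Submodule.span ℤ_[p] (Set.range fun i : Bool × M.t × ℕ =>
      (if i.1 then quatI ε θ else 1) * ((M.z i.2.1 : R) : ℍ[R, ε, θ]) * quatJ ε θ ^ i.2.2) := by
  set T := Submodule.span ℤ_[p] (Set.range fun i : Bool × M.t × ℕ =>
      (if i.1 then quatI ε θ else 1) * ((M.z i.2.1 : R) : ℍ[R, ε, θ]) * quatJ ε θ ^ i.2.2)
  have key : ∀ (δ : Bool) (r : R) (l : ℕ), (if δ then quatI ε θ else 1) * (r : ℍ[R, ε, θ]) *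
      quatJ ε θ ^ l ∈ T := by
    intro δ r l
    have hr : r ∈ Submodule.span ℤ_[p] (Set.range M.bz) := by rw [M.bz.span_eq]; trivial
    induction hr using Submodule.span_induction with
    | zero => simp
    | add x y _ _ hx hy =>
      rw [QuaternionAlgebra.coe_add, mul_add, add_mul]; exact add_mem hx hy
    | smul a x _ hx =>
      rw [QuaternionAlgebra.coe_smul, mul_smul_comm, smul_mul_assoc]; exact T.smul_mem _ hx
    | mem x hx =>
      obtain ⟨⟨x, k⟩, rfl⟩ := hx
      refine Submodule.subset_span ⟨(δ, x, 2 * k + l), ?_⟩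
      simp only
      rw [M.bz_apply, QuaternionAlgebra.coe_mul, QuaternionAlgebra.coe_pow, ← quatJ_sq, pow_add,
        pow_mul]
      simp only [mul_assoc]
  have hq : q = (q.re : ℍ[R, ε, θ]) + quatI ε θ * (q.imI : ℍ[R, ε, θ]) +
      (q.imJ : ℍ[R, ε, θ]) * quatJ ε θ + quatI ε θ * (q.imK : ℍ[R, ε, θ]) * quatJ ε θ := by
    ext <;> simp [quatI, quatJ]
  rw [hq]
  refine add_mem (add_mem (add_mem ?_ ?_) ?_) ?_
  · simpa using key false q.re 0
  · simpa using key true q.imI 0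
  · simpa using key false q.imJ 1
  · simpa using key true q.imK 1

variable [Module.Finite ℤ_[p] Λ] [Module.Free ℤ_[p] Λ] [ψ.IsPerfPair]

/-- The chart vectors span the quotient, so j^(n x) e x is congruent to an element of `nSub`. The
component at x of the difference, freed from i by `nElt_fst_mem`, is the monic polynomial sought. -/
lemma IsChartBasis.exists_polynomial (hp : p ≠ 2) (hβ : M.IsChartBasis D β)
    {P : Matrix (Fin m) (Fin m) A} (h : IsAlgPoint ρ cp ψ (frame β P)) (x : M.t) :
    ∃ Q : A[X], Q.degree < M.n x ∧ aeval (quatJ _ _) (X ^ M.n x - Q) * (M.eA A x :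
      ℍ[A ⊗[ℤ_[p]] R, (1 : A) ⊗ₜ[ℤ_[p]] ε, (1 : A) ⊗ₜ[ℤ_[p]] θ]) ∈ D.ideal (frame β P) := by
  classical
  let y : ℍ[A ⊗[ℤ_[p]] R, (1 : A) ⊗ₜ[ℤ_[p]] ε, (1 : A) ⊗ₜ[ℤ_[p]] θ] :=
    M.nElt ε (Pi.single x (X ^ M.n x)) 0
  obtain ⟨v, hv⟩ := (D.equiv A).surjective y
  have h1 : ∑ j, (frame β P).repr v (Sum.inr j) • D.equiv A (1 ⊗ₜ β (Sum.inr j)) ∈ M.nSub A ε :=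
    Submodule.sum_mem _ fun j _ => Submodule.smul_mem _ _ (hβ.mem_nSub j)
  have h2 : y - ∑ j, (frame β P).repr v (Sum.inr j) • D.equiv A (1 ⊗ₜ β (Sum.inr j)) ∈
      D.ideal (frame β P) := by
    rw [← hv]
    simp only [← map_smul, ← map_sum]
    rw [← map_sub, D.equiv_mem_ideal]
    intro j
    simp only [← frame_inr β P]
    simp [Finsupp.single_apply]
  obtain ⟨Q, Q', hQ, hQ', h3⟩ := h1
  refine ⟨Q x, hQ x, ?_⟩
  have h4 : y - M.nElt ε Q Q' =
      M.nElt ε (Pi.single x (X ^ M.n x) + (-1 : A) • Q) (0 + (-1 : A) • Q') := by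
    rw [nElt_add, nElt_smul, neg_one_smul, sub_eq_add_neg]
  rw [h3, h4] at h2
  simpa [sub_eq_add_neg] using (nElt_fst_mem hp h h2 x).1

-- The entries of P are quotient coordinates of elements of Λ. The congruence of j^(n x) e x with
-- Q_x(j) e x reduces all powers of j to exponents below n x, so these coordinates are polynomials
-- in the coefficients of Q. `MS` collects the elements with all coordinates in the subalgebra `S`.
omit [Module.Finite ℤ_[p] Λ] [Module.Free ℤ_[p] Λ] [ψ.IsPerfPair] in
lemma IsChartBasis.adjoin_coeff_eq_top (hβ : M.IsChartBasis D β)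
    {P : Matrix (Fin m) (Fin m) A} (h : IsAlgPoint ρ cp ψ (frame β P))
    (hP : Algebra.adjoin W (Set.range fun x : Fin m × Fin m => P x.1 x.2) = ⊤)
    (Q : M.t → A[X]) (hQ : ∀ x, (Q x).degree < M.n x)
    (hQI : ∀ x, aeval (quatJ _ _) (X ^ M.n x - Q x) * (M.eA A x :
      ℍ[A ⊗[ℤ_[p]] R, (1 : A) ⊗ₜ[ℤ_[p]] ε, (1 : A) ⊗ₜ[ℤ_[p]] θ]) ∈ D.ideal (frame β P)) :
    Algebra.adjoin W (Set.range fun i : Σ x : M.t, Fin (M.n x) => (Q i.1).coeff i.2) = ⊤ := by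
  classical
  set S := Algebra.adjoin W (Set.range fun i : Σ x : M.t, Fin (M.n x) => (Q i.1).coeff i.2)
  let MS : AddSubmonoid ℍ[A ⊗[ℤ_[p]] R, (1 : A) ⊗ₜ[ℤ_[p]] ε, (1 : A) ⊗ₜ[ℤ_[p]] θ] :=
    { carrier := {y | ∀ j, D.proj (frame β P) y j ∈ S}
      zero_mem' := fun j => by rw [map_zero]; exact zero_mem S
      add_mem' := fun {a b} ha hb j => by rw [map_add]; exact add_mem (ha j) (hb j) }
  have hsmul : ∀ a ∈ S, ∀ y ∈ MS, a • y ∈ MS := fun a ha y hy j => by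
    rw [map_smul]; exact mul_mem ha (hy j)
  have hI : ∀ y ∈ D.ideal (frame β P), y ∈ MS := fun y hy j => by
    rw [LinearMap.mem_ker.1 hy]; exact zero_mem S
  have hinr : ∀ k, D.equiv A (1 ⊗ₜ β (Sum.inr k)) ∈ MS := fun k j => by
    rw [D.proj_equiv, ← frame_inr β P]
    simp only [Module.Basis.repr_self, Finsupp.single_apply]
    split
    · exact one_mem S
    · exact zero_mem S
  have hpow : ∀ (δ : Bool) (x : M.t) (l : ℕ), (if δ then quatI _ _ else 1) * quatJ _ _ ^ l *
      (M.eA A x : ℍ[A ⊗[ℤ_[p]] R, (1 : A) ⊗ₜ[ℤ_[p]] ε, (1 : A) ⊗ₜ[ℤ_[p]] θ]) ∈ MS := by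
    intro δ x l
    induction l using Nat.strong_induction_on with
    | _ l ih =>
      rcases lt_or_ge l (M.n x) with hl | hl
      · exact hβ.mem_addSubmonoid δ x hl MS
          (fun a y hy => hsmul _ (S.algebraMap_mem a) y hy) hinr
      · obtain ⟨k, rfl⟩ := Nat.exists_eq_add_of_le' hl
        have h1 := D.isLeftStable h ((if δ then quatI _ _ else 1) * quatJ _ _ ^ k) _ (hQI x)
        have h2 : (if δ then quatI _ _ else 1) * quatJ _ _ ^ (k + M.n x) *
            (M.eA A x : ℍ[A ⊗[ℤ_[p]] R, (1 : A) ⊗ₜ[ℤ_[p]] ε, (1 : A) ⊗ₜ[ℤ_[p]] θ]) =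
            (if δ then quatI _ _ else 1) * quatJ _ _ ^ k * (aeval (quatJ _ _) (X ^ M.n x - Q x) *
              (M.eA A x : ℍ[A ⊗[ℤ_[p]] R, (1 : A) ⊗ₜ[ℤ_[p]] ε, (1 : A) ⊗ₜ[ℤ_[p]] θ])) +
            ∑ i ∈ Finset.range (M.n x), (Q x).coeff i • ((if δ then quatI _ _ else 1) *
              quatJ _ _ ^ (k + i) * (M.eA A x :
                ℍ[A ⊗[ℤ_[p]] R, (1 : A) ⊗ₜ[ℤ_[p]] ε, (1 : A) ⊗ₜ[ℤ_[p]] θ])) := by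
          have h3 : ∑ i ∈ Finset.range (M.n x), (Q x).coeff i • ((if δ then quatI _ _ else 1) *
              quatJ _ _ ^ (k + i) * (M.eA A x :
                ℍ[A ⊗[ℤ_[p]] R, (1 : A) ⊗ₜ[ℤ_[p]] ε, (1 : A) ⊗ₜ[ℤ_[p]] θ])) =
              (if δ then quatI _ _ else 1) * quatJ _ _ ^ k * (aeval (quatJ _ _) (Q x) *
              (M.eA A x : ℍ[A ⊗[ℤ_[p]] R, (1 : A) ⊗ₜ[ℤ_[p]] ε, (1 : A) ⊗ₜ[ℤ_[p]] θ])) := by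
            rw [aeval_eq_sum_range' (n := M.n x) (by
              rcases eq_or_ne (Q x) 0 with h0 | hne
              · rw [h0]; simpa using M.n_pos x
              · exact (natDegree_lt_iff_degree_lt hne).2 (hQ x)), Finset.sum_mul, Finset.mul_sum]
            refine Finset.sum_congr rfl fun i _ => ?_
            rw [smul_mul_assoc, mul_smul_comm, pow_add]
            simp only [mul_assoc]
          rw [h3, map_sub, map_pow, aeval_X, pow_add]
          noncomm_ring
        rw [h2]
        refine add_mem (hI _ h1) (sum_mem fun i hi => hsmul _ ?_ _ (ih _ ?_))
        · exact Algebra.subset_adjoin ⟨⟨x, ⟨i, Finset.mem_range.1 hi⟩⟩, rfl⟩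
        · have := Finset.mem_range.1 hi
          omega
  have hall : ∀ q : ℍ[R, ε, θ], quatMapHom ℤ_[p] A q ∈ MS := by
    intro q
    have hq := M.mem_span_chart q
    induction hq using Submodule.span_induction with
    | zero => rw [map_zero]; exact zero_mem _
    | add x y _ _ hx hy => rw [map_add]; exact add_mem hx hy
    | smul a x _ hx =>
      rw [map_smul, ← IsScalarTower.algebraMap_smul A a, IsScalarTower.algebraMap_apply ℤ_[p] W A]
      exact hsmul _ (S.algebraMap_mem _) _ hx
    | mem x hx =>
      obtain ⟨⟨δ, x, l⟩, rfl⟩ := hx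
      simp only
      rw [quatMapHom_chart]
      exact sum_mem fun y _ => hsmul _ (S.algebraMap_mem _) _ (hpow δ y l)
  rw [eq_top_iff, ← hP]
  refine Algebra.adjoin_le ?_
  rintro _ ⟨⟨k, j⟩, rfl⟩
  have h1 := hall (D.u (β (Sum.inl k))) j
  rw [← one_smul A (quatMapHom _ _ _), ← D.equiv_tmul, D.proj_equiv,
    frame_repr_inr β P (1 ⊗ₜ β (Sum.inl k)), ← Module.Basis.baseChange_apply A β] at h1
  simpa [Finsupp.single_apply] using h1

-- Compare the coefficients of X^(2l) in P(X) P(-X) = ± E(X²). The diagonal term is ± the square of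
-- the l-th coefficient. The others have indices a + b = 2l with a ≠ l, so a² + b² > 2l², and the
-- weight 2n² + 1 - a² makes them lighter. The constant 2n² + 1 makes linear and constant terms
-- lighter too, since l < n.
omit [Module.Finite ℤ_[p] Λ] [Module.Free ℤ_[p] Λ] [ψ.IsPerfPair] in
lemma sq_coeff_mem_span {x : M.t} {I : Submodule A ℍ[A ⊗[ℤ_[p]] R, (1 : A) ⊗ₜ[ℤ_[p]] ε,
    (1 : A) ⊗ₜ[ℤ_[p]] θ]} (hzero : ∀ x ∈ I, ∀ x' ∈ I, x * star x' = 0)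
    (Q : M.t → A[X]) (hQ : (Q x).degree < M.n x)
    (hQI : aeval (quatJ _ _) (X ^ M.n x - Q x) * (M.eA A x :
      ℍ[A ⊗[ℤ_[p]] R, (1 : A) ⊗ₜ[ℤ_[p]] ε, (1 : A) ⊗ₜ[ℤ_[p]] θ]) ∈ I) (l : Fin (M.n x)) :
    (Q x).coeff l ^ 2 ∈ Submodule.span W {y | ∃ s : Multiset (Σ x : M.t, Fin (M.n x)),
      (s.map fun i => 2 * M.n i.1 ^ 2 + 1 - (i.2 : ℕ) ^ 2).sum < 2 * (2 * M.n x ^ 2 + 1 - l ^ 2) ∧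
        y = (s.map fun i => (Q i.1).coeff i.2).prod} := by
  set T := Submodule.span W {y | ∃ s : Multiset (Σ x : M.t, Fin (M.n x)),
      (s.map fun i => 2 * M.n i.1 ^ 2 + 1 - (i.2 : ℕ) ^ 2).sum < 2 * (2 * M.n x ^ 2 + 1 - l ^ 2) ∧
        y = (s.map fun i => (Q i.1).coeff i.2).prod}
  rcases subsingleton_or_nontrivial A with _ | _
  · rw [Subsingleton.elim ((Q x).coeff l ^ 2) 0]; exact zero_mem _
  obtain ⟨E, hE, hEn, hEθ⟩ := M.exists_monic A x
  have hsq : ∀ a : Fin (M.n x), (a : ℕ) ^ 2 < M.n x ^ 2 := fun a =>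
    Nat.pow_lt_pow_left a.2 two_ne_zero
  have hl := hsq l
  set F : A[X] := X ^ M.n x - Q x
  have hrel := mul_comp_neg_eq_of_monic hzero (M.eA_mul_self A x) (M.eq_zero_of_aeval_mul_eA A x)
    (E.map (algebraMap W A)) (hE.map _) (by rw [hE.natDegree_map, hEn]) hEθ
    (monic_X_pow_sub hQ) (by
      refine natDegree_eq_of_degree_eq_some ?_
      rw [degree_sub_eq_left_of_degree_lt (by rwa [degree_X_pow]), degree_X_pow]) hQI
  have hF : ∀ a, a < M.n x → F.coeff a = -(Q x).coeff a := fun a ha => by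
    simp [F, coeff_X_pow, ha.ne]
  have hFn : F.coeff (M.n x) = 1 := by
    simp [F, coeff_X_pow, coeff_eq_zero_of_degree_lt hQ]
  have hFgt : ∀ a, M.n x < a → F.coeff a = 0 := fun a ha => by
    simp [F, coeff_X_pow, ha.ne', coeff_eq_zero_of_degree_lt
      (hQ.trans (by exact_mod_cast ha : (M.n x : WithBot ℕ) < a))]
  have hone : ∀ a : W, algebraMap W A a ∈ T := fun a => by
    rw [Algebra.algebraMap_eq_smul_one]
    refine T.smul_mem _ (Submodule.subset_span ⟨0, ?_, by simp⟩)
    simp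
    omega
  have hlin : ∀ a : Fin (M.n x), 2 * M.n x ^ 2 + 1 - (a : ℕ) ^ 2 <
      2 * (2 * M.n x ^ 2 + 1 - l ^ 2) → (Q x).coeff a ∈ T := fun a ha =>
    Submodule.subset_span ⟨{⟨x, a⟩}, by simpa using ha, by simp⟩
  have hquad : ∀ a b : Fin (M.n x), 2 * M.n x ^ 2 + 1 - (a : ℕ) ^ 2 +
      (2 * M.n x ^ 2 + 1 - (b : ℕ) ^ 2) < 2 * (2 * M.n x ^ 2 + 1 - l ^ 2) →
      (Q x).coeff a * (Q x).coeff b ∈ T := fun a b hab =>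
    Submodule.subset_span ⟨{⟨x, a⟩, ⟨x, b⟩}, by simpa using hab, by simp⟩
  have hterm : ∀ ab ∈ (Finset.HasAntidiagonal.antidiagonal (2 * (l : ℕ))).erase ((l : ℕ), (l : ℕ)),
      F.coeff ab.1 * (F.comp (-X)).coeff ab.2 ∈ T := by
    rintro ⟨a, b⟩ hab
    rw [Finset.mem_erase, Finset.HasAntidiagonal.mem_antidiagonal] at hab
    obtain ⟨hne, hab⟩ := hab
    simp only at hab ⊢
    have hsign : ∀ (y : A) (k : ℕ), y ∈ T → y * (-1) ^ k ∈ T := fun y k hy => by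
      rcases neg_one_pow_eq_or A k with h | h <;> rw [h] <;> simpa using hy
    rw [coeff_comp_neg_X, ← mul_assoc]
    refine hsign _ _ ?_
    have hne' : (a : ℕ) ≠ l := fun h => hne (by rw [Prod.mk.injEq]; omega)
    have hlow : 2 * (l : ℕ) ^ 2 < a ^ 2 + b ^ 2 := by
      have h1 : (a : ℤ) + b = 2 * l := by exact_mod_cast hab
      have h2 : (a : ℤ) - l ≠ 0 := sub_ne_zero.2 (by exact_mod_cast hne')
      have h3 : 0 < ((a : ℤ) - l) ^ 2 := by positivity
      have h4 : (b : ℤ) = 2 * l - a := by linarith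
      have : 2 * (l : ℤ) ^ 2 < a ^ 2 + b ^ 2 := by rw [h4]; nlinarith
      exact_mod_cast this
    rcases lt_trichotomy a (M.n x) with ha | ha | ha
    · rcases lt_trichotomy b (M.n x) with hb | hb | hb
      · rw [hF a ha, hF b hb, neg_mul_neg]
        refine hquad ⟨a, ha⟩ ⟨b, hb⟩ ?_
        have h1 := hsq ⟨a, ha⟩
        have h2 := hsq ⟨b, hb⟩
        simp only at h1 h2 ⊢
        omega
      · rw [hb, hFn, mul_one, hF a ha]
        refine neg_mem (hlin ⟨a, ha⟩ ?_)
        have h1 := hsq ⟨a, ha⟩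
        simp only at h1 ⊢
        omega
      · rw [hFgt b hb, mul_zero]; exact zero_mem _
    · rw [ha, hFn, one_mul]
      have hb : b < M.n x := by have := l.2; omega
      rw [hF b hb]
      refine neg_mem (hlin ⟨b, hb⟩ ?_)
      have h1 := hsq ⟨b, hb⟩
      simp only at h1 ⊢
      omega
    · rw [hFgt a ha, zero_mul]; exact zero_mem _
  have hc := congrArg (fun G => G.coeff (2 * (l : ℕ))) hrel
  rw [coeff_mul, ← Finset.add_sum_erase _ _ (show ((l : ℕ), (l : ℕ)) ∈
    Finset.HasAntidiagonal.antidiagonal (2 * (l : ℕ)) by rw [Finset.HasAntidiagonal.mem_antidiagonal]; omega), coeff_comp_neg_X,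
    hF _ l.2] at hc
  have hr : ((-1) ^ M.n x * expand A 2 (E.map (algebraMap W A))).coeff (2 * (l : ℕ)) ∈ T := by
    have h1 : ((-1) ^ M.n x * expand A 2 (E.map (algebraMap W A))).coeff (2 * (l : ℕ)) =
        algebraMap W A ((-1) ^ M.n x * E.coeff l) := by
      rw [show ((-1) ^ M.n x : A[X]) = C ((-1) ^ M.n x) by simp, coeff_C_mul, mul_comm 2,
        coeff_expand_mul two_pos, coeff_map, map_mul, map_pow, map_neg, map_one]
    rw [h1]
    exact hone _
  rw [← hc] at hr
  have h1 := sub_mem hr (sum_mem hterm)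
  rw [add_sub_cancel_right] at h1
  rcases neg_one_pow_eq_or A (l : ℕ) with h | h <;> rw [h] at h1
  · simpa [sq] using h1
  · simpa [sq] using neg_mem h1

end SplitModel

/-! ### Determinants as products over homomorphisms -/

section Dedekind

variable {k Z K ι : Type*} [CommRing k] [CommRing Z] [Algebra k Z] [Field K] [Algebra k K]
  [Fintype ι] [DecidableEq ι]

/-- A vanishing combination of the rows would be a linear relation between distinct homomorphisms.
-/
lemma isUnit_det_algHom (b : Module.Basis ι k Z) (φ : ι → Z →ₐ[k] K)
    (hφ : Function.Injective φ) : IsUnit (Matrix.of fun i j => φ i (b j)).det := by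
  rw [isUnit_iff_ne_zero]
  intro h
  obtain ⟨v, hv, hvM⟩ := Matrix.exists_vecMul_eq_zero_iff.2 h
  apply hv
  have hli := (linearIndependent_algHom_toLinearMap k Z K).comp φ hφ
  ext i
  refine Fintype.linearIndependent_iff.1 hli v ?_ i
  refine b.ext fun j => ?_
  have := congrFun hvM j
  simpa [Matrix.vecMul, dotProduct] using this

/-- If `Z` has as many homomorphisms to `K` as its rank, then `det (X² - t X + n)` is the product
of the polynomials `X² - φ t X + φ n`. -/
lemma quadDet_leftMulMatrix_map (b : Module.Basis ι k Z) (φ : ι → Z →ₐ[k] K)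
    (hφ : Function.Injective φ) (t n : Z) :
    (quadDet (Algebra.leftMulMatrix b t) (Algebra.leftMulMatrix b n)).map (algebraMap k K) =
      ∏ i, ((X : K[X]) ^ 2 - C (φ i t) * X + C (φ i n)) := by
  have hV := isUnit_det_algHom b φ hφ
  set V : Matrix ι ι K := Matrix.of fun i j => φ i (b j)
  -- The matrix of values `V` diagonalizes all multiplications at once, with the φ i x as
  -- eigenvalues.
  have key : ∀ x : Z, V * (Algebra.leftMulMatrix b x).map (algebraMap k K) =
      Matrix.diagonal (fun i => φ i x) * V := by
    intro x
    ext i j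
    rw [Matrix.mul_apply, Matrix.diagonal_mul]
    simp only [V, Matrix.of_apply, Matrix.map_apply]
    rw [← map_mul, ← b.sum_repr (x * b j), map_sum]
    refine Finset.sum_congr rfl fun l _ => ?_
    rw [map_smul, Algebra.leftMulMatrix_eq_repr_mul, Algebra.smul_def, mul_comm]
  have h1 : ∀ x : Z, V.map C * ((Algebra.leftMulMatrix b x).map (algebraMap k K)).map C =
      (Matrix.diagonal fun i => C (φ i x)) * V.map C := by
    intro x
    have := congrArg (fun N => Matrix.map N (C : K →+* K[X])) (key x)
    simp only [Matrix.map_mul] at this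
    rw [this]
    congr 1
    ext i j
    by_cases h : i = j
    · subst h; simp
    · simp [Matrix.diagonal_apply_ne _ h]
  rw [← quadDet_map, quadDet]
  have hV' : (V.map (C : K →+* K[X])).det ≠ 0 := by
    have h2 : (V.map (C : K →+* K[X])).det = C V.det := by
      rw [RingHom.map_det]; rfl
    rw [h2]
    exact C_ne_zero.2 hV.ne_zero
  apply mul_left_cancel₀ hV'
  rw [← Matrix.det_mul, mul_add, mul_sub, mul_smul_comm, mul_smul_comm, mul_one]
  erw [h1 t, h1 n]
  have h3 : (X : K[X]) ^ 2 • V.map (C : K →+* K[X]) - (X : K[X]) • ((Matrix.diagonal fun i =>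
      C (φ i t)) * V.map C) + (Matrix.diagonal fun i => C (φ i n)) * V.map C =
      (Matrix.diagonal fun i => (X : K[X]) ^ 2 - C (φ i t) * X + C (φ i n)) * V.map C := by
    ext1 i j
    simp only [Matrix.add_apply, Matrix.sub_apply, Matrix.smul_apply, Matrix.diagonal_mul,
      smul_eq_mul]
    ring
  erw [h3]
  rw [Matrix.det_mul, Matrix.det_diagonal, mul_comm]

end Dedekind

lemma charpoly_blockDiagonal {ι K : Type*} [Fintype ι] [DecidableEq ι] [CommRing K]
    (N : ι → Matrix (Fin 2) (Fin 2) K) :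
    (Matrix.blockDiagonal N).charpoly = ∏ i, (N i).charpoly := by
  rw [Matrix.charpoly]
  have : (Matrix.blockDiagonal N).charmatrix = Matrix.blockDiagonal fun i => (N i).charmatrix := by
    ext1 ⟨a, i⟩ ⟨b, j⟩
    by_cases h : i = j
    · subst h
      simp [Matrix.charmatrix_apply, Matrix.blockDiagonal_apply, Matrix.diagonal_apply]
    · simp [Matrix.blockDiagonal_apply, h]
  rw [this, Matrix.det_blockDiagonal]
  rfl

/-! ### Geometric points from square roots of θ -/

section GeometricPoints

variable {p : ℕ} [Fact p.Prime] {R : Type*} [CommRing R] [Algebra ℤ_[p] R] {ε θ : R}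
  {O : Type*} [Ring O] {Λ : Type*} [AddCommGroup Λ] [Module ℤ_[p] Λ]
  {ρ : O → Module.End ℤ_[p] Λ} {cp : O → ℤ[X]} {ψ : LinearMap.BilinForm ℤ_[p] Λ}
  {K : Type} [Field K] [Algebra ℤ_[p] K] {ι : Type} [Fintype ι] [DecidableEq ι]
  (χ : ι → R →ₐ[ℤ_[p]] K)

/-- The evaluation `K ⊗ R → K` at a homomorphism `R → K`. -/
noncomputable def evK (k : ι) : K ⊗[ℤ_[p]] R →ₐ[K] K :=
  Algebra.TensorProduct.lift (AlgHom.id K K) (χ k) fun _ _ => mul_comm _ _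

omit [Fintype ι] [DecidableEq ι] in
lemma evK_tmul (k : ι) (a : K) (r : R) : evK χ k (a ⊗ₜ r) = a * χ k r := by
  exact Algebra.TensorProduct.lift_tmul _ _ _ _ _

/-- With as many homomorphisms as its rank, R becomes a product of copies of K. -/
lemma evK_bijective (b : Module.Basis ι ℤ_[p] R) (hχ : Function.Injective χ) :
    Function.Bijective (fun (x : K ⊗[ℤ_[p]] R) k => evK χ k x) := by
  let f : K ⊗[ℤ_[p]] R →ₗ[K] (ι → K) := LinearMap.pi fun k => (evK χ k).toLinearMap
  have hV := isUnit_det_algHom b χ hχ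
  set V : Matrix ι ι K := Matrix.of fun i j => χ i (b j)
  have hf : LinearMap.toMatrix (b.baseChange K) (Pi.basisFun K ι) f = V := by
    ext i j
    rw [LinearMap.toMatrix_apply, Module.Basis.baseChange_apply]
    simp [f, V, evK_tmul]
  let e : K ⊗[ℤ_[p]] R ≃ₗ[K] (ι → K) :=
    LinearEquiv.ofIsUnitDet (f := f) (v := b.baseChange K) (v' := Pi.basisFun K ι) (hf ▸ hV)
  exact e.bijective

variable (r : ι → K)

variable (ε θ) in
/-- The projection with kernel the left ideal generated by the elements `j - r k`. -/
noncomputable def projK : ℍ[K ⊗[ℤ_[p]] R, (1 : K) ⊗ₜ[ℤ_[p]] ε, (1 : K) ⊗ₜ[ℤ_[p]] θ] →ₗ[K]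
    (Fin 2 × ι → K) where
  toFun x := fun i => if i.1 = 0 then evK χ i.2 x.re + r i.2 * evK χ i.2 x.imJ
    else evK χ i.2 x.imI + r i.2 * evK χ i.2 x.imK
  map_add' x y := by
    ext ⟨a, k⟩
    fin_cases a <;> simp <;> ring
  map_smul' a x := by
    ext ⟨b, k⟩
    fin_cases b <;> simp <;> ring

/-- The matrix of `x` on the quotient by the left ideal. -/
noncomputable def blockK (x : ℍ[R, ε, θ]) (k : ι) : Matrix (Fin 2) (Fin 2) K :=
  !![χ k x.re + r k * χ k x.imJ, χ k ε * χ k x.imI - χ k ε * r k * χ k x.imK;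
    χ k x.imI + r k * χ k x.imK, χ k x.re - r k * χ k x.imJ]

variable {χ r}

/-- At k the quotient has basis 1, i, and j acts on these by r k and -r k. This is compatible with
j² = θ because r k is a square root of χ k θ. -/
lemma projK_mul (hr : ∀ k, r k ^ 2 = χ k θ) (x : ℍ[R, ε, θ]) (y) :
    projK ε θ χ r (quatMapHom ℤ_[p] K x * y) =
      (Matrix.blockDiagonal (blockK χ r x)).mulVec (projK ε θ χ r y) := by
  ext ⟨a, k⟩
  have h : ∀ v : Fin 2 × ι → K, (Matrix.blockDiagonal (blockK χ r x)).mulVec v (a, k) =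
      (blockK χ r x k).mulVec (fun b => v (b, k)) a := by
    intro v
    simp only [Matrix.mulVec, dotProduct, Fintype.sum_prod_type, Matrix.blockDiagonal_apply]
    refine Finset.sum_congr rfl fun b _ => ?_
    rw [Finset.sum_eq_single k]
    · simp
    · intro l _ hl
      simp [hl.symm]
    · simp
  rw [h]
  have hk := hr k
  fin_cases a
  · simp [projK, blockK, Matrix.mulVec, dotProduct, Fin.sum_univ_two, evK_tmul, ← hk]
    ring
  · simp [projK, blockK, Matrix.mulVec, dotProduct, Fin.sum_univ_two, evK_tmul, ← hk]
    ring

omit [Fintype ι] [DecidableEq ι] in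
lemma charpoly_blockK (hr : ∀ k, r k ^ 2 = χ k θ) (x : ℍ[R, ε, θ]) (k : ι) :
    (blockK χ r x k).charpoly = X ^ 2 - C (χ k (2 * x.re)) * X + C (χ k (x * star x).re) := by
  rw [Matrix.charpoly_fin_two]
  congr 1
  · congr 3
    simp [blockK, Matrix.trace_fin_two, map_ofNat]
    ring
  · congr 1
    simp [blockK, Matrix.det_fin_two, ← hr k]
    ring

lemma imJ_star_mul_eq_zero (b : Module.Basis ι ℤ_[p] R) (hχ : Function.Injective χ)
    {x y : ℍ[K ⊗[ℤ_[p]] R, (1 : K) ⊗ₜ[ℤ_[p]] ε, (1 : K) ⊗ₜ[ℤ_[p]] θ]}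
    (hx : projK ε θ χ r x = 0) (hy : projK ε θ χ r y = 0) : (star x * y).imJ = 0 := by
  apply (evK_bijective χ b hχ).injective
  ext k
  have h1 := congrFun hx (0, k)
  have h2 := congrFun hx (1, k)
  have h3 := congrFun hy (0, k)
  have h4 := congrFun hy (1, k)
  simp [projK] at h1 h2 h3 h4 ⊢
  rw [eq_neg_of_add_eq_zero_left h1, eq_neg_of_add_eq_zero_left h2,
    eq_neg_of_add_eq_zero_left h3, eq_neg_of_add_eq_zero_left h4]
  ring

lemma projK_surjective (b : Module.Basis ι ℤ_[p] R) (hχ : Function.Injective χ) :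
    Function.Surjective (projK ε θ χ r) := by
  intro v
  obtain ⟨s, hs⟩ := (evK_bijective χ b hχ).surjective fun k => v (0, k)
  obtain ⟨t, ht⟩ := (evK_bijective χ b hχ).surjective fun k => v (1, k)
  refine ⟨⟨s, t, 0, 0⟩, ?_⟩
  ext ⟨a, k⟩
  have h1 := congrFun hs k
  have h2 := congrFun ht k
  fin_cases a
  · simpa [projK] using h1
  · simpa [projK] using h2

/-- The element j - r k supported at k lies in the first kernel; lying in the second as well forces
r k = r' k. -/
lemma eq_of_ker_projK_le {r' : ι → K} (b : Module.Basis ι ℤ_[p] R) (hχ : Function.Injective χ)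
    (h : LinearMap.ker (projK ε θ χ r) ≤ LinearMap.ker (projK ε θ χ r')) : r = r' := by
  ext k
  obtain ⟨t, ht⟩ := (evK_bijective χ b hχ).surjective fun l => if l = k then 1 else 0
  have ht' : ∀ l, evK χ l t = if l = k then 1 else 0 := fun l => congrFun ht l
  have h1 : (⟨-r k • t, 0, t, 0⟩ : ℍ[K ⊗[ℤ_[p]] R, (1 : K) ⊗ₜ[ℤ_[p]] ε, (1 : K) ⊗ₜ[ℤ_[p]] θ]) ∈
      LinearMap.ker (projK ε θ χ r) := by
    rw [LinearMap.mem_ker]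
    ext ⟨a, l⟩
    fin_cases a
    · by_cases hl : l = k
      · subst hl; simp [projK, ht']
      · simp [projK, ht', hl]
    · simp [projK]
  have h2 := congrFun (LinearMap.mem_ker.1 (h h1)) (0, k)
  simp [projK, ht'] at h2
  linear_combination -h2

/-- A surjection onto `K ^ m` from a space of dimension `2 m` is given by the last coordinates of
some basis. -/
lemma exists_basis_repr_inr {V : Type*} [AddCommGroup V] [Module K V] {m : ℕ} [Module.Finite K V]
    (hV : Module.finrank K V = m + m) (f : V →ₗ[K] (Fin m → K)) (hf : Function.Surjective f) :
    ∃ b : Module.Basis (Fin m ⊕ Fin m) K V, ∀ x j, b.repr x (Sum.inr j) = f x j := by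
  obtain ⟨g, hg⟩ := f.exists_rightInverse_of_surjective (LinearMap.range_eq_top.2 hf)
  have hg' : ∀ v, f (g v) = v := fun v => LinearMap.congr_fun hg v
  have hker : Module.finrank K (LinearMap.ker f) = m := by
    have h1 := f.finrank_range_add_finrank_ker
    rw [LinearMap.range_eq_top.2 hf, finrank_top, Module.finrank_fin_fun, hV] at h1
    omega
  let bk : Module.Basis (Fin m) K (LinearMap.ker f) := Module.finBasisOfFinrankEq K _ hker
  let v : Fin m ⊕ Fin m → V := Sum.elim (fun i => (bk i : V)) fun j => g (Pi.single j 1)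
  have hfb : ∀ i, f (bk i : V) = 0 := fun i => (bk i).2
  have hli : LinearIndependent K v := by
    rw [Fintype.linearIndependent_iff]
    intro c hc
    rw [Fintype.sum_sum_type] at hc
    simp only [v, Sum.elim_inl, Sum.elim_inr] at hc
    have h1 : ∀ j, c (Sum.inr j) = 0 := by
      have h2 := congrArg f hc
      simp only [map_add, map_sum, map_smul, hfb, smul_zero, Finset.sum_const_zero, zero_add,
        hg', map_zero] at h2
      intro j
      have := congrFun h2 j
      simpa [Finset.sum_apply, Pi.single_apply] using this
    simp only [h1, zero_smul, Finset.sum_const_zero, add_zero] at hc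
    have h3 : ∑ i, c (Sum.inl i) • bk i = 0 := by
      apply Subtype.ext
      simpa using hc
    have h4 := Fintype.linearIndependent_iff.1 bk.linearIndependent _ h3
    rintro (i | j)
    · exact h4 i
    · exact h1 j
  let b := Module.Basis.mk hli (hli.span_eq_top_of_card_eq_finrank' (by simp [hV])).ge
  have hb : ∀ i, b i = v i := fun i => by simp [b]
  refine ⟨b, fun x j => ?_⟩
  conv_rhs => rw [← b.sum_repr x, Fintype.sum_sum_type]
  simp [hb, v, hfb, hg', Pi.single_apply]

variable [Module.Finite ℤ_[p] Λ] [Module.Free ℤ_[p] Λ]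

/-- The ideal is the kernel of `projK`. The determinant condition holds because the block at k has
trace and determinant the images under χ k of the reduced trace and norm. -/
lemma QuatModel.exists_point (D : QuatModel ρ cp ψ R ε θ) {m : ℕ} (em : Fin m ≃ Fin 2 × ι)
    (hm : Module.finrank ℤ_[p] Λ = m + m) (b : Module.Basis ι ℤ_[p] R)
    (hχ : Function.Injective χ) (hr : ∀ k, r k ^ 2 = χ k θ) :
    ∃ f : Module.Basis (Fin m ⊕ Fin m) K (K ⊗[ℤ_[p]] Λ), IsAlgPoint ρ cp ψ f ∧
      ∀ x, (∀ j, f.repr x (Sum.inr j) = 0) ↔ projK ε θ χ r (D.equiv K x) = 0 := by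
  classical
  let F : K ⊗[ℤ_[p]] Λ →ₗ[K] (Fin m → K) :=
    LinearMap.funLeft K K em ∘ₗ projK ε θ χ r ∘ₗ (D.equiv K).toLinearMap
  have hF : ∀ x i, F x i = projK ε θ χ r (D.equiv K x) (em i) := fun x i => rfl
  have hFs : Function.Surjective F := by
    intro v
    obtain ⟨y, hy⟩ := projK_surjective (ε := ε) (θ := θ) (r := r) b hχ (fun i => v (em.symm i))
    obtain ⟨x, rfl⟩ := (D.equiv K).surjective y
    exact ⟨x, funext fun i => by
    rw [hF, hy]; exact congrArg v (em.symm_apply_apply i)⟩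
  obtain ⟨f, hf⟩ := exists_basis_repr_inr (by rw [Module.finrank_baseChange, hm]) F hFs
  have hker : ∀ x, (∀ j, f.repr x (Sum.inr j) = 0) ↔ projK ε θ χ r (D.equiv K x) = 0 := by
    intro x
    simp only [hf, hF]
    constructor
    · intro h
      ext i
      simpa using h (em.symm i)
    · intro h j
      rw [h]; rfl
  have hinl : ∀ i, projK ε θ χ r (D.equiv K (f (Sum.inl i))) = 0 := fun i =>
    (hker _).1 fun j => by simp
  refine ⟨f, ⟨fun i j => ?_, fun a i => ?_, fun a => ?_⟩, hker⟩
  · rw [D.baseChange_form, imJ_star_mul_eq_zero b hχ (hinl i) (hinl j), map_zero]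
  · rw [hker, D.equiv_act, projK_mul hr, hinl, Matrix.mulVec_zero]
  · have h1 : (LinearMap.toMatrix f f ((ρ a).baseChange K)).toBlocks₂₂ =
        Matrix.reindex em.symm em.symm (Matrix.blockDiagonal (blockK χ r (D.φ a))) := by
      ext i j
      simp only [Matrix.toBlocks₂₂, LinearMap.toMatrix_apply, Matrix.of_apply, hf, hF]
      rw [D.equiv_act, projK_mul hr]
      have h2 : projK ε θ χ r (D.equiv K (f (Sum.inr j))) = Pi.single (em j) 1 := by
        ext i
        have h3 := hf (f (Sum.inr j)) (em.symm i)
        rw [hF, Equiv.apply_symm_apply] at h3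
        rw [← h3]
        simp [Finsupp.single_apply, Pi.single_apply, Equiv.eq_symm_apply, eq_comm]
      rw [h2]
      simp
    have hind : Nonempty (ι ≃ Fin D.d) := ⟨b.indexEquiv D.bR⟩
    obtain ⟨eι⟩ := hind
    rw [h1, Matrix.charpoly_reindex, charpoly_blockDiagonal]
    have h3 := congrArg (Polynomial.map (algebraMap ℤ_[p] K)) (D.map_c a)
    rw [Polynomial.map_map, show (algebraMap ℤ_[p] K).comp (Int.castRingHom ℤ_[p]) =
      Int.castRingHom K from RingHom.ext_int _ _] at h3
    rw [h3, rcp, quadDet_leftMulMatrix_map D.bR (χ ∘ eι.symm) (hχ.comp eι.symm.injective)]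
    rw [← Equiv.prod_comp eι.symm]
    refine Finset.prod_congr rfl fun k _ => ?_
    rw [charpoly_blockK hr]
    rfl

end GeometricPoints

/-! ### Finiteness and flatness of the chart -/

namespace SplitModel

variable {p : ℕ} [Fact p.Prime] {R : Type*} [CommRing R] [Algebra ℤ_[p] R] {ε θ : R}
  {W : Type} [CommRing W] [IsDomain W] [Algebra ℤ_[p] W] {M : SplitModel p θ W}
  {O : Type*} [Ring O] {Λ : Type*} [AddCommGroup Λ] [Module ℤ_[p] Λ]
  {ρ : O → Module.End ℤ_[p] Λ} {cp : O → ℤ[X]} {ψ : LinearMap.BilinForm ℤ_[p] Λ}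
  {D : QuatModel ρ cp ψ R ε θ} {m : ℕ} {β : Module.Basis (Fin m ⊕ Fin m) ℤ_[p] Λ}
  [Module.Finite ℤ_[p] W] [Module.Free ℤ_[p] W]
  [Module.Finite ℤ_[p] Λ] [Module.Free ℤ_[p] Λ] [ψ.IsPerfPair]

/-- There is one point for each choice of signs of the square roots of the χ k θ. Since χ k θ and 2
are nonzero, different signs give different roots, hence different ideals. -/
lemma IsChartBasis.exists_chart_algHoms (hp : p ≠ 2) (hβ : M.IsChartBasis D β)
    (em : Fin m ≃ Fin 2 × Σ x : M.t, Fin (M.n x)) (hm : Module.finrank ℤ_[p] Λ = m + m) :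
    ∃ f : ((Σ x : M.t, Fin (M.n x)) → Bool) →
      (ChartRing ρ cp ψ β →ₐ[ℤ_[p]] AlgebraicClosure (FractionRing W)), Function.Injective f := by
  classical
  set K := AlgebraicClosure (FractionRing W)
  have h2 : (2 : K) ≠ 0 := by
    have h2 : IsUnit (2 : ℤ_[p]) := by
      rw [PadicInt.isUnit_iff, ← Nat.cast_ofNat, PadicInt.norm_natCast_eq_one_iff]
      exact (Nat.coprime_primes Fact.out Nat.prime_two).2 hp
    have := (h2.map (algebraMap ℤ_[p] K)).ne_zero
    rwa [map_ofNat] at this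
  choose s hs using fun k => IsAlgClosed.exists_pow_nat_eq (M.χ k θ) two_pos
  have hs0 : ∀ k, s k ≠ 0 := fun k h => M.χ_ne_zero k (by rw [← hs k, h]; simp)
  let r : ((Σ x : M.t, Fin (M.n x)) → Bool) → (Σ x : M.t, Fin (M.n x)) → K :=
    fun σ k => if σ k then s k else -s k
  have hr : ∀ σ k, r σ k ^ 2 = M.χ k θ := fun σ k => by
    simp only [r]; split <;> simp [hs]
  have hrinj : Function.Injective r := by
    intro σ σ' h
    ext k
    have h1 := congrFun h k
    have h3 : s k ≠ -s k := fun h => hs0 k (by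
      have : 2 * s k = 0 := by linear_combination h
      exact (mul_eq_zero.1 this).resolve_left h2)
    simp only [r] at h1
    rcases hσ : σ k <;> rcases hσ' : σ' k <;> simp [hσ, hσ'] at h1 ⊢
    · exact h3 h1.symm
    · exact h3 h1
  choose f hf hf' using fun σ => D.exists_point em hm M.bz M.χ_injective (hr σ)
  choose P hP hP1 hP2 using fun σ => (hf σ).exists_frame β (hβ.isUnit_det hp (hf σ))
  choose g hg using fun σ => exists_chartRing_algHom (hP σ)
  refine ⟨g, fun σ σ' h => hrinj (eq_of_ker_projK_le (ε := ε) (θ := θ) M.bz M.χ_injective ?_)⟩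
  have hPP : P σ = P σ' := by rw [← hg σ, ← hg σ', h]
  intro y hy
  obtain ⟨x, rfl⟩ := (D.equiv K).surjective y
  rw [LinearMap.mem_ker] at hy ⊢
  rw [← hf'] at hy ⊢
  have key : ∀ (b b' : Module.Basis (Fin m ⊕ Fin m) K (K ⊗[ℤ_[p]] Λ)),
      (∀ k j, b.repr (b' (Sum.inl k)) (Sum.inr j) = 0) →
      (∀ j, b'.repr x (Sum.inr j) = 0) → ∀ j, b.repr x (Sum.inr j) = 0 := by
    intro b b' h1 h2 j
    rw [← b'.sum_repr x, Fintype.sum_sum_type]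
    simp [h1, h2]
  exact key _ _ (hP1 σ') (hPP ▸ key _ _ (hP2 σ) hy)

omit [Module.Finite ℤ_[p] W] [Module.Free ℤ_[p] W] [Module.Finite ℤ_[p] Λ] [Module.Free ℤ_[p] Λ]
  [ψ.IsPerfPair] [Ring O] [IsDomain W] in
variable (W) in
lemma adjoin_includeRight {B : Type} [CommRing B] [Algebra ℤ_[p] B] {ι : Type*} (P : ι → B)
    (hP : Algebra.adjoin ℤ_[p] (Set.range P) = ⊤) : Algebra.adjoin W (Set.range fun x : ι =>
      (Algebra.TensorProduct.includeRight : B →ₐ[ℤ_[p]] W ⊗[ℤ_[p]] B) (P x)) = ⊤ := by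
  rw [eq_top_iff]
  rintro x -
  induction x using TensorProduct.induction_on with
  | zero => exact zero_mem _
  | add x y hx hy => exact add_mem hx hy
  | tmul a x =>
    have h1 : (Algebra.TensorProduct.includeRight : B →ₐ[ℤ_[p]] W ⊗[ℤ_[p]] B) x ∈
        Algebra.adjoin W (Set.range fun x : ι =>
      (Algebra.TensorProduct.includeRight : B →ₐ[ℤ_[p]] W ⊗[ℤ_[p]] B) (P x)) := by
      have hx : x ∈ Algebra.adjoin ℤ_[p] (Set.range P) := by rw [hP]; trivial
      induction hx using Algebra.adjoin_induction with
      | mem x hx =>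
        obtain ⟨x, rfl⟩ := hx
        exact Algebra.subset_adjoin ⟨x, rfl⟩
      | algebraMap r =>
        rw [AlgHom.commutes, IsScalarTower.algebraMap_apply ℤ_[p] W (W ⊗[ℤ_[p]] B)]
        exact Subalgebra.algebraMap_mem _ _
      | add x y _ _ hx hy => rw [map_add]; exact add_mem hx hy
      | mul x y _ _ hx hy => rw [map_mul]; exact mul_mem hx hy
    have h2 := Subalgebra.smul_mem _ h1 a
    simpa [TensorProduct.smul_tmul'] using h2

omit [Module.Finite ℤ_[p] W] [Module.Free ℤ_[p] W] in
lemma IsChartBasis.exists_span {A : Type} [CommRing A] [Algebra ℤ_[p] A] [Algebra W A]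
    [IsScalarTower ℤ_[p] W A] (hp : p ≠ 2) (hβ : M.IsChartBasis D β)
    {P : Matrix (Fin m) (Fin m) A} (hP : IsAlgPoint ρ cp ψ (frame β P))
    (hgen : Algebra.adjoin W (Set.range fun x : Fin m × Fin m => P x.1 x.2) = ⊤) :
    ∃ c : Finset (Σ x : M.t, Fin (M.n x)) → A, Submodule.span W (Set.range c) = ⊤ := by
  choose Q hQ hQI using fun x => hβ.exists_polynomial hp hP x
  have htop := hβ.adjoin_coeff_eq_top hP hgen Q hQ hQI
  exact ⟨_, span_prod_eq_top_of_sq (A := W)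
    (fun i : Σ x : M.t, Fin (M.n x) => (Q i.1).coeff i.2)
    (fun i => 2 * M.n i.1 ^ 2 + 1 - (i.2 : ℕ) ^ 2) htop
    (fun i => sq_coeff_mem_span (fun x hx x' hx' => D.mul_star_eq_zero hP hx hx') Q (hQ i.1)
      (hQI i.1) i.2)⟩

omit [Module.Finite ℤ_[p] W] [Module.Free ℤ_[p] W] in
lemma IsChartBasis.exists_span_baseChange {B : Type} [CommRing B] [Algebra ℤ_[p] B]
    (hp : p ≠ 2) (hβ : M.IsChartBasis D β) {P : Matrix (Fin m) (Fin m) B}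
    (hP : IsAlgPoint ρ cp ψ (frame β P))
    (hgen : Algebra.adjoin ℤ_[p] (Set.range fun x : Fin m × Fin m => P x.1 x.2) = ⊤) :
    ∃ c : Finset (Σ x : M.t, Fin (M.n x)) → W ⊗[ℤ_[p]] B,
      Submodule.span W (Set.range c) = ⊤ := by
  let f : B →ₐ[ℤ_[p]] W ⊗[ℤ_[p]] B := Algebra.TensorProduct.includeRight
  have h1 : IsAlgPoint ρ cp ψ (frame β (P.map f)) := hP.map f (frame_map β f P)
  exact hβ.exists_span hp h1 (adjoin_includeRight W (fun x : Fin m × Fin m => P x.1 x.2) hgen)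

-- Equally many spanning elements and points, namely 2 to the size of ι, give freeness over W.
-- Finiteness descends along the faithfully flat ℤ_p → W, and B is torsion-free, hence flat, because
-- it embeds in W ⊗ B.
omit [Module.Finite ℤ_[p] Λ] [Module.Free ℤ_[p] Λ] [ψ.IsPerfPair] [Ring O] in
lemma finite_flat_of_span {B : Type} [CommRing B] [Algebra ℤ_[p] B] {ι : Type} [Fintype ι]
    (c : Finset ι → W ⊗[ℤ_[p]] B) (hc : Submodule.span W (Set.range c) = ⊤)
    (f : (ι → Bool) → (B →ₐ[ℤ_[p]] AlgebraicClosure (FractionRing W)))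
    (hf : Function.Injective f) : Module.Finite ℤ_[p] B ∧ Module.Flat ℤ_[p] B := by
  classical
  let F : (ι → Bool) → (W ⊗[ℤ_[p]] B →ₐ[W] AlgebraicClosure (FractionRing W)) := fun σ =>
    Algebra.TensorProduct.lift (Algebra.ofId W _) (f σ) fun _ _ => mul_comm _ _
  have hF : Function.Injective F := by
    intro σ σ' h
    apply hf
    ext x
    have h1 : ∀ σ, F σ (1 ⊗ₜ x) = f σ x := fun σ =>
      (Algebra.TensorProduct.lift_tmul _ _ _ _ _).trans (by rw [map_one, one_mul])
    rw [← h1, ← h1, h]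
  have hWK : Function.Injective (algebraMap W (AlgebraicClosure (FractionRing W))) := by
    rw [IsScalarTower.algebraMap_eq W (FractionRing W)]
    exact (algebraMap (FractionRing W) _).injective.comp (IsFractionRing.injective W _)
  obtain ⟨h1, h2⟩ := free_of_span_of_algHom hWK (by simp) c hc F hF
  have : Module.FaithfullyFlat ℤ_[p] W := inferInstance
  refine ⟨Module.Finite.of_finite_tensorProduct_of_faithfullyFlat W, ?_⟩
  have h4 : Module.Free ℤ_[p] (W ⊗[ℤ_[p]] B) := Module.Free.trans (S := W)
  have h3 : Module.IsTorsionFree ℤ_[p] B :=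
    Function.Injective.moduleIsTorsionFree
      (TensorProduct.mk ℤ_[p] W B 1) (Module.FaithfullyFlat.tensorProduct_mk_injective B)
      (fun a x => by simp)
  infer_instance

/-- The chart of the local model is finite and flat over `ℤ_p`. -/
theorem IsChartBasis.finite_flat (hp : p ≠ 2) (hβ : M.IsChartBasis D β)
    (em : Fin m ≃ Fin 2 × Σ x : M.t, Fin (M.n x)) (hm : Module.finrank ℤ_[p] Λ = m + m) :
    Module.Finite ℤ_[p] (ChartRing ρ cp ψ β) ∧ Module.Flat ℤ_[p] (ChartRing ρ cp ψ β) := by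
  obtain ⟨c, hc⟩ := hβ.exists_span_baseChange hp (isAlgPoint_chartMatrix ρ cp ψ β) adjoin_chartMatrix
  obtain ⟨f, hf⟩ := hβ.exists_chart_algHoms hp em hm
  exact finite_flat_of_span c hc f hf

end SplitModel

/-! ### Subsheaves given by matrices -/

section Points

variable {p : ℕ} [Fact p.Prime] {Λ : Type w} [AddCommGroup Λ] [Module ℤ_[p] Λ]

lemma Module.Basis.repr_inr_eq_zero_iff {ι κ A M : Type*} [CommRing A] [AddCommGroup M]
    [Module A M] [Fintype ι] [Fintype κ] (b : Module.Basis (ι ⊕ κ) A M) (x : M) :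
    (∀ j, b.repr x (Sum.inr j) = 0) ↔
      x ∈ Submodule.span A (Set.range fun i => b (Sum.inl i)) := by
  classical
  constructor
  · intro h
    rw [← b.sum_repr x, Fintype.sum_sum_type]
    simp only [h, zero_smul, Finset.sum_const_zero, add_zero]
    exact Submodule.sum_mem _ fun i _ => Submodule.smul_mem _ _ (Submodule.subset_span ⟨i, rfl⟩)
  · intro h j
    have : Submodule.span A (Set.range fun i => b (Sum.inl i)) ≤
        LinearMap.ker (b.coord (Sum.inr j)) := by
      refine Submodule.span_le.2 ?_
      rintro _ ⟨i, rfl⟩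
      simp
    exact this h

lemma secMap_secMap {S T X : Sch p} (g : X ⟶ T) (f : T ⟶ S) {U : S.left.Opens} {V : T.left.Opens}
    {Y : X.left.Opens} (h : V ≤ f.left ⁻¹ᵁ U) (h' : Y ≤ g.left ⁻¹ᵁ V)
    (k : X ⟶ S) (hk : g ≫ f = k) (h'' : Y ≤ k.left ⁻¹ᵁ U) (a : Sec S U) :
    secMap g h' (secMap f h a) = secMap k h'' a := by
  subst hk
  change (f.left.appLE U V h ≫ g.left.appLE V Y h').hom a = _
  rw [Scheme.Hom.appLE_comp_appLE]
  rfl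

lemma secMap_id_apply {S : Sch p} {U V : S.left.Opens} (h : V ≤ U) (a : Sec S U) :
    secMap (𝟙 S) h a = S.left.presheaf.map (homOfLE h).op a := by
  change ((𝟙 S.left : S.left ⟶ S.left).appLE U V h).hom a = _
  simp only [Scheme.Hom.appLE, Scheme.Hom.id_app]
  rfl

lemma secMap_id_id {S : Sch p} {U V W : S.left.Opens} (h : V ≤ U) (h' : W ≤ V) (a : Sec S U) :
    secMap (𝟙 S) h' (secMap (𝟙 S) h a) = secMap (𝟙 S) (h'.trans h) a :=
  secMap_secMap (𝟙 S) (𝟙 S) h h' (𝟙 S) (Category.id_comp _) (h'.trans h) a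

/-- Two subsheaves that agree locally are equal. -/
lemma RZLocalModel.Subsheaf.ext_of_local {S : Sch p} {𝓕 𝓖 : Subsheaf Λ S}
    (h : ∀ s : S.left, ∃ U : S.left.Opens, s ∈ U ∧ ∀ V ≤ U, 𝓕.sec V = 𝓖.sec V) : 𝓕 = 𝓖 := by
  have key : ∀ {𝓕 𝓖 : Subsheaf Λ S},
      (∀ s : S.left, ∃ U : S.left.Opens, s ∈ U ∧ ∀ V ≤ U, 𝓕.sec V = 𝓖.sec V) →
      ∀ V, 𝓕.sec V ≤ 𝓖.sec V := by
    intro 𝓕 𝓖 h V s hs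
    refine 𝓖.mem_of_local s fun x hx => ?_
    obtain ⟨U, hxU, hU⟩ := h x
    refine ⟨V ⊓ U, inf_le_left, ⟨hx, hxU⟩, ?_⟩
    rw [← hU _ inf_le_right]
    exact 𝓕.res_mem inf_le_left hs
  ext1
  funext V
  refine le_antisymm (key h V) (key (fun s => ?_) V)
  obtain ⟨U, hs, hU⟩ := h s
  exact ⟨U, hs, fun V hV => (hU V hV).symm⟩

variable {m : ℕ} (β : Module.Basis (Fin m ⊕ Fin m) ℤ_[p] Λ)

lemma frame_secMap {S T : Sch p} (f : T ⟶ S) {U : S.left.Opens} {V : T.left.Opens}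
    (h : V ≤ f.left ⁻¹ᵁ U) (P : Matrix (Fin m) (Fin m) (Sec S U)) (i : Fin m ⊕ Fin m) :
    frame β (P.map (secMap f h)) i = pull Λ f h (frame β P i) :=
  frame_map β (secMap f h) P i

/-- The subsheaf of `Λ ⊗ 𝒪_S` spanned by the first `m` vectors of the frame with matrix `P`. -/
noncomputable def graphSubsheaf (S : Sch p) (P : Matrix (Fin m) (Fin m) (Sec S ⊤)) :
    Subsheaf Λ S where
  sec V := Submodule.span (Sec S V) (Set.range fun k : Fin m =>
    frame β (P.map (secMap (𝟙 S) (le_top : V ≤ ⊤))) (Sum.inl k))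
  res_mem := by
    intro U V h s hs
    rw [← Module.Basis.repr_inr_eq_zero_iff] at hs ⊢
    intro j
    have h1 : P.map (secMap (𝟙 S) (le_top : V ≤ ⊤)) =
        (P.map (secMap (𝟙 S) (le_top : U ≤ ⊤))).map (secMap (𝟙 S) h) := by
      ext i j
      exact (secMap_id_id _ _ _).symm
    rw [h1]
    refine (repr_map (secMap (𝟙 S) h) _ _ (frame_secMap β (𝟙 S) h _) s _).trans ?_
    rw [hs, map_zero]
  mem_of_local := by
    intro U s hs
    rw [← Module.Basis.repr_inr_eq_zero_iff]
    intro j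
    refine secMap_eq_zero _ fun x hx => ?_
    obtain ⟨V, hV, hxV, hs'⟩ := hs x hx
    refine ⟨V, hV, hxV, ?_⟩
    rw [← Module.Basis.repr_inr_eq_zero_iff] at hs'
    have h1 : P.map (secMap (𝟙 S) (le_top : V ≤ ⊤)) =
        (P.map (secMap (𝟙 S) (le_top : U ≤ ⊤))).map (secMap (𝟙 S) hV) := by
      ext i j
      exact (secMap_id_id _ _ _).symm
    have h2 := hs' j
    rw [h1] at h2
    exact (repr_map (secMap (𝟙 S) hV) _ _ (frame_secMap β (𝟙 S) hV _) s _).symm.trans h2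

lemma isAdapted_graphSubsheaf {S : Sch p} (P : Matrix (Fin m) (Fin m) (Sec S ⊤)) :
    IsAdapted (graphSubsheaf β S P) (frame β P) := by
  intro V h
  change Submodule.span _ _ = _
  congr 2
  funext k
  exact frame_secMap β (𝟙 S) h P _

variable {β}

lemma RZLocalModel.IsAdapted.mem_iff {S : Sch p} {𝓕 : Subsheaf Λ S} {U : S.left.Opens} {n : ℕ}
    {b : Module.Basis (Fin m ⊕ Fin n) (Sec S U) (LSec Λ S U)} (hb : IsAdapted 𝓕 b)
    (x : LSec Λ S U) : x ∈ 𝓕.sec U ↔ ∀ j, b.repr x (Sum.inr j) = 0 := by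
  rw [hb U le_rfl, Module.Basis.repr_inr_eq_zero_iff]
  simp only [res_self]

lemma RZLocalModel.IsAdapted.of_repr_eq_zero {S : Sch p} {𝓕 : Subsheaf Λ S} {U : S.left.Opens} {n : ℕ}
    {b b' : Module.Basis (Fin m ⊕ Fin n) (Sec S U) (LSec Λ S U)} (hb : IsAdapted 𝓕 b)
    (h : ∀ k j, b.repr (b' (Sum.inl k)) (Sum.inr j) = 0)
    (h' : ∀ k j, b'.repr (b (Sum.inl k)) (Sum.inr j) = 0) : IsAdapted 𝓕 b' := by
  have key : ∀ {b b' : Module.Basis (Fin m ⊕ Fin n) (Sec S U) (LSec Λ S U)}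
      (_ : ∀ k j, b.repr (b' (Sum.inl k)) (Sum.inr j) = 0) (V : S.left.Opens) (hV : V ≤ U),
      Submodule.span (Sec S V) (Set.range fun i : Fin m => res Λ hV (b' (Sum.inl i))) ≤
      Submodule.span (Sec S V) (Set.range fun i : Fin m => res Λ hV (b (Sum.inl i))) := by
    intro b b' h V hV
    refine Submodule.span_le.2 ?_
    rintro _ ⟨k, rfl⟩
    change res Λ hV (b' (Sum.inl k)) ∈ _
    rw [← b.sum_repr (b' (Sum.inl k)), Fintype.sum_sum_type, map_add, map_sum, map_sum]
    simp only [h, zero_smul, map_zero, Finset.sum_const_zero, add_zero, res_smul]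
    exact Submodule.sum_mem _ fun i _ => Submodule.smul_mem _ _ (Submodule.subset_span ⟨i, rfl⟩)
  intro V hV
  rw [hb V hV]
  exact le_antisymm (key h' V hV) (key h V hV)

lemma RZLocalModel.IsAdapted.restrict {S : Sch p} {𝓕 : Subsheaf Λ S} {U V : S.left.Opens}
    {P : Matrix (Fin m) (Fin m) (Sec S U)} (hP : IsAdapted 𝓕 (frame β P)) (h : V ≤ U) :
    IsAdapted 𝓕 (frame β (P.map (secMap (𝟙 S) h))) := by
  intro W hW
  rw [hP W (hW.trans h)]
  congr 2
  funext k
  rw [frame_secMap β (𝟙 S) h P]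
  exact (res_res h hW _ _).symm

lemma RZLocalModel.IsAdapted.frame_inj {S : Sch p} {𝓕 : Subsheaf Λ S} {U : S.left.Opens}
    {P P' : Matrix (Fin m) (Fin m) (Sec S U)} (hP : IsAdapted 𝓕 (frame β P))
    (hP' : IsAdapted 𝓕 (frame β P')) : P = P' := by
  refine frame_injective β fun k => (hP.mem_iff _).1 ((hP'.mem_iff _).2 fun j => ?_)
  simp

lemma graphSubsheaf_pullback {S T : Sch p} (f : T ⟶ S) (P : Matrix (Fin m) (Fin m) (Sec S ⊤)) :
    (graphSubsheaf β S P).pullback f =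
      graphSubsheaf β T (P.map (secMap f (le_top : (⊤ : T.left.Opens) ≤ f.left ⁻¹ᵁ ⊤))) := by
  obtain ⟨b', hb', hb''⟩ := (isAdapted_graphSubsheaf β P).exists_pullback f
    (V := ⊤) (le_top : (⊤ : T.left.Opens) ≤ f.left ⁻¹ᵁ ⊤)
  have h1 : b' = frame β (P.map (secMap f (le_top : (⊤ : T.left.Opens) ≤ f.left ⁻¹ᵁ ⊤))) :=
    Module.Basis.eq_of_apply_eq fun i => (hb' i).trans (frame_secMap β f _ P i).symm
  subst h1
  refine Subsheaf.ext_of_local fun s => ⟨⊤, trivial, fun V hV => ?_⟩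
  rw [hb'' V hV, isAdapted_graphSubsheaf β _ V hV]

/-- Matrices that describe a subsheaf locally glue. -/
lemma exists_eq_graphSubsheaf {S : Sch p} {𝓕 : Subsheaf Λ S}
    (h : ∀ s : S.left, ∃ U : S.left.Opens, s ∈ U ∧ ∃ P : Matrix (Fin m) (Fin m) (Sec S U),
      IsAdapted 𝓕 (frame β P)) :
    ∃ P, 𝓕 = graphSubsheaf β S P ∧ IsAdapted 𝓕 (frame β P) := by
  choose U hU P hP using h
  have hcov : (⊤ : S.left.Opens) ≤ iSup U := fun s _ =>
    (TopologicalSpace.Opens.mem_iSup.2 ⟨s, hU s⟩)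
  -- A subsheaf has at most one matrix over a given open set, so the local matrices agree on
  -- overlaps.
  have hcompat : ∀ k j, TopCat.Presheaf.IsCompatible S.left.sheaf.1 U (fun s => P s k j) := by
    intro k j s t
    have h1 := ((hP s).restrict (inf_le_left : U s ⊓ U t ≤ U s)).frame_inj
      ((hP t).restrict (inf_le_right : U s ⊓ U t ≤ U t))
    have h2 := congrFun (congrFun h1 k) j
    rw [Matrix.map_apply, Matrix.map_apply, secMap_id_apply, secMap_id_apply] at h2
    exact h2
  have hglue := fun k j => (S.left.sheaf.existsUnique_gluing' U ⊤ (fun s => homOfLE le_top) hcov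
    (fun s => P s k j) (hcompat k j)).exists
  choose Q hQ using hglue
  have hQP : ∀ s, (Matrix.of Q : Matrix (Fin m) (Fin m) (Sec S ⊤)).map
      (secMap (𝟙 S) (le_top : U s ≤ ⊤)) = P s := by
    intro s
    ext k j
    rw [Matrix.map_apply, secMap_id_apply]
    exact hQ k j s
  have h1 : 𝓕 = graphSubsheaf β S (Matrix.of Q) := by
    refine Subsheaf.ext_of_local fun s => ⟨U s, hU s, fun V hV => ?_⟩
    have h2 := (isAdapted_graphSubsheaf β (S := S) (Matrix.of Q)).restrict (le_top : U s ≤ ⊤)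
    rw [hQP s] at h2
    rw [hP s V hV, h2 V hV]
  refine ⟨Matrix.of Q, h1, ?_⟩
  rw [h1]
  exact isAdapted_graphSubsheaf β _

end Points

/-! ### Representability by the chart -/

section Representability

variable {p : ℕ} [Fact p.Prime] {Λ : Type w} [AddCommGroup Λ] [Module ℤ_[p] Λ]
  {F : Type*} [Field F] [NumberField F] {α β : F} {O : Subring ℍ[F, α, β]}
  [Module (ℤ_[p] ⊗[ℤ] O) Λ] [IsScalarTower ℤ_[p] (ℤ_[p] ⊗[ℤ] O) Λ]
  {c : O → ℤ[X]} {ψ : LinearMap.BilinForm ℤ_[p] Λ}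

lemma RZLocalModel.IsLocalModelPoint.isAlgPoint
    (hc : ∀ a, (c a).map (Int.castRingHom ℝ) = redCharpoly (a : ℍ[F, α, β]))
    {S : Sch p} {𝓕 : Subsheaf Λ S} (h : IsLocalModelPoint O ψ 𝓕) (s : S.left) :
    ∃ U : S.left.Opens, s ∈ U ∧
      ∃ b : Module.Basis (Fin (2 * Module.finrank ℚ F) ⊕ Fin (2 * Module.finrank ℚ F))
        (Sec S U) (LSec Λ S U), IsAdapted 𝓕 b ∧ IsAlgPoint (act p Λ : O → _) c ψ b := by
  obtain ⟨U, hs, b, hb, hdet⟩ := h.locally_summand_det s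
  have hmem : ∀ i, b (Sum.inl i) ∈ 𝓕.sec U := fun i => (hb.mem_iff _).2 fun j => by simp
  refine ⟨U, hs, b, hb, fun i j => h.isotropic U _ _ (hmem i) (hmem j),
    fun a i j => (hb.mem_iff _).1 (h.stable a U _ (hmem i)) j, fun a => ?_⟩
  obtain ⟨c', hc', hdet'⟩ := hdet a
  -- The integral polynomial in the determinant condition is unique, as ℤ[X] embeds in ℝ[X].
  rw [hdet', Polynomial.map_injective _ (RingHom.injective_int (Int.castRingHom ℝ))
    (hc'.trans (hc a).symm)]

variable {β' : Module.Basis (Fin (2 * Module.finrank ℚ F) ⊕ Fin (2 * Module.finrank ℚ F)) ℤ_[p] Λ}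

lemma isLocalModelPoint_graphSubsheaf
    (hc : ∀ a, (c a).map (Int.castRingHom ℝ) = redCharpoly (a : ℍ[F, α, β]))
    {S : Sch p} {P : Matrix _ _ (Sec S ⊤)}
    (h : IsAlgPoint (act p Λ : O → _) c ψ (frame β' P)) :
    IsLocalModelPoint O ψ (graphSubsheaf β' S P) where
  isotropic U x y hx hy := by
    have h1 := h.map (secMap (𝟙 S) (le_top : U ≤ ⊤)) (frame_map β' _ P)
    change x ∈ Submodule.span _ _ at hx
    change y ∈ Submodule.span _ _ at hy
    induction hx, hy using Submodule.span_induction₂ with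
    | mem_mem x y hx hy =>
      obtain ⟨x, hx, rfl⟩ := hx
      obtain ⟨y, hy, rfl⟩ := hy
      exact h1.isotropic _ _
    | zero_left y hy => simp
    | zero_right y hy => simp
    | add_left x y z _ _ _ h₁ h₂ => rw [map_add, LinearMap.add_apply, h₁, h₂, add_zero]
    | add_right x y z _ _ _ h₁ h₂ => rw [map_add, h₁, h₂, add_zero]
    | smul_left r x y _ _ h => rw [map_smul, LinearMap.smul_apply, h, smul_zero]
    | smul_right r x y _ _ h => rw [map_smul, h, smul_zero]
  stable a U x hx := by
    have h1 := h.map (secMap (𝟙 S) (le_top : U ≤ ⊤)) (frame_map β' _ P)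
    change x ∈ Submodule.span _ _ at hx
    change _ ∈ Submodule.span _ _
    induction hx using Submodule.span_induction with
    | mem x hx =>
      obtain ⟨y, rfl⟩ := hx
      exact (Module.Basis.repr_inr_eq_zero_iff _ _).1 fun j => h1.stable a y j
    | zero => rw [map_zero]; exact zero_mem _
    | add x y _ _ hx hy => rw [map_add]; exact add_mem hx hy
    | smul r x _ hx => rw [map_smul]; exact Submodule.smul_mem _ _ hx
  locally_summand_det s :=
    ⟨⊤, trivial, frame β' P, isAdapted_graphSubsheaf β' P, fun a => ⟨c a, hc a, h.det a⟩⟩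

/-- The points of the local model are given by matrices if the last basis vectors are a basis of
every quotient. -/
lemma RZLocalModel.IsLocalModelPoint.exists_eq_graphSubsheaf
    (hc : ∀ a, (c a).map (Int.castRingHom ℝ) = redCharpoly (a : ℍ[F, α, β]))
    (hu : ∀ (A : Type) [CommRing A] [Algebra ℤ_[p] A] (b : Module.Basis _ A (A ⊗[ℤ_[p]] Λ)),
      IsAlgPoint (act p Λ : O → _) c ψ b →
      IsUnit (Matrix.of fun k j => b.repr (1 ⊗ₜ β' (Sum.inr k)) (Sum.inr j)).det)
    {S : Sch p} {𝓕 : Subsheaf Λ S} (h : IsLocalModelPoint O ψ 𝓕) :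
    ∃ P, 𝓕 = graphSubsheaf β' S P ∧ IsAlgPoint (act p Λ : O → _) c ψ (frame β' P) := by
  have hloc : ∀ s : S.left, ∃ U : S.left.Opens, s ∈ U ∧ ∃ P : Matrix _ _ (Sec S U),
      IsAdapted 𝓕 (frame β' P) ∧ IsAlgPoint (act p Λ : O → _) c ψ (frame β' P) := by
    intro s
    obtain ⟨U, hs, b, hb, hb'⟩ := h.isAlgPoint hc s
    obtain ⟨P, hP, h1, h2⟩ := hb'.exists_frame β' (hu _ b hb')
    exact ⟨U, hs, P, hb.of_repr_eq_zero h1 h2, hP⟩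
  obtain ⟨P, h𝓕, hP⟩ := _root_.exists_eq_graphSubsheaf (𝓕 := 𝓕) (β := β') fun s => by
    obtain ⟨U, hs, P, hP, -⟩ := hloc s
    exact ⟨U, hs, P, hP⟩
  refine ⟨P, h𝓕, isAlgPoint_iff.2 fun x hx => secMap_eq_zero x fun s _ => ?_⟩
  obtain ⟨U, hs, P', hP', hP''⟩ := hloc s
  refine ⟨U, le_top, hs, ?_⟩
  have h1 := (hP.restrict (le_top : U ≤ ⊤)).frame_inj hP'
  refine isAlgPoint_iff.1 hP'' _ ?_
  rw [← h1, frameEqns_map (secMap (𝟙 S) (le_top : U ≤ ⊤)) (frame_map β' _ P)]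
  exact ⟨x, hx, rfl⟩

/-- The spectrum of a `ℤ_p`-algebra. -/
noncomputable abbrev specOver (p : ℕ) [Fact p.Prime] (C : Type) [CommRing C] [Algebra ℤ_[p] C] :
    Sch p :=
  Over.mk (Spec.map (CommRingCat.ofHom (algebraMap ℤ_[p] C)))

/-- The global sections of the spectrum. -/
noncomputable def secSpec (C : Type) [CommRing C] [Algebra ℤ_[p] C] :
    C →ₐ[ℤ_[p]] Sec (specOver p C) ⊤ :=
  { (Scheme.ΓSpecIso (CommRingCat.of C)).inv.hom with
    commutes' := fun r => by
      change ((CommRingCat.ofHom (algebraMap ℤ_[p] C)) ≫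
        (Scheme.ΓSpecIso (CommRingCat.of C)).inv).hom r = ((Scheme.ΓSpecIso _).inv ≫
        Scheme.Hom.appLE (Spec.map (CommRingCat.ofHom (algebraMap ℤ_[p] C))) ⊤ ⊤ _).hom r
      rw [Scheme.ΓSpecIso_inv_naturality]
      rfl }

lemma secMap_top_apply {S T : Sch p} (f : T ⟶ S) (a : Sec S ⊤) :
    secMap f (le_top : (⊤ : T.left.Opens) ≤ f.left ⁻¹ᵁ ⊤) a = f.left.appTop.hom a := by
  exact congrArg (fun k => k.hom a) (Scheme.Hom.appLE_eq_app f.left (U := ⊤))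

lemma specOver_hom_ext {C : Type} [CommRing C] [Algebra ℤ_[p] C] {S : Sch p}
    {f g : S ⟶ specOver p C}
    (h : ∀ a, secMap f (le_top : (⊤ : S.left.Opens) ≤ f.left ⁻¹ᵁ ⊤) (secSpec C a) =
      secMap g (le_top : (⊤ : S.left.Opens) ≤ g.left ⁻¹ᵁ ⊤) (secSpec C a)) : f = g := by
  refine Over.OverMorphism.ext (ext_of_isAffine (Y := Spec (CommRingCat.of C)) ?_)
  rw [← cancel_epi (Scheme.ΓSpecIso (CommRingCat.of C)).inv]
  ext a
  have := h a
  rw [secMap_top_apply, secMap_top_apply] at this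
  exact this

lemma exists_hom_specOver {C : Type} [CommRing C] [Algebra ℤ_[p] C] {S : Sch p}
    (φ : C →ₐ[ℤ_[p]] Sec S ⊤) :
    ∃ f : S ⟶ specOver p C, ∀ a,
      secMap f (le_top : (⊤ : S.left.Opens) ≤ f.left ⁻¹ᵁ ⊤) (secSpec C a) = φ a := by
  let g : S.left ⟶ Spec (CommRingCat.of C) :=
    S.left.toSpecΓ ≫ Spec.map (CommRingCat.ofHom φ.toRingHom)
  have hg : (Scheme.ΓSpecIso (CommRingCat.of C)).inv ≫ g.appTop =
      CommRingCat.ofHom φ.toRingHom := by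
    simp only [g, Scheme.Hom.comp_appTop, Scheme.toSpecΓ_appTop]
    rw [Iso.inv_comp_eq, Scheme.ΓSpecIso_naturality]
  have hw : g ≫ Spec.map (CommRingCat.ofHom (algebraMap ℤ_[p] C)) = S.hom := by
    refine ext_of_isAffine ?_
    rw [← cancel_epi (Scheme.ΓSpecIso (CommRingCat.of ℤ_[p])).inv, Scheme.Hom.comp_appTop,
      ← Category.assoc, ← Scheme.ΓSpecIso_inv_naturality, Category.assoc, hg]
    ext r
    refine (φ.commutes r).trans ?_
    change ((Scheme.ΓSpecIso _).inv ≫ Scheme.Hom.appLE S.hom ⊤ ⊤ _).hom r = _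
    exact congrArg (fun k => ((Scheme.ΓSpecIso (CommRingCat.of ℤ_[p])).inv ≫ k).hom r)
      (Scheme.Hom.appLE_eq_app S.hom (U := ⊤))
  refine ⟨Over.homMk g hw, fun a => ?_⟩
  rw [secMap_top_apply]
  exact congrArg (fun k => k.hom a) hg

/-- Every point over S is the graph of one matrix over the global sections, and a morphism to Spec C
is an algebra map from C to the global sections. The universal property of the matrix P₀ on algebras
therefore yields that of Spec C on schemes. -/
lemma nonempty_representableBy_of_universal {C : Type} [CommRing C] [Algebra ℤ_[p] C]
    (hc : ∀ a, (c a).map (Int.castRingHom ℝ) = redCharpoly (a : ℍ[F, α, β]))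
    (hu : ∀ (A : Type) [CommRing A] [Algebra ℤ_[p] A] (b : Module.Basis _ A (A ⊗[ℤ_[p]] Λ)),
      IsAlgPoint (act p Λ : O → _) c ψ b →
      IsUnit (Matrix.of fun k j => b.repr (1 ⊗ₜ β' (Sum.inr k)) (Sum.inr j)).det)
    {P₀ : Matrix _ _ C} (hP₀ : IsAlgPoint (act p Λ : O → _) c ψ (frame β' P₀))
    (hext : ∀ (A : Type) [CommRing A] [Algebra ℤ_[p] A] (f g : C →ₐ[ℤ_[p]] A),
      P₀.map f = P₀.map g → f = g)
    (hex : ∀ (A : Type) [CommRing A] [Algebra ℤ_[p] A] (P : Matrix _ _ A),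
      IsAlgPoint (act p Λ : O → _) c ψ (frame β' P) → ∃ f : C →ₐ[ℤ_[p]] A, P₀.map f = P) :
    Nonempty ((localModelFunctor O ψ).RepresentableBy (specOver p C)) := by
  let Q : Matrix _ _ (Sec (specOver p C) ⊤) := P₀.map (secSpec C)
  have hQ : IsLocalModelPoint O ψ (graphSubsheaf β' _ Q) :=
    isLocalModelPoint_graphSubsheaf hc (hP₀.map (secSpec C) (frame_map β' _ P₀))
  let T (S : Sch p) (f : S ⟶ specOver p C) : C →ₐ[ℤ_[p]] Sec S ⊤ :=
    (secMap f (le_top : (⊤ : S.left.Opens) ≤ f.left ⁻¹ᵁ ⊤)).comp (secSpec C)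
  let ev (S : Sch p) (f : S ⟶ specOver p C) : (localModelFunctor O ψ).obj (op S) :=
    ⟨(graphSubsheaf β' _ Q).pullback f, hQ.pullback f⟩
  have hev : ∀ S f, (ev S f).1 = graphSubsheaf β' S (P₀.map (T S f)) := fun S f =>
    (graphSubsheaf_pullback f Q).trans (by congr 1)
  refine ⟨⟨fun {S} => Equiv.ofBijective (ev S) ⟨fun f g hfg => ?_, fun 𝓕 => ?_⟩,
    fun {S S'} f g => Subtype.ext (Subsheaf.pullback_comp f g _)⟩⟩
  · have h1 := congrArg Subtype.val hfg
    rw [hev, hev] at h1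
    have h2 := isAdapted_graphSubsheaf β' (P₀.map (T S f))
    have h3 := h1 ▸ h2
    have h4 := hext _ _ _ (h3.frame_inj (isAdapted_graphSubsheaf β' (P₀.map (T S g))))
    exact specOver_hom_ext fun a => DFunLike.congr_fun h4 a
  · obtain ⟨P, hP, hP'⟩ := 𝓕.2.exists_eq_graphSubsheaf hc hu
    obtain ⟨φ, rfl⟩ := hex _ P hP'
    obtain ⟨f, hf⟩ := exists_hom_specOver φ
    refine ⟨f, Subtype.ext ?_⟩
    rw [hev, hP, show T S f = φ from AlgHom.ext hf]

variable (β') in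
/-- The local model is represented by the spectrum of the chart ring. -/
theorem nonempty_representableBy_specOver
    (hc : ∀ a, (c a).map (Int.castRingHom ℝ) = redCharpoly (a : ℍ[F, α, β]))
    (hu : ∀ (A : Type) [CommRing A] [Algebra ℤ_[p] A] (b : Module.Basis _ A (A ⊗[ℤ_[p]] Λ)),
      IsAlgPoint (act p Λ : O → _) c ψ b →
      IsUnit (Matrix.of fun k j => b.repr (1 ⊗ₜ β' (Sum.inr k)) (Sum.inr j)).det) :
    Nonempty ((localModelFunctor O ψ).RepresentableBy
      (specOver p (ChartRing (act p Λ : O → _) c ψ β'))) :=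
  nonempty_representableBy_of_universal hc hu (isAlgPoint_chartMatrix _ _ _ _)
    (fun _ _ _ _ _ h => chartRing_algHom_ext h) (fun _ _ _ _ h => exists_chartRing_algHom h)

/-- A functor represented by the spectrum of a finite flat algebra is only represented by finite
flat schemes. -/
lemma finite_flat_of_representableBy {G : (Sch p)ᵒᵖ ⥤ Type w} {C : Type} [CommRing C]
    [Algebra ℤ_[p] C] [Module.Finite ℤ_[p] C] [Module.Flat ℤ_[p] C]
    (h : G.RepresentableBy (specOver p C)) {M : Sch p} (hM : G.RepresentableBy M) :
    AlgebraicGeometry.IsFinite M.hom ∧ AlgebraicGeometry.Flat M.hom := by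
  let e := hM.uniqueUpToIso h
  have h1 : M.hom = e.hom.left ≫ Spec.map (CommRingCat.ofHom (algebraMap ℤ_[p] C)) :=
    (Over.w e.hom).symm
  have h2 : AlgebraicGeometry.IsFinite (Spec.map (CommRingCat.ofHom (algebraMap ℤ_[p] C))) := by
    rw [IsFinite.SpecMap_iff]
    exact RingHom.finite_algebraMap.2 inferInstance
  have h3 : AlgebraicGeometry.Flat (Spec.map (CommRingCat.ofHom (algebraMap ℤ_[p] C))) := by
    rw [Flat.SpecMap_iff]
    exact RingHom.flat_algebraMap_iff.2 inferInstance
  have : IsIso e.hom.left := inferInstanceAs (IsIso ((Over.forget _).map e.hom))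
  rw [h1]
  constructor <;> infer_instance

end Representability

/-! ### Finite algebras over ℤ_p and unit generators -/

section ZpFinite

variable {p : ℕ} [Fact p.Prime]

/-- Nakayama's lemma for the maximal ideal (p). -/
lemma eq_top_of_forall_exists_sub_mem {M : Type*} [AddCommGroup M] [Module ℤ_[p] M]
    [Module.Finite ℤ_[p] M] (N : Submodule ℤ_[p] M)
    (h : ∀ x, ∃ y ∈ N, ∃ z, x = y + (p : ℤ_[p]) • z) : N = ⊤ := by
  refine top_le_iff.1 (Submodule.le_of_le_smul_of_le_jacobson_bot
    (I := IsLocalRing.maximalIdeal ℤ_[p]) Module.Finite.fg_top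
    (IsLocalRing.maximalIdeal_le_jacobson _) fun x _ => ?_)
  obtain ⟨y, hy, z, rfl⟩ := h x
  refine Submodule.add_mem_sup hy (Submodule.smul_mem_smul ?_ trivial)
  rw [PadicInt.maximalIdeal_eq_span_p]
  exact Ideal.mem_span_singleton_self _

variable {S : Type*} [CommRing S] [Algebra ℤ_[p] S] [Module.Finite ℤ_[p] S]

lemma isUnit_one_add_p_mul (c : S) : IsUnit (1 + (p : S) * c) := by
  have h : LinearMap.range (LinearMap.mulLeft ℤ_[p] (1 + (p : S) * c)) = ⊤ := by
    refine eq_top_of_forall_exists_sub_mem _ fun x => ⟨(1 + (p : S) * c) * x, ⟨x, rfl⟩,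
      -(c * x), ?_⟩
    rw [Algebra.smul_def, map_natCast]
    ring
  obtain ⟨x, hx⟩ := LinearMap.range_eq_top.1 h 1
  exact IsUnit.of_mul_eq_one x hx

lemma isUnit_of_sub_mem_span_p {x y : S} (hx : IsUnit x) (h : x - y ∈ Ideal.span {(p : S)}) :
    IsUnit y := by
  obtain ⟨c, hc⟩ := Ideal.mem_span_singleton.1 h
  obtain ⟨u, rfl⟩ := hx
  have h1 : y = u * (1 + (p : S) * (-(↑u⁻¹ * c))) := by
    have h2 : (u : S) * (↑u⁻¹ * c) = c := by rw [← mul_assoc, Units.mul_inv, one_mul]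
    linear_combination h2 * (p : S) - hc
  rw [h1]
  exact u.isUnit.mul (isUnit_one_add_p_mul _)

/-- An element generating a proper ideal modulo which a power vanishes modulo `p` lies in the
Jacobson radical. -/
lemma isUnit_of_sub_mem_span {ϖ : S} {N : ℕ} (hN : ϖ ^ N ∈ Ideal.span {(p : S)}) {x y : S}
    (h : x * y - 1 ∈ Ideal.span {ϖ}) : IsUnit x := by
  obtain ⟨c, hc⟩ := Ideal.mem_span_singleton.1 h
  have h1 : x * y ∣ 1 - (-(ϖ * c)) ^ N := by
    have := sub_dvd_pow_sub_pow 1 (-(ϖ * c)) N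
    rw [one_pow, sub_neg_eq_add, show 1 + ϖ * c = x * y by rw [← hc]; ring] at this
    exact this
  have h2 : IsUnit (1 - (-(ϖ * c)) ^ N) := by
    refine isUnit_of_sub_mem_span_p (p := p) isUnit_one ?_
    rw [sub_sub_cancel, neg_eq_neg_one_mul, mul_pow, mul_pow, mul_left_comm]
    exact Ideal.mul_mem_right _ _ hN
  exact isUnit_of_mul_isUnit_left (isUnit_of_dvd_unit h1 h2)

lemma finite_quotient_of_p_mem {I : Ideal S} (hp : (p : S) ∈ I) : Finite (S ⧸ I) := by
  obtain ⟨n, g, hg⟩ := Module.Finite.exists_fin (R := ℤ_[p]) (M := S)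
  refine Finite.of_surjective
    (fun c : Fin n → Fin p => ∑ i, ((c i : ℕ) : S ⧸ I) * Ideal.Quotient.mk I (g i)) fun x => ?_
  obtain ⟨y, rfl⟩ := Ideal.Quotient.mk_surjective x
  have hy : y ∈ Submodule.span ℤ_[p] (Set.range g) := hg ▸ trivial
  obtain ⟨c, rfl⟩ := (Submodule.mem_span_range_iff_exists_fun _).1 hy
  choose m hm hm' using fun i => PadicInt.exists_mem_range (c i)
  refine ⟨fun i => ⟨m i, hm i⟩, ?_⟩
  rw [map_sum]
  refine Finset.sum_congr rfl fun i _ => ?_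
  obtain ⟨d, hd⟩ : (p : ℤ_[p]) ∣ c i - m i := by
    rw [← Ideal.mem_span_singleton, ← PadicInt.maximalIdeal_eq_span_p]
    exact hm' i
  rw [show c i = m i + p * d by rw [← hd]; ring, Algebra.smul_def, map_mul, map_add, map_natCast,
    map_mul, map_natCast, map_add, map_mul, map_natCast, map_natCast,
    show ((p : S ⧸ I)) = 0 from by
      rw [← map_natCast (Ideal.Quotient.mk I)]; exact Ideal.Quotient.eq_zero_iff_mem.2 hp]
  simp

lemma eq_castHom_comp_toZMod {k : Type*} [CommRing k] [Algebra (ZMod p) k] (f : ℤ_[p] →+* k) :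
    f = (algebraMap (ZMod p) k).comp PadicInt.toZMod := by
  ext x
  have hpk : (p : k) = 0 := by
    rw [← map_natCast (algebraMap (ZMod p) k), ZMod.natCast_self, map_zero]
  obtain ⟨m, hm, hm'⟩ := PadicInt.exists_mem_range x
  rw [PadicInt.maximalIdeal_eq_span_p, Ideal.mem_span_singleton] at hm'
  obtain ⟨d, hd⟩ := hm'
  rw [show x = m + p * d by rw [← hd]; ring]
  simp [hpk]

/-- A lift of the minimal polynomial of a generator of the residue field. -/
lemma exists_residue_polynomial {ϖ : S} (hmax : (Ideal.span {ϖ}).IsMaximal)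
    (hp : (p : S) ∈ Ideal.span {ϖ}) :
    ∃ (f : ℤ_[p][X]) (w : S), f.Monic ∧ w ∉ Ideal.span {ϖ} ∧ aeval w f ∈ Ideal.span {ϖ} ∧
      aeval w (derivative f) ∉ Ideal.span {ϖ} ∧
      (∃ A B C : ℤ_[p][X], A * f + B * derivative f = 1 + (p : ℤ_[p][X]) * C) ∧
      (∀ x : S, ∃ P : ℤ_[p][X], x - aeval w P ∈ Ideal.span {ϖ}) ∧
      ∀ P : ℤ_[p][X], P.degree < f.degree → aeval w P ∈ Ideal.span {ϖ} →
        ∀ j, P.coeff j ∈ Ideal.span {(p : ℤ_[p])} := by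
  classical
  set I := Ideal.span {ϖ}
  let k := S ⧸ I
  let _ : Field k := Ideal.Quotient.field I
  have : Finite k := finite_quotient_of_p_mem hp
  have : CharP k p := by
    refine (CharP.charP_iff_prime_eq_zero (Fact.out : p.Prime)).2 ?_
    rw [← map_natCast (Ideal.Quotient.mk I)]
    exact Ideal.Quotient.eq_zero_iff_mem.2 hp
  let _ : Algebra (ZMod p) k := ZMod.algebra k p
  -- For a generator g of the unit group of the finite residue field, the powers of a lift w
  -- represent all nonzero residues; f lifts the minimal polynomial of g over 𝔽_p.
  obtain ⟨g, hg⟩ := IsCyclic.exists_generator (α := kˣ)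
  obtain ⟨w, hw⟩ := Ideal.Quotient.mk_surjective (g : k)
  have hw' : ∀ P : ℤ_[p][X], Ideal.Quotient.mk I (aeval w P) =
      aeval (g : k) (P.map PadicInt.toZMod) := by
    intro P
    rw [aeval_def, hom_eval₂, hw, aeval_def, eval₂_map, ← eq_castHom_comp_toZMod]
  have hsurj : Function.Surjective (PadicInt.toZMod (p := p)) := ZMod.ringHom_surjective _
  have hker : ∀ c : ℤ_[p], PadicInt.toZMod c = 0 ↔ c ∈ Ideal.span {(p : ℤ_[p])} := fun c => by
    rw [← RingHom.mem_ker, PadicInt.ker_toZMod, PadicInt.maximalIdeal_eq_span_p]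
  have hint : IsIntegral (ZMod p) (g : k) := Algebra.IsIntegral.isIntegral _
  obtain ⟨f, hf, hfd, hfm⟩ := lifts_and_natDegree_eq_and_monic
    ((Polynomial.lifts_iff_coeff_lifts _).2 fun n => hsurj _) (minpoly.monic hint)
  have hsep : (minpoly (ZMod p) (g : k)).Separable :=
    PerfectField.separable_of_irreducible (minpoly.irreducible hint)
  refine ⟨f, w, hfm, ?_, ?_, ?_, ?_, ?_, ?_⟩
  · intro h
    rw [← Ideal.Quotient.eq_zero_iff_mem, hw] at h
    exact g.ne_zero h
  · rw [← Ideal.Quotient.eq_zero_iff_mem, hw', hf, minpoly.aeval]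
  · rw [← Ideal.Quotient.eq_zero_iff_mem, hw', ← derivative_map, hf]
    exact hsep.aeval_derivative_ne_zero (minpoly.aeval _ _)
  · obtain ⟨a, b, hab⟩ := hsep
    obtain ⟨A, rfl⟩ := Polynomial.map_surjective _ hsurj a
    obtain ⟨B, rfl⟩ := Polynomial.map_surjective _ hsurj b
    rw [← hf, derivative_map, ← Polynomial.map_mul, ← Polynomial.map_mul, ← Polynomial.map_add]
      at hab
    have h1 : (C (p : ℤ_[p])) ∣ A * f + B * derivative f - 1 := by
      refine (C_dvd_iff_dvd_coeff _ _).2 fun n => ?_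
      rw [← Ideal.mem_span_singleton, ← hker, ← Polynomial.coeff_map, Polynomial.map_sub, hab]
      simp
    obtain ⟨D, hD⟩ := h1
    refine ⟨A, B, D, ?_⟩
    rw [sub_eq_iff_eq_add'] at hD
    simpa using hD
  · intro x
    by_cases hx : Ideal.Quotient.mk I x = 0
    · exact ⟨0, by simpa using Ideal.Quotient.eq_zero_iff_mem.1 hx⟩
    · obtain ⟨n, hn⟩ := (mem_powers_iff_mem_zpowers.2 (hg (Units.mk0 _ hx)))
      refine ⟨X ^ n, ?_⟩
      rw [← Ideal.Quotient.eq, map_pow, aeval_X, map_pow, hw]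
      have := congrArg Units.val hn
      simpa using this.symm
  · intro P hP hPw j
    rw [← Ideal.Quotient.eq_zero_iff_mem, hw'] at hPw
    rw [← hker, ← Polynomial.coeff_map]
    have h0 : P.map PadicInt.toZMod = 0 := by
      by_contra hne
      have h1 := minpoly.degree_le_of_ne_zero (ZMod p) (g : k) hne hPw
      have h2 : (minpoly (ZMod p) (g : k)).degree = f.degree := by
        rw [degree_eq_natDegree hfm.ne_zero, hfd, degree_eq_natDegree (minpoly.ne_zero hint)]
      rw [h2] at h1
      exact absurd (h1.trans (degree_map_le)) (not_le.2 hP)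
    rw [h0, coeff_zero]

/-- A finite `ℤ_p`-algebra that is local with principal maximal ideal is generated by a unit. -/
theorem exists_isUnit_adjoin_eq_top {ϖ : S} {N : ℕ} (hmax : (Ideal.span {ϖ}).IsMaximal)
    (hp : (p : S) ∈ Ideal.span {ϖ}) (hN : ϖ ^ N ∈ Ideal.span {(p : S)}) :
    ∃ w : S, IsUnit w ∧ ∀ x : S, ∃ P : ℤ_[p][X], x = aeval w P := by
  obtain ⟨f, w₀, -, hw₀, hf₀, hdf₀, -, hgen₀, -⟩ := exists_residue_polynomial hmax hp
  set I := Ideal.span {ϖ} with hI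
  let _ : Field (S ⧸ I) := Ideal.Quotient.field I
  have hunit : ∀ x, x ∉ I → IsUnit x := by
    intro x hx
    have hx' : Ideal.Quotient.mk I x ≠ 0 := fun h => hx (Ideal.Quotient.eq_zero_iff_mem.1 h)
    obtain ⟨y, hy⟩ := Ideal.Quotient.mk_surjective (Ideal.Quotient.mk I x)⁻¹
    refine isUnit_of_sub_mem_span (y := y) hN ?_
    rw [← Ideal.Quotient.eq_zero_iff_mem, map_sub, map_mul, hy, mul_inv_cancel₀ hx', map_one,
      sub_self]
  have hcong : ∀ w, w - w₀ ∈ I → ∀ P : ℤ_[p][X], aeval w P - aeval w₀ P ∈ I := by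
    intro w hw P
    rw [← Ideal.Quotient.eq] at hw ⊢
    rw [aeval_def, aeval_def, hom_eval₂, hom_eval₂, hw]
  have hgood : ∃ w, w - w₀ ∈ I ∧ ∃ u : S, IsUnit u ∧ aeval w f = ϖ * u := by
    obtain ⟨a, ha⟩ := Ideal.mem_span_singleton.1 hf₀
    by_cases haI : a ∈ I
    · refine ⟨w₀ + ϖ, by rw [add_sub_cancel_left]; exact Ideal.mem_span_singleton_self ϖ, ?_⟩
      obtain ⟨r, hr⟩ := Polynomial.binomExpansion (f.map (algebraMap ℤ_[p] S)) w₀ ϖ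
      refine ⟨a + aeval w₀ (derivative f) + r * ϖ, hunit _ fun h => hdf₀ ?_, ?_⟩
      · have h1 := I.sub_mem (I.sub_mem h haI)
          (I.mul_mem_left r (Ideal.mem_span_singleton_self ϖ))
        convert h1 using 1
        ring
      · rw [derivative_map] at hr
        simp only [eval_map_algebraMap] at hr
        rw [hr, ha]
        ring
    · exact ⟨w₀, by simp, a, hunit a haI, ha⟩
  obtain ⟨w, hw, u, hu, hwf⟩ := hgood
  refine ⟨w, hunit w fun h => hw₀ ?_, ?_⟩
  · have := I.sub_mem h hw
    rwa [sub_sub_cancel] at this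
  -- As f(w) is ϖ times a unit, every element is a polynomial in w modulo f(w). After N iterations
  -- the remainder is divisible by ϖ^N, hence by p, and Nakayama's lemma concludes.
  have hstep : ∀ x : S, ∃ (P : ℤ_[p][X]) (y : S), x = aeval w P + aeval w f * y := by
    intro x
    obtain ⟨P, hP⟩ := hgen₀ x
    have h1 : x - aeval w P ∈ I := by
      have := I.sub_mem hP (hcong w hw P)
      convert this using 1
      ring
    obtain ⟨y, hy⟩ := Ideal.mem_span_singleton.1 h1
    obtain ⟨v, rfl⟩ := hu
    refine ⟨P, ↑v⁻¹ * y, ?_⟩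
    rw [hwf, mul_assoc, Units.mul_inv_cancel_left, ← hy]
    ring
  have hsteps : ∀ n (x : S), ∃ (P : ℤ_[p][X]) (y : S), x = aeval w P + aeval w f ^ n * y := by
    intro n
    induction n with
    | zero => exact fun x => ⟨0, x, by simp⟩
    | succ n ih =>
      intro x
      obtain ⟨P, y, hx⟩ := ih x
      obtain ⟨Q, z, hy⟩ := hstep y
      refine ⟨P + f ^ n * Q, z, ?_⟩
      rw [hx, hy, map_add, map_mul, map_pow]
      ring
  have htop : LinearMap.range (aeval (R := ℤ_[p]) w).toLinearMap = ⊤ := by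
    refine eq_top_of_forall_exists_sub_mem _ fun x => ?_
    obtain ⟨P, y, hx⟩ := hsteps N x
    obtain ⟨c, hc⟩ := Ideal.mem_span_singleton.1 hN
    refine ⟨aeval w P, ⟨P, rfl⟩, c * u ^ N * y, ?_⟩
    rw [hx, hwf, mul_pow, hc, Algebra.smul_def, map_natCast]
    ring
  intro x
  obtain ⟨P, hP⟩ := LinearMap.range_eq_top.1 htop x
  exact ⟨P, hP.symm⟩

end ZpFinite

/-! ### Hensel's lemma over finite free ℤ_p-algebras -/

section Henselian

lemma Module.Basis.mem_ideal_smul_top_iff {ι A M : Type*} [CommRing A] [AddCommGroup M]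
    [Module A M] [Fintype ι] (b : Module.Basis ι A M) (I : Ideal A) (x : M) :
    x ∈ I • (⊤ : Submodule A M) ↔ ∀ i, b.repr x i ∈ I := by
  constructor
  · intro h i
    induction h using Submodule.smul_induction_on' with
    | smul r hr n _ => simpa using I.mul_mem_right _ hr
    | add x _ y _ hx hy => rw [map_add]; exact I.add_mem hx hy
  · intro h
    rw [← b.sum_repr x]
    exact Submodule.sum_mem _ fun i _ => Submodule.smul_mem_smul (h i) trivial

lemma isPrecomplete_of_basis {ι A M : Type*} [CommRing A] [AddCommGroup M] [Module A M]
    [Fintype ι] (b : Module.Basis ι A M) (I : Ideal A) [IsPrecomplete I A] :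
    IsPrecomplete I M where
  prec' f hf := by
    have h1 : ∀ i, ∃ L : A, ∀ n, b.repr (f n) i ≡ L [SMOD (I ^ n • ⊤ : Submodule A A)] := by
      intro i
      refine IsPrecomplete.prec' _ fun {m n} hmn => ?_
      rw [SModEq.sub_mem, smul_eq_mul, Ideal.mul_top]
      have := hf hmn
      rw [SModEq.sub_mem, b.mem_ideal_smul_top_iff] at this
      simpa using this i
    choose L hL using h1
    refine ⟨∑ i, L i • b i, fun n => ?_⟩
    rw [SModEq.sub_mem, b.mem_ideal_smul_top_iff]
    intro i
    have := hL i n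
    rw [SModEq.sub_mem, smul_eq_mul, Ideal.mul_top] at this
    rwa [map_sub, Finsupp.sub_apply, b.repr_sum_self]

variable {p : ℕ} [Fact p.Prime] {S : Type*} [CommRing S] [Algebra ℤ_[p] S] [Module.Finite ℤ_[p] S]
  [Module.Free ℤ_[p] S]

variable (p S) in
lemma isAdicComplete_span_p : IsAdicComplete (Ideal.span {(p : S)}) S := by
  have h1 : IsPrecomplete (IsLocalRing.maximalIdeal ℤ_[p]) S :=
    isPrecomplete_of_basis (Module.Free.chooseBasis ℤ_[p] S) _
  have h2 : IsHausdorff (IsLocalRing.maximalIdeal ℤ_[p]) S :=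
    IsHausdorff.of_le_jacobson _ _ (IsLocalRing.maximalIdeal_le_jacobson _)
  have h3 : IsAdicComplete (IsLocalRing.maximalIdeal ℤ_[p]) S := { h1, h2 with }
  have h4 : Ideal.span {(p : S)} = (IsLocalRing.maximalIdeal ℤ_[p]).map (algebraMap ℤ_[p] S) := by
    rw [PadicInt.maximalIdeal_eq_span_p, Ideal.map_span, Set.image_singleton, map_natCast]
  rw [h4]
  exact (IsAdicComplete.map_algebraMap_iff _ _).2 h3

/-- Hensel's lemma for an ideal generated by an element with a power divisible by `p`. -/
lemma exists_root_of_aeval_mem {ϖ : S} {N : ℕ} (hN : ϖ ^ N ∈ Ideal.span {(p : S)})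
    {f : ℤ_[p][X]} (hf : f.Monic) {a₀ : S} (h₀ : aeval a₀ f ∈ Ideal.span {ϖ})
    (h₁ : ∃ y, aeval a₀ (derivative f) * y - 1 ∈ Ideal.span {ϖ}) :
    ∃ a, aeval a f = 0 ∧ a - a₀ ∈ Ideal.span {ϖ} ⊔ Ideal.span {(p : S)} := by
  have hcong : ∀ a b : S, a - b ∈ Ideal.span {ϖ} → ∀ P : ℤ_[p][X],
      aeval a P - aeval b P ∈ Ideal.span {ϖ} := by
    intro w w₀ hw P
    rw [← Ideal.Quotient.eq] at hw ⊢
    rw [aeval_def, aeval_def, hom_eval₂, hom_eval₂, hw]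
  have hunit : ∀ a, a - a₀ ∈ Ideal.span {ϖ} → IsUnit (aeval a (derivative f)) := by
    intro a ha
    obtain ⟨y, hy⟩ := h₁
    refine isUnit_of_sub_mem_span (y := y) hN ?_
    have h2 := Ideal.mul_mem_right y _ (hcong a a₀ ha (derivative f))
    have h3 := Ideal.add_mem _ h2 hy
    convert h3 using 1
    ring
  -- Completeness is used only p-adically, so Newton's iteration first runs in powers of ϖ until p
  -- divides f(a).
  have happrox : ∀ n, ∃ a, a - a₀ ∈ Ideal.span {ϖ} ∧ ϖ ^ (n + 1) ∣ aeval a f := by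
    intro n
    induction n with
    | zero => exact ⟨a₀, by simp, by simpa using Ideal.mem_span_singleton.1 h₀⟩
    | succ n ih =>
      obtain ⟨a, ha, c, hc⟩ := ih
      obtain ⟨u, hu⟩ := hunit a ha
      refine ⟨a + -(aeval a f * ↑u⁻¹), ?_, ?_⟩
      · rw [add_sub_right_comm]
        refine Ideal.add_mem _ ha (Ideal.neg_mem_iff _ |>.2 (Ideal.mul_mem_right _ _ ?_))
        rw [Ideal.mem_span_singleton, hc]
        exact (dvd_pow_self ϖ n.succ_ne_zero).mul_right c
      · obtain ⟨r, hr⟩ := Polynomial.binomExpansion (f.map (algebraMap ℤ_[p] S)) a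
          (-(aeval a f * ↑u⁻¹))
        rw [derivative_map] at hr
        simp only [eval_map_algebraMap] at hr
        rw [hr, ← hu]
        have h2 : aeval a f + u * -(aeval a f * ↑u⁻¹) = 0 := by
          rw [show (u : S) * -(aeval a f * ↑u⁻¹) = -(aeval a f) * (u * ↑u⁻¹) by ring,
            Units.mul_inv]
          ring
        rw [h2, zero_add, hc]
        refine ⟨r * (c * ↑u⁻¹) ^ 2 * ϖ ^ n, ?_⟩
        ring
  obtain ⟨a, ha, hNa⟩ := happrox N
  have := isAdicComplete_span_p p S
  obtain ⟨b, hb, hba⟩ := HenselianRing.is_henselian (I := Ideal.span {(p : S)})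
    (f.map (algebraMap ℤ_[p] S)) (hf.map _) a (by
      rw [eval_map_algebraMap]
      exact Ideal.mem_of_dvd _ ((pow_dvd_pow _ N.le_succ).trans hNa) hN)
    (by
      rw [derivative_map, eval_map_algebraMap]
      exact (hunit a ha).map _)
  refine ⟨b, by simpa [Polynomial.IsRoot, eval_map_algebraMap] using hb, ?_⟩
  rw [← sub_add_sub_cancel b a a₀, add_comm]
  exact Submodule.add_mem_sup ha hba

end Henselian

/-! ### Bases adapted to the unramified part -/

section UnramifiedBasis

variable {p : ℕ} [Fact p.Prime] {R : Type*} [CommRing R] [Algebra ℤ_[p] R]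

lemma aeval_mul_pow_mem_span {f : ℤ_[p][X]} (hf : f.Monic) {ζ : R} (hζ : aeval ζ f = 0) (θ : R)
    {n l : ℕ} (hl : l < n) (P : ℤ_[p][X]) :
    aeval ζ P * θ ^ l ∈ Submodule.span ℤ_[p]
      (Set.range fun x : Fin f.natDegree × Fin n => ζ ^ (x.1 : ℕ) * θ ^ (x.2 : ℕ)) := by
  nontriviality R
  have h1 : aeval ζ P = aeval ζ (P %ₘ f) := by
    conv_lhs => rw [← modByMonic_add_div P f]
    rw [map_add, map_mul, hζ, zero_mul, add_zero]
  have hf1 : f ≠ 1 := fun h => by rw [h, map_one] at hζ; exact one_ne_zero hζ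
  rw [h1, aeval_eq_sum_range' (natDegree_modByMonic_lt P hf hf1), Finset.sum_mul]
  refine Submodule.sum_mem _ fun i hi => ?_
  rw [smul_mul_assoc]
  exact Submodule.smul_mem _ _ (Submodule.subset_span ⟨(⟨i, Finset.mem_range.1 hi⟩, ⟨l, hl⟩), rfl⟩)

variable [Module.Finite ℤ_[p] R]

/-- The element θ - Q(ζ) is a uniformizer with residues represented by polynomials in ζ, so R is
generated modulo p by its powers with exponent below n. Expanding them in θ does not raise the
exponent, so they stay in the span. -/
lemma span_unramified_eq_top {f : ℤ_[p][X]} (hf : f.Monic) {ζ : R} (hζ : aeval ζ f = 0) {ϖ : R}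
    {n : ℕ} (hn : Associated (ϖ ^ n) (p : R))
    (hgen : ∀ x : R, ∃ P : ℤ_[p][X], x - aeval ζ P ∈ Ideal.span {ϖ}) {θ : R}
    (hθ : ∃ Q : ℤ_[p][X], Associated ϖ (θ - aeval ζ Q)) :
    Submodule.span ℤ_[p]
      (Set.range fun x : Fin f.natDegree × Fin n => ζ ^ (x.1 : ℕ) * θ ^ (x.2 : ℕ)) = ⊤ := by
  obtain ⟨Q, hQ⟩ := hθ
  set N := Submodule.span ℤ_[p]
      (Set.range fun x : Fin f.natDegree × Fin n => ζ ^ (x.1 : ℕ) * θ ^ (x.2 : ℕ)) with hN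
  have hmem : ∀ l < n, ∀ P : ℤ_[p][X], aeval ζ P * (θ - aeval ζ Q) ^ l ∈ N := by
    intro l hl P
    rw [sub_eq_add_neg, add_pow, Finset.mul_sum]
    refine Submodule.sum_mem _ fun j hj => ?_
    have := aeval_mul_pow_mem_span hf hζ θ (n := n) (l := j)
      (lt_of_le_of_lt (Finset.mem_range_succ_iff.1 hj) hl) (P * (-Q) ^ (l - j) * (l.choose j : ℤ_[p][X]))
    convert this using 1
    simp only [map_mul, map_pow, map_neg, map_natCast]
    ring
  have hsteps : ∀ k ≤ n, ∀ x : R, ∃ y ∈ N, ∃ z, x = y + (θ - aeval ζ Q) ^ k * z := by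
    intro k
    induction k with
    | zero => exact fun _ x => ⟨0, zero_mem _, x, by simp⟩
    | succ k ih =>
      intro hk x
      obtain ⟨y, hy, z, hx⟩ := ih (by omega) x
      obtain ⟨P, hP⟩ := hgen z
      obtain ⟨v, hv⟩ := Ideal.mem_span_singleton.1 hP
      obtain ⟨u, hu⟩ := hQ
      refine ⟨y + aeval ζ P * (θ - aeval ζ Q) ^ k, N.add_mem hy (hmem k (by omega) P), ↑u⁻¹ * v, ?_⟩
      have h2 : ϖ = (θ - aeval ζ Q) * ↑u⁻¹ := by rw [← hu, mul_assoc, Units.mul_inv, mul_one]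
      have h3 : z = aeval ζ P + (θ - aeval ζ Q) * (↑u⁻¹ * v) := by
        rw [← mul_assoc, ← h2, ← hv]; ring
      rw [hx, pow_succ]
      conv_lhs => rw [h3]
      ring
  refine eq_top_of_forall_exists_sub_mem _ fun x => ?_
  obtain ⟨y, hy, z, hx⟩ := hsteps n le_rfl x
  obtain ⟨u, hu⟩ := (hQ.symm.pow_pow (n := n)).trans hn
  refine ⟨y, hy, ↑u⁻¹ * z, ?_⟩
  rw [hx, Algebra.smul_def, map_natCast, ← hu, mul_assoc, Units.mul_inv_cancel_left]

variable [Module.Free ℤ_[p] R]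

-- Group a relation by powers of ϖ. By induction each group is divisible by ϖ, since the lower ones
-- are then already divisible by p and so by ϖ^n. Then `hmin` makes all coefficients divisible by p,
-- and dividing repeatedly by p shows that they vanish.
omit [Module.Finite ℤ_[p] R] in
lemma linearIndependent_unramified [IsDomain R] {f : ℤ_[p][X]} {ζ ϖ : R}
    {n : ℕ} (hn : Associated (ϖ ^ n) (p : R))
    (hmin : ∀ P : ℤ_[p][X], P.degree < f.degree → aeval ζ P ∈ Ideal.span {ϖ} →
        ∀ j, P.coeff j ∈ Ideal.span {(p : ℤ_[p])}) (hf : f.Monic) :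
    LinearIndependent ℤ_[p]
      (fun x : Fin f.natDegree × Fin n => ζ ^ (x.1 : ℕ) * ϖ ^ (x.2 : ℕ)) := by
  have hpR : (p : R) ≠ 0 := by
    have h1 : (p : R) = algebraMap ℤ_[p] R p := by simp
    rw [h1]
    exact (map_ne_zero_iff _ (FaithfulSMul.algebraMap_injective ℤ_[p] R)).2
      (Nat.cast_ne_zero.2 (Fact.out : p.Prime).ne_zero)
  have hϖ : n ≠ 0 → ϖ ≠ 0 := fun h0 h => by
    rw [h, zero_pow h0] at hn
    exact hpR ((associated_zero_iff_eq_zero _).1 hn.symm)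
  have key : ∀ c : Fin f.natDegree × Fin n → ℤ_[p],
      ∑ x, c x • (ζ ^ (x.1 : ℕ) * ϖ ^ (x.2 : ℕ)) = 0 → ∀ x, (p : ℤ_[p]) ∣ c x := by
    intro c hc
    let A (l : Fin n) : ℤ_[p][X] := ∑ a : Fin f.natDegree, C (c (a, l)) * X ^ (a : ℕ)
    have hA : ∀ l, (A l).degree < f.degree := by
      intro l
      rw [degree_eq_natDegree hf.ne_zero]
      refine (degree_sum_le _ _).trans_lt ((Finset.sup_lt_iff (WithBot.bot_lt_coe _)).2 ?_)
      exact fun a _ => (degree_C_mul_X_pow_le _ _).trans_lt (WithBot.coe_lt_coe.2 a.2)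
    have hAc : ∀ l (a : Fin f.natDegree), (A l).coeff a = c (a, l) := by
      intro l a
      simp only [A, finsetSum_coeff, coeff_C_mul, coeff_X_pow]
      rw [Finset.sum_eq_single a]
      · simp
      · intro b _ hb
        rw [if_neg (fun h => hb (Fin.ext h.symm)), mul_zero]
      · simp
    have hsum : ∑ l, aeval ζ (A l) * ϖ ^ (l : ℕ) = 0 := by
      rw [← hc, Fintype.sum_prod_type_right]
      refine Finset.sum_congr rfl fun l _ => ?_
      simp only [A, map_sum, map_mul, aeval_C, map_pow, aeval_X, Finset.sum_mul, Algebra.smul_def,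
        mul_assoc]
    have hdvd : ∀ l, aeval ζ (A l) ∈ Ideal.span {ϖ} → (p : R) ∣ aeval ζ (A l) := by
      intro l hl
      rw [aeval_eq_sum_range]
      refine Finset.dvd_sum fun j _ => ?_
      obtain ⟨e, he⟩ := Ideal.mem_span_singleton.1 (hmin _ (hA l) hl j)
      rw [he, Algebra.smul_def, map_mul, map_natCast, mul_assoc]
      exact dvd_mul_right _ _
    have hmem : ∀ k (hk : k < n), aeval ζ (A ⟨k, hk⟩) ∈ Ideal.span {ϖ} := by
      intro k
      induction k using Nat.strong_induction_on with
      | _ k ih =>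
        intro hk
        have h1 : aeval ζ (A ⟨k, hk⟩) * ϖ ^ k =
            -∑ l ∈ Finset.univ.erase (⟨k, hk⟩ : Fin n), aeval ζ (A l) * ϖ ^ (l : ℕ) := by
          rw [eq_neg_iff_add_eq_zero, ← hsum,
            ← Finset.add_sum_erase _ _ (Finset.mem_univ (⟨k, hk⟩ : Fin n))]
        have h2 : ϖ ^ (k + 1) ∣ aeval ζ (A ⟨k, hk⟩) * ϖ ^ k := by
          rw [h1]
          refine (dvd_neg.2 (Finset.dvd_sum fun l hl => ?_))
          rcases lt_trichotomy (l : ℕ) k with h | h | h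
          · have h3 := hdvd l (ih l h l.2)
            exact (((pow_dvd_pow ϖ hk).trans hn.dvd).trans h3).mul_right _
          · exact absurd (Fin.ext h) (Finset.ne_of_mem_erase hl)
          · exact (pow_dvd_pow ϖ h).mul_left _
        obtain ⟨e, he⟩ := h2
        rw [Ideal.mem_span_singleton]
        refine ⟨e, mul_right_cancel₀ (pow_ne_zero k (hϖ (by omega))) ?_⟩
        rw [he]
        ring
    rintro ⟨a, l⟩
    rw [← hAc, ← Ideal.mem_span_singleton]
    exact hmin _ (hA l) (hmem l l.2) a
  have hpow : ∀ k (c : Fin f.natDegree × Fin n → ℤ_[p]),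
      ∑ x, c x • (ζ ^ (x.1 : ℕ) * ϖ ^ (x.2 : ℕ)) = 0 → ∀ x, (p : ℤ_[p]) ^ k ∣ c x := by
    intro k
    induction k with
    | zero => simp
    | succ k ih =>
      intro c hc x
      choose c' hc' using key c hc
      rw [hc', pow_succ']
      refine mul_dvd_mul_left _ (ih c' ?_ x)
      have h1 : (p : R) * ∑ x, c' x • (ζ ^ (x.1 : ℕ) * ϖ ^ (x.2 : ℕ)) = 0 := by
        rw [← hc, Finset.mul_sum]
        refine Finset.sum_congr rfl fun x _ => ?_
        rw [hc' x, mul_smul, Algebra.smul_def (p : ℤ_[p]), map_natCast]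
      exact (mul_eq_zero.1 h1).resolve_left hpR
  rw [Fintype.linearIndependent_iff]
  intro c hc x
  by_contra hx
  obtain ⟨k, hk⟩ := FiniteMultiplicity.of_not_isUnit (a := (p : ℤ_[p]))
    (PadicInt.prime_p.not_isUnit) hx
  exact hk (hpow _ c hc x)

/-- The structure of a discrete valuation ring that is finite over `ℤ_p`. -/
theorem exists_unramified_root [IsDomain R] {ϖ : R} {n : ℕ}
    (hmax : (Ideal.span {ϖ}).IsMaximal) (hn : Associated (ϖ ^ n) (p : R)) :
    ∃ (f : ℤ_[p][X]) (ζ : R), f.Monic ∧ aeval ζ f = 0 ∧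
      (∃ A B C : ℤ_[p][X], A * f + B * derivative f = 1 + (p : ℤ_[p][X]) * C) ∧
      (∀ x : R, ∃ P : ℤ_[p][X], x - aeval ζ P ∈ Ideal.span {ϖ}) ∧
      ∀ θ : R, (∃ Q : ℤ_[p][X], Associated ϖ (θ - aeval ζ Q)) →
        ∃ b : Module.Basis (Fin f.natDegree × Fin n) ℤ_[p] R,
          ∀ x, b x = ζ ^ (x.1 : ℕ) * θ ^ (x.2 : ℕ) := by
  have hn0 : n ≠ 0 := by
    rintro rfl
    rw [pow_zero] at hn
    obtain ⟨u, hu⟩ := hn.isUnit isUnit_one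
    have h1 : (⊥ : Submodule ℤ_[p] R) = ⊤ := eq_top_of_forall_exists_sub_mem _ fun x =>
      ⟨0, zero_mem _, ↑u⁻¹ * x, by
        rw [zero_add, Algebra.smul_def, map_natCast, ← hu, Units.mul_inv_cancel_left]⟩
    exact bot_ne_top h1
  have hp : (p : R) ∈ Ideal.span {ϖ} := by
    rw [Ideal.mem_span_singleton]
    exact (dvd_pow_self ϖ hn0).trans hn.dvd
  have hN : ϖ ^ n ∈ Ideal.span {(p : R)} := Ideal.mem_span_singleton.2 hn.dvd'
  obtain ⟨f, w, hf, hw, hfw, hdfw, hbez, hgen, hmin⟩ := exists_residue_polynomial hmax hp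
  have hle : Ideal.span {(p : R)} ≤ Ideal.span {ϖ} := (Ideal.span_singleton_le_iff_mem _).2 hp
  obtain ⟨ζ, hζ, hζw⟩ := exists_root_of_aeval_mem hN hf hfw (by
    let _ : Field (R ⧸ Ideal.span {ϖ}) := Ideal.Quotient.field _
    have hx' : Ideal.Quotient.mk (Ideal.span {ϖ}) (aeval w (derivative f)) ≠ 0 :=
      fun h => hdfw (Ideal.Quotient.eq_zero_iff_mem.1 h)
    obtain ⟨y, hy⟩ := Ideal.Quotient.mk_surjective
      (Ideal.Quotient.mk (Ideal.span {ϖ}) (aeval w (derivative f)))⁻¹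
    refine ⟨y, ?_⟩
    rw [← Ideal.Quotient.eq_zero_iff_mem, map_sub, map_mul, hy, mul_inv_cancel₀ hx', map_one,
      sub_self])
  rw [sup_eq_left.2 hle] at hζw
  have hcong : ∀ P : ℤ_[p][X], aeval ζ P - aeval w P ∈ Ideal.span {ϖ} := by
    intro P
    rw [← Ideal.Quotient.eq] at hζw ⊢
    rw [aeval_def, aeval_def, hom_eval₂, hom_eval₂, hζw]
  have hgen' : ∀ x : R, ∃ P : ℤ_[p][X], x - aeval ζ P ∈ Ideal.span {ϖ} := by
    intro x
    obtain ⟨P, hP⟩ := hgen x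
    refine ⟨P, ?_⟩
    have := Ideal.sub_mem _ hP (hcong P)
    convert this using 1
    ring
  have hmin' : ∀ P : ℤ_[p][X], P.degree < f.degree → aeval ζ P ∈ Ideal.span {ϖ} →
      ∀ j, P.coeff j ∈ Ideal.span {(p : ℤ_[p])} := by
    intro P hP h
    refine hmin P hP ?_
    have := Ideal.sub_mem _ h (hcong P)
    rwa [sub_sub_cancel] at this
  refine ⟨f, ζ, hf, hζ, hbez, hgen', fun θ hθ => ?_⟩
  have hli := linearIndependent_unramified hn hmin' hf
  have hsp := span_unramified_eq_top hf hζ hn hgen' (θ := ϖ) ⟨0, by simp⟩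
  -- The rank is computed with ϖ in place of θ, where independence is known; a spanning family of
  -- that size is a basis for the given θ.
  have hcard := Module.finrank_eq_card_basis (Module.Basis.mk hli hsp.ge)
  have hsp' := span_unramified_eq_top hf hζ hn hgen' hθ
  exact ⟨Module.Basis.mk (linearIndependent_of_top_le_span_of_card_eq_finrank hsp'.ge hcard.symm)
    hsp'.ge, fun x => by simp⟩

end UnramifiedBasis

/-! ### Rings of integers of finite extensions of ℚ_p -/

section IntegralClosure

variable {p : ℕ} [Fact p.Prime] {L : Type*} [Field L] [Algebra ℚ_[p] L] [FiniteDimensional ℚ_[p] L]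
  [Algebra ℤ_[p] L] [IsScalarTower ℤ_[p] ℚ_[p] L]

lemma isIntegral_iff_spectralNorm_le_one (x : L) :
    IsIntegral ℤ_[p] x ↔ spectralNorm ℚ_[p] L x ≤ 1 := by
  have hx : IsIntegral ℚ_[p] x := Algebra.IsIntegral.isIntegral x
  rw [spectralNorm, spectralValue_le_one_iff (minpoly.monic hx)]
  constructor
  · intro h n
    rw [minpoly.isIntegrallyClosed_eq_field_fractions' ℚ_[p] h, coeff_map]
    exact PadicInt.norm_le_one _
  · intro h
    have hl : minpoly ℚ_[p] x ∈ Polynomial.lifts (algebraMap ℤ_[p] ℚ_[p]) :=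
      (Polynomial.lifts_iff_coeff_lifts _).2 fun n => ⟨⟨_, h n⟩, rfl⟩
    obtain ⟨q, hq, -, hqm⟩ := lifts_and_natDegree_eq_and_monic hl (minpoly.monic hx)
    refine ⟨q, hqm, ?_⟩
    rw [← aeval_def, ← aeval_map_algebraMap ℚ_[p], hq, minpoly.aeval]

-- The integers are the unit ball of the multiplicative nonarchimedean spectral norm. Elements of
-- norm 1 are units, and x and 1 - x cannot both have norm less than 1.
variable (p L) in
lemma isLocalRing_integralClosure : IsLocalRing (integralClosure ℤ_[p] L) := by
  have hunit : ∀ x : integralClosure ℤ_[p] L, spectralNorm ℚ_[p] L x = 1 → IsUnit x := by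
    intro x hx
    have hx0 : (x : L) ≠ 0 := fun h => by
      rw [h, spectralNorm_zero] at hx
      exact zero_ne_one hx
    have h1 := map_mul (spectralMulAlgNorm ℚ_[p] L) (x : L) (x : L)⁻¹
    rw [mul_inv_cancel₀ hx0, map_one, spectralMulAlgNorm_def, spectralMulAlgNorm_def, hx,
      one_mul] at h1
    refine IsUnit.of_mul_eq_one ⟨(x : L)⁻¹, (isIntegral_iff_spectralNorm_le_one _).2 h1.symm.le⟩ ?_
    exact Subtype.ext (mul_inv_cancel₀ hx0)
  refine IsLocalRing.of_isUnit_or_isUnit_one_sub_self fun x => ?_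
  by_contra! h
  have h1 := lt_of_le_of_ne ((isIntegral_iff_spectralNorm_le_one (x : L)).1 x.2)
    fun h' => h.1 (hunit _ h')
  have h2 := lt_of_le_of_ne ((isIntegral_iff_spectralNorm_le_one _).1 (1 - x).2)
    fun h' => h.2 (hunit _ h')
  have h3 := isNonarchimedean_spectralNorm (K := ℚ_[p]) (L := L) (x : L)
    ((1 - x : integralClosure ℤ_[p] L) : L)
  rw [show (x : L) + ((1 - x : integralClosure ℤ_[p] L) : L) = 1 by simp, spectralNorm_one] at h3
  exact absurd h3 (not_le.2 (max_lt h1 h2))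

variable (p L) in
lemma isDiscreteValuationRing_integralClosure :
    IsDiscreteValuationRing (integralClosure ℤ_[p] L) := by
  have := isLocalRing_integralClosure p L
  have hD : IsDedekindDomain (integralClosure ℤ_[p] L) :=
    integralClosure.isDedekindDomain ℤ_[p] ℚ_[p] L
  have hf : ¬ IsField (integralClosure ℤ_[p] L) := fun h => by
    have : FaithfulSMul ℤ_[p] L := .trans ℤ_[p] ℚ_[p] L
    have hinj : Function.Injective (algebraMap ℤ_[p] (integralClosure ℤ_[p] L)) :=
      FaithfulSMul.algebraMap_injective _ _
    exact IsDiscreteValuationRing.not_isField ℤ_[p]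
      (isField_of_isIntegral_of_isField hinj h)
  have h := (IsDiscreteValuationRing.TFAE (integralClosure ℤ_[p] L) hf).out 0 2
  exact h.2 hD

variable (p L) in
lemma finite_integralClosure : Module.Finite ℤ_[p] (integralClosure ℤ_[p] L) :=
  IsIntegralClosure.finite ℤ_[p] ℚ_[p] L _

variable (p L) in
lemma free_integralClosure : Module.Free ℤ_[p] (integralClosure ℤ_[p] L) :=
  have : Module.IsTorsionFree ℤ_[p] L := .trans_faithfulSMul ℤ_[p] ℚ_[p] L
  IsIntegralClosure.module_free ℤ_[p] ℚ_[p] L _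

variable (p L) in
lemma isFractionRing_integralClosure : IsFractionRing (integralClosure ℤ_[p] L) L :=
  integralClosure.isFractionRing_of_finite_extension ℚ_[p] L

end IntegralClosure

section QuaternionIdentities

variable {A : Type*} [CommRing A] {a b : A}

lemma quat_re_mul_comm (x y : ℍ[A, a, b]) : (x * y).re = (y * x).re := by
  simp; ring

lemma quat_mul_self_of_re_eq_zero {x : ℍ[A, a, b]} (hx : x.re = 0) :
    x * x = ((x * x).re : ℍ[A, a, b]) := by
  ext <;> simp [hx] <;> ring

end QuaternionIdentities

/-! ### Self-dual maximal orders -/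

section SelfDualOrder

variable {p : ℕ} [Fact p.Prime] {L : Type*} [Field L] [Algebra ℚ_[p] L]
  [Algebra ℤ_[p] L] {α β : L}

/-- A maximal order, stable under the involution, which is self-dual for the form `ℓ (x y)`, where
`ℓ` changes its sign under the involution. -/
structure IsSelfDualMaxOrder (O : Subalgebra ℤ_[p] ℍ[L, α, β]) (ℓ : ℍ[L, α, β] →ₗ[ℚ_[p]] ℚ_[p]) :
    Prop where
  max : IsMaximalOrder ℤ_[p] ℚ_[p] O
  star_mem (x) : x ∈ O → star x ∈ O
  map_star (x) : ℓ (star x) = - ℓ x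
  mem_iff (x) : x ∈ O ↔ ∀ y ∈ O, ‖ℓ (x * y)‖ ≤ 1

namespace IsSelfDualMaxOrder

variable {O : Subalgebra ℤ_[p] ℍ[L, α, β]} {ℓ : ℍ[L, α, β] →ₗ[ℚ_[p]] ℚ_[p]}
  (h : IsSelfDualMaxOrder O ℓ)

include h

/-- Nakayama's lemma: a submodule of `O` is finitely generated, and here it equals p times itself.
-/
lemma eq_bot_of_le {N : Submodule ℤ_[p] ℍ[L, α, β]} (hN : ∀ x ∈ N, x ∈ O)
    (hp : ∀ x ∈ N, ∃ y ∈ N, x = (p : ℤ_[p]) • y) : N = ⊥ := by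
  have hfin : Module.Finite ℤ_[p] O := h.max.1.1
  have hOfg : (Subalgebra.toSubmodule O).FG := Module.Finite.iff_fg.1 hfin
  have : IsNoetherian ℤ_[p] (Subalgebra.toSubmodule O) := isNoetherian_of_isNoetherianRing_of_finite _ _
  have hNfg : N.FG := by
    have h1 : (N.comap (Subalgebra.toSubmodule O).subtype).FG := IsNoetherian.noetherian _
    have h2 := h1.map (Subalgebra.toSubmodule O).subtype
    rwa [Submodule.map_comap_subtype, inf_eq_right.2 (fun x hx => hN x hx)] at h2
  refine Submodule.eq_bot_of_le_smul_of_le_jacobson_bot (IsLocalRing.maximalIdeal ℤ_[p]) N hNfg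
    (fun x hx => ?_) (IsLocalRing.maximalIdeal_le_jacobson _)
  obtain ⟨y, hy, rfl⟩ := hp x hx
  refine Submodule.smul_mem_smul ?_ hy
  rw [PadicInt.maximalIdeal_eq_span_p]
  exact Ideal.mem_span_singleton_self _

/-- This is maximality in its usable form: a finitely generated multiplicatively closed submodule
containing `O` is an order. -/
lemma mem_of_mul_le {P : Submodule ℤ_[p] ℍ[L, α, β]} (hP : P.FG) (hO : ∀ x ∈ O, x ∈ P)
    (hmul : ∀ x ∈ P, ∀ y ∈ P, x * y ∈ P) {x : ℍ[L, α, β]} (hx : x ∈ P) : x ∈ O := by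
  let O' : Subalgebra ℤ_[p] ℍ[L, α, β] := P.toSubalgebra (hO 1 O.one_mem) fun x y hx hy => hmul x hx y hy
  have h1 : IsOrder ℤ_[p] ℚ_[p] O' :=
    ⟨Module.Finite.iff_fg.2 hP, top_le_iff.1 (h.max.1.2.ge.trans (Submodule.span_mono hO))⟩
  exact h.max.2 h1 hO hx

omit [Algebra ℚ_[p] L] h in
lemma isIntegral_of_coe_mem [Module.Finite ℤ_[p] O] {r : L} (hr : (r : ℍ[L, α, β]) ∈ O) :
    IsIntegral ℤ_[p] r := by
  have h1 : IsIntegral ℤ_[p] (⟨_, hr⟩ : O) := Algebra.IsIntegral.isIntegral _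
  have h2 : IsIntegral ℤ_[p] (algebraMap L ℍ[L, α, β] r) := h1.map O.val
  exact (isIntegral_algHom_iff (IsScalarTower.toAlgHom ℤ_[p] L ℍ[L, α, β])
    QuaternionAlgebra.algebraMap_injective).1 h2

omit [Algebra ℚ_[p] L] h in
variable (L) in
lemma two_inv_mem (hp : p ≠ 2) : IsIntegral ℤ_[p] (2⁻¹ : L) := by
  have h1 : IsUnit (2 : ℤ_[p]) := by
    rw [PadicInt.isUnit_iff]
    have := (PadicInt.norm_natCast_eq_one_iff (p := p) (n := 2)).2
      ((Nat.coprime_primes Fact.out Nat.prime_two).2 hp)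
    simpa using this
  obtain ⟨u, hu⟩ := h1
  have h2 : (2⁻¹ : L) = algebraMap ℤ_[p] L ↑u⁻¹ := by
    have h3 : algebraMap ℤ_[p] L ↑u * algebraMap ℤ_[p] L ↑u⁻¹ = 1 := by
      rw [← map_mul, Units.mul_inv, map_one]
    rw [hu, map_ofNat] at h3
    exact inv_eq_of_mul_eq_one_right h3
  rw [h2]
  exact isIntegral_algebraMap

variable [IsScalarTower ℤ_[p] ℚ_[p] L] [FiniteDimensional ℚ_[p] L]

/-- The product of `O` with the ring of integers, which is central, is again an order. -/
lemma coe_mem (r : L) (hr : IsIntegral ℤ_[p] r) : (r : ℍ[L, α, β]) ∈ O := by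
  have hfin : Module.Finite ℤ_[p] (integralClosure ℤ_[p] L) := finite_integralClosure p L
  let f : L →ₐ[ℤ_[p]] ℍ[L, α, β] := IsScalarTower.toAlgHom ℤ_[p] L ℍ[L, α, β]
  let P := (Subalgebra.toSubmodule (integralClosure ℤ_[p] L)).map f.toLinearMap *
    Subalgebra.toSubmodule O
  have hOfin : Module.Finite ℤ_[p] O := h.max.1.1
  have hP : P.FG := ((Module.Finite.iff_fg.1 hfin).map _).mul (Module.Finite.iff_fg.1 hOfin)
  have hmem : ∀ (r : L) (_ : IsIntegral ℤ_[p] r), ∀ x ∈ O, (r : ℍ[L, α, β]) * x ∈ P :=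
    fun r hr x hx => Submodule.mul_mem_mul ⟨r, hr, rfl⟩ hx
  refine h.mem_of_mul_le hP (fun x hx => ?_) ?_ (by simpa using hmem r hr 1 O.one_mem)
  · simpa using hmem 1 isIntegral_one x hx
  · intro x hx y hy
    induction hx using Submodule.mul_induction_on' with
    | add x _ x' _ hx hx' => rw [add_mul]; exact P.add_mem hx hx'
    | mem_mul_mem m hm n hn =>
      induction hy using Submodule.mul_induction_on' with
      | add y _ y' _ hy hy' => rw [mul_add]; exact P.add_mem hy hy'
      | mem_mul_mem m' hm' n' hn' =>
        obtain ⟨r, hr, rfl⟩ := hm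
        obtain ⟨r', hr', rfl⟩ := hm'
        have := hmem (r * r') (hr.mul hr') (n * n') (O.mul_mem hn hn')
        convert this using 1
        change (r : ℍ[L, α, β]) * n * (r' * n') = _
        rw [QuaternionAlgebra.coe_mul, mul_assoc, ← mul_assoc n, ← QuaternionAlgebra.coe_commutes,
          mul_assoc, mul_assoc]

omit [IsScalarTower ℤ_[p] ℚ_[p] L] [FiniteDimensional ℚ_[p] L] in
lemma isIntegral_re (hp : p ≠ 2) {x : ℍ[L, α, β]} (hx : x ∈ O) : IsIntegral ℤ_[p] x.re := by
  have : Module.Finite ℤ_[p] O := h.max.1.1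
  have h1 : ((2 * x.re : L) : ℍ[L, α, β]) ∈ O := by
    have := O.add_mem hx (h.star_mem x hx)
    rw [QuaternionAlgebra.self_add_star'] at this
    simpa using this
  have h2 := (two_inv_mem L hp).mul (isIntegral_of_coe_mem h1)
  have : CharZero L := charZero_of_injective_algebraMap (algebraMap ℚ_[p] L).injective
  rwa [inv_mul_cancel_left₀ two_ne_zero] at h2

omit [IsScalarTower ℤ_[p] ℚ_[p] L] [FiniteDimensional ℚ_[p] L] in
lemma isIntegral_mul_self {x : ℍ[L, α, β]} (hx : x ∈ O) (hre : x.re = 0) :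
    IsIntegral ℤ_[p] (x * x).re := by
  have : Module.Finite ℤ_[p] O := h.max.1.1
  refine isIntegral_of_coe_mem (O := O) ?_
  rw [← quat_mul_self_of_re_eq_zero hre]
  exact O.mul_mem hx hx

omit [IsScalarTower ℤ_[p] ℚ_[p] L] in
/-- The functional `ℓ` is represented by a pure quaternion. -/
lemma exists_pure (hα : α ≠ 0) (hβ : β ≠ 0) : ∃ t : ℍ[L, α, β], t.re = 0 ∧
    ∀ x, ℓ x = Algebra.trace ℚ_[p] L (x * t).re := by
  have : CharZero L := charZero_of_injective_algebraMap (algebraMap ℚ_[p] L).injective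
  have hnd := traceForm_nondegenerate ℚ_[p] L
  have hrep : ∀ q : ℍ[L, α, β], ∃ c : L, ∀ a : L, ℓ (a • q) = Algebra.trace ℚ_[p] L (a * c) := by
    intro q
    let g : Module.Dual ℚ_[p] L := ℓ ∘ₗ (LinearMap.toSpanSingleton L _ q).restrictScalars ℚ_[p]
    obtain ⟨c, hc⟩ := ((Algebra.traceForm ℚ_[p] L).toDual hnd).surjective g
    refine ⟨c, fun a => ?_⟩
    have := LinearMap.congr_fun hc a
    rw [LinearMap.BilinForm.toDual_def, Algebra.traceForm_apply, mul_comm] at this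
    exact this.symm
  obtain ⟨c₀, h₀⟩ := hrep 1
  obtain ⟨c₁, h₁⟩ := hrep ⟨0, 1, 0, 0⟩
  obtain ⟨c₂, h₂⟩ := hrep ⟨0, 0, 1, 0⟩
  obtain ⟨c₃, h₃⟩ := hrep ⟨0, 0, 0, 1⟩
  -- The involution fixes the scalars while ℓ changes sign, so the representing quaternion has no
  -- real part.
  have hc₀ : c₀ = 0 := by
    refine hnd.1 c₀ fun a => ?_
    have h1 := h.map_star (a • 1)
    have h2 : star (a • (1 : ℍ[L, α, β])) = a • 1 := by ext <;> simp
    rw [h2, h₀] at h1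
    rw [Algebra.traceForm_apply, mul_comm]
    exact self_eq_neg.1 h1
  refine ⟨⟨0, c₁ / α, c₂ / β, -c₃ / (α * β)⟩, rfl, fun x => ?_⟩
  have hx : x = x.re • 1 + x.imI • ⟨0, 1, 0, 0⟩ + x.imJ • ⟨0, 0, 1, 0⟩ + x.imK • ⟨0, 0, 0, 1⟩ := by
    ext <;> simp
  conv_lhs => rw [hx]
  rw [map_add, map_add, map_add, h₀, h₁, h₂, h₃, hc₀, ← map_add, ← map_add, ← map_add]
  congr 1
  simp
  field_simp
  ring

-- As the real part is cyclic and t² is central, ℓ(t x t⁻¹ z) = ℓ(z x), so self-duality puts t x t⁻¹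
-- in `O`. If t² were zero, self-duality would put a whole line L t, or L itself when t = 0, in the
-- finitely generated `O`.
omit [IsScalarTower ℤ_[p] ℚ_[p] L] in
lemma exists_conj (hα : α ≠ 0) (hβ : β ≠ 0) : ∃ t : ℍ[L, α, β], t.re = 0 ∧ (t * t).re ≠ 0 ∧
    (∀ x, ℓ x = Algebra.trace ℚ_[p] L (x * t).re) ∧ ∀ x ∈ O, ∃ y ∈ O, t * x = y * t := by
  have : CharZero L := charZero_of_injective_algebraMap (algebraMap ℚ_[p] L).injective
  obtain ⟨t, ht, hℓ⟩ := h.exists_pure hα hβ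
  have htt := quat_mul_self_of_re_eq_zero ht
  set τ := (t * t).re with hτ
  have hline : ∀ q : ℍ[L, α, β], (∀ c : L, c • q ∈ O) → q = 0 := by
    intro q hq
    have hp0 : (p : L) ≠ 0 := Nat.cast_ne_zero.2 (Fact.out : p.Prime).ne_zero
    have h1 := h.eq_bot_of_le (N := (Submodule.span L {q}).restrictScalars ℤ_[p]) (by
      intro x hx
      obtain ⟨c, rfl⟩ := Submodule.mem_span_singleton.1 hx
      exact hq c) (by
      intro x hx
      refine ⟨(p : L)⁻¹ • x, Submodule.smul_mem (Submodule.span L {q}) _ hx, ?_⟩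
      rw [← IsScalarTower.algebraMap_smul L (p : ℤ_[p]), map_natCast, smul_inv_smul₀ hp0])
    have h2 : q ∈ (Submodule.span L {q}).restrictScalars ℤ_[p] := Submodule.mem_span_singleton_self q
    rw [h1] at h2
    exact h2
  have hτ0 : τ ≠ 0 := by
    intro h0
    rw [h0, QuaternionAlgebra.coe_zero] at htt
    have ht0 : t = 0 := by
      refine hline t fun c => (h.mem_iff _).2 fun y _ => ?_
      have : (c • t * y * t).re = 0 := by
        rw [smul_mul_assoc, smul_mul_assoc, QuaternionAlgebra.re_smul, quat_re_mul_comm,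
          ← mul_assoc, htt, zero_mul]
        simp
      rw [hℓ, this, map_zero, norm_zero]
      exact zero_le_one
    refine one_ne_zero (hline 1 fun c => (h.mem_iff _).2 fun y _ => ?_)
    rw [hℓ, ht0, mul_zero]
    simp
  refine ⟨t, ht, hτ0, hℓ, fun x hx => ⟨t * x * (τ⁻¹ • t), ?_, ?_⟩⟩
  · refine (h.mem_iff _).2 fun z hz => ?_
    have h1 : (t * x * (τ⁻¹ • t) * z * t).re = (z * x * t).re := by
      rw [quat_re_mul_comm]
      simp only [mul_smul_comm, smul_mul_assoc, ← mul_assoc]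
      rw [htt]
      simp only [mul_assoc]
      rw [QuaternionAlgebra.coe_mul_eq_smul, smul_smul, inv_mul_cancel₀ hτ0, one_smul,
        quat_re_mul_comm]
      simp only [mul_assoc]
      rw [quat_re_mul_comm]
      simp only [mul_assoc]
    rw [hℓ, h1, ← hℓ]
    exact (h.mem_iff z).1 hz x hx
  · rw [mul_assoc, smul_mul_assoc, htt, QuaternionAlgebra.smul_coe, inv_mul_cancel₀ hτ0,
      QuaternionAlgebra.coe_one, mul_one]

end IsSelfDualMaxOrder

end SelfDualOrder

/-! ### Adjusting an element by squares -/

section Uniformizer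

variable {R L : Type*} [CommRing R] [IsDomain R] [IsDiscreteValuationRing R] [Field L] [Algebra R L]
  [IsFractionRing R L] {ϖ : R}

lemma isUnit_of_not_mem_span (hϖ : Irreducible ϖ) {x : R} (hx : x ∉ Ideal.span {ϖ}) : IsUnit x := by
  by_contra h
  rw [← hϖ.maximalIdeal_eq] at hx
  exact hx ((IsLocalRing.mem_maximalIdeal x).2 h)

/-- Multiplication by squares changes the valuation by even amounts, so it can be made 0 or 1. -/
lemma exists_sq_mul_eq (hϖ : Irreducible ϖ) {τ : L} (hτ : τ ≠ 0) :
    ∃ (f : L) (θ : R), f ≠ 0 ∧ f ^ 2 * τ = algebraMap R L θ ∧ (IsUnit θ ∨ Associated ϖ θ) := by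
  obtain ⟨a, b, hb, rfl⟩ := IsFractionRing.div_surjective (A := R) τ
  have hb0 : algebraMap R L b ≠ 0 := IsFractionRing.to_map_ne_zero_of_mem_nonZeroDivisors hb
  have ha0 : algebraMap R L a ≠ 0 := fun h => hτ (by rw [h, zero_div])
  have hϖ0 : algebraMap R L ϖ ≠ 0 :=
    (map_ne_zero_iff _ (IsFractionRing.injective R L)).2 hϖ.ne_zero
  have hab : a * b ≠ 0 := fun h => (mul_ne_zero ha0 hb0) (by rw [← map_mul, h, map_zero])
  obtain ⟨k, u, hk⟩ := IsDiscreteValuationRing.eq_unit_mul_pow_irreducible hab hϖ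
  have hk' := congrArg (algebraMap R L) hk
  rw [map_mul, map_mul, map_pow] at hk'
  rcases Nat.even_or_odd' k with ⟨q, rfl | rfl⟩
  · refine ⟨algebraMap R L b / algebraMap R L ϖ ^ q, u, div_ne_zero hb0 (pow_ne_zero _ hϖ0), ?_,
      Or.inl u.isUnit⟩
    field_simp
    linear_combination hk'
  · refine ⟨algebraMap R L b / algebraMap R L ϖ ^ q, u * ϖ, div_ne_zero hb0 (pow_ne_zero _ hϖ0),
      ?_, Or.inr ⟨u, mul_comm _ _⟩⟩
    rw [map_mul]
    field_simp
    linear_combination hk'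

/-- A unit θ has moreover to generate R over its unramified part, so θ - Q(ζ) should be a
uniformizer. If it is not, multiplying θ by (1 + ϖ)² changes it by 2 θ ϖ modulo ϖ², and 2 θ is a
unit. -/
lemma exists_sq_mul_eq_of_generator {S : Type*} [CommRing S] [Algebra S R] (hϖ : Irreducible ϖ)
    (h2 : IsUnit (2 : R))
    {ζ : R} (hζ : ∀ x : R, ∃ P : S[X], x - aeval ζ P ∈ Ideal.span {ϖ}) {τ : L} (hτ : τ ≠ 0) :
    ∃ (f : L) (θ : R), f ≠ 0 ∧ f ^ 2 * τ = algebraMap R L θ ∧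
      ((IsUnit θ ∧ ∃ Q : S[X], Associated ϖ (θ - aeval ζ Q)) ∨ Associated ϖ θ) := by
  obtain ⟨f, θ, hf, hfθ, hθ | hθ⟩ := exists_sq_mul_eq (R := R) hϖ hτ
  · obtain ⟨Q, hQ⟩ := hζ θ
    obtain ⟨c, hc⟩ := Ideal.mem_span_singleton.1 hQ
    by_cases hcu : IsUnit c
    · exact ⟨f, θ, hf, hfθ, Or.inl ⟨hθ, Q, by rw [hc]; exact ⟨hcu.unit, rfl⟩⟩⟩
    · have hcm : c ∈ Ideal.span {ϖ} := by
        by_contra h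
        exact hcu (isUnit_of_not_mem_span hϖ h)
      have hϖm : ϖ ∈ Ideal.span {ϖ} := Ideal.mem_span_singleton_self ϖ
      have hne : Ideal.span {ϖ} ≠ ⊤ := by
        rw [Ne, Ideal.span_singleton_eq_top]
        exact hϖ.not_isUnit
      have h1 : IsUnit (1 + ϖ) := isUnit_of_not_mem_span hϖ fun h =>
        hne ((Ideal.eq_top_iff_one _).2 (by simpa using Ideal.sub_mem _ h hϖm))
      have h3 : IsUnit (c + 2 * θ + ϖ * θ) := isUnit_of_not_mem_span hϖ fun h => by
        have h4 : 2 * θ ∈ Ideal.span {ϖ} := by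
          have := Ideal.sub_mem _ (Ideal.sub_mem _ h hcm) (Ideal.mul_mem_right θ _ hϖm)
          convert this using 1
          ring
        exact hne (Ideal.eq_top_of_isUnit_mem _ h4 (h2.mul hθ))
      refine ⟨f * algebraMap R L (1 + ϖ), θ * (1 + ϖ) ^ 2, mul_ne_zero hf ?_, ?_,
        Or.inl ⟨hθ.mul (h1.pow 2), Q, h3.unit, ?_⟩⟩
      · exact (map_ne_zero_iff _ (IsFractionRing.injective R L)).2 h1.ne_zero
      · rw [mul_pow, mul_right_comm, hfθ, map_mul, map_pow]
      · rw [IsUnit.unit_spec]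
        linear_combination -hc
  · exact ⟨f, θ, hf, hfθ, Or.inr hθ⟩

end Uniformizer

/-! ### The normalizing pure quaternion -/

section SelfDualOrder

variable {p : ℕ} [Fact p.Prime] {L : Type*} [Field L] [Algebra ℚ_[p] L]
  [Algebra ℤ_[p] L] {α β : L} [IsScalarTower ℤ_[p] ℚ_[p] L] [FiniteDimensional ℚ_[p] L]

/-- A pure quaternion `s` that normalizes the order `O`, whose square is integral and not divisible
by `ϖ ^ 2`, and that represents the functional `ℓ`. -/
structure IsNormalizer (O : Subalgebra ℤ_[p] ℍ[L, α, β]) (ℓ : ℍ[L, α, β] →ₗ[ℚ_[p]] ℚ_[p])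
    (ϖ θ : integralClosure ℤ_[p] L) (s : ℍ[L, α, β]) (μ : L →ₗ[ℚ_[p]] ℚ_[p]) : Prop where
  re_eq : s.re = 0
  mul_self : s * s = ((θ : L) : ℍ[L, α, β])
  ne_zero : θ ≠ 0
  not_dvd : ¬ ϖ ^ 2 ∣ θ
  map_eq (x) : ℓ x = μ (x * s).re
  conj (x) : x ∈ O → ∃ y ∈ O, s * x = y * s

variable {O : Subalgebra ℤ_[p] ℍ[L, α, β]} {ℓ : ℍ[L, α, β] →ₗ[ℚ_[p]] ℚ_[p]}
  {ϖ θ : integralClosure ℤ_[p] L} {s : ℍ[L, α, β]} {μ : L →ₗ[ℚ_[p]] ℚ_[p]}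

lemma IsSelfDualMaxOrder.exists_isNormalizer (h : IsSelfDualMaxOrder O ℓ) (hp : p ≠ 2)
    (hα : α ≠ 0) (hβ : β ≠ 0) (hϖ : Irreducible ϖ) {ζ : integralClosure ℤ_[p] L}
    (hζ : ∀ x : integralClosure ℤ_[p] L, ∃ P : ℤ_[p][X], x - aeval ζ P ∈ Ideal.span {ϖ}) :
    ∃ θ s μ, IsNormalizer O ℓ ϖ θ s μ ∧
      ((IsUnit θ ∧ ∃ Q : ℤ_[p][X], Associated ϖ (θ - aeval ζ Q)) ∨ Associated ϖ θ) := by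
  have := isDiscreteValuationRing_integralClosure p L
  have := isFractionRing_integralClosure p L
  have : CharZero L := charZero_of_injective_algebraMap (algebraMap ℚ_[p] L).injective
  obtain ⟨t, ht, hτ, hℓ, hconj⟩ := h.exists_conj hα hβ
  have h2 : IsUnit (2 : integralClosure ℤ_[p] L) :=
    IsUnit.of_mul_eq_one ⟨2⁻¹, IsSelfDualMaxOrder.two_inv_mem L hp⟩
      (Subtype.ext (mul_inv_cancel₀ two_ne_zero))
  obtain ⟨f, θ, hf, hfθ, hθ⟩ := exists_sq_mul_eq_of_generator
    (R := integralClosure ℤ_[p] L) hϖ h2 hζ hτ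
  have hθ0 : θ ≠ 0 := by
    rintro rfl
    rw [map_zero] at hfθ
    exact mul_ne_zero (pow_ne_zero 2 hf) hτ hfθ
  refine ⟨θ, f • t, Algebra.trace ℚ_[p] L ∘ₗ (LinearMap.mulLeft ℚ_[p] f⁻¹),
    ⟨?_, ?_, hθ0, ?_, fun x => ?_, fun x hx => ?_⟩, hθ⟩
  · rw [QuaternionAlgebra.re_smul, ht, smul_zero]
  · rw [smul_mul_smul_comm, quat_mul_self_of_re_eq_zero ht, QuaternionAlgebra.smul_coe, ← sq, hfθ]
    rfl
  · intro hd
    rcases hθ with ⟨hu, -⟩ | ha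
    · exact hϖ.not_isUnit (isUnit_of_dvd_unit ((dvd_pow_self ϖ two_ne_zero).trans hd) hu)
    · obtain ⟨c, hc⟩ := hd.trans ha.symm.dvd
      refine hϖ.not_isUnit (IsUnit.of_mul_eq_one c (mul_left_cancel₀ hϖ.ne_zero ?_))
      rw [mul_one, ← mul_assoc, ← sq, ← hc]
  · rw [hℓ, mul_smul_comm, QuaternionAlgebra.re_smul, LinearMap.comp_apply,
      LinearMap.mulLeft_apply, smul_eq_mul, inv_mul_cancel_left₀ hf]
  · obtain ⟨y, hy, hxy⟩ := hconj x hx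
    exact ⟨y, hy, by rw [smul_mul_assoc, hxy, mul_smul_comm]⟩

namespace IsNormalizer

variable (h : IsSelfDualMaxOrder O ℓ) (hs : IsNormalizer O ℓ ϖ θ s μ)

include h hs

/-- The module O + O s is an order, because s normalizes `O` and s² is integral. -/
lemma mem : s ∈ O := by
  let P := Subalgebra.toSubmodule O ⊔ (Subalgebra.toSubmodule O).map (LinearMap.mulRight ℤ_[p] s)
  have hOfin : Module.Finite ℤ_[p] O := h.max.1.1
  have hP : P.FG := (Module.Finite.iff_fg.1 hOfin).sup ((Module.Finite.iff_fg.1 hOfin).map _)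
  have hmem : ∀ x ∈ O, ∀ y ∈ O, x + y * s ∈ P :=
    fun x hx y hy => Submodule.add_mem_sup hx ⟨y, hy, rfl⟩
  refine h.mem_of_mul_le hP (fun x hx => ?_) ?_ (by simpa using hmem 0 O.zero_mem 1 O.one_mem)
  · simpa using hmem x hx 0 O.zero_mem
  · intro x hx y hy
    obtain ⟨x, hx₁, _, ⟨x', hx', rfl⟩, rfl⟩ := Submodule.mem_sup.1 hx
    obtain ⟨y, hy₁, _, ⟨y', hy', rfl⟩, rfl⟩ := Submodule.mem_sup.1 hy
    obtain ⟨z, hz, hyz⟩ := hs.conj y hy₁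
    obtain ⟨z', hz', hyz'⟩ := hs.conj y' hy'
    have hθ := h.coe_mem (θ : L) θ.2
    have := hmem (x * y + x' * z' * ((θ : L) : ℍ[L, α, β]))
      (O.add_mem (O.mul_mem hx₁ hy₁) (O.mul_mem (O.mul_mem hx' hz') hθ))
      (x * y' + x' * z) (O.add_mem (O.mul_mem hx₁ hy') (O.mul_mem hx' hz))
    convert this using 1
    change (x + x' * s) * (y + y' * s) = _
    rw [← hs.mul_self]
    calc (x + x' * s) * (y + y' * s) = x * y + x * y' * s + x' * (s * y) + x' * (s * y') * s := by
          noncomm_ring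
      _ = _ := by rw [hyz, hyz']; noncomm_ring

omit h [IsScalarTower ℤ_[p] ℚ_[p] L] [FiniteDimensional ℚ_[p] L] in
lemma star_eq : star s = -s := by
  have : CharZero L := charZero_of_injective_algebraMap (algebraMap ℚ_[p] L).injective
  exact QuaternionAlgebra.star_eq_neg.2 hs.re_eq

omit h [IsScalarTower ℤ_[p] ℚ_[p] L] [FiniteDimensional ℚ_[p] L] in
lemma ne_zero' : s ≠ 0 := by
  rintro rfl
  have := hs.mul_self
  rw [mul_zero] at this
  exact hs.ne_zero (Subtype.ext (QuaternionAlgebra.coe_injective this).symm)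

omit h [IsScalarTower ℤ_[p] ℚ_[p] L] [FiniteDimensional ℚ_[p] L] in
lemma coe_ne_zero : (θ : L) ≠ 0 := fun h => hs.ne_zero (Subtype.ext h)

omit h [IsScalarTower ℤ_[p] ℚ_[p] L] [FiniteDimensional ℚ_[p] L] in
lemma mul_right_cancel {x y : ℍ[L, α, β]} (hxy : x * s = y * s) : x = y := by
  have h1 : x * s * s = y * s * s := by rw [hxy]
  rw [mul_assoc, mul_assoc, hs.mul_self, QuaternionAlgebra.mul_coe_eq_smul,
    QuaternionAlgebra.mul_coe_eq_smul] at h1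
  exact smul_right_injective _ hs.coe_ne_zero h1

/-- The pure part of x is b s for some b in L, as its product with s is fixed by the involution.
Then b² θ is integral, and since ϖ² does not divide θ, so is b. -/
lemma eq_of_commute [IsDiscreteValuationRing (integralClosure ℤ_[p] L)] (hϖ : Irreducible ϖ)
    (hp : p ≠ 2) {x : ℍ[L, α, β]} (hx : x ∈ O) (hc : s * x = x * s) :
    ∃ a b : integralClosure ℤ_[p] L,
      x = ((a : L) : ℍ[L, α, β]) + ((b : L) : ℍ[L, α, β]) * s := by
  have : CharZero L := charZero_of_injective_algebraMap (algebraMap ℚ_[p] L).injective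
  have := isFractionRing_integralClosure p L
  have ha := h.isIntegral_re hp hx
  set y := x - (x.re : ℍ[L, α, β]) with hy
  have hyre : y.re = 0 := by simp [hy]
  have hyc : s * y = y * s := by
    rw [hy, mul_sub, sub_mul, hc, QuaternionAlgebra.coe_commutes]
  have h1 : star (y * s) = y * s := by
    rw [star_mul, hs.star_eq, QuaternionAlgebra.star_eq_neg.2 hyre, neg_mul_neg, hyc]
  rw [QuaternionAlgebra.star_eq_self] at h1
  set c := (y * s).re
  have h2 : y = (c / (θ : L)) • s := by
    apply hs.mul_right_cancel
    rw [h1, smul_mul_assoc, hs.mul_self, QuaternionAlgebra.smul_coe,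
      div_mul_cancel₀ _ hs.coe_ne_zero]
  set b := c / (θ : L)
  have hyO : y ∈ O := O.sub_mem hx (h.coe_mem _ ha)
  have h3 := h.isIntegral_mul_self hyO hyre
  have h4 : (y * y).re = b ^ 2 * θ := by
    rw [h2, smul_mul_smul_comm, hs.mul_self, QuaternionAlgebra.smul_coe, QuaternionAlgebra.re_coe,
      sq]
  rw [h4] at h3
  have hb : IsIntegral ℤ_[p] b := by
    by_cases hb0 : b = 0
    · rw [hb0]; exact isIntegral_zero
    rcases ValuationRing.isInteger_or_isInteger (integralClosure ℤ_[p] L) b with ⟨r, hr⟩ | ⟨r, hr⟩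
    · rw [← hr]; exact r.2
    · by_cases hru : IsUnit r
      · obtain ⟨u, rfl⟩ := hru
        have h5 : b = ((↑u⁻¹ : integralClosure ℤ_[p] L) : L) := by
          rw [← inv_inv b, ← hr]
          refine inv_eq_of_mul_eq_one_right ?_
          have := congrArg (algebraMap (integralClosure ℤ_[p] L) L) (Units.mul_inv u)
          rwa [map_mul, map_one] at this
        rw [h5]
        exact (↑u⁻¹ : integralClosure ℤ_[p] L).2
      · exfalso
        have h6 : r ∈ Ideal.span {ϖ} := by
          by_contra h
          exact hru (isUnit_of_not_mem_span hϖ h)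
        obtain ⟨v, hv⟩ := Ideal.mem_span_singleton.1 h6
        refine hs.not_dvd ⟨v ^ 2 * ⟨_, h3⟩, Subtype.ext ?_⟩
        change (θ : L) = (ϖ : L) ^ 2 * ((v : L) ^ 2 * (b ^ 2 * θ))
        have h7 : (ϖ : L) * v = b⁻¹ := by
          rw [← hr, hv]
          rfl
        rw [← mul_assoc, ← mul_pow, h7, ← mul_assoc, ← mul_pow, inv_mul_cancel₀ hb0, one_pow,
          one_mul]
  refine ⟨⟨_, ha⟩, ⟨b, hb⟩, ?_⟩
  change x = (x.re : ℍ[L, α, β]) + (b : ℍ[L, α, β]) * s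
  rw [QuaternionAlgebra.coe_mul_eq_smul, ← h2, hy, add_sub_cancel]

end IsNormalizer

end SelfDualOrder

/-- Over a finite field of odd characteristic the form a² - u b² takes every value; it is made equal
to δ / e for a nonsquare δ. -/
lemma exists_nonsquare_norm {k : Type*} [Field k] [Finite k] (h2 : (2 : k) ≠ 0) {u e : k}
    (hu : u ≠ 0) (he : e ≠ 0) :
    ∃ a b : k, a ^ 2 - u * b ^ 2 ≠ 0 ∧ ∀ c, c ^ 2 ≠ (a ^ 2 - u * b ^ 2) * e := by
  have := Fintype.ofFinite k
  have hchar : ringChar k ≠ 2 := fun h => h2 (by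
    have := ringChar.Nat.cast_ringChar (R := k)
    rwa [h, Nat.cast_ofNat] at this)
  obtain ⟨δ, hδ⟩ := FiniteField.exists_nonsquare hchar
  obtain ⟨a, b, hab⟩ := FiniteField.exists_root_sum_quadratic (R := k)
    (f := X ^ 2 - C (δ / e)) (g := C (-u) * X ^ 2)
    (by simpa using degree_X_pow_sub_C two_pos (δ / e))
    (by simpa using degree_C_mul_X_pow 2 (neg_ne_zero.2 hu))
    (FiniteField.odd_card_of_char_ne_two hchar)
  have h1 : a ^ 2 - u * b ^ 2 = δ / e := by
    simp only [eval_sub, eval_pow, eval_X, eval_C, eval_mul] at hab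
    linear_combination hab
  refine ⟨a, b, ?_, fun c hc => hδ ⟨c, ?_⟩⟩
  · rw [h1]
    refine div_ne_zero (fun h => hδ ?_) he
    rw [h]
    exact IsSquare.zero
  · rw [← sq, hc, h1, div_mul_cancel₀ _ he]

/-! ### Elements anticommuting with the normalizer -/

section Standard

variable {p : ℕ} [Fact p.Prime] {L : Type*} [Field L] [Algebra ℚ_[p] L]
  [Algebra ℤ_[p] L] {α β : L} [IsScalarTower ℤ_[p] ℚ_[p] L] [FiniteDimensional ℚ_[p] L]
  {O : Subalgebra ℤ_[p] ℍ[L, α, β]} {ℓ : ℍ[L, α, β] →ₗ[ℚ_[p]] ℚ_[p]}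
  {ϖ θ : integralClosure ℤ_[p] L} {s : ℍ[L, α, β]} {μ : L →ₗ[ℚ_[p]] ℚ_[p]}

namespace IsNormalizer

variable (h : IsSelfDualMaxOrder O ℓ) (hs : IsNormalizer O ℓ ϖ θ s μ)

include h hs

lemma norm_map_le (r : integralClosure ℤ_[p] L) : ‖μ (θ * r)‖ ≤ 1 := by
  have h1 := (h.mem_iff _).1 (O.mul_mem (h.coe_mem (r : L) r.2) (mem h hs)) 1 O.one_mem
  rwa [mul_one, hs.map_eq, mul_assoc, hs.mul_self, ← QuaternionAlgebra.coe_mul,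
    QuaternionAlgebra.re_coe, mul_comm] at h1

omit h [IsScalarTower ℤ_[p] ℚ_[p] L] [FiniteDimensional ℚ_[p] L] in
lemma dvd_uniformizer [IsDiscreteValuationRing (integralClosure ℤ_[p] L)] (hϖ : Irreducible ϖ) :
    θ ∣ ϖ := by
  rcases ValuationRing.dvd_total θ ϖ with hd | ⟨c, rfl⟩
  · exact hd
  · have hc : IsUnit c := isUnit_of_not_mem_span hϖ fun hc => by
      obtain ⟨d, rfl⟩ := Ideal.mem_span_singleton.1 hc
      exact hs.not_dvd ⟨d, by ring⟩
    exact ((associated_mul_unit_left ϖ c hc).symm.dvd').trans dvd_rfl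

omit h [IsScalarTower ℤ_[p] ℚ_[p] L] [FiniteDimensional ℚ_[p] L] in
lemma re_eq_zero_of_anticommute {y : ℍ[L, α, β]} (hy : s * y = -(y * s)) : y.re = 0 := by
  have : CharZero L := charZero_of_injective_algebraMap (algebraMap ℚ_[p] L).injective
  have h1 : (s * y * s).re = θ * y.re := by
    rw [mul_assoc, quat_re_mul_comm, mul_assoc, hs.mul_self, QuaternionAlgebra.mul_coe_eq_smul]
    rfl
  rw [hy, neg_mul, mul_assoc, hs.mul_self, QuaternionAlgebra.mul_coe_eq_smul] at h1
  change -((θ : L) * y.re) = _ at h1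
  exact (mul_eq_zero.1 (self_eq_neg.1 h1.symm)).resolve_left hs.coe_ne_zero

/-- These are the two eigencomponents of conjugation by s, which preserves `O` and has order at most
two because s² is central; the projections need 1/2. -/
lemma exists_decomp (hp : p ≠ 2) {x : ℍ[L, α, β]} (hx : x ∈ O) : ∃ y ∈ O, ∃ z ∈ O, x = y + z ∧
    s * y = y * s ∧ s * z = -(z * s) := by
  have : CharZero L := charZero_of_injective_algebraMap (algebraMap ℚ_[p] L).injective
  obtain ⟨x', hx', hxx⟩ := hs.conj x hx
  have hxx' : s * x' = x * s := by
    apply hs.mul_right_cancel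
    rw [mul_assoc, ← hxx, mul_assoc, ← mul_assoc s s, hs.mul_self, QuaternionAlgebra.coe_commutes]
  have h2 := h.coe_mem _ (IsSelfDualMaxOrder.two_inv_mem L hp)
  have h3 : ∀ q : ℍ[L, α, β], (2⁻¹ : L) • (q + q) = q := fun q => by
    rw [← two_smul L q, inv_smul_smul₀ two_ne_zero]
  have h4 : ∀ q ∈ O, (2⁻¹ : L) • q ∈ O := fun q hq => by
    rw [← QuaternionAlgebra.coe_mul_eq_smul]
    exact O.mul_mem h2 hq
  refine ⟨(2⁻¹ : L) • (x + x'), h4 _ (O.add_mem hx hx'), (2⁻¹ : L) • (x - x'),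
    h4 _ (O.sub_mem hx hx'), ?_, ?_, ?_⟩
  · rw [← smul_add, add_add_sub_cancel, h3]
  · rw [mul_smul_comm, smul_mul_assoc, mul_add, add_mul, hxx, hxx', add_comm]
  · rw [mul_smul_comm, smul_mul_assoc, mul_sub, sub_mul, hxx, hxx', ← smul_neg, neg_sub]

/-- Otherwise all squares in the anticommuting part N are divisible by ϖ and, after polarization, so
are the re(x y). Self-duality then gives ϖ⁻¹ s N ⊆ N. Applied twice, with θ dividing ϖ, this gives
ϖ⁻¹ N ⊆ N, so N = 0 by Nakayama's lemma; but then s would be central. -/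
lemma exists_anticommute [IsDiscreteValuationRing (integralClosure ℤ_[p] L)] (hϖ : Irreducible ϖ)
    (hp : p ≠ 2) (hα : α ≠ 0) : ∃ η ∈ O, s * η = -(η * s) ∧
      ∃ ε : integralClosure ℤ_[p] L, IsUnit ε ∧ η * η = ((ε : L) : ℍ[L, α, β]) := by
  have : CharZero L := charZero_of_injective_algebraMap (algebraMap ℚ_[p] L).injective
  have hϖ0 : (ϖ : L) ≠ 0 := fun h => hϖ.ne_zero (Subtype.ext h)
  by_contra! hcon
  let N : Submodule ℤ_[p] ℍ[L, α, β] := Subalgebra.toSubmodule O ⊓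
    LinearMap.ker (LinearMap.mulLeft ℤ_[p] s + LinearMap.mulRight ℤ_[p] s)
  have hN : ∀ x, x ∈ N ↔ x ∈ O ∧ s * x = -(x * s) := fun x => by
    rw [Submodule.mem_inf, LinearMap.mem_ker, LinearMap.add_apply, LinearMap.mulLeft_apply,
      LinearMap.mulRight_apply, add_eq_zero_iff_eq_neg]
    rfl
  have hsmul : ∀ (r : integralClosure ℤ_[p] L), ∀ x ∈ N, (r : L) • x ∈ N := fun r x hx => by
    rw [hN] at hx ⊢
    refine ⟨?_, ?_⟩
    · rw [← QuaternionAlgebra.coe_mul_eq_smul]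
      exact O.mul_mem (h.coe_mem _ r.2) hx.1
    · rw [mul_smul_comm, hx.2, smul_neg, smul_mul_assoc]
  have hsq : ∀ x ∈ N, ∃ r : integralClosure ℤ_[p] L, (x * x).re = ϖ * r := fun x hx => by
    rw [hN] at hx
    have hre := hs.re_eq_zero_of_anticommute hx.2
    have hint := h.isIntegral_mul_self hx.1 hre
    have h1 : (⟨_, hint⟩ : integralClosure ℤ_[p] L) ∈ Ideal.span {ϖ} := by
      by_contra h1
      exact hcon x hx.1 hx.2 _ (isUnit_of_not_mem_span hϖ h1) (quat_mul_self_of_re_eq_zero hre)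
    obtain ⟨r, hr⟩ := Ideal.mem_span_singleton.1 h1
    exact ⟨r, congrArg Subtype.val hr⟩
  have hmul : ∀ x ∈ N, ∀ y ∈ N, ∃ r : integralClosure ℤ_[p] L, (x * y).re = ϖ * r := by
    intro x hx y hy
    obtain ⟨a, ha⟩ := hsq x hx
    obtain ⟨b, hb⟩ := hsq y hy
    obtain ⟨c, hc⟩ := hsq _ (N.add_mem hx hy)
    refine ⟨⟨2⁻¹, IsSelfDualMaxOrder.two_inv_mem L hp⟩ * (c - a - b), ?_⟩
    have h1 : ((x + y) * (x + y)).re = (x * x).re + (y * y).re + 2 * (x * y).re := by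
      rw [add_mul, mul_add, mul_add, QuaternionAlgebra.re_add, QuaternionAlgebra.re_add,
        QuaternionAlgebra.re_add, quat_re_mul_comm y x]
      ring
    change _ = (ϖ : L) * ((2 : L)⁻¹ * ((c : L) - a - b))
    have h2 : (2 : L) ≠ 0 := two_ne_zero
    field_simp
    linear_combination -h1 - ha - hb + hc
  have hdiv : ∀ x ∈ N, (ϖ : L)⁻¹ • (s * x) ∈ N := by
    intro x hx
    have hx' := (hN x).1 hx
    refine (hN _).2 ⟨(h.mem_iff _).2 fun z hz => ?_, ?_⟩
    · obtain ⟨y, hy, z, hz', rfl, hyc, hzc⟩ := exists_decomp h hs hp hz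
      have h1 : (x * y).re = 0 := hs.re_eq_zero_of_anticommute (by
        rw [← mul_assoc, hx'.2, neg_mul, mul_assoc, hyc, ← mul_assoc])
      obtain ⟨r, hr⟩ := hmul x hx z ((hN z).2 ⟨hz', hzc⟩)
      have h2 : ((ϖ : L)⁻¹ • (s * x) * (y + z) * s).re = θ * r := by
        rw [smul_mul_assoc, smul_mul_assoc, QuaternionAlgebra.re_smul, mul_assoc, mul_assoc,
          quat_re_mul_comm, mul_assoc, mul_assoc, hs.mul_self, ← mul_assoc,
          QuaternionAlgebra.mul_coe_eq_smul, QuaternionAlgebra.re_smul, mul_add,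
          QuaternionAlgebra.re_add, h1, hr, smul_eq_mul, smul_eq_mul]
        field_simp
        ring
      rw [hs.map_eq, h2]
      exact norm_map_le h hs r
    · rw [mul_smul_comm, smul_mul_assoc, ← smul_neg, mul_assoc, ← mul_neg, ← hx'.2]
  have hdiv' : ∀ x ∈ N, (ϖ : L)⁻¹ • x ∈ N := by
    intro x hx
    obtain ⟨c, hc⟩ := hs.dvd_uniformizer hϖ
    have h1 := hsmul c _ (hdiv _ (hdiv x hx))
    rw [mul_smul_comm, ← mul_assoc, hs.mul_self, QuaternionAlgebra.coe_mul_eq_smul, smul_smul,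
      smul_smul, smul_smul] at h1
    have hc' : (ϖ : L) = θ * c := congrArg Subtype.val hc
    convert h1 using 2
    have hθ0 := hs.coe_ne_zero
    have hc0 : (c : L) ≠ 0 := fun h => hϖ0 (by rw [hc', h, mul_zero])
    rw [hc']
    field_simp
  have hdivn : ∀ n : ℕ, ∀ x ∈ N, ((ϖ : L) ^ n)⁻¹ • x ∈ N := by
    intro n
    induction n with
    | zero => intro x hx; simpa using hx
    | succ n ih =>
      intro x hx
      have := ih _ (hdiv' x hx)
      rwa [smul_smul, ← mul_inv, ← pow_succ] at this
  have hp0 : (p : integralClosure ℤ_[p] L) ≠ 0 := fun h0 => by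
    have := congrArg Subtype.val h0
    have h1 : ((p : ℕ) : L) = 0 := by simpa using this
    exact (Fact.out : p.Prime).ne_zero (Nat.cast_eq_zero.1 h1)
  obtain ⟨n, u, hu⟩ := IsDiscreteValuationRing.eq_unit_mul_pow_irreducible hp0 hϖ
  have hNbot : N = ⊥ := by
    refine h.eq_bot_of_le (fun x hx => ((hN x).1 hx).1) fun x hx => ?_
    refine ⟨_, hsmul (↑u⁻¹ : integralClosure ℤ_[p] L) _ (hdivn n x hx), ?_⟩
    have hu1 : (p : L) = ((u : integralClosure ℤ_[p] L) : L) * (ϖ : L) ^ n := by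
      have := congrArg Subtype.val hu
      simpa using this
    have hu2 : ((u : integralClosure ℤ_[p] L) : L) * ((↑u⁻¹ : integralClosure ℤ_[p] L) : L) = 1 :=
      congrArg Subtype.val (Units.mul_inv u)
    rw [← IsScalarTower.algebraMap_smul L (p : ℤ_[p]), map_natCast, smul_smul, smul_smul, hu1]
    have : ((u : integralClosure ℤ_[p] L) : L) * (ϖ : L) ^ n *
      ((↑u⁻¹ : integralClosure ℤ_[p] L) : L) * ((ϖ : L) ^ n)⁻¹ = 1 := by
      field_simp
      exact hu2
    rw [this, one_smul]
  have hcomm : ∀ x : ℍ[L, α, β], s * x = x * s := by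
    intro x
    have hx : x ∈ Submodule.span ℚ_[p] (O : Set ℍ[L, α, β]) := by rw [h.max.1.2]; trivial
    induction hx using Submodule.span_induction with
    | mem x hx =>
      obtain ⟨y, -, z, hz, rfl, hyc, hzc⟩ := exists_decomp h hs hp hx
      have : z ∈ N := (hN z).2 ⟨hz, hzc⟩
      rw [hNbot, Submodule.mem_bot] at this
      rw [this, add_zero, hyc]
    | zero => simp
    | add x y _ _ hx hy => rw [mul_add, add_mul, hx, hy]
    | smul c x _ hx => rw [mul_smul_comm, smul_mul_assoc, hx]
  have h1 := hcomm ⟨0, 1, 0, 0⟩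
  have h2 := hcomm ⟨0, 0, 1, 0⟩
  have hre := hs.re_eq
  have hI := congrArg QuaternionAlgebra.imK h2
  have hJ := congrArg QuaternionAlgebra.imK h1
  have hK := congrArg QuaternionAlgebra.imJ h1
  simp only [QuaternionAlgebra.imK_mul, QuaternionAlgebra.imJ_mul, mul_zero, zero_mul, mul_one,
    one_mul, zero_add, add_zero, sub_zero, zero_sub] at hI hJ hK
  have h2 : (2 : L) ≠ 0 := two_ne_zero
  refine hs.ne_zero' (QuaternionAlgebra.ext hre ?_ ?_ ?_)
  · exact (mul_eq_zero.1 (show 2 * s.imI = 0 by linear_combination hI)).resolve_left h2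
  · exact (mul_eq_zero.1 (show 2 * s.imJ = 0 by linear_combination -hJ)).resolve_left h2
  · exact (mul_eq_zero.1 (show 2 * α * s.imK = 0 by linear_combination -hK)).resolve_left
      (mul_ne_zero h2 hα)

/-- Replacing η by (a + b s) η multiplies η² by the norm a² - θ b², chosen modulo ϖ by
`exists_nonsquare_norm`. -/
lemma exists_anticommute_nonsquare [IsDiscreteValuationRing (integralClosure ℤ_[p] L)]
    (hϖ : Irreducible ϖ) (hp : p ≠ 2) (hα : α ≠ 0) (hθ : IsUnit θ)
    (hpϖ : (p : integralClosure ℤ_[p] L) ∈ Ideal.span {ϖ}) :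
    ∃ η ∈ O, s * η = -(η * s) ∧ ∃ ε : integralClosure ℤ_[p] L, IsUnit ε ∧
      η * η = ((ε : L) : ℍ[L, α, β]) ∧ ∀ x, x ^ 2 - ε ∉ Ideal.span {ϖ} := by
  obtain ⟨η, hη, hsη, ε, hε, hηη⟩ := exists_anticommute h hs hϖ hp hα
  have hmax : (Ideal.span {ϖ}).IsMaximal := by
    rw [← hϖ.maximalIdeal_eq]; infer_instance
  have hfin := finite_integralClosure p L
  have := finite_quotient_of_p_mem (p := p) hpϖ
  let k := integralClosure ℤ_[p] L ⧸ Ideal.span {ϖ}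
  let _ : Field k := Ideal.Quotient.field _
  have : CharZero L := charZero_of_injective_algebraMap (algebraMap ℚ_[p] L).injective
  have h2 : IsUnit (2 : integralClosure ℤ_[p] L) :=
    IsUnit.of_mul_eq_one ⟨2⁻¹, IsSelfDualMaxOrder.two_inv_mem L hp⟩
      (Subtype.ext (mul_inv_cancel₀ two_ne_zero))
  let π : integralClosure ℤ_[p] L →+* k := Ideal.Quotient.mk _
  have hu : ∀ r, IsUnit r → π r ≠ 0 := fun r hr => (hr.map π).ne_zero
  obtain ⟨a, b, hab, hsq⟩ := exists_nonsquare_norm (k := k)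
    (by rw [← map_ofNat π 2]; exact hu _ h2) (hu θ hθ) (hu ε hε)
  obtain ⟨a, rfl⟩ := Ideal.Quotient.mk_surjective a
  obtain ⟨b, rfl⟩ := Ideal.Quotient.mk_surjective b
  change π a ^ 2 - π θ * π b ^ 2 ≠ 0 at hab
  change ∀ c, c ^ 2 ≠ (π a ^ 2 - π θ * π b ^ 2) * π ε at hsq
  rw [← map_pow, ← map_pow, ← map_mul, ← map_sub] at hab
  have hsO := mem h hs
  refine ⟨(((a : L) : ℍ[L, α, β]) + ((b : L) : ℍ[L, α, β]) * s) * η,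
    O.mul_mem (O.add_mem (h.coe_mem _ a.2) (O.mul_mem (h.coe_mem _ b.2) hsO)) hη, ?_,
    (a ^ 2 - θ * b ^ 2) * ε, IsUnit.mul (isUnit_of_not_mem_span hϖ fun hm =>
      hab (Ideal.Quotient.eq_zero_iff_mem.2 hm)) hε, ?_, fun x hx => ?_⟩
  · rw [mul_assoc _ η s, ← neg_eq_iff_eq_neg.2 hsη]
    simp only [QuaternionAlgebra.coe_mul_eq_smul, mul_add, add_mul, smul_mul_assoc, mul_smul_comm,
      mul_neg, neg_neg]
  · have h3 : η * (((a : L) : ℍ[L, α, β]) + ((b : L) : ℍ[L, α, β]) * s) =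
        (((a : L) : ℍ[L, α, β]) - ((b : L) : ℍ[L, α, β]) * s) * η := by
      rw [QuaternionAlgebra.coe_mul_eq_smul, mul_add, sub_mul, smul_mul_assoc, hsη,
        mul_smul_comm, smul_neg, sub_neg_eq_add, ← QuaternionAlgebra.coe_commutes]
    have h4 : (((a : L) : ℍ[L, α, β]) + ((b : L) : ℍ[L, α, β]) * s) *
        (((a : L) : ℍ[L, α, β]) - ((b : L) : ℍ[L, α, β]) * s) =
        (((a : L) ^ 2 - θ * (b : L) ^ 2 : L) : ℍ[L, α, β]) := by
      simp only [mul_sub, add_mul, mul_smul_comm, smul_mul_assoc, hs.mul_self, smul_smul,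
        QuaternionAlgebra.smul_coe, QuaternionAlgebra.coe_mul_eq_smul,
        QuaternionAlgebra.mul_coe_eq_smul, QuaternionAlgebra.coe_sub]
      rw [smul_add, smul_smul, QuaternionAlgebra.smul_coe,
        show (b : L) * (b * θ) = θ * b ^ 2 by ring, sq (a : L), mul_comm (b : L)]
      abel
    rw [mul_assoc, ← mul_assoc η, h3, ← mul_assoc, ← mul_assoc, h4, mul_assoc, hηη,
      ← QuaternionAlgebra.coe_mul]
    rfl
  · refine hsq (π x) ?_
    have := Ideal.Quotient.eq_zero_iff_mem.2 hx
    change π _ = 0 at this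
    rw [map_sub, sub_eq_zero] at this
    rw [← map_pow, this, map_mul, map_sub, map_pow, map_mul, map_pow]

end IsNormalizer

end Standard

/-! ### The standard presentation of the order -/

section Standard

variable {p : ℕ} [Fact p.Prime] {L : Type*} [Field L] [Algebra ℚ_[p] L]
  [Algebra ℤ_[p] L] {α β : L} [IsScalarTower ℤ_[p] ℚ_[p] L] [FiniteDimensional ℚ_[p] L]
  {O : Subalgebra ℤ_[p] ℍ[L, α, β]} {ℓ : ℍ[L, α, β] →ₗ[ℚ_[p]] ℚ_[p]}
  {ϖ θ : integralClosure ℤ_[p] L} {s : ℍ[L, α, β]} {μ : L →ₗ[ℚ_[p]] ℚ_[p]}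

/-- A presentation of an order `O` as a standard quaternion order over the ring of integers, in
which the functional `ℓ` is a functional of the coefficient of `j`. -/
structure IsStandard (O : Subalgebra ℤ_[p] ℍ[L, α, β]) (ℓ : ℍ[L, α, β] →ₗ[ℚ_[p]] ℚ_[p])
    (ε θ : integralClosure ℤ_[p] L)
    (v : ℍ[integralClosure ℤ_[p] L, ε, θ] →ₐ[integralClosure ℤ_[p] L] ℍ[L, α, β])
    (lam : integralClosure ℤ_[p] L →ₗ[ℤ_[p]] ℤ_[p]) : Prop where
  injective : Function.Injective v
  mem_iff (x) : x ∈ O ↔ ∃ q, v q = x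
  map_star (q) : v (star q) = star (v q)
  map_re (q) : (v q).re = q.re
  map_eq (q) : ℓ (v q) = lam q.imJ

lemma IsNormalizer.exists_isStandard [IsDiscreteValuationRing (integralClosure ℤ_[p] L)]
    (h : IsSelfDualMaxOrder O ℓ) (hs : IsNormalizer O ℓ ϖ θ s μ)
    (hϖ : Irreducible ϖ) (hp : p ≠ 2) {η : ℍ[L, α, β]} (hη : η ∈ O) (hsη : s * η = -(η * s))
    {ε : integralClosure ℤ_[p] L} (hε : IsUnit ε) (hηη : η * η = ((ε : L) : ℍ[L, α, β])) :
    ∃ v lam, IsStandard O ℓ ε θ v lam := by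
  have : CharZero L := charZero_of_injective_algebraMap (algebraMap ℚ_[p] L).injective
  have hre : η.re = 0 := hs.re_eq_zero_of_anticommute hsη
  have hre' : (η * s).re = 0 := hs.re_eq_zero_of_anticommute (by
    rw [← mul_assoc, hsη, neg_mul])
  have hsmul : ∀ (r : integralClosure ℤ_[p] L) (x : ℍ[L, α, β]), r • x = (r : L) • x :=
    fun r x => rfl
  let B : QuaternionAlgebra.Basis ℍ[L, α, β] ε 0 θ :=
    { i := η
      j := s
      k := η * s
      i_mul_i := by
        rw [hηη, zero_smul, add_zero, hsmul]
        ext <;> simp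
      j_mul_j := by
        rw [hs.mul_self, hsmul]
        ext <;> simp
      i_mul_j := rfl
      j_mul_i := by rw [hsη, zero_smul, zero_sub] }
  let v := QuaternionAlgebra.lift B
  have hv : ∀ q, v q = ((q.re : L) : ℍ[L, α, β]) + (q.imI : L) • η + (q.imJ : L) • s +
      (q.imK : L) • (η * s) := fun q => by
    change algebraMap _ _ q.re + q.imI • η + q.imJ • s + q.imK • (η * s) = _
    rfl
  have hvre : ∀ q, (v q).re = q.re := fun q => by
    rw [hv]
    simp [hre, hs.re_eq, hre', -QuaternionAlgebra.re_mul]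
  have hvi : v ⟨0, 1, 0, 0⟩ = η := by rw [hv]; simp
  have hvj : v ⟨0, 0, 1, 0⟩ = s := by rw [hv]; simp
  have hmul_s : ∀ q, ((v q) * s).re = θ * q.imJ := fun q => by
    rw [← hvj, ← map_mul, hvre]
    simp
  have hlam : ∀ r : integralClosure ℤ_[p] L, ‖μ (θ * r)‖ ≤ 1 := norm_map_le h hs
  refine ⟨v, { toFun := fun r => ⟨μ (θ * r), hlam r⟩, map_add' := ?_, map_smul' := ?_ },
    ?_, ?_, ?_, hvre, ?_⟩
  · intro x y
    refine Subtype.ext ?_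
    change μ (θ * (x + y)) = μ (θ * x) + μ (θ * y)
    rw [mul_add, map_add]
  · intro c x
    refine Subtype.ext ?_
    change μ (θ * (c • (x : L))) = (c : ℚ_[p]) • μ (θ * x)
    rw [← map_smul, mul_smul_comm]
    congr 1
    exact (IsScalarTower.algebraMap_smul ℚ_[p] c _).symm
  -- Real parts are preserved, so re(q q') = 0 for every q' when q is in the kernel. Testing on 1,
  -- i, j, k gives q = 0, as ε and θ are nonzero.
  · refine (injective_iff_map_eq_zero v).2 fun q hq => ?_
    have h1 : ∀ q', (q * q').re = 0 := fun q' => by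
      have := hvre (q * q')
      rw [map_mul, hq, zero_mul] at this
      exact Subtype.ext this.symm
    have hθ0 := hs.ne_zero
    have e1 := h1 1
    have e2 := h1 ⟨0, 1, 0, 0⟩
    have e3 := h1 ⟨0, 0, 1, 0⟩
    have e4 := h1 ⟨0, 0, 0, 1⟩
    simp [hε.ne_zero, hθ0] at e1 e2 e3 e4
    ext <;> simp [*]
  · have hηs : ∀ a b : L, ((a : ℍ[L, α, β]) + (b : ℍ[L, α, β]) * s) * η =
        a • η - b • (η * s) := fun a b => by
      rw [add_mul, QuaternionAlgebra.coe_mul_eq_smul, QuaternionAlgebra.coe_mul_eq_smul,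
        smul_mul_assoc, hsη, smul_neg, sub_eq_add_neg]
    intro x
    constructor
    · intro hx
      obtain ⟨y, hy, z, hz, rfl, hyc, hzc⟩ := exists_decomp h hs hp hx
      obtain ⟨a, b, rfl⟩ := eq_of_commute h hs hϖ hp hy hyc
      -- The product of the anticommuting part z with η commutes with s, hence is c + d s; then z is
      -- recovered as ε⁻¹ (z η) η.
      obtain ⟨c, d, hcd⟩ := eq_of_commute h hs hϖ hp (O.mul_mem hz hη) (by
        rw [← mul_assoc, hzc, neg_mul, mul_assoc, hsη, mul_neg, neg_neg, mul_assoc])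
      obtain ⟨u, rfl⟩ := hε
      have hu : ((u : integralClosure ℤ_[p] L) : L) * ((↑u⁻¹ : integralClosure ℤ_[p] L) : L) = 1 :=
        congrArg Subtype.val (Units.mul_inv u)
      have hz' : z = ((↑u⁻¹ : integralClosure ℤ_[p] L) : L) • (z * η * η) := by
        rw [mul_assoc, hηη, QuaternionAlgebra.mul_coe_eq_smul, smul_smul, mul_comm, hu, one_smul]
      refine ⟨⟨a, ↑u⁻¹ * c, b, -(↑u⁻¹ * d)⟩, ?_⟩
      rw [hz', hcd, hηs, hv, QuaternionAlgebra.coe_mul_eq_smul, smul_sub, smul_smul, smul_smul]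
      change _ + (_ * _ : L) • _ + _ + (-(_ * _) : L) • _ = _
      rw [neg_smul]
      abel
    · rintro ⟨q, rfl⟩
      have hm : ∀ (r : integralClosure ℤ_[p] L), ∀ x ∈ O, (r : L) • x ∈ O := fun r x hx => by
        rw [← QuaternionAlgebra.coe_mul_eq_smul]
        exact O.mul_mem (h.coe_mem _ r.2) hx
      have hsO := mem h hs
      rw [hv]
      exact O.add_mem (O.add_mem (O.add_mem (h.coe_mem _ q.re.2) (hm _ _ hη)) (hm _ _ hsO))
        (hm _ _ (O.mul_mem hη hsO))
  · intro q
    have h1 : v (q + star q) = v q + star (v q) := by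
      rw [QuaternionAlgebra.self_add_star', QuaternionAlgebra.self_add_star', hvre]
      have : ((2 * q.re + 0 * q.imI : integralClosure ℤ_[p] L) : ℍ[integralClosure ℤ_[p] L, ε, θ]) =
        algebraMap _ _ (2 * q.re + 0 * q.imI) := rfl
      rw [this, AlgHom.commutes]
      rw [zero_mul, zero_mul, add_zero, add_zero]
      rfl
    rw [map_add] at h1
    exact add_left_cancel h1
  · intro q
    rw [hs.map_eq, hmul_s]
    rfl

end Standard

/-! ### The reduced norm and the Cayley–Hamilton theorem -/

section QuaternionNorm

variable {A : Type*} [CommRing A] {a b : A}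

lemma quat_mul_star_eq_coe (x : ℍ[A, a, b]) : x * star x = ((x * star x).re : ℍ[A, a, b]) := by
  ext <;> simp <;> ring

lemma quat_mul_self_eq (x : ℍ[A, a, b]) :
    x ^ 2 - (2 * x.re) • x + ((x * star x).re : ℍ[A, a, b]) = 0 := by
  rw [sq]
  ext <;> simp [-QuaternionAlgebra.coe_mul] <;> ring

lemma isUnit_nrd {x y : ℍ[A, a, b]} (h : x * y = 1) : IsUnit (x * star x).re := by
  refine IsUnit.of_mul_eq_one (y * star y).re (QuaternionAlgebra.coe_injective (c₁ := a) (c₂ := 0)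
    (c₃ := b) ?_)
  rw [QuaternionAlgebra.coe_mul, ← quat_mul_star_eq_coe x, mul_assoc,
    ← QuaternionAlgebra.coe_commutes, ← quat_mul_star_eq_coe, mul_assoc, ← star_mul, ← mul_assoc, h,
    star_one, one_mul, QuaternionAlgebra.coe_one]

end QuaternionNorm

section CayleyHamilton

variable {p : ℕ} [Fact p.Prime] {R : Type*} [CommRing R] [Algebra ℤ_[p] R] {ε θ : R}
  {ι : Type*} [Fintype ι] [DecidableEq ι] (bR : Module.Basis ι ℤ_[p] R)

/-- By the quadratic equation of x, the matrix X² - T X + N evaluated at x kills the column of basis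
elements of R. Multiplying by the adjugate replaces the matrix by its determinant. -/
lemma aeval_rcp (x : ℍ[R, ε, θ]) : aeval x (rcp bR x) = 0 := by
  set T := Algebra.leftMulMatrix bR (2 * x.re) with hT
  set N := Algebra.leftMulMatrix bR (x * star x).re with hN
  set M : Matrix ι ι ℤ_[p][X] := (X : ℤ_[p][X]) ^ 2 • 1 - (X : ℤ_[p][X]) • T.map C + N.map C with hM
  have hdet : rcp bR x = M.det := rfl
  have hlm : ∀ (r : R) (j : ι), ∑ i, Algebra.leftMulMatrix bR r i j • bR i = r * bR j :=
    fun r j => by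
      simp only [Algebra.leftMulMatrix_eq_repr_mul]
      exact bR.sum_repr _
  have hcol : ∀ j, ∑ i, aeval x (M i j) * (bR i : ℍ[R, ε, θ]) = 0 := by
    intro j
    have h1 : ∀ i, aeval x (M i j) * (bR i : ℍ[R, ε, θ]) =
        x ^ 2 * ((if i = j then bR i else 0 : R) : ℍ[R, ε, θ]) - x * ((T i j • bR i : R) : ℍ[R, ε, θ])
          + ((N i j • bR i : R) : ℍ[R, ε, θ]) := by
      intro i
      have h2 : ∀ (c : ℤ_[p]) (r : R), ((c • r : R) : ℍ[R, ε, θ]) = c • (r : ℍ[R, ε, θ]) :=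
        fun c r => by ext <;> simp
      simp only [hM, Matrix.add_apply, Matrix.sub_apply, Matrix.smul_apply, Matrix.map_apply,
        Matrix.one_apply, smul_eq_mul, map_add, map_sub, map_mul, map_pow, aeval_X, aeval_C, h2,
        add_mul, sub_mul, Algebra.algebraMap_eq_smul_one, smul_mul_assoc, mul_smul_comm, one_mul,
        mul_one]
      by_cases hij : i = j <;> simp [hij]
    have h3 : ∀ f : ι → R, ∑ i, ((f i : R) : ℍ[R, ε, θ]) = ((∑ i, f i : R) : ℍ[R, ε, θ]) :=
      fun f => (map_sum (algebraMap R ℍ[R, ε, θ]) f Finset.univ).symm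
    rw [Finset.sum_congr rfl fun i _ => h1 i, Finset.sum_add_distrib, Finset.sum_sub_distrib,
      ← Finset.mul_sum, ← Finset.mul_sum, h3, h3, h3, hlm, hlm]
    rw [Finset.sum_ite_eq' Finset.univ j, if_pos (Finset.mem_univ _), QuaternionAlgebra.coe_mul,
      QuaternionAlgebra.coe_mul (y := bR j), ← mul_assoc, ← sub_mul, ← add_mul]
    rw [QuaternionAlgebra.mul_coe_eq_smul (2 * x.re) x, quat_mul_self_eq, zero_mul]
  have hk : ∀ k, aeval x (rcp bR x) * (bR k : ℍ[R, ε, θ]) = 0 := by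
    intro k
    have h1 : ∑ j, aeval x (M.adjugate j k) * ∑ i, aeval x (M i j) * (bR i : ℍ[R, ε, θ]) = 0 := by
      simp [hcol]
    simp only [Finset.mul_sum] at h1
    rw [Finset.sum_comm] at h1
    have h2 : ∀ i, ∑ j, aeval x (M.adjugate j k) * (aeval x (M i j) * (bR i : ℍ[R, ε, θ])) =
        aeval x ((M * M.adjugate) i k) * (bR i : ℍ[R, ε, θ]) := by
      intro i
      rw [Matrix.mul_apply, map_sum, Finset.sum_mul]
      refine Finset.sum_congr rfl fun j _ => ?_
      rw [← mul_assoc, ← map_mul, mul_comm]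
    rw [Finset.sum_congr rfl fun i _ => h2 i, Matrix.mul_adjugate,
      Finset.sum_eq_single k (fun i _ hik => by simp [Matrix.one_apply_ne hik]) (by simp)] at h1
    simpa [hdet] using h1
  have h1 : (1 : ℍ[R, ε, θ]) = ∑ k, bR.repr 1 k • (bR k : ℍ[R, ε, θ]) := by
    have := congrArg (algebraMap R ℍ[R, ε, θ]) (bR.sum_repr 1)
    rw [RingHom.map_one, map_sum] at this
    rw [← this]
    refine Finset.sum_congr rfl fun k _ => ?_
    change ((bR.repr 1 k • bR k : R) : ℍ[R, ε, θ]) = _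
    ext <;> simp
  rw [← mul_one (aeval x _), h1, Finset.mul_sum]
  refine Finset.sum_eq_zero fun k _ => ?_
  rw [mul_smul_comm, hk, smul_zero]

/-- The constant coefficient is the determinant of multiplication by the reduced norm. -/
lemma isUnit_coeff_zero_rcp {x y : ℍ[R, ε, θ]} (h : x * y = 1) : IsUnit ((rcp bR x).coeff 0) := by
  have h1 : (rcp bR x).coeff 0 = (Algebra.leftMulMatrix bR (x * star x).re).det := by
    rw [coeff_zero_eq_eval_zero, ← coe_evalRingHom, rcp, quadDet, RingHom.map_det]
    congr 1
    ext i j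
    simp
  rw [h1]
  exact (Matrix.isUnit_iff_isUnit_det _).1 ((isUnit_nrd h).map (Algebra.leftMulMatrix bR))

end CayleyHamilton

/-! ### Unit generators of quadratic suborders -/

section Generator

variable {p : ℕ} [Fact p.Prime] {R : Type*} [CommRing R] [Algebra ℤ_[p] R]
  {ε θ : R} {ι : Type*} [Fintype ι] [DecidableEq ι] (bR : Module.Basis ι ℤ_[p] R)

/-- Take for w the image of a unit generating the quadratic algebra and for E its reduced
characteristic polynomial, which kills w and has unit constant term because w is invertible. -/
lemma exists_isLocalGenerator_of_algHom {c : R} {ϖ : QuadraticAlgebra R c 0} {N : ℕ}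
    (hmax : (Ideal.span {ϖ}).IsMaximal) (hp : (p : QuadraticAlgebra R c 0) ∈ Ideal.span {ϖ})
    (hN : ϖ ^ N ∈ Ideal.span {(p : QuadraticAlgebra R c 0)})
    (f : QuadraticAlgebra R c 0 →ₐ[R] ℍ[R, ε, θ]) :
    ∃ w, IsLocalGenerator bR ε θ 1 (fun a b => f ⟨a, b⟩) w := by
  have : Module.Finite ℤ_[p] R := .of_basis bR
  have : Module.Finite ℤ_[p] (QuadraticAlgebra R c 0) := .trans R _
  obtain ⟨w, ⟨u, rfl⟩, hw⟩ := exists_isUnit_adjoin_eq_top hmax hp hN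
  refine ⟨f u, by simp, ⟨rcp bR (f u), isUnit_coeff_zero_rcp bR (y := f ↑u⁻¹) ?_, ?_, dvd_rfl⟩,
    fun a b => ?_⟩
  · rw [← map_mul, Units.mul_inv, map_one]
  · rw [aeval_rcp, zero_mul]
  · obtain ⟨P, hP⟩ := hw ⟨a, b⟩
    refine ⟨P, ?_⟩
    rw [hP]
    simp only [QuaternionAlgebra.coe_one, one_mul, mul_one]
    exact (aeval_algHom_apply (f.restrictScalars ℤ_[p]) (u : QuadraticAlgebra R c 0) P).symm

/-- The quadratic subalgebra generated by `i` if `ε` is not a square modulo `ϖ`, or by `j` if `θ`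
is a uniformizer, is generated by a unit over `ℤ_p`. -/
theorem exists_isLocalGenerator [IsDomain R] [IsDiscreteValuationRing R] {ϖ : R}
    (hϖ : Irreducible ϖ) {n : ℕ} (hn : Associated (ϖ ^ n) (p : R)) (hpϖ : (p : R) ∈ Ideal.span {ϖ})
    (h : (∀ x, x ^ 2 - ε ∉ Ideal.span {ϖ}) ∨ Associated ϖ θ) :
    (∃ w, IsLocalGenerator bR ε θ 1 (fun a b => ⟨a, b, 0, 0⟩) w) ∨
      ∃ w, IsLocalGenerator bR ε θ 1 (fun a b => ⟨a, 0, b, 0⟩) w := by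
  have hprime : (Ideal.span {ϖ}).IsPrime := by
    rw [← hϖ.maximalIdeal_eq]; infer_instance
  rcases h with h | h
  · left
    let f : QuadraticAlgebra R ε 0 →ₐ[R] ℍ[R, ε, θ] := QuadraticAlgebra.lift ⟨⟨0, 1, 0, 0⟩, by
      ext <;> simp⟩
    have hf : ∀ a b, f ⟨a, b⟩ = ⟨a, b, 0, 0⟩ := fun a b => by
      change a • (1 : ℍ[R, ε, θ]) + b • ⟨0, 1, 0, 0⟩ = _
      ext <;> simp
    let ϖ' := algebraMap R (QuadraticAlgebra R ε 0) ϖ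
    have hmem : ∀ x, x ∈ Ideal.span {ϖ'} ↔ ϖ ∣ x.re ∧ ϖ ∣ x.im := fun x => by
      rw [Ideal.mem_span_singleton, QuadraticAlgebra.algebraMap_dvd_iff]
    -- R[i] is unramified: if ϖ divides the norm re² - ε im² and im were a unit, ε would be a square
    -- modulo ϖ. So ϖ divides both components, and elements outside (ϖ) are units.
    have hmax : (Ideal.span {ϖ'}).IsMaximal := by
      refine Ideal.isMaximal_iff.2 ⟨fun h1 => ?_, fun J x hJ hx hxJ => ?_⟩
      · exact hϖ.not_isUnit (isUnit_of_dvd_one ((hmem 1).1 h1).1)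
      · have hu : IsUnit x := by
          rw [QuadraticAlgebra.isUnit_iff_norm_isUnit]
          refine isUnit_of_not_mem_span hϖ fun hno => hx ((hmem x).2 ?_)
          rw [QuadraticAlgebra.norm_def, zero_mul, zero_mul, add_zero] at hno
          have him : x.im ∈ Ideal.span {ϖ} := by
            by_contra him
            obtain ⟨u, hu⟩ := isUnit_of_not_mem_span hϖ him
            refine h (x.re * ↑u⁻¹) ?_
            have := Ideal.mul_mem_right ((↑u⁻¹ : R) ^ 2) _ hno
            convert this using 1
            rw [← hu]
            have h1 : (u : R) * ↑u⁻¹ = 1 := Units.mul_inv u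
            linear_combination ε * ((u : R) * ↑u⁻¹ + 1) * h1
          have hre : x.re * x.re ∈ Ideal.span {ϖ} := by
            have := Ideal.add_mem _ hno (Ideal.mul_mem_left _ (ε * x.im) him)
            rwa [sub_add_cancel] at this
          exact ⟨Ideal.mem_span_singleton.1 ((hprime.mem_or_mem hre).elim id id),
            Ideal.mem_span_singleton.1 him⟩
        have := J.mul_mem_left (↑hu.unit⁻¹) hxJ
        rwa [IsUnit.val_inv_mul] at this
    have hp' : (p : QuadraticAlgebra R ε 0) ∈ Ideal.span {ϖ'} := by
      rw [Ideal.mem_span_singleton] at hpϖ ⊢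
      simpa using map_dvd (algebraMap R (QuadraticAlgebra R ε 0)) hpϖ
    obtain ⟨w, hw⟩ := exists_isLocalGenerator_of_algHom bR (N := n) hmax hp' (by
      rw [Ideal.mem_span_singleton, ← map_pow]
      simpa using map_dvd (algebraMap R (QuadraticAlgebra R ε 0)) hn.symm.dvd) f
    simp only [hf] at hw
    exact ⟨w, hw⟩
  · right
    let f : QuadraticAlgebra R θ 0 →ₐ[R] ℍ[R, ε, θ] := QuadraticAlgebra.lift ⟨⟨0, 0, 1, 0⟩, by
      ext <;> simp⟩
    have hf : ∀ a b, f ⟨a, b⟩ = ⟨a, 0, b, 0⟩ := fun a b => by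
      change a • (1 : ℍ[R, ε, θ]) + b • ⟨0, 0, 1, 0⟩ = _
      ext <;> simp
    -- R[j] is totally ramified with uniformizer j, because j² = θ is a uniformizer of R.
    let ϖ' : QuadraticAlgebra R θ 0 := ⟨0, 1⟩
    have hsq : ϖ' ^ 2 = algebraMap R (QuadraticAlgebra R θ 0) θ := by
      rw [sq]
      ext <;> simp [ϖ']
    have hspan : Ideal.span {θ} = Ideal.span {ϖ} := Ideal.span_singleton_eq_span_singleton.2 h.symm
    have hθ0 : Irreducible θ := h.irreducible hϖ
    have hmem : ∀ x, x ∈ Ideal.span {ϖ'} ↔ θ ∣ x.re := fun x => by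
      rw [Ideal.mem_span_singleton]
      constructor
      · rintro ⟨y, rfl⟩
        exact ⟨y.im, by simp [ϖ']⟩
      · rintro ⟨y, hy⟩
        refine ⟨⟨x.im, y⟩, ?_⟩
        ext <;> simp [ϖ', hy]
    have hmax : (Ideal.span {ϖ'}).IsMaximal := by
      refine Ideal.isMaximal_iff.2 ⟨fun h1 => ?_, fun J x hJ hx hxJ => ?_⟩
      · exact hθ0.not_isUnit (isUnit_of_dvd_one ((hmem 1).1 h1))
      · have hu : IsUnit x := by
          rw [QuadraticAlgebra.isUnit_iff_norm_isUnit]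
          refine isUnit_of_not_mem_span hϖ fun hno => hx ((hmem x).2 ?_)
          rw [QuadraticAlgebra.norm_def, zero_mul, zero_mul, add_zero] at hno
          have hre : x.re * x.re ∈ Ideal.span {ϖ} := by
            have hθm : θ ∈ Ideal.span {ϖ} := hspan ▸ Ideal.mem_span_singleton_self θ
            have := Ideal.add_mem _ hno (Ideal.mul_mem_right (x.im * x.im) _ hθm)
            convert this using 1
            ring
          rw [← Ideal.mem_span_singleton, hspan]
          exact (hprime.mem_or_mem hre).elim id id
        have := J.mul_mem_left (↑hu.unit⁻¹) hxJ
        rwa [IsUnit.val_inv_mul] at this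
    have hp' : (p : QuadraticAlgebra R θ 0) ∈ Ideal.span {ϖ'} := by
      rw [hmem, ← Ideal.mem_span_singleton, hspan]
      simpa using hpϖ
    obtain ⟨w, hw⟩ := exists_isLocalGenerator_of_algHom bR (N := 2 * n) hmax hp' (by
      rw [Ideal.mem_span_singleton, pow_mul, hsq, ← map_pow]
      simpa using map_dvd (algebraMap R (QuadraticAlgebra R θ 0))
        (hn.symm.trans (h.pow_pow)).dvd) f
    simp only [hf] at hw
    exact ⟨w, hw⟩

end Generator

section LocalStructure

variable {p : ℕ} [Fact p.Prime]

/-- A basis of a ring of integers adapted to its unramified part `ℤ_p[ζ]` and to `θ`. -/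
structure IsUnramifiedBasis {R : Type*} [CommRing R] [Algebra ℤ_[p] R] (θ : R) (f : ℤ_[p][X]) (ζ : R)
    {n : ℕ} (b : Module.Basis (Fin f.natDegree × Fin n) ℤ_[p] R) : Prop where
  monic : f.Monic
  root : aeval ζ f = 0
  separable : ∃ A B C : ℤ_[p][X], A * f + B * derivative f = 1 + (p : ℤ_[p][X]) * C
  apply (x) : b x = ζ ^ (x.1 : ℕ) * θ ^ (x.2 : ℕ)

variable {L : Type*} [Field L] [Algebra ℚ_[p] L]
  [Algebra ℤ_[p] L] {α β : L} [IsScalarTower ℤ_[p] ℚ_[p] L] [FiniteDimensional ℚ_[p] L]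
  {O : Subalgebra ℤ_[p] ℍ[L, α, β]} {ℓ : ℍ[L, α, β] →ₗ[ℚ_[p]] ℚ_[p]}

theorem IsSelfDualMaxOrder.exists_isStandard (h : IsSelfDualMaxOrder O ℓ) (hp : p ≠ 2)
    (hα : α ≠ 0) (hβ : β ≠ 0) :
    ∃ (ε θ : integralClosure ℤ_[p] L) (v : _) (lam : _), IsStandard O ℓ ε θ v lam ∧ IsUnit ε ∧
      θ ≠ 0 ∧ (∀ (d : ℕ) (b : Module.Basis (Fin d) ℤ_[p] (integralClosure ℤ_[p] L)),
        (∃ w, IsLocalGenerator b ε θ 1 (fun a b => ⟨a, b, 0, 0⟩) w) ∨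
          ∃ w, IsLocalGenerator b ε θ 1 (fun a b => ⟨a, 0, b, 0⟩) w) ∧
      ∃ (f : ℤ_[p][X]) (ζ : integralClosure ℤ_[p] L) (n : ℕ)
        (b : Module.Basis (Fin f.natDegree × Fin n) ℤ_[p] (integralClosure ℤ_[p] L)),
        0 < n ∧ IsUnramifiedBasis θ f ζ b := by
  have := isDiscreteValuationRing_integralClosure p L
  have := finite_integralClosure p L
  have := free_integralClosure p L
  have : CharZero L := charZero_of_injective_algebraMap (algebraMap ℚ_[p] L).injective
  obtain ⟨ϖ, hϖ⟩ := IsDiscreteValuationRing.exists_irreducible (integralClosure ℤ_[p] L)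
  have hmax : (Ideal.span {ϖ}).IsMaximal := by
    rw [← hϖ.maximalIdeal_eq]; infer_instance
  have hp0 : (p : integralClosure ℤ_[p] L) ≠ 0 := fun h0 => by
    have h1 : ((p : ℕ) : L) = 0 := by simpa using congrArg Subtype.val h0
    exact (Fact.out : p.Prime).ne_zero (Nat.cast_eq_zero.1 h1)
  have hpu : ¬ IsUnit (p : integralClosure ℤ_[p] L) := by
    rintro ⟨u, hu⟩
    have h1 := isUnit_one_add_p_mul (p := p) (-(↑u⁻¹ : integralClosure ℤ_[p] L))
    rw [← hu, mul_neg, Units.mul_inv, add_neg_cancel] at h1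
    exact not_isUnit_zero h1
  have hpϖ : (p : integralClosure ℤ_[p] L) ∈ Ideal.span {ϖ} := by
    by_contra h0
    exact hpu (isUnit_of_not_mem_span hϖ h0)
  obtain ⟨n, hn'⟩ := IsDiscreteValuationRing.associated_pow_irreducible hp0 hϖ
  have hn := hn'.symm
  have hn0 : 0 < n := by
    rw [Nat.pos_iff_ne_zero]
    rintro rfl
    rw [pow_zero] at hn
    exact hpu (hn.isUnit isUnit_one)
  obtain ⟨f, ζ, hf, hζ, hsep, hres, hbasis⟩ := exists_unramified_root hmax hn
  obtain ⟨θ, s, μ, hs, hθ⟩ := h.exists_isNormalizer hp hα hβ hϖ hres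
  obtain ⟨b, hb⟩ := hbasis θ (by
    rcases hθ with ⟨-, hQ⟩ | hQ
    · exact hQ
    · exact ⟨0, by rwa [map_zero, sub_zero]⟩)
  have key : ∃ η ∈ O, s * η = -(η * s) ∧ ∃ ε : integralClosure ℤ_[p] L, IsUnit ε ∧
      η * η = ((ε : L) : ℍ[L, α, β]) ∧ ((∀ x, x ^ 2 - ε ∉ Ideal.span {ϖ}) ∨ Associated ϖ θ) := by
    rcases hθ with ⟨hθ, -⟩ | hθ
    · obtain ⟨η, hη, hsη, ε, hε, hηη, hns⟩ :=
        IsNormalizer.exists_anticommute_nonsquare h hs hϖ hp hα hθ hpϖ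
      exact ⟨η, hη, hsη, ε, hε, hηη, Or.inl hns⟩
    · obtain ⟨η, hη, hsη, ε, hε, hηη⟩ := IsNormalizer.exists_anticommute h hs hϖ hp hα
      exact ⟨η, hη, hsη, ε, hε, hηη, Or.inr hθ⟩
  obtain ⟨η, hη, hsη, ε, hε, hηη, hεθ⟩ := key
  obtain ⟨v, lam, hv⟩ := hs.exists_isStandard h hϖ hp hη hsη hε hηη
  exact ⟨ε, θ, v, lam, hv, hε, hs.ne_zero, fun d b => exists_isLocalGenerator b hϖ hn hpϖ hεθ,
    f, ζ, n, b, hn0, ⟨hf, hζ, hsep, hb⟩⟩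

end LocalStructure

/-! ### Quaternion algebras over products of rings -/

section QuaternionProduct

variable {k : Type*} [CommRing k] {I : Type*} {R : I → Type*} [∀ i, CommRing (R i)]
  [∀ i, Algebra k (R i)] {ε θ : ∀ i, R i}

variable (k) in
/-- The projections of a quaternion algebra over a product of rings. -/
def quatProj (i : I) : ℍ[(∀ i, R i), ε, θ] →ₐ[k] ℍ[R i, ε i, θ i] :=
  AlgHom.ofLinearMap
    { toFun := fun x => ⟨x.re i, x.imI i, x.imJ i, x.imK i⟩
      map_add' := fun x y => by ext <;> simp
      map_smul' := fun c x => by ext <;> simp }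
    (by ext <;> simp)
    (fun x y => by ext <;> simp)

@[simp] lemma quatProj_re (i : I) (x : ℍ[(∀ i, R i), ε, θ]) : (quatProj k i x).re = x.re i := rfl
@[simp] lemma quatProj_imI (i : I) (x : ℍ[(∀ i, R i), ε, θ]) : (quatProj k i x).imI = x.imI i := rfl
@[simp] lemma quatProj_imJ (i : I) (x : ℍ[(∀ i, R i), ε, θ]) : (quatProj k i x).imJ = x.imJ i := rfl
@[simp] lemma quatProj_imK (i : I) (x : ℍ[(∀ i, R i), ε, θ]) : (quatProj k i x).imK = x.imK i := rfl

lemma quatProj_star (i : I) (x : ℍ[(∀ i, R i), ε, θ]) :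
    quatProj k i (star x) = star (quatProj k i x) := by
  ext <;> simp

variable (k) in
/-- A quaternion algebra over a product of rings is a product of quaternion algebras. -/
noncomputable def quatPiEquiv : ℍ[(∀ i, R i), ε, θ] ≃ₐ[k] ∀ i, ℍ[R i, ε i, θ i] :=
  AlgEquiv.ofBijective (AlgHom.pi (quatProj k))
    ⟨fun x y h => by
      have h' : ∀ i, quatProj k i x = quatProj k i y := fun i => congrFun h i
      ext i
      · exact congrArg QuaternionAlgebra.re (h' i)
      · exact congrArg QuaternionAlgebra.imI (h' i)
      · exact congrArg QuaternionAlgebra.imJ (h' i)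
      · exact congrArg QuaternionAlgebra.imK (h' i),
    fun y => ⟨⟨fun i => (y i).re, fun i => (y i).imI, fun i => (y i).imJ, fun i => (y i).imK⟩, rfl⟩⟩

@[simp] lemma quatPiEquiv_apply (x : ℍ[(∀ i, R i), ε, θ]) (i : I) :
    quatPiEquiv k x i = quatProj k i x := rfl

variable (k) in
lemma quat_ext_proj {x y : ℍ[(∀ i, R i), ε, θ]} (h : ∀ i, quatProj k i x = quatProj k i y) :
    x = y :=
  (quatPiEquiv k).injective (funext h)

lemma quatProj_coe (i : I) (r : ∀ i, R i) :
    quatProj k i (r : ℍ[(∀ i, R i), ε, θ]) = (r i : ℍ[R i, ε i, θ i]) := by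
  ext <;> simp

end QuaternionProduct

section ReducedCharpolyProduct

variable {p : ℕ} [Fact p.Prime] {I : Type*} [Fintype I] [LinearOrder I] {R : I → Type*}
  [∀ i, CommRing (R i)] [∀ i, Algebra ℤ_[p] (R i)] {ε θ : ∀ i, R i}

lemma quadDet_reindex {B ι ι' : Type*} [CommRing B] [Fintype ι] [DecidableEq ι] [Fintype ι']
    [DecidableEq ι'] (e : ι' ≃ ι) (t n : Matrix ι ι B) :
    quadDet (t.submatrix e e) (n.submatrix e e) = quadDet t n := by
  rw [quadDet, quadDet, ← Matrix.det_submatrix_equiv_self e]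
  congr 1
  ext i j
  simp [Matrix.one_apply]

lemma det_blockDiagonal' {B : Type*} [CommRing B] {d : I → Type*} [∀ i, Fintype (d i)]
    [∀ i, DecidableEq (d i)] (M : ∀ i, Matrix (d i) (d i) B) :
    (Matrix.blockDiagonal' M).det = ∏ i, (M i).det := by
  rw [(Matrix.blockTriangular_blockDiagonal' M).det_fintype]
  refine Finset.prod_congr rfl fun i _ => ?_
  rw [← Matrix.det_submatrix_equiv_self (Equiv.sigmaSubtype i).symm]
  congr 1
  ext a b
  simp [Matrix.toSquareBlock_def, Equiv.sigmaSubtype, Matrix.blockDiagonal'_apply]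

lemma quadDet_blockDiagonal' {B : Type*} [CommRing B] {d : I → Type*} [∀ i, Fintype (d i)]
    [∀ i, DecidableEq (d i)] (t n : ∀ i, Matrix (d i) (d i) B) :
    quadDet (Matrix.blockDiagonal' t) (Matrix.blockDiagonal' n) = ∏ i, quadDet (t i) (n i) := by
  simp only [quadDet]
  rw [← det_blockDiagonal']
  congr 1
  ext ⟨i, a⟩ ⟨j, b⟩
  by_cases h : i = j
  · subst h
    simp [Matrix.blockDiagonal'_apply, Matrix.one_apply]
  · simp [Matrix.blockDiagonal'_apply, h]

variable {d : I → Type*} [∀ i, Fintype (d i)] [∀ i, DecidableEq (d i)]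
  (b : ∀ i, Module.Basis (d i) ℤ_[p] (R i))

lemma leftMulMatrix_pi (x : ∀ i, R i) : Algebra.leftMulMatrix (Pi.basis b) x =
    Matrix.blockDiagonal' fun i => Algebra.leftMulMatrix (b i) (x i) := by
  ext ⟨i, a⟩ ⟨j, c⟩
  rw [Algebra.leftMulMatrix_eq_repr_mul, Matrix.blockDiagonal'_apply, Pi.basis_repr, Pi.basis_apply]
  by_cases h : i = j
  · subst h
    simp [Algebra.leftMulMatrix_eq_repr_mul]
  · simp [h]

lemma rcp_pi {d' : Type*} [Fintype d'] [DecidableEq d'] (e : (Σ i, d i) ≃ d')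
    (x : ℍ[(∀ i, R i), ε, θ]) :
    rcp ((Pi.basis b).reindex e) x = ∏ i, rcp (b i) (quatProj ℤ_[p] i x) := by
  have h : ∀ y, Algebra.leftMulMatrix ((Pi.basis b).reindex e) y =
      (Matrix.blockDiagonal' fun i => Algebra.leftMulMatrix (b i) (y i)).submatrix e.symm e.symm := by
    intro y
    rw [← leftMulMatrix_pi]
    ext i j
    simp [Algebra.leftMulMatrix_eq_repr_mul]
  rw [rcp, h, h, quadDet_reindex, quadDet_blockDiagonal']
  refine Finset.prod_congr rfl fun i _ => ?_
  rw [rcp, quatProj_re, ← quatProj_star, ← map_mul, quatProj_re]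
  rfl

/-- The generator is extended by zero to the other factors and need no longer be a unit; its reduced
characteristic polynomial gains factors from them. This is why only a divisor E of it with unit
constant term is recorded. -/
lemma isLocalGenerator_single {d' : Type*} [Fintype d'] [DecidableEq d'] (e : (Σ i, d i) ≃ d') (i : I)
    (g : (∀ i, R i) → (∀ i, R i) → ℍ[(∀ i, R i), ε, θ]) {g' : R i → R i → ℍ[R i, ε i, θ i]}
    (hg : ∀ a b, quatProj ℤ_[p] i (g a b) = g' (a i) (b i)) {w : ℍ[R i, ε i, θ i]}
    (h : IsLocalGenerator (b i) (ε i) (θ i) 1 g' w) :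
    ∃ w, IsLocalGenerator ((Pi.basis b).reindex e) ε θ (Pi.single i 1) g w := by
  obtain ⟨w', hw'⟩ := (quatPiEquiv (ε := ε) (θ := θ) ℤ_[p]).surjective (Pi.single i w)
  have hi : quatProj ℤ_[p] i w' = w := by
    have := congrFun hw' i
    rwa [Pi.single_eq_same] at this
  have hcoe : ∀ j, j ≠ i → quatProj ℤ_[p] j
      ((Pi.single i 1 : ∀ i, R i) : ℍ[(∀ i, R i), ε, θ]) = 0 := fun j hj => by
    rw [quatProj_coe, Pi.single_eq_of_ne hj, QuaternionAlgebra.coe_zero]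
  have hcoe' : quatProj ℤ_[p] i ((Pi.single i 1 : ∀ i, R i) : ℍ[(∀ i, R i), ε, θ]) = 1 := by
    rw [quatProj_coe, Pi.single_eq_same, QuaternionAlgebra.coe_one]
  refine ⟨w', ?_, ?_, fun x y => ?_⟩
  · refine quat_ext_proj ℤ_[p] fun j => ?_
    rw [map_mul]
    by_cases hj : j = i
    · subst hj; rw [hcoe', mul_one]
    · have := congrFun hw' j
      rw [Pi.single_eq_of_ne hj] at this
      rw [hcoe j hj, mul_zero]
      exact this.symm
  · obtain ⟨E, hE, hwE, hdvd⟩ := h.exists_poly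
    refine ⟨E, hE, quat_ext_proj ℤ_[p] fun j => ?_, ?_⟩
    · rw [map_mul, map_zero]
      by_cases hj : j = i
      · subst hj
        rw [← aeval_algHom_apply, hi]
        rw [hcoe']
        simpa using hwE
      · rw [hcoe j hj, mul_zero]
    · rw [rcp_pi]
      refine dvd_trans ?_ (Finset.dvd_prod_of_mem _ (Finset.mem_univ i))
      rwa [hi]
  · obtain ⟨P, hP⟩ := h.gen (x i) (y i)
    refine ⟨P, quat_ext_proj ℤ_[p] fun j => ?_⟩
    rw [map_mul, map_mul]
    by_cases hj : j = i
    · subst hj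
      rw [hcoe', ← aeval_algHom_apply, hi, hg]
      simpa using hP
    · rw [hcoe j hj, zero_mul, mul_zero]

end ReducedCharpolyProduct

/-! ### Orders and functionals on products -/

section ProductOrder

variable {R K : Type*} [CommRing R] [Field K] {I : Type*} [Finite I] {A : I → Type*}
  [∀ i, Ring (A i)] [∀ i, Algebra R (A i)] [∀ i, Algebra K (A i)]

lemma isOrder_pi {O : Subalgebra R (∀ i, A i)} (hO : IsOrder R K O) {S : ∀ i, Subalgebra R (A i)}
    (hS : ∀ i, Module.Finite R (S i)) (hle : O ≤ Subalgebra.pi Set.univ S) :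
    IsOrder R K (Subalgebra.pi Set.univ S) := by
  refine ⟨Module.Finite.iff_fg.2 ?_, top_le_iff.1 (hO.2.ge.trans (Submodule.span_mono hle))⟩
  exact Submodule.fg_pi fun i => Module.Finite.iff_fg.1 (hS i)

omit [Finite I] in
lemma isOrder_map_eval {O : Subalgebra R (∀ i, A i)} (hO : IsOrder R K O) (i : I) :
    IsOrder R K (O.map (Pi.evalAlgHom R A i)) := by
  have hO1 : Module.Finite R (Subalgebra.toSubmodule O) := hO.1
  refine ⟨?_, ?_⟩
  · have : ((Subalgebra.toSubmodule O).map (Pi.evalAlgHom R A i).toLinearMap).FG :=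
      (Module.Finite.iff_fg.1 hO1).map _
    exact Module.Finite.iff_fg.2 this
  · have h1 : ((O.map (Pi.evalAlgHom R A i) : Subalgebra R (A i)) : Set (A i)) =
      (LinearMap.proj i : (∀ i, A i) →ₗ[K] A i) '' O := rfl
    rw [h1, ← Submodule.map_span, hO.2, Submodule.map_top, LinearMap.range_eq_top]
    exact LinearMap.proj_surjective i

/-- The product of the projections of `O` is an order containing `O`, so maximality makes them
equal. -/
theorem RZLocalModel.IsMaximalOrder.mem_iff_forall {O : Subalgebra R (∀ i, A i)} (hO : IsMaximalOrder R K O)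
    (x : ∀ i, A i) : x ∈ O ↔ ∀ i, x i ∈ O.map (Pi.evalAlgHom R A i) := by
  have hle : O ≤ Subalgebra.pi Set.univ fun i => O.map (Pi.evalAlgHom R A i) :=
    fun x hx i _ => ⟨x, hx, rfl⟩
  have := hO.2 (isOrder_pi hO.1 (fun i => (isOrder_map_eval hO.1 i).1) hle) hle
  exact ⟨fun hx i => hle hx i trivial, fun hx => this fun i _ => hx i⟩

/-- Replacing one projection by a larger order would enlarge the product. -/
theorem RZLocalModel.IsMaximalOrder.map_eval {O : Subalgebra R (∀ i, A i)} (hO : IsMaximalOrder R K O) (i : I) :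
    IsMaximalOrder R K (O.map (Pi.evalAlgHom R A i)) := by
  classical
  refine ⟨isOrder_map_eval hO.1 i, fun O' hO' hle x hx => ?_⟩
  let S : ∀ j, Subalgebra R (A j) :=
    Function.update (fun j => O.map (Pi.evalAlgHom R A j)) i O'
  have hSi : S i = O' := Function.update_self ..
  have hSj : ∀ j, j ≠ i → S j = O.map (Pi.evalAlgHom R A j) := fun j hj =>
    Function.update_of_ne hj ..
  have hOS : O ≤ Subalgebra.pi Set.univ S := fun y hy j _ => by
    by_cases hj : j = i
    · subst hj
      change y j ∈ S j
      rw [hSi]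
      exact hle ⟨y, hy, rfl⟩
    · change y j ∈ S j
      rw [hSj j hj]
      exact ⟨y, hy, rfl⟩
  have h1 := hO.2 (isOrder_pi hO.1 (fun j => by
    by_cases hj : j = i
    · subst hj
      rw [hSi]
      exact hO'.1
    · rw [hSj j hj]
      exact (isOrder_map_eval hO.1 j).1) hOS) hOS
  refine ⟨Pi.single i x, h1 fun j _ => ?_, Pi.single_eq_same i x⟩
  change (Pi.single i x : ∀ i, A i) j ∈ S j
  by_cases hj : j = i
  · subst hj
    rw [hSi, Pi.single_eq_same]
    exact hx
  · rw [Pi.single_eq_of_ne hj]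
    exact zero_mem _

end ProductOrder

section ProductSelfDual

variable {p : ℕ} [Fact p.Prime] {I : Type*} [Fintype I] [DecidableEq I] {L : I → Type*}
  [∀ i, Field (L i)] [∀ i, Algebra ℚ_[p] (L i)] [∀ i, Algebra ℤ_[p] (L i)] {α β : ∀ i, L i}

/-- As `O` is the product of its projections, extension by zero sends each projection into `O`, and
duality can be tested on elements supported at i. -/
theorem isSelfDualMaxOrder_map_eval {O : Subalgebra ℤ_[p] (∀ i, ℍ[L i, α i, β i])}
    {ℓ : (∀ i, ℍ[L i, α i, β i]) →ₗ[ℚ_[p]] ℚ_[p]} (hmax : IsMaximalOrder ℤ_[p] ℚ_[p] O)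
    (hstar : ∀ x ∈ O, star x ∈ O) (hℓ : ∀ x, ℓ (star x) = - ℓ x)
    (hdual : ∀ x, x ∈ O ↔ ∀ y ∈ O, ‖ℓ (x * y)‖ ≤ 1) (i : I) :
    IsSelfDualMaxOrder (O.map (Pi.evalAlgHom ℤ_[p] (fun i => ℍ[L i, α i, β i]) i))
      (ℓ ∘ₗ LinearMap.single ℚ_[p] (fun i => ℍ[L i, α i, β i]) i) where
  max := hmax.map_eval i
  star_mem := by
    rintro _ ⟨y, hy, rfl⟩
    exact ⟨star y, hstar y hy, rfl⟩
  map_star x := by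
    rw [LinearMap.comp_apply, LinearMap.comp_apply, ← hℓ]
    congr 1
    exact (Pi.single_star (f := fun i => ℍ[L i, α i, β i]) i x)
  mem_iff x := by
    have hmem : ∀ x : ℍ[L i, α i, β i], x ∈ O.map (Pi.evalAlgHom ℤ_[p] _ i) ↔
        (Pi.single i x : ∀ i, ℍ[L i, α i, β i]) ∈ O := fun x => by
      rw [hmax.mem_iff_forall]
      refine ⟨fun hx j => ?_, fun h => ?_⟩
      · by_cases hj : j = i
        · subst hj
          rwa [Pi.single_eq_same]
        · rw [Pi.single_eq_of_ne hj]
          exact zero_mem _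
      · have := h i
        rwa [Pi.single_eq_same] at this
    rw [hmem, hdual]
    constructor
    · intro h y hy
      have := h _ ((hmem y).1 hy)
      rwa [← Pi.single_mul] at this
    · intro h y hy
      have := h (y i) ⟨y, hy, rfl⟩
      rw [LinearMap.comp_apply, LinearMap.single_apply] at this
      rwa [← Pi.single_mul_left]

end ProductSelfDual

/-! ### The functional attached to the pairing -/

section Form

variable {p : ℕ} [Fact p.Prime] {F : Type*} [Field F] {α β : F}
  {O : Subring ℍ[F, α, β]} (hstar : ∀ x ∈ O, star x ∈ O)
  {Λ : Type*} [AddCommGroup Λ] [Module ℤ_[p] Λ] [Module (ℤ_[p] ⊗[ℤ] O) Λ]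
  [IsScalarTower ℤ_[p] (ℤ_[p] ⊗[ℤ] O) Λ]
  {A : Type*} [Ring A] [StarRing A] [Algebra ℚ_[p] A] [Algebra ℤ_[p] A]
  [IsScalarTower ℤ_[p] ℚ_[p] A] (hsmul : ∀ (c : ℚ_[p]) (x : A), star (c • x) = c • star x)
  {j : ℤ_[p] ⊗[ℤ] O →ₐ[ℤ_[p]] A}
  (hj : ∀ a : O, star (j (1 ⊗ₜ a)) = j (1 ⊗ₜ ⟨star (a : ℍ[F, α, β]), hstar a a.2⟩))
  {ι : Type*} [Fintype ι] (bT : Module.Basis ι ℤ_[p] (ℤ_[p] ⊗[ℤ] O))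
  (bA : Module.Basis ι ℚ_[p] A) (hb : ∀ i, j (bT i) = bA i)

omit [StarRing A] in
lemma padic_smul_eq (c : ℤ_[p]) (x : A) : c • x = (c : ℚ_[p]) • x :=
  (IsScalarTower.algebraMap_smul ℚ_[p] c x).symm

include bT bA hb

omit [StarRing A] in
lemma injective_of_basis : Function.Injective j := by
  refine (injective_iff_map_eq_zero j).2 fun x hx => ?_
  have h1 : j x = ∑ i, (bT.repr x i : ℚ_[p]) • bA i := by
    conv_lhs => rw [← bT.sum_repr x, map_sum]
    simp only [map_smul, hb, padic_smul_eq]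
  rw [hx] at h1
  have h2 := (Fintype.linearIndependent_iff.1 bA.linearIndependent) _ h1.symm
  rw [← bT.sum_repr x]
  refine Finset.sum_eq_zero fun i _ => ?_
  have : bT.repr x i = 0 := Subtype.ext (h2 i)
  rw [this, zero_smul]

omit [StarRing A] in
lemma exists_extend (f : ℤ_[p] ⊗[ℤ] O →ₗ[ℤ_[p]] ℤ_[p]) :
    ∃ ℓ : A →ₗ[ℚ_[p]] ℚ_[p], ∀ x, ℓ (j x) = f x := by
  refine ⟨bA.constr ℚ_[p] fun i => (f (bT i) : ℚ_[p]), fun x => ?_⟩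
  conv_lhs => rw [← bT.sum_repr x, map_sum, map_sum]
  conv_rhs => rw [← bT.sum_repr x, map_sum]
  simp only [map_smul, padic_smul_eq, hb, Module.Basis.constr_basis]
  rw [PadicInt.coe_sum]
  simp

omit [StarRing A] in
lemma exists_pow_smul_mem (x : A) : ∃ (n : ℕ) (y : ℤ_[p] ⊗[ℤ] O), (p : ℚ_[p]) ^ n • x = j y := by
  have h1 : ∀ c : ℚ_[p], ∃ n : ℕ, ∀ m, n ≤ m → ‖(p : ℚ_[p]) ^ m * c‖ ≤ 1 := by
    intro c
    obtain ⟨n, hn⟩ := exists_pow_lt_of_lt_one (show (0 : ℝ) < 1 / (‖c‖ + 1) by positivity)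
      (Padic.norm_p_lt_one (p := p))
    refine ⟨n, fun m hm => ?_⟩
    have h1 : ‖(p : ℚ_[p])‖ ^ m ≤ ‖(p : ℚ_[p])‖ ^ n :=
      pow_le_pow_of_le_one (norm_nonneg _) Padic.norm_p_lt_one.le hm
    rw [norm_mul, norm_pow]
    calc _ ≤ 1 / (‖c‖ + 1) * ‖c‖ := mul_le_mul_of_nonneg_right (h1.trans hn.le) (norm_nonneg _)
      _ ≤ 1 := by
        rw [one_div, inv_mul_le_one₀ (by positivity)]
        linarith [norm_nonneg c]
  choose n hn using h1
  let N := Finset.univ.sup fun i => n (bA.repr x i)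
  let c : ι → ℤ_[p] := fun i => ⟨(p : ℚ_[p]) ^ N * bA.repr x i,
    hn _ _ (Finset.le_sup (f := fun i => n (bA.repr x i)) (Finset.mem_univ i))⟩
  refine ⟨N, ∑ i, c i • bT i, ?_⟩
  conv_lhs => rw [← bA.sum_repr x, Finset.smul_sum]
  rw [map_sum]
  refine Finset.sum_congr rfl fun i _ => ?_
  rw [map_smul, padic_smul_eq, hb, smul_smul]

include hsmul hj

omit bT bA hb in
lemma star_mem_range (X : ℤ_[p] ⊗[ℤ] O) : ∃ Y, star (j X) = j Y := by
  induction X using TensorProduct.induction_on with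
  | zero => exact ⟨0, by simp⟩
  | add x y hx hy =>
    obtain ⟨x', hx⟩ := hx
    obtain ⟨y', hy⟩ := hy
    exact ⟨x' + y', by rw [map_add, star_add, hx, hy, map_add]⟩
  | tmul c a =>
    refine ⟨c • (1 ⊗ₜ ⟨star (a : ℍ[F, α, β]), hstar a a.2⟩), ?_⟩
    rw [map_smul, ← hj, padic_smul_eq, ← hsmul, ← padic_smul_eq, ← map_smul,
      TensorProduct.smul_tmul', smul_eq_mul, mul_one]

variable (e : Λ ≃ₗ[ℤ_[p] ⊗[ℤ] O] (ℤ_[p] ⊗[ℤ] O))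
  (ψ : LinearMap.BilinForm ℤ_[p] Λ) (hperf : ψ.IsPerfPair) (halt : ψ.IsAlt)
  (hherm : ∀ (a : O) (x y : Λ),
      ψ ((1 ⊗ₜ a : ℤ_[p] ⊗[ℤ] O) • x) y =
        ψ x ((1 ⊗ₜ ⟨star (a : ℍ[F, α, β]), hstar a a.2⟩ : ℤ_[p] ⊗[ℤ] O) • y))

-- With g the generator of Λ corresponding to 1, ℓ extends X ↦ ψ(g, X g). The adjunction turns ψ(X
-- g, Y g) into ℓ(X^* Y), and alternation gives the sign under the involution. For self-duality, a
-- functional ℓ(x ·) that is integral on the order is ψ(z, ·) for some z by perfectness, and then x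
-- equals the star of the element of the order corresponding to z.
include hperf halt hherm in
theorem exists_functional : ∃ ℓ : A →ₗ[ℚ_[p]] ℚ_[p],
    (∀ x y, (ψ x y : ℚ_[p]) = ℓ (star (j (e x)) * j (e y))) ∧ (∀ x, ℓ (star x) = - ℓ x) ∧
      ∀ x, x ∈ j.range ↔ ∀ y ∈ j.range, ‖ℓ (x * y)‖ ≤ 1 := by
  let g := e.symm 1
  have he : ∀ x, e x • g = x := fun x => by
    rw [← map_smul, smul_eq_mul, mul_one, e.symm_apply_apply]
  let f : ℤ_[p] ⊗[ℤ] O →ₗ[ℤ_[p]] ℤ_[p] := ψ g ∘ₗ (e.symm : _ →ₗ[ℤ_[p] ⊗[ℤ] O] Λ).restrictScalars ℤ_[p]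
  have hf : ∀ X, f X = ψ g (X • g) := fun X => by
    change ψ g (e.symm X) = _
    rw [← map_smul, smul_eq_mul, mul_one]
  obtain ⟨ℓ, hℓ⟩ := exists_extend bT bA hb f
  have h1 : ∀ X Y : ℤ_[p] ⊗[ℤ] O, (ψ (X • g) (Y • g) : ℚ_[p]) = ℓ (star (j X) * j Y) := by
    intro X Y
    induction X using TensorProduct.induction_on with
    | zero =>
      have h0 : (0 : ℤ_[p] ⊗[ℤ] O) • g = 0 := zero_smul (ℤ_[p] ⊗[ℤ] O) g
      have h3 : ψ ((0 : ℤ_[p] ⊗[ℤ] O) • g) (Y • g) = 0 := by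
        simp only [h0, map_zero, LinearMap.zero_apply]
      rw [map_zero, star_zero, zero_mul, map_zero]
      exact congrArg Subtype.val h3
    | add x y hx hy =>
      rw [add_smul, map_add, LinearMap.add_apply, PadicInt.coe_add, hx, hy, map_add, star_add,
        add_mul, map_add]
    | tmul c a =>
      have hc : (c ⊗ₜ a : ℤ_[p] ⊗[ℤ] O) = c • (1 ⊗ₜ a) := by
        rw [TensorProduct.smul_tmul', smul_eq_mul, mul_one]
      rw [hc, smul_assoc, LinearMap.map_smul₂, hherm, smul_smul, ← hf, map_smul,
        padic_smul_eq (A := A), hsmul, hj, smul_mul_assoc, ← map_mul, map_smul, hℓ]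
      simp
  have h2 : ∀ X, ℓ (star (j X)) = - ℓ (j X) := by
    intro X
    have h3 := h1 X 1
    have h4 := h1 1 X
    rw [map_one, mul_one] at h3
    rw [map_one, star_one, one_mul] at h4
    rw [← h3, ← h4, ← PadicInt.coe_neg, LinearMap.BilinForm.IsAlt.neg_eq halt]
  refine ⟨ℓ, fun x y => ?_, fun x => ?_, fun x => ⟨?_, fun h => ?_⟩⟩
  · rw [← h1, he, he]
  · have : ∃ (n : ℕ) (y : ℤ_[p] ⊗[ℤ] O), (p : ℚ_[p]) ^ n • x = j y := exists_pow_smul_mem bT bA hb x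
    obtain ⟨n, y, hy⟩ := this
    have hp0 : (p : ℚ_[p]) ^ n ≠ 0 :=
      pow_ne_zero _ (Nat.cast_ne_zero.2 (Fact.out : p.Prime).ne_zero)
    have h3 := h2 y
    rw [← hy, hsmul, map_smul, map_smul, ← smul_neg] at h3
    exact smul_right_injective _ hp0 h3
  · rintro ⟨X, rfl⟩ _ ⟨Y, rfl⟩
    change ‖ℓ (j X * j Y)‖ ≤ 1
    rw [← map_mul, hℓ]
    exact PadicInt.norm_le_one _
  · let f' : Λ →ₗ[ℤ_[p]] ℤ_[p] :=
      { toFun := fun y => ⟨ℓ (x * j (e y)), h _ ⟨_, rfl⟩⟩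
        map_add' := fun y y' => Subtype.ext (by
          change ℓ (x * j (e (y + y'))) = ℓ (x * j (e y)) + ℓ (x * j (e y'))
          rw [map_add, map_add, mul_add, map_add])
        map_smul' := fun c y => Subtype.ext (by
          have : e (c • y) = c • e y := by
            rw [← one_smul (ℤ_[p] ⊗[ℤ] O) y, ← smul_assoc, map_smul, map_smul, smul_assoc, one_smul]
          change ℓ (x * j (e (c • y))) = (c : ℚ_[p]) * ℓ (x * j (e y))
          rw [this, map_smul, padic_smul_eq, mul_smul_comm, map_smul, smul_eq_mul]) }
    obtain ⟨z, hz⟩ := (LinearMap.IsPerfPair.bijective_left ψ).surjective f'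
    have h3 : ∀ Y, ℓ (x * j Y) = ℓ (star (j (e z)) * j Y) := by
      intro Y
      rw [← h1, he]
      have := congrArg Subtype.val (LinearMap.congr_fun hz (Y • g))
      change (ψ z (Y • g) : ℚ_[p]) = ℓ (x * j (e (Y • g))) at this
      rw [this, map_smul, e.apply_symm_apply, smul_eq_mul, mul_one]
    obtain ⟨Z, hZ⟩ := star_mem_range hstar hsmul hj (e z)
    -- Denominators are cleared so that nondegeneracy over ℤ_p applies to the difference.
    obtain ⟨n, y, hy⟩ := exists_pow_smul_mem bT bA hb (x - star (j (e z)))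
    obtain ⟨y', hy'⟩ := star_mem_range hstar hsmul hj y
    have h4 : e.symm y' = 0 := by
      apply (LinearMap.IsPerfPair.bijective_left ψ).injective
      rw [map_zero]
      refine LinearMap.ext fun w => Subtype.ext ?_
      rw [← he (e.symm y'), ← he w, e.apply_symm_apply, h1, ← hy', star_star, ← hy,
        smul_mul_assoc, map_smul, sub_mul, map_sub, h3, sub_self, smul_zero]
      rfl
    have h5 : y' = 0 := by simpa using h4
    rw [h5, map_zero, star_eq_zero] at hy'
    have hp0 : (p : ℚ_[p]) ^ n ≠ 0 :=
      pow_ne_zero _ (Nat.cast_ne_zero.2 (Fact.out : p.Prime).ne_zero)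
    rw [hy', smul_eq_zero_iff_right hp0, sub_eq_zero, hZ] at hy
    exact ⟨Z, hy.symm⟩

end Form

/-! ### Completion of orders and of the number field -/

section PadicBasis

lemma exists_padic_basis (p : ℕ) [Fact p.Prime] {B : Type*} [Ring B] [Algebra ℚ B] {O : Subring B}
    (hO : IsOrder ℤ ℚ (subalgebraOfSubring O)) :
    ∃ (n : ℕ) (bT : Module.Basis (Fin n) ℤ_[p] (ℤ_[p] ⊗[ℤ] O))
      (bB : Module.Basis (Fin n) ℚ_[p] (ℚ_[p] ⊗[ℚ] B)), ∀ i, padicMap p O (bT i) = bB i := by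
  have hfin : Module.Finite ℤ O := hO.1
  have : IsAddTorsionFree B := .of_module_rat B
  have h1 : Module.IsTorsionFree ℤ O :=
    Function.Injective.moduleIsTorsionFree (N := B) Subtype.val Subtype.val_injective
      fun _ _ => rfl
  have hfree : Module.Free ℤ O := Module.free_of_finite_type_torsion_free'
  let b := Module.finBasis ℤ O
  have hli : LinearIndependent ℚ fun i => (b i : B) := by
    rw [← LinearIndependent.iff_fractionRing ℤ ℚ]
    exact b.linearIndependent.map' (O.subtype.toAddMonoidHom.toIntLinearMap)
      (LinearMap.ker_eq_bot.2 Subtype.val_injective)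
  have hsp : ⊤ ≤ Submodule.span ℚ (Set.range fun i => (b i : B)) := by
    rw [← hO.2, Submodule.span_le]
    intro x hx
    have : (⟨x, hx⟩ : O) = ∑ i, b.repr ⟨x, hx⟩ i • b i := (b.sum_repr _).symm
    have h2 : x = ∑ i, b.repr ⟨x, hx⟩ i • (b i : B) := by
      have := congrArg O.subtype this
      rw [map_sum] at this
      refine this.trans (Finset.sum_congr rfl fun i _ => ?_)
      rw [map_zsmul]
      rfl
    rw [h2]
    refine Submodule.sum_mem _ fun i _ => ?_
    rw [← Int.cast_smul_eq_zsmul ℚ]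
    exact Submodule.smul_mem _ _ (Submodule.subset_span ⟨i, rfl⟩)
  let bB := Module.Basis.mk hli hsp
  refine ⟨_, b.baseChange ℤ_[p], bB.baseChange ℚ_[p], fun i => ?_⟩
  rw [Module.Basis.baseChange_apply, Module.Basis.baseChange_apply, Module.Basis.mk_apply]
  refine (Algebra.TensorProduct.lift_tmul _ _ _ _ _).trans ?_
  rw [map_one, one_mul]
  rfl

end PadicBasis

section Transport

lemma isOrder_map {R K A A' : Type*} [CommRing R] [Field K] [Ring A] [Ring A'] [Algebra R A]
    [Algebra R A'] [Algebra K A] [Algebra K A'] [Algebra R K] [IsScalarTower R K A]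
    [IsScalarTower R K A'] (Θ : A ≃ₐ[K] A') {O : Subalgebra R A} (hO : IsOrder R K O) :
    IsOrder R K (O.map ((Θ : A →ₐ[K] A').restrictScalars R)) := by
  have hO1 : Module.Finite R (Subalgebra.toSubmodule O) := hO.1
  refine ⟨?_, ?_⟩
  · have : ((Subalgebra.toSubmodule O).map ((Θ : A →ₐ[K] A').restrictScalars R).toLinearMap).FG :=
      (Module.Finite.iff_fg.1 hO1).map _
    exact Module.Finite.iff_fg.2 this
  · have h1 : ((O.map ((Θ : A →ₐ[K] A').restrictScalars R) : Subalgebra R A') : Set A') =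
      (Θ : A →ₐ[K] A').toLinearMap '' O := rfl
    rw [h1, ← Submodule.map_span, hO.2, Submodule.map_top, LinearMap.range_eq_top]
    exact Θ.surjective

lemma isMaximalOrder_map {R K A A' : Type*} [CommRing R] [Field K] [Ring A] [Ring A'] [Algebra R A]
    [Algebra R A'] [Algebra K A] [Algebra K A'] [Algebra R K] [IsScalarTower R K A]
    [IsScalarTower R K A'] (Θ : A ≃ₐ[K] A') {O : Subalgebra R A} (hO : IsMaximalOrder R K O) :
    IsMaximalOrder R K (O.map ((Θ : A →ₐ[K] A').restrictScalars R)) := by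
  refine ⟨isOrder_map Θ hO.1, fun O' hO' hle x hx => ?_⟩
  have := hO.2 (isOrder_map Θ.symm hO') (fun y hy => ⟨Θ y, hle ⟨y, hy, rfl⟩, Θ.symm_apply_apply y⟩)
  exact ⟨Θ.symm x, this ⟨x, hx, rfl⟩, Θ.apply_symm_apply x⟩

end Transport

section Decomposition

lemma exists_padic_decomposition (p : ℕ) [Fact p.Prime] (F : Type w) [Field F] [NumberField F] :
    ∃ (N : ℕ) (L : Fin N → Type w) (_ : ∀ i, Field (L i)) (_ : ∀ i, Algebra ℚ_[p] (L i))
      (_ : ∀ i, Algebra ℤ_[p] (L i)) (_ : ∀ i, IsScalarTower ℤ_[p] ℚ_[p] (L i))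
      (_ : ∀ i, FiniteDimensional ℚ_[p] (L i)), Nonempty (ℚ_[p] ⊗[ℚ] F ≃ₐ[ℚ_[p]] ∀ i, L i) := by
  have : Algebra.FormallyEtale ℚ F := Algebra.FormallyEtale.of_isSeparable ℚ F
  obtain ⟨I, hI, L, hL, hA, e, -⟩ := (Algebra.FormallyEtale.iff_exists_algEquiv_prod ℚ_[p]
    (ℚ_[p] ⊗[ℚ] F)).1 inferInstance
  obtain ⟨N, ⟨eI⟩⟩ := Finite.exists_equiv_fin I
  let e' := e.trans (AlgEquiv.piCongrLeft' ℚ_[p] L eI)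
  refine ⟨N, fun i => L (eI.symm i), inferInstance, inferInstance,
    fun i => ((algebraMap ℚ_[p] (L (eI.symm i))).comp (algebraMap ℤ_[p] ℚ_[p])).toAlgebra,
    fun i => @IsScalarTower.of_algebraMap_eq' _ _ _ _ _ _ _ _ (_) rfl, fun i => ?_, ⟨e'⟩⟩
  exact Module.Finite.of_surjective (((Pi.evalAlgHom ℚ_[p] (fun i => L (eI.symm i)) i).comp
    e'.toAlgHom).toLinearMap) ((Function.surjective_eval i).comp e'.surjective)

variable {k : Type*} [CommRing k]

/-- An isomorphism of rings induces an isomorphism of quaternion algebras. -/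
def quatCongr {S S' : Type*} [CommRing S] [CommRing S'] [Algebra k S] [Algebra k S']
    (e : S ≃ₐ[k] S') (a b : S) : ℍ[S, a, b] ≃ₐ[k] ℍ[S', e a, e b] :=
  AlgEquiv.ofLinearEquiv
    { toFun := fun x => ⟨e x.re, e x.imI, e x.imJ, e x.imK⟩
      invFun := fun x => ⟨e.symm x.re, e.symm x.imI, e.symm x.imJ, e.symm x.imK⟩
      left_inv := fun x => by ext <;> simp
      right_inv := fun x => by ext <;> simp
      map_add' := fun x y => by ext <;> simp
      map_smul' := fun c x => by ext <;> simp }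
    (by ext <;> simp)
    (fun x y => by ext <;> simp)

/-- `A ⊗ ℍ[R, a, b] ≃ ℍ[A ⊗ R, a, b]` as algebras. -/
noncomputable def quatBaseChangeAlg (A : Type*) [CommRing A] [Algebra k A] {R : Type*} [CommRing R]
    [Algebra k R] (a b : R) :
    A ⊗[k] ℍ[R, a, b] ≃ₐ[A] ℍ[A ⊗[k] R, (1 : A) ⊗ₜ[k] a, (1 : A) ⊗ₜ[k] b] :=
  AlgEquiv.ofLinearEquiv (quatBaseChange A)
    (by rw [Algebra.TensorProduct.one_def, quatBaseChange_tmul, one_smul, map_one])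
    (fun x y => by
      induction x using TensorProduct.induction_on with
      | zero => simp
      | add x x' hx hx' => rw [add_mul, map_add, hx, hx', map_add, add_mul]
      | tmul c x =>
        induction y using TensorProduct.induction_on with
        | zero => simp
        | add y y' hy hy' => rw [mul_add, map_add, hy, hy', map_add, mul_add]
        | tmul d y =>
          rw [Algebra.TensorProduct.tmul_mul_tmul, quatBaseChange_tmul, quatBaseChange_tmul,
            quatBaseChange_tmul, map_mul, smul_mul_smul_comm])

end Decomposition

section Embeddings

variable {p : ℕ} [Fact p.Prime] {I : Type*} {L : I → Type*} [∀ i, Field (L i)]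
  [∀ i, Algebra ℚ_[p] (L i)] [∀ i, Algebra ℤ_[p] (L i)] [∀ i, IsScalarTower ℤ_[p] ℚ_[p] (L i)]
  [∀ i, FiniteDimensional ℚ_[p] (L i)]

lemma finrank_integralClosure (L : Type*) [Field L] [Algebra ℚ_[p] L] [Algebra ℤ_[p] L]
    [IsScalarTower ℤ_[p] ℚ_[p] L] [FiniteDimensional ℚ_[p] L] :
    Module.finrank ℤ_[p] (integralClosure ℤ_[p] L) = Module.finrank ℚ_[p] L := by
  have := isFractionRing_integralClosure p L
  have := finite_integralClosure p L
  exact (IsFractionRing.finrank_eq ℤ_[p] ℚ_[p] (integralClosure ℤ_[p] L) L).symm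

/-- The homomorphisms from a product of finite extensions of `ℚ_p` to an algebraically closed field
are already distinct on the product of the rings of integers. -/
lemma exists_algHoms_pi [DecidableEq I] (K : Type*) [Field K] [IsAlgClosed K] [Algebra ℚ_[p] K]
    {ι : I → Type*} [∀ i, Fintype (ι i)]
    (hι : ∀ i, Fintype.card (ι i) = Module.finrank ℚ_[p] (L i)) :
    ∃ χ : (Σ i, ι i) → ((∀ i, L i) →ₐ[ℚ_[p]] K),
      (∀ k l, (∀ r : ∀ i, integralClosure ℤ_[p] (L i),
        χ k (fun i => (r i : L i)) = χ l (fun i => (r i : L i))) → k = l) ∧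
      ∀ k x, x k.1 ≠ 0 → χ k x ≠ 0 := by
  have hσ : ∀ i, Nonempty (ι i ≃ (L i →ₐ[ℚ_[p]] K)) := fun i =>
    ⟨Fintype.equivOfCardEq (by rw [hι, AlgHom.card])⟩
  let σ := fun i => (hσ i).some
  let χ : (Σ i, ι i) → ((∀ i, L i) →ₐ[ℚ_[p]] K) := fun k =>
    (σ k.1 k.2).comp (Pi.evalAlgHom ℚ_[p] _ k.1)
  have hχ : ∀ k r, χ k r = σ k.1 k.2 (r k.1) := fun k r => rfl
  refine ⟨χ, ?_, fun k r hr => ?_⟩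
  · rintro ⟨i, l⟩ ⟨i', l'⟩ h
    obtain rfl : i = i' := by
      by_contra hne
      have := h (Pi.single i 1)
      rw [hχ, hχ] at this
      simp [Pi.single_eq_of_ne (Ne.symm hne)] at this
    congr 1
    refine (σ i).injective (AlgHom.ext fun x => ?_)
    have := isFractionRing_integralClosure p (L i)
    have key : ∀ r : integralClosure ℤ_[p] (L i), σ i l (r : L i) = σ i l' (r : L i) := fun r => by
      have := h (Pi.single i r)
      rw [hχ, hχ] at this
      simpa using this
    obtain ⟨a, b, hb, rfl⟩ := IsFractionRing.div_surjective (A := integralClosure ℤ_[p] (L i)) x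
    rw [map_div₀, map_div₀]
    exact congrArg₂ _ (key a) (key b)
  · rwa [hχ, Ne, map_eq_zero]

/-- The inclusion of the product of the rings of integers. -/
noncomputable def piIntegralClosureVal (L : I → Type*) [∀ i, Field (L i)] [∀ i, Algebra ℤ_[p] (L i)] :
    (∀ i, integralClosure ℤ_[p] (L i)) →ₐ[ℤ_[p]] ∀ i, L i :=
  AlgHom.pi fun i => (integralClosure ℤ_[p] (L i)).val.comp (Pi.evalAlgHom ℤ_[p] _ i)

/-- The homomorphisms from a product of rings of integers to an algebraically closed field. -/
lemma exists_algHoms [DecidableEq I] (K : Type*) [Field K] [IsAlgClosed K] [Algebra ℤ_[p] K]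
    (hK : Function.Injective (algebraMap ℤ_[p] K)) {ι : I → Type*} [∀ i, Fintype (ι i)]
    (hι : ∀ i, Fintype.card (ι i) = Module.finrank ℚ_[p] (L i)) :
    ∃ χ : (Σ i, ι i) → ((∀ i, integralClosure ℤ_[p] (L i)) →ₐ[ℤ_[p]] K),
      Function.Injective χ ∧ ∀ k r, r k.1 ≠ 0 → χ k r ≠ 0 := by
  let _ : Algebra ℚ_[p] K := (IsFractionRing.lift hK : ℚ_[p] →+* K).toAlgebra
  have : IsScalarTower ℤ_[p] ℚ_[p] K := .of_algebraMap_eq fun x =>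
    (IsFractionRing.lift_algebraMap hK x).symm
  obtain ⟨χ, hχ, hχ0⟩ := exists_algHoms_pi (L := L) K hι
  refine ⟨fun k => ((χ k).restrictScalars ℤ_[p]).comp (piIntegralClosureVal L),
    fun k l h => hχ k l fun r => DFunLike.congr_fun h r, fun k r hr => hχ0 k _ fun h => hr ?_⟩
  exact Subtype.ext h

end Embeddings

/-! ### Assembling the local presentations -/

section StandardProduct

variable {p : ℕ} [Fact p.Prime] {I : Type*} {L : I → Type*}
  [∀ i, Field (L i)] [∀ i, Algebra ℚ_[p] (L i)] [∀ i, Algebra ℤ_[p] (L i)] {α β : ∀ i, L i}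

/-- A presentation of an order `O` in a product of quaternion algebras as a standard quaternion
order over the product of the rings of integers. -/
structure IsStandardProduct (O : Subalgebra ℤ_[p] (∀ i, ℍ[L i, α i, β i]))
    (ℓ : (∀ i, ℍ[L i, α i, β i]) →ₗ[ℚ_[p]] ℚ_[p]) (ε θ : ∀ i, integralClosure ℤ_[p] (L i))
    (V : ℍ[(∀ i, integralClosure ℤ_[p] (L i)), ε, θ] →ₐ[ℤ_[p]] ∀ i, ℍ[L i, α i, β i])
    (lam : (∀ i, integralClosure ℤ_[p] (L i)) →ₗ[ℤ_[p]] ℤ_[p]) : Prop where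
  injective : Function.Injective V
  range_eq : V.range = O
  map_star (q) : V (star q) = star (V q)
  map_re (q) (i) : (V q i).re = q.re i
  map_eq (q) : ℓ (V q) = lam q.imJ

theorem isStandardProduct_of_forall [Fintype I] [DecidableEq I]
    [∀ i, IsScalarTower ℤ_[p] ℚ_[p] (L i)]
    {O : Subalgebra ℤ_[p] (∀ i, ℍ[L i, α i, β i])} (hO : IsMaximalOrder ℤ_[p] ℚ_[p] O)
    {ℓ : (∀ i, ℍ[L i, α i, β i]) →ₗ[ℚ_[p]] ℚ_[p]} {ε θ : ∀ i, integralClosure ℤ_[p] (L i)}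
    {v : ∀ i, ℍ[integralClosure ℤ_[p] (L i), ε i, θ i] →ₐ[integralClosure ℤ_[p] (L i)]
      ℍ[L i, α i, β i]} {lam : ∀ i, integralClosure ℤ_[p] (L i) →ₗ[ℤ_[p]] ℤ_[p]}
    (h : ∀ i, IsStandard (O.map (Pi.evalAlgHom ℤ_[p] (fun i => ℍ[L i, α i, β i]) i))
      (ℓ ∘ₗ LinearMap.single ℚ_[p] (fun i => ℍ[L i, α i, β i]) i) (ε i) (θ i) (v i) (lam i)) :
    ∃ V, IsStandardProduct O ℓ ε θ V (∑ i, lam i ∘ₗ LinearMap.proj i) := by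
  let V : ℍ[(∀ i, integralClosure ℤ_[p] (L i)), ε, θ] →ₐ[ℤ_[p]] ∀ i, ℍ[L i, α i, β i] :=
    AlgHom.pi fun i => ((v i).restrictScalars ℤ_[p]).comp (quatProj ℤ_[p] i)
  have hV : ∀ q i, V q i = v i (quatProj ℤ_[p] i q) := fun q i => rfl
  refine ⟨V, ?_, ?_, ?_, ?_, ?_⟩
  · intro x y hxy
    exact quat_ext_proj ℤ_[p] fun i => (h i).injective (congrFun hxy i)
  · ext x
    rw [hO.mem_iff_forall]
    constructor
    · rintro ⟨q, rfl⟩ i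
      exact ((h i).mem_iff _).2 ⟨_, rfl⟩
    · intro hx
      choose q hq using fun i => ((h i).mem_iff _).1 (hx i)
      obtain ⟨q', hq'⟩ := (quatPiEquiv (ε := ε) (θ := θ) ℤ_[p]).surjective q
      refine ⟨q', funext fun i => ?_⟩
      change V q' i = _
      rw [hV, ← quatPiEquiv_apply, hq', hq]
  · intro q
    funext i
    rw [hV, quatProj_star, (h i).map_star]
    rfl
  · intro q i
    rw [hV, (h i).map_re]
    rfl
  · intro q
    rw [← Finset.univ_sum_single (V q), map_sum]
    simp only [LinearMap.sum_apply, PadicInt.coe_sum]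
    exact Finset.sum_congr rfl fun i _ => (h i).map_eq _

variable {F : Type*} [Field F] {a b : F}
  {O : Subring ℍ[F, a, b]} {Λ : Type*} [AddCommGroup Λ] [Module ℤ_[p] Λ] [Module (ℤ_[p] ⊗[ℤ] O) Λ]
  [IsScalarTower ℤ_[p] (ℤ_[p] ⊗[ℤ] O) Λ]

theorem IsStandardProduct.nonempty_quatModel {N : ℕ} {L : Fin N → Type*}
    [∀ i, Field (L i)] [∀ i, Algebra ℚ_[p] (L i)] [∀ i, Algebra ℤ_[p] (L i)]
    [∀ i, IsScalarTower ℤ_[p] ℚ_[p] (L i)] [∀ i, FiniteDimensional ℚ_[p] (L i)] {α β : ∀ i, L i}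
    {j : ℤ_[p] ⊗[ℤ] O →ₐ[ℤ_[p]] ∀ i, ℍ[L i, α i, β i]} (hj : Function.Injective j)
    {ℓ : (∀ i, ℍ[L i, α i, β i]) →ₗ[ℚ_[p]] ℚ_[p]}
    {ε θ : ∀ i, integralClosure ℤ_[p] (L i)} {V lam}
    (h : IsStandardProduct j.range ℓ ε θ V lam) (hε : ∀ i, IsUnit (ε i))
    (hgen : ∀ i d (b : Module.Basis (Fin d) ℤ_[p] (integralClosure ℤ_[p] (L i))),
        (∃ w, IsLocalGenerator b (ε i) (θ i) 1 (fun a b => ⟨a, b, 0, 0⟩) w) ∨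
          ∃ w, IsLocalGenerator b (ε i) (θ i) 1 (fun a b => ⟨a, 0, b, 0⟩) w)
    (e : Λ ≃ₗ[ℤ_[p] ⊗[ℤ] O] (ℤ_[p] ⊗[ℤ] O)) (ψ : LinearMap.BilinForm ℤ_[p] Λ)
    (hψ : ∀ x y, (ψ x y : ℚ_[p]) = ℓ (star (j (e x)) * j (e y))) (c : O → ℤ[X])
    (hc : ∀ d (bR : Module.Basis (Fin d) ℤ_[p] (∀ i, integralClosure ℤ_[p] (L i))) q x,
      V q = j (1 ⊗ₜ x) → (c x).map (Int.castRingHom ℤ_[p]) = rcp bR q) :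
    Nonempty (QuatModel (act p Λ : O → _) c ψ (∀ i, integralClosure ℤ_[p] (L i)) ε θ) := by
  have := fun i => finite_integralClosure p (L i)
  have := fun i => free_integralClosure p (L i)
  let w : (ℤ_[p] ⊗[ℤ] O) ≃ₐ[ℤ_[p]] ℍ[(∀ i, integralClosure ℤ_[p] (L i)), ε, θ] :=
    (AlgEquiv.ofInjective j hj).trans ((Subalgebra.equivOfEq _ _ h.range_eq.symm).trans
      (AlgEquiv.ofInjective V h.injective).symm)
  have hw : ∀ X, V (w X) = j X := fun X => by
    have := (AlgEquiv.ofInjective V h.injective).apply_symm_apply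
      (Subalgebra.equivOfEq _ _ h.range_eq.symm (AlgEquiv.ofInjective j hj X))
    exact congrArg Subtype.val this
  let φ : O →+* ℍ[(∀ i, integralClosure ℤ_[p] (L i)), ε, θ] :=
    (w : (ℤ_[p] ⊗[ℤ] O) →+* ℍ[(∀ i, integralClosure ℤ_[p] (L i)), ε, θ]).comp
      (Algebra.TensorProduct.includeRight : O →ₐ[ℤ] ℤ_[p] ⊗[ℤ] O).toRingHom
  have hφ : ∀ x, φ x = w (1 ⊗ₜ x) := fun x => rfl
  let bi := fun i => Module.finBasis ℤ_[p] (integralClosure ℤ_[p] (L i))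
  exact ⟨{
    d := _
    bR := (Pi.basis bi).reindex finSigmaFinEquiv
    isUnit_ε := Pi.isUnit_iff.2 hε
    u := (e.restrictScalars ℤ_[p]).trans w.toLinearEquiv
    φ := φ
    u_act := fun x y => by
      change w (e ((1 ⊗ₜ x : ℤ_[p] ⊗[ℤ] O) • y)) = w (1 ⊗ₜ x) * w (e y)
      rw [map_smul, smul_eq_mul, map_mul]
    span_φ := by
      rw [eq_top_iff]
      rintro x -
      obtain ⟨y, rfl⟩ := w.surjective x
      induction y using TensorProduct.induction_on with
      | zero => rw [map_zero]; exact zero_mem _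
      | add x y hx hy => rw [map_add]; exact add_mem hx hy
      | tmul c x =>
        have : c ⊗ₜ[ℤ] x = c • (1 ⊗ₜ[ℤ] x : ℤ_[p] ⊗[ℤ] O) := by
          rw [TensorProduct.smul_tmul', smul_eq_mul, mul_one]
        rw [this, map_smul]
        exact Submodule.smul_mem _ _ (Submodule.subset_span ⟨x, rfl⟩)
    map_c := fun x => hc _ _ _ _ (hw _)
    lam := lam
    form_eq := fun x y => by
      have h1 := hψ x y
      rw [← hw, ← hw, ← h.map_star, ← map_mul, h.map_eq] at h1
      exact Subtype.ext h1
    κ := Fin N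
    fintypeκ := inferInstance
    e := fun i => Pi.single i 1
    idem := fun i => by rw [← Pi.single_mul, mul_one]
    sum_e := Finset.univ_sum_single 1
    exists_gen := fun i => by
      rcases hgen i _ (bi i) with ⟨w, hw⟩ | ⟨w, hw⟩
      · exact Or.inl (isLocalGenerator_single bi _ i _ (fun a b => rfl) hw)
      · exact Or.inr (isLocalGenerator_single bi _ i _ (fun a b => rfl) hw) }⟩

end StandardProduct

/-! ### Splitting the unramified part -/

section Splitting

lemma exists_fin_prod_eq {E : Type*} [Field E] {g : E[X]} (hg : g.Monic) (hs : g.Splits) {m : ℕ}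
    (hm : g.natDegree = m) : ∃ r : Fin m → E, g = ∏ k, (X - C (r k)) := by
  have h1 := hs.eq_prod_roots_of_monic hg
  have h2 : g.roots.card = m := by rw [← hm, hs.natDegree_eq_card_roots]
  have h3 : g.roots.toList.length = m := by rw [Multiset.length_toList, h2]
  refine ⟨fun k => g.roots.toList.get (k.cast h3.symm), ?_⟩
  conv_lhs => rw [h1, ← Multiset.coe_toList g.roots, Multiset.map_coe, Multiset.prod_coe]
  clear h1 h2 hm
  subst h3
  rw [← List.prod_ofFn]
  congr 1
  refine List.ext_getElem (by simp) fun n h h' => by simp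

/-- Monic polynomials over `ℤ_p` split over a common finite extension. -/
lemma exists_common_splitting {p : ℕ} [Fact p.Prime] {I : Type*} [Fintype I] (f : I → ℤ_[p][X])
    (hf : ∀ i, (f i).Monic) :
    ∃ (W : Type) (_ : CommRing W) (_ : IsDomain W) (_ : Algebra ℤ_[p] W)
      (_ : Module.Finite ℤ_[p] W) (_ : Module.Free ℤ_[p] W),
      Function.Injective (algebraMap ℤ_[p] W) ∧
      ∀ i, ∃ r : Fin (f i).natDegree → W,
        (f i).map (algebraMap ℤ_[p] W) = ∏ k, (X - C (r k)) := by
  let g : ℚ_[p][X] := ∏ i, (f i).map (algebraMap ℤ_[p] ℚ_[p])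
  let E := g.SplittingField
  have hinj : Function.Injective (algebraMap ℤ_[p] E) := by
    rw [IsScalarTower.algebraMap_eq ℤ_[p] ℚ_[p] E]
    exact (algebraMap ℚ_[p] E).injective.comp (IsFractionRing.injective ℤ_[p] ℚ_[p])
  have hg : g ≠ 0 := (monic_prod_of_monic _ _ fun i _ => (hf i).map _).ne_zero
  refine ⟨integralClosure ℤ_[p] E, inferInstance, inferInstance, inferInstance,
    finite_integralClosure p E, free_integralClosure p E, ?_, fun i => ?_⟩
  · exact fun x y h => hinj (congrArg Subtype.val h)
  · have h1 : (g.map (algebraMap ℚ_[p] E)).Splits := SplittingField.splits g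
    have h2 : ((f i).map (algebraMap ℤ_[p] E)).Splits := by
      refine h1.of_dvd ((Polynomial.map_ne_zero_iff (algebraMap ℚ_[p] E).injective).2 hg) ?_
      rw [IsScalarTower.algebraMap_eq ℤ_[p] ℚ_[p] E, ← Polynomial.map_map]
      exact Polynomial.map_dvd _ (Finset.dvd_prod_of_mem _ (Finset.mem_univ i))
    obtain ⟨r, hr⟩ := exists_fin_prod_eq ((hf i).map _) h2 ((hf i).natDegree_map _)
    have hint : ∀ k, IsIntegral ℤ_[p] (r k) := fun k => ⟨f i, hf i, by
      rw [← Polynomial.eval_map, hr, eval_prod]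
      exact Finset.prod_eq_zero (Finset.mem_univ k) (by simp)⟩
    refine ⟨fun k => ⟨r k, hint k⟩, ?_⟩
    refine Polynomial.map_injective (algebraMap (integralClosure ℤ_[p] E) E)
      Subtype.val_injective ?_
    rw [Polynomial.map_map, ← IsScalarTower.algebraMap_eq, hr, Polynomial.map_prod]
    simp

variable {p : ℕ} [Fact p.Prime] {W : Type*} [CommRing W] [IsDomain W] [Algebra ℤ_[p] W]
  [Module.Finite ℤ_[p] W]

-- The product is f'(r k). The Bézout identity modulo p, evaluated at the root r k, makes a multiple
-- of it equal to 1 + p D, a unit in a finite ℤ_p-algebra.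
omit [IsDomain W] in
lemma isUnit_prod_sub {f : ℤ_[p][X]} {r : Fin f.natDegree → W}
    (hr : f.map (algebraMap ℤ_[p] W) = ∏ k, (X - C (r k)))
    (hsep : ∃ A B C : ℤ_[p][X], A * f + B * derivative f = 1 + (p : ℤ_[p][X]) * C)
    (k : Fin f.natDegree) : IsUnit (∏ l ∈ Finset.univ.erase k, (r k - r l)) := by
  obtain ⟨A, B, D, h⟩ := hsep
  have h0 : aeval (r k) f = 0 := by
    rw [aeval_def, ← Polynomial.eval_map, hr, eval_prod]
    exact Finset.prod_eq_zero (Finset.mem_univ k) (by simp)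
  have h1 : aeval (r k) (derivative f) = ∏ l ∈ Finset.univ.erase k, (r k - r l) := by
    rw [aeval_def, ← Polynomial.eval_map, ← derivative_map, hr,
      ← Finset.mul_prod_erase _ _ (Finset.mem_univ k), derivative_mul, eval_add, eval_mul, eval_mul,
      eval_prod]
    simp
  have h2 := congrArg (aeval (r k)) h
  rw [map_add, map_mul, h0, mul_zero, zero_add, map_mul, h1, map_add, map_one, map_mul,
    map_natCast] at h2
  exact isUnit_of_mul_isUnit_right (h2 ▸ isUnit_one_add_p_mul (p := p) (aeval (r k) D))

/-- The orthogonal idempotents of `W ⊗ R` attached to the roots in `W` of a separable polynomial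
with a root `ζ ∈ R`. -/
lemma exists_idempotents {R : Type*} [CommRing R] [Algebra ℤ_[p] R] {f : ℤ_[p][X]}
    {ζ : R} (hζ : aeval ζ f = 0) {r : Fin f.natDegree → W}
    (hr : f.map (algebraMap ℤ_[p] W) = ∏ k, (X - C (r k)))
    (hsep : ∃ A B C : ℤ_[p][X], A * f + B * derivative f = 1 + (p : ℤ_[p][X]) * C) :
    ∃ (e : Fin f.natDegree → W ⊗[ℤ_[p]] R) (c c' : Fin f.natDegree → Fin f.natDegree → W),
      (∀ k, e k * e k = e k) ∧ (∀ k l, k ≠ l → e k * e l = 0) ∧ ∑ k, e k = 1 ∧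
      (∀ k : Fin f.natDegree, (1 : W) ⊗ₜ (ζ ^ (k : ℕ)) = ∑ l, c k l • e l) ∧
      ∀ k, e k = ∑ l, c' k l • ((1 : W) ⊗ₜ[ℤ_[p]] (ζ ^ (l : ℕ))) := by
  classical
  have hu := isUnit_prod_sub hr hsep
  have hinj : Function.Injective r := by
    intro k l hkl
    by_contra hne
    refine (hu k).ne_zero (Finset.prod_eq_zero (Finset.mem_erase.2 ⟨Ne.symm hne, Finset.mem_univ l⟩) ?_)
    rw [hkl, sub_self]
  let Z : W ⊗[ℤ_[p]] R := 1 ⊗ₜ ζ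
  -- W is a domain and the roots are distinct, so a polynomial vanishing at all of them is divisible
  -- by f and vanishes at 1 ⊗ ζ. Identities in W ⊗ R can thus be checked at the roots.
  have hvan : ∀ Q : W[X], (∀ k, Q.eval (r k) = 0) → aeval Z Q = 0 := by
    intro Q hQ
    by_cases hQ0 : Q = 0
    · rw [hQ0, map_zero]
    have h1 : (∏ k, (X - C (r k))) ∣ Q := by
      have h2 : (Finset.univ.val.map r) ≤ Q.roots := by
        rw [Multiset.le_iff_subset (Finset.univ.nodup.map hinj)]
        intro x hx
        obtain ⟨k, -, rfl⟩ := Multiset.mem_map.1 hx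
        exact (mem_roots hQ0).2 (hQ k)
      have := (Multiset.prod_X_sub_C_dvd_iff_le_roots hQ0 _).2 h2
      rwa [Multiset.map_map] at this
    obtain ⟨Q', rfl⟩ := h1
    have h3 : aeval Z (f.map (algebraMap ℤ_[p] W)) = 0 := by
      rw [aeval_map_algebraMap]
      have := aeval_algHom_apply (Algebra.TensorProduct.includeRight : R →ₐ[ℤ_[p]] W ⊗[ℤ_[p]] R) ζ f
      rw [hζ, map_zero] at this
      exact this
    rw [map_mul, ← hr, h3, zero_mul]
  -- These are the Lagrange interpolation polynomials at the roots, whose denominators are units by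
  -- `isUnit_prod_sub`.
  let P : Fin f.natDegree → W[X] := fun k =>
    C ((hu k).unit⁻¹ : Wˣ).val * ∏ l ∈ Finset.univ.erase k, (X - C (r l))
  have hPk : ∀ k, (P k).eval (r k) = 1 := fun k => by
    rw [eval_mul, eval_C, eval_prod]
    simp only [eval_sub, eval_X, eval_C]
    exact (hu k).val_inv_mul
  have hPl : ∀ k l, l ≠ k → (P k).eval (r l) = 0 := fun k l hl => by
    have h0 : (∏ j ∈ Finset.univ.erase k, (X - C (r j))).eval (r l) = 0 := by
      rw [eval_prod]
      exact Finset.prod_eq_zero (Finset.mem_erase.2 ⟨hl, Finset.mem_univ l⟩) (by simp)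
    rw [eval_mul, h0, mul_zero]
  have hdeg : ∀ k, (P k).natDegree < f.natDegree := fun k => by
    refine (natDegree_C_mul_le _ _).trans_lt ?_
    rw [natDegree_prod_of_monic _ _ fun l _ => monic_X_sub_C _]
    simp only [natDegree_X_sub_C, Finset.sum_const, smul_eq_mul, mul_one]
    rw [Finset.card_erase_of_mem (Finset.mem_univ k), Finset.card_univ, Fintype.card_fin]
    have := k.2
    omega
  have hpow : ∀ n, Z ^ n = (1 : W) ⊗ₜ[ℤ_[p]] (ζ ^ n) := fun n => by
    rw [Algebra.TensorProduct.tmul_pow, one_pow]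
  refine ⟨fun k => aeval Z (P k), fun k l => r l ^ (k : ℕ), fun k l => (P k).coeff l,
    fun k => ?_, fun k l hkl => ?_, ?_, fun k => ?_, fun k => ?_⟩
  · rw [← map_mul, ← sub_eq_zero, ← map_sub]
    refine hvan _ fun l => ?_
    rw [eval_sub, eval_mul]
    by_cases h : l = k
    · rw [h, hPk]; ring
    · rw [hPl k l h]; ring
  · rw [← map_mul]
    refine hvan _ fun j => ?_
    rw [eval_mul]
    by_cases h : j = k
    · rw [h, hPl l k hkl, mul_zero]
    · rw [hPl k j h, zero_mul]
  · rw [← map_sum, ← sub_eq_zero, ← map_one (aeval Z (R := W)), ← map_sub]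
    refine hvan _ fun j => ?_
    rw [eval_sub, eval_finsetSum, Finset.sum_eq_single j (fun k _ hk => hPl k j hk.symm)
      (fun h => absurd (Finset.mem_univ j) h), hPk, eval_one, sub_self]
  · rw [← hpow, ← sub_eq_zero]
    have := hvan (X ^ (k : ℕ) - ∑ l, C (r l ^ (k : ℕ)) * P l) fun j => by
      rw [eval_sub, eval_finsetSum, Finset.sum_eq_single j
        (fun l _ hl => by rw [eval_mul, hPl l j hl.symm, mul_zero])
        (fun h => absurd (Finset.mem_univ j) h), eval_mul, hPk]
      simp
    rw [map_sub, map_sum, map_pow, aeval_X] at this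
    simpa [Algebra.smul_def] using this
  · change aeval Z (P k) = _
    rw [aeval_eq_sum_range' (hdeg k), ← Fin.sum_univ_eq_sum_range fun l => (P k).coeff l • Z ^ l]
    simp only [hpow]

end Splitting

section ProductSplitting

/-- The extension by zero `A ⊗ R i → A ⊗ ∏ i, R i`. -/
noncomputable def tensorSingle {k : Type*} [CommRing k] {I : Type*} [DecidableEq I] (A : Type*)
    [CommRing A] [Algebra k A] (R : I → Type*) [∀ i, CommRing (R i)] [∀ i, Algebra k (R i)] (i : I) :
    A ⊗[k] R i →ₗ[A] A ⊗[k] (∀ i, R i) :=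
  (LinearMap.single k R i).baseChange A

section TensorSingle

variable {k : Type*} [CommRing k] {I : Type*} [DecidableEq I] {A : Type*} [CommRing A]
  [Algebra k A] {R : I → Type*} [∀ i, CommRing (R i)] [∀ i, Algebra k (R i)]

lemma tensorSingle_tmul (i : I) (a : A) (x : R i) :
    tensorSingle A R i (a ⊗ₜ[k] x) = a ⊗ₜ Pi.single i x := rfl

lemma tensorSingle_mul (i : I) (x y : A ⊗[k] R i) :
    tensorSingle A R i x * tensorSingle A R i y = tensorSingle A R i (x * y) := by
  induction x using TensorProduct.induction_on with
  | zero => simp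
  | add x x' hx hx' => rw [map_add, add_mul, hx, hx', add_mul, map_add]
  | tmul a x =>
    induction y using TensorProduct.induction_on with
    | zero => simp
    | add y y' hy hy' => rw [map_add, mul_add, hy, hy', mul_add, map_add]
    | tmul b y =>
      rw [Algebra.TensorProduct.tmul_mul_tmul, tensorSingle_tmul, tensorSingle_tmul,
        tensorSingle_tmul, Algebra.TensorProduct.tmul_mul_tmul, Pi.single_mul]

lemma tensorSingle_mul_of_ne {i j : I} (hij : i ≠ j) (x : A ⊗[k] R i) (y : A ⊗[k] R j) :
    tensorSingle A R i x * tensorSingle A R j y = 0 := by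
  induction x using TensorProduct.induction_on with
  | zero => simp
  | add x x' hx hx' => rw [map_add, add_mul, hx, hx', add_zero]
  | tmul a x =>
    induction y using TensorProduct.induction_on with
    | zero => simp
    | add y y' hy hy' => rw [map_add, mul_add, hy, hy', add_zero]
    | tmul b y =>
      have h : (Pi.single i x : ∀ i, R i) * Pi.single j y = 0 := by
        ext l
        by_cases hl : l = i
        · subst hl
          rw [Pi.mul_apply, Pi.single_eq_of_ne hij, mul_zero]; rfl
        · rw [Pi.mul_apply, Pi.single_eq_of_ne hl, zero_mul]; rfl
      rw [tensorSingle_tmul, tensorSingle_tmul, Algebra.TensorProduct.tmul_mul_tmul, h, tmul_zero]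

lemma sum_tensorSingle_one [Fintype I] : ∑ i, tensorSingle A R i (1 : A ⊗[k] R i) = 1 := by
  simp only [Algebra.TensorProduct.one_def, tensorSingle_tmul]
  rw [← tmul_sum]
  congr 1
  exact Finset.univ_sum_single 1

end TensorSingle

variable {p : ℕ} [Fact p.Prime]

/-- The index set of a product of unramified bases. -/
def sigmaSigmaEquiv {N : ℕ} (m n : Fin N → ℕ) :
    (Σ i : Fin N, Fin (m i) × Fin (n i)) ≃ Σ x : (Σ i : Fin N, Fin (m i)), Fin (n x.1) where
  toFun x := ⟨⟨x.1, x.2.1⟩, x.2.2⟩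
  invFun x := ⟨x.1.1, x.1.2, x.2⟩
  left_inv _ := rfl
  right_inv _ := rfl

theorem exists_splitModel {N : ℕ} {L : Fin N → Type*}
    [∀ i, Field (L i)] [∀ i, Algebra ℚ_[p] (L i)] [∀ i, Algebra ℤ_[p] (L i)]
    [∀ i, IsScalarTower ℤ_[p] ℚ_[p] (L i)] [∀ i, FiniteDimensional ℚ_[p] (L i)]
    {θ : ∀ i, integralClosure ℤ_[p] (L i)} (hθ : ∀ i, θ i ≠ 0) {f : Fin N → ℤ_[p][X]}
    {ζ : ∀ i, integralClosure ℤ_[p] (L i)} {n : Fin N → ℕ} (hn : ∀ i, 0 < n i)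
    {b : ∀ i, Module.Basis (Fin (f i).natDegree × Fin (n i)) ℤ_[p] (integralClosure ℤ_[p] (L i))}
    (hb : ∀ i, IsUnramifiedBasis (θ i) (f i) (ζ i) (b i)) :
    ∃ (W : Type) (_ : CommRing W) (_ : IsDomain W) (_ : Algebra ℤ_[p] W)
      (_ : Module.Finite ℤ_[p] W) (_ : Module.Free ℤ_[p] W), Nonempty (SplitModel p θ W) := by
  classical
  obtain ⟨W, _, _, _, _, _, hW, hr⟩ := exists_common_splitting f fun i => (hb i).monic
  refine ⟨W, inferInstance, inferInstance, inferInstance, inferInstance, inferInstance, ?_⟩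
  choose r hr using hr
  choose e c c' hee hne hsum hc hc' using fun i =>
    exists_idempotents (hb i).root (hr i) (hb i).separable
  have hK : Function.Injective (algebraMap ℤ_[p] (AlgebraicClosure (FractionRing W))) := by
    rw [IsScalarTower.algebraMap_eq ℤ_[p] W, IsScalarTower.algebraMap_eq W (FractionRing W)]
    exact ((algebraMap (FractionRing W) (AlgebraicClosure (FractionRing W))).injective.comp
      (IsFractionRing.injective W (FractionRing W))).comp hW
  obtain ⟨χ, hχ, hχ0⟩ := exists_algHoms (L := L) (AlgebraicClosure (FractionRing W)) hK
    (ι := fun i => Fin (f i).natDegree × Fin (n i)) fun i => by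
      rw [← finrank_integralClosure, Module.finrank_eq_card_basis (b i)]
  -- The transition matrices are block diagonal over the factors, so the ramification degree n is
  -- constant on each block.
  let cc : (Σ i : Fin N, Fin (f i).natDegree) → (Σ i : Fin N, Fin (f i).natDegree) → W :=
    fun x y => if h : y.1 = x.1 then c x.1 x.2 (h ▸ y.2) else 0
  let cc' : (Σ i : Fin N, Fin (f i).natDegree) → (Σ i : Fin N, Fin (f i).natDegree) → W :=
    fun x y => if h : y.1 = x.1 then c' x.1 x.2 (h ▸ y.2) else 0
  have hsumdep : ∀ {M : Type _} [AddCommGroup M] [Module W M]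
      (d : ∀ i, Fin (f i).natDegree → Fin (f i).natDegree → W)
      (g : (Σ i : Fin N, Fin (f i).natDegree) → M) (x : Σ i : Fin N, Fin (f i).natDegree),
      ∑ y : Σ i : Fin N, Fin (f i).natDegree,
        (if h : y.1 = x.1 then d x.1 x.2 (h ▸ y.2) else 0) • g y =
      ∑ l, d x.1 x.2 l • g ⟨x.1, l⟩ := by
    intro M _ _ d g x
    rw [Fintype.sum_sigma, Finset.sum_eq_single x.1]
    · simp
    · intro i _ hi
      simp [hi]
    · simp
  exact ⟨{
    t := Σ i : Fin N, Fin (f i).natDegree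
    n := fun x => n x.1
    n_pos := fun x => hn x.1
    z := fun x => Pi.single x.1 (ζ x.1 ^ (x.2 : ℕ))
    bz := (Pi.basis b).reindex (sigmaSigmaEquiv _ n)
    bz_apply := fun x l => by
      rw [Module.Basis.reindex_apply]
      change Pi.basis b ⟨x.1, x.2, l⟩ = _
      rw [Pi.basis_apply, (hb _).apply]
      ext i
      by_cases hi : i = x.1
      · subst hi; simp
      · simp [Pi.single_eq_of_ne hi]
    e := fun x => tensorSingle W _ x.1 (e x.1 x.2)
    mul_e_self := fun x => by rw [tensorSingle_mul, hee]
    mul_e_ne := by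
      rintro ⟨i, k⟩ ⟨j, l⟩ h
      by_cases hij : i = j
      · subst hij
        rw [tensorSingle_mul, hne _ _ _ (fun h' => h (congrArg (Sigma.mk i) h')), map_zero]
      · exact tensorSingle_mul_of_ne hij _ _
    sum_e := by
      rw [Fintype.sum_sigma, ← sum_tensorSingle_one]
      exact Finset.sum_congr rfl fun i _ => by rw [← hsum, map_sum]
    c := cc
    c' := cc'
    z_eq := fun x => by
      simp only [cc]
      rw [hsumdep, ← tensorSingle_tmul, hc, map_sum]
      simp only [map_smul]
    e_eq := fun x => by
      simp only [cc']
      rw [hsumdep, hc', map_sum]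
      simp only [map_smul, tensorSingle_tmul]
    c_ne := fun x y h => by
      by_cases hxy : y.1 = x.1
      · rw [hxy]
      · exact absurd (dif_neg hxy) h
    c'_ne := fun x y h => by
      by_cases hxy : y.1 = x.1
      · rw [hxy]
      · exact absurd (dif_neg hxy) h
    χ := χ ∘ (sigmaSigmaEquiv _ n).symm
    χ_injective := hχ.comp (Equiv.injective _)
    χ_ne_zero := fun k => hχ0 _ _ (hθ _) }⟩

end ProductSplitting

/-! ### A basis of Λ adapted to the chart -/

section ChartBasis

variable {p : ℕ} [Fact p.Prime] {R : Type*} [CommRing R] [Algebra ℤ_[p] R] {ε θ : R} {W : Type}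
  [CommRing W] [IsDomain W] [Algebra ℤ_[p] W] {O : Type*} [Ring O] {Λ : Type*} [AddCommGroup Λ]
  [Module ℤ_[p] Λ] {ρ : O → Module.End ℤ_[p] Λ} {c : O → ℤ[X]} {ψ : LinearMap.BilinForm ℤ_[p] Λ}

lemma quatJ_pow_two_mul (l : ℕ) :
    quatJ ε θ ^ (2 * l) = ((θ ^ l : R) : ℍ[R, ε, θ]) := by
  have h : quatJ ε θ ^ 2 = ((θ : R) : ℍ[R, ε, θ]) := by
    rw [pow_two]; ext <;> simp [quatJ]
  rw [pow_mul, h]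
  induction l with
  | zero => simp
  | succ l ih => rw [pow_succ, ih, pow_succ]; ext <;> simp

lemma quatJ_pow_two_mul_add_one (l : ℕ) :
    quatJ ε θ ^ (2 * l + 1) = ((θ ^ l : R) : ℍ[R, ε, θ]) * quatJ ε θ := by
  rw [pow_succ, quatJ_pow_two_mul]

/-- The position of `i ^ δ * j ^ l` in the standard basis of a quaternion algebra. -/
def quatIndex (δ : Bool) (l : ℕ) : Fin 4 :=
  if l % 2 = 0 then if δ then 1 else 0 else if δ then 3 else 2

lemma quatIndex_eq_iff {δ δ' : Bool} {l l' : ℕ} :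
    quatIndex δ l = quatIndex δ' l' ↔ δ = δ' ∧ l % 2 = l' % 2 := by
  rcases Nat.mod_two_eq_zero_or_one l with h | h <;>
    rcases Nat.mod_two_eq_zero_or_one l' with h' | h' <;>
      cases δ <;> cases δ' <;> simp [quatIndex, h, h']

lemma basisOneIJK_apply (k : Fin 4) : QuaternionAlgebra.basisOneIJK ε 0 θ k =
    ![1, ⟨0, 1, 0, 0⟩, ⟨0, 0, 1, 0⟩, ⟨0, 0, 0, 1⟩] k := by
  rw [QuaternionAlgebra.basisOneIJK, Module.Basis.coe_ofEquivFun]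
  fin_cases k <;> ext <;> simp

lemma chart_eq_smul_basis (δ : Bool) (z : R) (l : ℕ) :
    (if δ then SplitModel.quatI ε θ else 1) * (z : ℍ[R, ε, θ]) * quatJ ε θ ^ l =
      (z * θ ^ (l / 2)) • QuaternionAlgebra.basisOneIJK ε 0 θ (quatIndex δ l) := by
  have hl := Nat.div_add_mod l 2
  rw [basisOneIJK_apply]
  rcases Nat.mod_two_eq_zero_or_one l with h | h <;> rw [h] at hl
  · conv_lhs => rw [← hl, add_zero, quatJ_pow_two_mul]
    generalize θ ^ (l / 2) = r
    cases δ <;> ext <;> simp [quatIndex, h, SplitModel.quatI, -QuaternionAlgebra.coe_mul]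
  · conv_lhs => rw [← hl, quatJ_pow_two_mul_add_one]
    generalize θ ^ (l / 2) = r
    cases δ <;> ext <;> simp [quatIndex, h, SplitModel.quatI, quatJ, -QuaternionAlgebra.coe_mul]

theorem SplitModel.exists_isChartBasis (M : SplitModel p θ W) (D : QuatModel ρ c ψ R ε θ) {m : ℕ}
    (em : Fin m ≃ Bool × Σ x : M.t, Fin (M.n x)) :
    ∃ β : Module.Basis (Fin m ⊕ Fin m) ℤ_[p] Λ, M.IsChartBasis D β := by
  -- The basis elements i^δ z θ^q and i^δ z θ^q j are the i^δ z j^l with l < 2 n. Those with l < n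
  -- form the second half, and the first half has its exponents shifted by n.
  let ex : (Bool × Σ x : M.t, Fin (M.n x)) ⊕ (Bool × Σ x : M.t, Fin (M.n x)) →
      Bool × Σ _ : M.t, ℕ :=
    Sum.elim (fun k => (k.1, ⟨k.2.1, k.2.2 + M.n k.2.1⟩)) fun k => (k.1, ⟨k.2.1, k.2.2⟩)
  have hex : ∀ k, (ex k).2.2 / 2 < M.n (ex k).2.1 := by
    rintro (⟨δ, x, l⟩ | ⟨δ, x, l⟩) <;> simp only [ex, Sum.elim_inl, Sum.elim_inr] <;>
      have := l.2 <;> omega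
  let E : (Bool × Σ x : M.t, Fin (M.n x)) ⊕ (Bool × Σ x : M.t, Fin (M.n x)) →
      (Σ x : M.t, Fin (M.n x)) × Fin 4 := fun k =>
    (⟨(ex k).2.1, ⟨(ex k).2.2 / 2, hex k⟩⟩, quatIndex (ex k).1 (ex k).2.2)
  have hEinj : Function.Injective E := by
    intro k k' h
    obtain ⟨h1, h2⟩ := Prod.ext_iff.1 h
    obtain ⟨h3, h4⟩ := quatIndex_eq_iff.1 h2
    have h5 : (ex k).2.1 = (ex k').2.1 := congrArg (fun y : Σ x : M.t, Fin (M.n x) => y.1) h1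
    have h6 : (ex k).2.2 / 2 = (ex k').2.2 / 2 := 
      congrArg (fun y : Σ x : M.t, Fin (M.n x) => (y.2 : ℕ)) h1
    have h7 : (ex k).2.2 = (ex k').2.2 := by omega
    rcases k with ⟨δ, x, l⟩ | ⟨δ, x, l⟩ <;> rcases k' with ⟨δ', x', l'⟩ | ⟨δ', x', l'⟩ <;>
      simp only [ex, Sum.elim_inl, Sum.elim_inr] at h3 h5 h7 <;> subst h3 <;> subst h5 <;>
      have := l.2 <;> have := l'.2
    · obtain rfl : l = l' := Fin.ext (by omega)
      rfl
    · omega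
    · omega
    · obtain rfl : l = l' := Fin.ext (by omega)
      rfl
  have hE : Function.Bijective E := (Fintype.bijective_iff_injective_and_card E).2 ⟨hEinj, by
    simp only [Fintype.card_sum, Fintype.card_prod, Fintype.card_bool, Fintype.card_fin]
    ring⟩
  let bH : Module.Basis ((Σ x : M.t, Fin (M.n x)) × Fin 4) ℤ_[p] ℍ[R, ε, θ] :=
    M.bz.smulTower (QuaternionAlgebra.basisOneIJK ε 0 θ)
  let β : Module.Basis (Fin m ⊕ Fin m) ℤ_[p] Λ :=
    (bH.reindex ((Equiv.sumCongr em em).trans (Equiv.ofBijective E hE)).symm).map D.u.symm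
  have hβ : ∀ k, D.u (β (Sum.inr k)) = (if (em k).1 then quatI ε θ else 1) *
      ((M.z (em k).2.1 : R) : ℍ[R, ε, θ]) * quatJ ε θ ^ ((em k).2.2 : ℕ) := fun k => by
    rw [chart_eq_smul_basis]
    simp only [β, Module.Basis.map_apply, LinearEquiv.apply_symm_apply, Module.Basis.reindex_apply,
      Equiv.symm_symm]
    change bH (E (Sum.inr (em k))) = _
    rw [Module.Basis.smulTower_apply, M.bz_apply]
    rfl
  refine ⟨β, ?_⟩
  rw [SplitModel.IsChartBasis, ← em.surjective.range_comp]
  exact congrArg Set.range (funext hβ)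

end ChartBasis

/-! ### Integrality of the reduced characteristic polynomial -/

section ReducedCharpoly

open NumberField in
lemma card_real_embeddings (F : Type*) [Field F] [NumberField F] [IsTotallyReal F] :
    Fintype.card (F →+* ℝ) = Module.finrank ℚ F := by
  rw [← Embeddings.card F ℂ]
  refine Fintype.card_of_bijective (f := fun σ : F →+* ℝ => Complex.ofRealHom.comp σ) ⟨?_, ?_⟩
  · intro σ τ h
    ext x
    exact Complex.ofReal_injective (DFunLike.congr_fun h x)
  · intro φ
    have hφ : ComplexEmbedding.IsReal φ := IsTotallyReal.complexEmbedding_isReal φ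
    exact ⟨hφ.embedding, RingHom.ext fun x => hφ.coe_embedding_apply x⟩

variable {F : Type*} [Field F] [NumberField F]

-- The ring of integers has as many real embeddings as its rank, so `quadDet_leftMulMatrix_map`
-- applies; the left side is visibly integral.
open NumberField in
lemma exists_integral_charpoly_map_real [IsTotallyReal F] {ι : Type*} [Fintype ι] [DecidableEq ι]
    (b : Module.Basis ι ℤ (𝓞 F)) (t n : 𝓞 F) :
    (quadDet (Algebra.leftMulMatrix b t) (Algebra.leftMulMatrix b n)).map (Int.castRingHom ℝ) =
      ∏ σ : F →+* ℝ, (X ^ 2 - C (σ t) * X + C (σ n)) := by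
  have hc : Fintype.card ι = Fintype.card (F →+* ℝ) := by
    rw [card_real_embeddings, ← Module.finrank_eq_card_basis b, RingOfIntegers.rank]
  let e : ι ≃ (F →+* ℝ) := Fintype.equivOfCardEq hc
  let φ : ι → (𝓞 F →ₐ[ℤ] ℝ) := fun i => ((e i).comp (algebraMap (𝓞 F) F)).toIntAlgHom
  have hφ : Function.Injective φ := by
    intro i j h
    refine e.injective (IsFractionRing.injective_comp_algebraMap (A := 𝓞 F) ?_)
    exact RingHom.ext fun x => DFunLike.congr_fun h x
  have := quadDet_leftMulMatrix_map b φ hφ t n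
  rw [algebraMap_int_eq] at this
  rw [this, ← e.prod_comp]
  rfl

variable {p : ℕ} [Fact p.Prime] {N : ℕ} {L : Fin N → Type*}
    [∀ i, Field (L i)] [∀ i, Algebra ℚ_[p] (L i)] [∀ i, Algebra ℤ_[p] (L i)]
    [∀ i, IsScalarTower ℤ_[p] ℚ_[p] (L i)] [∀ i, FiniteDimensional ℚ_[p] (L i)]
    (e : ℚ_[p] ⊗[ℚ] F ≃ₐ[ℚ_[p]] ∀ i, L i)

include e

omit [∀ i, Algebra ℤ_[p] (L i)] [∀ i, IsScalarTower ℤ_[p] ℚ_[p] (L i)] in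
lemma sum_finrank_eq : ∑ i, Module.finrank ℚ_[p] (L i) = Module.finrank ℚ F := by
  rw [← Module.finrank_pi_fintype, ← e.toLinearEquiv.finrank_eq, Module.finrank_baseChange]

-- Over an algebraic closure of ℚ_p both sides become products over homomorphisms, and those of ∏ L
-- i restrict bijectively to the embeddings of F.
open NumberField in
lemma map_quadDet_eq_rcp {ε θ : ∀ i, integralClosure ℤ_[p] (L i)} {ι : Type*} [Fintype ι]
    [DecidableEq ι] (b : Module.Basis ι ℤ (𝓞 F)) {d : ℕ}
    (bR : Module.Basis (Fin d) ℤ_[p] (∀ i, integralClosure ℤ_[p] (L i))) {t n : 𝓞 F}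
    {q : ℍ[(∀ i, integralClosure ℤ_[p] (L i)), ε, θ]}
    (ht : ∀ i, ((2 * q.re : ∀ i, integralClosure ℤ_[p] (L i)) i : L i) = e (1 ⊗ₜ (t : F)) i)
    (hn : ∀ i, ((q * star q).re i : L i) = e (1 ⊗ₜ (n : F)) i) :
    (quadDet (Algebra.leftMulMatrix b t) (Algebra.leftMulMatrix b n)).map (Int.castRingHom ℤ_[p]) =
      rcp bR q := by
  have := fun i => finite_integralClosure p (L i)
  have := fun i => free_integralClosure p (L i)
  let K := AlgebraicClosure ℚ_[p]
  have hK : Function.Injective (algebraMap ℤ_[p] K) := by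
    rw [IsScalarTower.algebraMap_eq ℤ_[p] ℚ_[p] K]
    exact (algebraMap ℚ_[p] K).injective.comp (IsFractionRing.injective ℤ_[p] ℚ_[p])
  obtain ⟨χ, hχ, -⟩ := exists_algHoms_pi (L := L) K (ι := fun i => Fin (Module.finrank ℚ_[p] (L i)))
    fun i => Fintype.card_fin _
  have hcard : Fintype.card (Σ i, Fin (Module.finrank ℚ_[p] (L i))) = Module.finrank ℚ F := by
    rw [Fintype.card_sigma, ← sum_finrank_eq e]
    simp
  let e₁ : ι ≃ Σ i, Fin (Module.finrank ℚ_[p] (L i)) := Fintype.equivOfCardEq (by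
    rw [hcard, ← Module.finrank_eq_card_basis b, RingOfIntegers.rank])
  let e₂ : Fin d ≃ Σ i, Fin (Module.finrank ℚ_[p] (L i)) := Fintype.equivOfCardEq (by
    rw [← Module.finrank_eq_card_basis bR, Module.finrank_pi_fintype, Fintype.card_sigma]
    simp only [finrank_integralClosure, Fintype.card_fin])
  let φ₁ : (Σ i, Fin (Module.finrank ℚ_[p] (L i))) → (𝓞 F →ₐ[ℤ] K) := fun k =>
    ((((χ k).comp e.toAlgHom : ℚ_[p] ⊗[ℚ] F →ₐ[ℚ_[p]] K).toRingHom.comp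
      (Algebra.TensorProduct.includeRight : F →ₐ[ℚ] ℚ_[p] ⊗[ℚ] F).toRingHom).comp
        (algebraMap (𝓞 F) F)).toIntAlgHom
  have hφ₁ : ∀ k x, φ₁ k x = χ k (e (1 ⊗ₜ (x : F))) := fun k x => rfl
  have hφ₁i : Function.Injective φ₁ := by
    intro k l h
    have h1 : ((χ k).comp e.toAlgHom : ℚ_[p] ⊗[ℚ] F →ₐ[ℚ_[p]] K).toRingHom.comp
        (Algebra.TensorProduct.includeRight : F →ₐ[ℚ] ℚ_[p] ⊗[ℚ] F).toRingHom =
        ((χ l).comp e.toAlgHom : ℚ_[p] ⊗[ℚ] F →ₐ[ℚ_[p]] K).toRingHom.comp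
        (Algebra.TensorProduct.includeRight : F →ₐ[ℚ] ℚ_[p] ⊗[ℚ] F).toRingHom :=
      IsFractionRing.injective_comp_algebraMap (A := 𝓞 F)
        (RingHom.ext fun x => DFunLike.congr_fun h x)
    have h2 : ∀ y : ℚ_[p] ⊗[ℚ] F, χ k (e y) = χ l (e y) := fun y => by
      induction y using TensorProduct.induction_on with
      | zero => simp
      | add x y hx hy => simp only [map_add, hx, hy]
      | tmul c x =>
        have h3 : c ⊗ₜ[ℚ] x = c • ((1 : ℚ_[p]) ⊗ₜ[ℚ] x) := by
          rw [TensorProduct.smul_tmul', smul_eq_mul, mul_one]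
        rw [h3, map_smul, map_smul, map_smul]
        exact congrArg (c • ·) (DFunLike.congr_fun h1 x)
    refine hχ k l fun r => ?_
    obtain ⟨y, hy⟩ := e.surjective fun i => (r i : L i)
    rw [← hy, h2]
  let φ₂ : (Σ i, Fin (Module.finrank ℚ_[p] (L i))) →
      ((∀ i, integralClosure ℤ_[p] (L i)) →ₐ[ℤ_[p]] K) := fun k =>
    ((χ k).restrictScalars ℤ_[p]).comp (piIntegralClosureVal L)
  have hφ₂i : Function.Injective φ₂ := fun k l h => hχ k l fun r => DFunLike.congr_fun h r
  have h1 := quadDet_leftMulMatrix_map b (φ₁ ∘ e₁) (hφ₁i.comp e₁.injective) t n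
  have h2 := quadDet_leftMulMatrix_map bR (φ₂ ∘ e₂) (hφ₂i.comp e₂.injective) (2 * q.re)
    (q * star q).re
  refine Polynomial.map_injective _ hK ?_
  rw [Polynomial.map_map, show (algebraMap ℤ_[p] K).comp (Int.castRingHom ℤ_[p]) = algebraMap ℤ K
    from RingHom.ext_int _ _, h1, rcp, h2]
  simp only [Function.comp_apply]
  rw [e₁.prod_comp fun k => X ^ 2 - C (φ₁ k t) * X + C (φ₁ k n),
    e₂.prod_comp fun k => X ^ 2 - C (φ₂ k (2 * q.re)) * X + C (φ₂ k (q * star q).re)]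
  refine Finset.prod_congr rfl fun k _ => ?_
  have h3 : φ₁ k t = φ₂ k (2 * q.re) := congrArg (χ k) (funext fun i => (ht i).symm)
  have h4 : φ₁ k n = φ₂ k (q * star q).re := congrArg (χ k) (funext fun i => (hn i).symm)
  rw [h3, h4]

end ReducedCharpoly

section Integrality

open NumberField

lemma exists_integer_re {F : Type*} [Field F] [NumberField F] {α β : F} {O : Subring ℍ[F, α, β]}
    (hO : IsOrder ℤ ℚ (subalgebraOfSubring O)) {x : ℍ[F, α, β]} (hx : x ∈ O) {r : F}
    (hr : x = (r : ℍ[F, α, β])) : ∃ t : 𝓞 F, (t : F) = r := by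
  have : Module.Finite ℤ O := hO.1
  have h1 : IsIntegral ℤ (⟨x, hx⟩ : O) := IsIntegral.of_finite ℤ _
  have h2 : IsIntegral ℤ x := h1.map O.subtype.toIntAlgHom
  have h3 : IsIntegral ℤ r := by
    rw [hr] at h2
    exact (isIntegral_algHom_iff (algebraMap F ℍ[F, α, β]).toIntAlgHom
      (algebraMap F ℍ[F, α, β]).injective).1 h2
  exact ⟨⟨r, h3⟩, rfl⟩

end Integrality

/-! ### Totally definite algebras and their completions -/

section TotallyDefinite

variable {F : Type*} [Field F] [NumberField F] [NumberField.IsTotallyReal F] {α β : F}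

lemma eq_zero_of_mul_self {a b : ℝ} (f : ℍ[ℝ, a, b] ≃ₐ[ℝ] ℍ[ℝ]) {x : ℍ[ℝ, a, b]} (hx : x * x = 0) :
    x = 0 := by
  have h := congrArg f hx
  rw [map_mul, map_zero, mul_self_eq_zero] at h
  exact f.injective (h.trans (map_zero f).symm)

/-- Hamilton's quaternions contain no nonzero element of square zero, but i or j would be one if α
or β vanished. -/
lemma RZLocalModel.IsTotallyDefinite.ne_zero (hB : IsTotallyDefinite α β) : α ≠ 0 ∧ β ≠ 0 := by
  have hpos : 0 < Fintype.card (F →+* ℝ) := by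
    rw [card_real_embeddings]
    exact Module.finrank_pos
  obtain ⟨σ⟩ := Fintype.card_pos_iff.1 hpos
  obtain ⟨f⟩ := hB σ
  constructor
  · rintro rfl
    have h := eq_zero_of_mul_self f (x := ⟨0, 1, 0, 0⟩) (by ext <;> simp)
    exact one_ne_zero (congrArg QuaternionAlgebra.imI h)
  · rintro rfl
    have h := eq_zero_of_mul_self f (x := ⟨0, 0, 1, 0⟩) (by ext <;> simp)
    exact one_ne_zero (congrArg QuaternionAlgebra.imJ h)

end TotallyDefinite

section Completion

variable {p : ℕ} [Fact p.Prime] {F : Type*} [Field F] [NumberField F] {I : Type*} {L : I → Type*}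
  [∀ i, Field (L i)] [∀ i, Algebra ℚ_[p] (L i)]
  (e : ℚ_[p] ⊗[ℚ] F ≃ₐ[ℚ_[p]] ∀ i, L i) (α β : F)

/-- The decomposition of the completion at `p` of a quaternion algebra over a number field. -/
noncomputable def quatCompletion : ℚ_[p] ⊗[ℚ] ℍ[F, α, β] ≃ₐ[ℚ_[p]]
    ∀ i, ℍ[L i, e (1 ⊗ₜ α) i, e (1 ⊗ₜ β) i] :=
  ((quatBaseChangeAlg ℚ_[p] α β).trans (quatCongr e _ _)).trans (quatPiEquiv ℚ_[p])

variable {α β}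

lemma quatCompletion_tmul (x : ℍ[F, α, β]) (i : I) : quatCompletion e α β (1 ⊗ₜ x) i =
    ⟨e (1 ⊗ₜ x.re) i, e (1 ⊗ₜ x.imI) i, e (1 ⊗ₜ x.imJ) i, e (1 ⊗ₜ x.imK) i⟩ := by
  have h : quatBaseChangeAlg ℚ_[p] α β (1 ⊗ₜ x) = quatMapHom ℚ ℚ_[p] x := by
    refine (quatBaseChange_tmul _ (1 : ℚ_[p]) x).trans ?_
    exact one_smul _ _
  change quatProj ℚ_[p] i (quatCongr e _ _ (quatBaseChangeAlg ℚ_[p] α β (1 ⊗ₜ x))) = _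
  rw [h]
  rfl

lemma quatCompletion_star (x : ℍ[F, α, β]) :
    star (quatCompletion e α β (1 ⊗ₜ x)) = quatCompletion e α β (1 ⊗ₜ star x) := by
  funext i
  rw [Pi.star_apply, quatCompletion_tmul, quatCompletion_tmul]
  ext <;> simp [tmul_neg]

lemma completion_ne_zero {a : F} (ha : a ≠ 0) (i : I) : e (1 ⊗ₜ a) i ≠ 0 := fun h => by
  have h1 : e (1 ⊗ₜ a) * e (1 ⊗ₜ a⁻¹) = 1 := by
    rw [← map_mul, Algebra.TensorProduct.tmul_mul_tmul, mul_one, mul_inv_cancel₀ ha,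
      ← Algebra.TensorProduct.one_def, map_one]
  have h2 := congrFun h1 i
  rw [Pi.mul_apply, h, zero_mul, Pi.one_apply] at h2
  exact zero_ne_one h2

end Completion

section CompletionOrder

variable {p : ℕ} [Fact p.Prime] {F : Type*} [Field F] [NumberField F] {I : Type*} {L : I → Type*}
  [∀ i, Field (L i)] [∀ i, Algebra ℚ_[p] (L i)] [∀ i, Algebra ℤ_[p] (L i)]
  [∀ i, IsScalarTower ℤ_[p] ℚ_[p] (L i)] (e : ℚ_[p] ⊗[ℚ] F ≃ₐ[ℚ_[p]] ∀ i, L i) {α β : F}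
  (O : Subring ℍ[F, α, β])

/-- The map from the completion at `p` of an order to the product of quaternion algebras over the
completions of the center. -/
noncomputable def orderCompletion :
    ℤ_[p] ⊗[ℤ] O →ₐ[ℤ_[p]] ∀ i, ℍ[L i, e (1 ⊗ₜ α) i, e (1 ⊗ₜ β) i] :=
  (((quatCompletion e α β) : _ →ₐ[ℚ_[p]] _).restrictScalars ℤ_[p]).comp (padicMap p O)

lemma orderCompletion_apply (x : ℤ_[p] ⊗[ℤ] O) :
    orderCompletion e O x = quatCompletion e α β (padicMap p O x) := rfl

variable {O}

lemma orderCompletion_tmul (a : O) :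
    orderCompletion e O (1 ⊗ₜ a) = quatCompletion e α β (1 ⊗ₜ (a : ℍ[F, α, β])) := by
  have : padicMap p O (1 ⊗ₜ a) = 1 ⊗ₜ (a : ℍ[F, α, β]) := by
    refine (Algebra.TensorProduct.lift_tmul _ _ _ _ _).trans ?_
    rw [map_one, one_mul]
    rfl
  rw [orderCompletion_apply, this]

lemma star_orderCompletion_tmul (hstar : ∀ x ∈ O, star x ∈ O) (a : O) :
    star (orderCompletion e O (1 ⊗ₜ a)) =
      orderCompletion e O (1 ⊗ₜ ⟨star (a : ℍ[F, α, β]), hstar a a.2⟩) := by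
  have h1 := orderCompletion_tmul e a
  have h2 := orderCompletion_tmul e ⟨star (a : ℍ[F, α, β]), hstar a a.2⟩
  have h3 := quatCompletion_star e (a : ℍ[F, α, β])
  exact (congrArg star h1).trans (h3.trans h2.symm)

lemma isMaximalOrder_range_orderCompletion (hmax : IsMaximalAt p O) :
    IsMaximalOrder ℤ_[p] ℚ_[p] (orderCompletion e O).range := by
  have h1 : IsMaximalOrder ℤ_[p] ℚ_[p] (padicMap p O).range := hmax
  have h2 := isMaximalOrder_map (R := ℤ_[p]) (K := ℚ_[p]) (quatCompletion e α β)
    (O := (padicMap p O).range)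
  have h3 := h2 h1
  rw [orderCompletion, AlgHom.range_comp]
  exact h3

end CompletionOrder

section LocalModel

variable {p : ℕ} [Fact p.Prime] {F : Type*} [Field F] [NumberField F] [NumberField.IsTotallyReal F]
  {α β : F} {O : Subring ℍ[F, α, β]} {Λ : Type*} [AddCommGroup Λ] [Module ℤ_[p] Λ]
  [Module (ℤ_[p] ⊗[ℤ] O) Λ] [IsScalarTower ℤ_[p] (ℤ_[p] ⊗[ℤ] O) Λ]

/-- The reduced characteristic polynomial has integral coefficients and is compatible with the
decomposition of the completion at `p`. -/
lemma exists_integral_redCharpoly (hO : IsOrder ℤ ℚ (subalgebraOfSubring O))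
    (hstar : ∀ x ∈ O, star x ∈ O) {N : ℕ} {L : Fin N → Type*} [∀ i, Field (L i)]
    [∀ i, Algebra ℚ_[p] (L i)] [∀ i, Algebra ℤ_[p] (L i)] [∀ i, IsScalarTower ℤ_[p] ℚ_[p] (L i)]
    [∀ i, FiniteDimensional ℚ_[p] (L i)] (e : ℚ_[p] ⊗[ℚ] F ≃ₐ[ℚ_[p]] ∀ i, L i) {x : ℍ[F, α, β]}
    (hx : x ∈ O) : ∃ c : ℤ[X], c.map (Int.castRingHom ℝ) = redCharpoly x ∧
      ∀ (ε θ : ∀ i, integralClosure ℤ_[p] (L i))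
        (V : ℍ[(∀ i, integralClosure ℤ_[p] (L i)), ε, θ] →ₐ[ℤ_[p]] _) (d : ℕ)
        (bR : Module.Basis (Fin d) ℤ_[p] (∀ i, integralClosure ℤ_[p] (L i))) q,
        (∀ q, V (star q) = star (V q)) → (∀ q i, (V q i).re = q.re i) →
        V q = quatCompletion e α β (1 ⊗ₜ x) → c.map (Int.castRingHom ℤ_[p]) = rcp bR q := by
  classical
  obtain ⟨t, ht⟩ := exists_integer_re hO (add_mem hx (hstar x hx)) (r := (x + star x).re)
    (by ext <;> simp)
  obtain ⟨n, hn⟩ := exists_integer_re hO (mul_mem hx (hstar x hx)) (r := (x * star x).re)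
    (quat_mul_star_eq_coe x)
  let b := NumberField.RingOfIntegers.basis F
  refine ⟨quadDet (Algebra.leftMulMatrix b t) (Algebra.leftMulMatrix b n), ?_,
    fun ε θ V d bR q hV hre hq => map_quadDet_eq_rcp e b bR (fun i => ?_) fun i => ?_⟩
  · rw [exists_integral_charpoly_map_real, redCharpoly, ht, hn]
  · have h1 := hre q i
    rw [hq, quatCompletion_tmul] at h1
    change e (1 ⊗ₜ x.re) i = _ at h1
    rw [ht, QuaternionAlgebra.re_add, QuaternionAlgebra.re_star, two_mul, tmul_add, map_add]
    simp [← h1]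
  · have h1 : V (q * star q) = quatCompletion e α β (1 ⊗ₜ (x * star x)) := by
      rw [map_mul, hV, hq, quatCompletion_star, ← map_mul, Algebra.TensorProduct.tmul_mul_tmul,
        mul_one]
    have h2 := hre (q * star q) i
    rw [h1, quatCompletion_tmul] at h2
    rw [hn]
    exact h2.symm

end LocalModel

/-! ### Conclusion -/

section FiniteFlat

variable {p : ℕ} [Fact p.Prime] {F : Type*} [Field F] [NumberField F] {α β : F}
  {O : Subring ℍ[F, α, β]} {Λ : Type*} [AddCommGroup Λ] [Module ℤ_[p] Λ]
  [Module (ℤ_[p] ⊗[ℤ] O) Λ] [IsScalarTower ℤ_[p] (ℤ_[p] ⊗[ℤ] O) Λ]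

theorem representable_of_models (hp : p ≠ 2) {ψ : LinearMap.BilinForm ℤ_[p] Λ} (hperf : ψ.IsPerfPair)
    {c : O → ℤ[X]} (hc : ∀ a, (c a).map (Int.castRingHom ℝ) = redCharpoly (a : ℍ[F, α, β]))
    {R : Type*} [CommRing R] [Algebra ℤ_[p] R] {ε θ : R} {W : Type} [CommRing W] [IsDomain W]
    [Algebra ℤ_[p] W] [Module.Finite ℤ_[p] W] [Module.Free ℤ_[p] W]
    (D : QuatModel (act p Λ : O → _) c ψ R ε θ) (M : SplitModel p θ W)
    (hR : Module.finrank ℤ_[p] R = Module.finrank ℚ F) :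
    (localModelFunctor O ψ).IsRepresentable ∧
      ∀ M : Sch p, (localModelFunctor O ψ).RepresentableBy M →
        AlgebraicGeometry.IsFinite M.hom ∧ AlgebraicGeometry.Flat M.hom := by
  have hcard : Fintype.card (Σ x : M.t, Fin (M.n x)) = Module.finrank ℚ F := by
    rw [← hR, Module.finrank_eq_card_basis M.bz]
  let em : Fin (2 * Module.finrank ℚ F) ≃ Fin 2 × Σ x : M.t, Fin (M.n x) :=
    Fintype.equivOfCardEq (by rw [Fintype.card_prod, hcard, Fintype.card_fin, Fintype.card_fin])
  obtain ⟨β', hβ⟩ := M.exists_isChartBasis D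
    (em.trans (finTwoEquiv.prodCongr (Equiv.refl _)))
  have := Module.Finite.of_basis β'
  have := Module.Free.of_basis β'
  obtain ⟨h1, h2⟩ := hβ.finite_flat hp em (by
    rw [Module.finrank_eq_card_basis β', Fintype.card_sum, Fintype.card_fin])
  obtain ⟨h⟩ := nonempty_representableBy_specOver β' hc fun A _ _ b hb => hβ.isUnit_det hp hb
  exact ⟨h.isRepresentable, fun M hM => finite_flat_of_representableBy h hM⟩

end FiniteFlat

theorem theorem11p8 (p : ℕ) [Fact p.Prime] (hp : p ≠ 2)
    {F : Type*} [Field F] [NumberField F] [NumberField.IsTotallyReal F]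
    (α β : F) (hB : IsTotallyDefinite α β)
    (O : Subring ℍ[F, α, β])
    (hO : IsOrder ℤ ℚ (subalgebraOfSubring O))
    (hstar : ∀ x ∈ O, star x ∈ O)
    (hmax : IsMaximalAt p O)
    {Λ : Type*} [AddCommGroup Λ] [Module ℤ_[p] Λ] [Module (ℤ_[p] ⊗[ℤ] O) Λ]
    [IsScalarTower ℤ_[p] (ℤ_[p] ⊗[ℤ] O) Λ]
    (hΛ : Nonempty (Λ ≃ₗ[ℤ_[p] ⊗[ℤ] O] (ℤ_[p] ⊗[ℤ] O)))
    (ψ : LinearMap.BilinForm ℤ_[p] Λ) (hperf : ψ.IsPerfPair) (halt : ψ.IsAlt)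
    (hherm : ∀ (a : O) (x y : Λ),
      ψ (act p Λ a x) y = ψ x (act p Λ ⟨star (a : ℍ[F, α, β]), hstar a a.2⟩ y)) :
    (localModelFunctor O ψ).IsRepresentable ∧
      ∀ M : Sch p, (localModelFunctor O ψ).RepresentableBy M →
        AlgebraicGeometry.IsFinite M.hom ∧ AlgebraicGeometry.Flat M.hom := by
  obtain ⟨g⟩ := hΛ
  obtain ⟨hα, hβ⟩ := hB.ne_zero
  obtain ⟨N, L, _, _, _, _, _, ⟨e⟩⟩ := exists_padic_decomposition p F
  obtain ⟨m, bT, bB, hb⟩ := exists_padic_basis p hO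
  have hj := star_orderCompletion_tmul e hstar
  have hjmax := isMaximalOrder_range_orderCompletion e hmax
  have hsmul : ∀ (c : ℚ_[p]) (x : ∀ i, ℍ[L i, e (1 ⊗ₜ α) i, e (1 ⊗ₜ β) i]),
      star (c • x) = c • star x := fun c x => by
    funext i
    ext <;> simp
  let bA := bB.map (quatCompletion e α β).toLinearEquiv
  have hbA : ∀ i, orderCompletion e O (bT i) = bA i := fun i =>
    congrArg (quatCompletion e α β) (hb i)
  have hjinj := injective_of_basis bT bA hbA
  obtain ⟨ℓ, hℓψ, hℓ, hdual⟩ := exists_functional hstar hsmul hj bT bA hbA g ψ hperf halt hherm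
  have hjstar : ∀ x ∈ (orderCompletion e O).range, star x ∈ (orderCompletion e O).range := by
    rintro _ ⟨X, rfl⟩
    obtain ⟨Y, hY⟩ := star_mem_range hstar hsmul hj X
    exact ⟨Y, hY.symm⟩
  choose ε θ v lam hstd hε hθ hgen f ζ n b hn hbu using fun i =>
    (isSelfDualMaxOrder_map_eval hjmax hjstar hℓ hdual i).exists_isStandard hp
      (completion_ne_zero e hα i) (completion_ne_zero e hβ i)
  obtain ⟨V, hV⟩ := isStandardProduct_of_forall hjmax hstd
  choose c hc hcp using fun a : O => exists_integral_redCharpoly hO hstar e a.2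
  obtain ⟨D⟩ := hV.nonempty_quatModel hjinj hε hgen g ψ hℓψ c fun d bR q x hq =>
    hcp x ε θ V d bR q hV.map_star hV.map_re (hq.trans (orderCompletion_tmul e x))
  obtain ⟨W, _, _, _, _, _, ⟨M⟩⟩ := exists_splitModel hθ hn hbu
  have := fun i => finite_integralClosure p (L i)
  have := fun i => free_integralClosure p (L i)
  refine representable_of_models hp hperf hc D M ?_
  rw [Module.finrank_pi_fintype, ← sum_finrank_eq e]
  exact Finset.sum_congr rfl fun i _ => finrank_integralClosure (L i)
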